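/- Let $\Gamma\subset\mathbb R^d$ be a lattice with basis $\mathbf a_1,\dots,\mathbf a_d$ and let $\Omega$ be the cell $\{\sum_j\xi_j\mathbf a_j:\ 0\le\xi_j<1\}$. Let $m\ge n$, let $b_1,\dots,b_d$ be constant complex $(m\times n)$-matrices, $b(\mathbf D)=\sum_l b_lD_l$ with $D_l=-i\partial_l$, and suppose that the symbol $b(\boldsymbol\xi)=\sum_l\xi_lb_l$ has rank $n$ for all $0\ne\boldsymbol\xi\in\mathbb R^d$. Let $g$ be a $\Gamma$-periodic function on $\mathbb R^d$ whose values are Hermitian positive definite $(m\times m)$-matrices, with $g,g^{-1}\in L_\infty$. For $\varepsilon>0$ put $g^\varepsilon(\mathbf x)=g(\varepsilon^{-1}\mathbf x)$, and let $\widehat{\mathcal A}_\varepsilon=b(\mathbf D)^*g^\varepsilon(\mathbf x)b(\mathbf D)$ be the selfadjoint operator in $L_2(\mathbb R^d;\mathbb C^n)$ generated by the quadratic form $\int_{\mathbb R^d}\langle g^\varepsilon b(\mathbf D)\mathbf u,b(\mathbf D)\mathbf u\rangle\,d\mathbf x$, $\mathbf u\in H^1(\mathbb R^d;\mathbb C^n)$.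 Let $\Lambda$ be the $\Gamma$-periodic $(n\times m)$-matrix-valued function in $H^1_{\mathrm{loc}}$ that is the weak solution of $$b(\mathbf D)^*g(\mathbf x)\bigl(b(\mathbf D)\Lambda(\mathbf x)+\mathbf 1_m\bigr)=0,\qquad \int_\Omega\Lambda(\mathbf x)\,d\mathbf x=0,$$ and put $$\widetilde g=g\,(b(\mathbf D)\Lambda+\mathbf 1_m),\qquad g^0=|\Omega|^{-1}\int_\Omega\widetilde g(\mathbf x)\,d\mathbf x,\qquad \widehat{\mathcal A}^0=b(\mathbf D)^*g^0b(\mathbf D).$$ For $\boldsymbol\theta\in\mathbb S^{d-1}$ put $$\widehat S(\boldsymbol\theta)=b(\boldsymbol\theta)^*g^0b(\boldsymbol\theta),\qquad \widehat N(\boldsymbol\theta)=b(\boldsymbol\theta)^*L(\boldsymbol\theta)b(\boldsymbol\theta),$$ $$L(\boldsymbol\theta)=|\Omega|^{-1}\int_\Omega\bigl(\Lambda(\mathbf x)^*b(\boldsymbol\theta)^*\widetilde g(\mathbf x)+\widetilde g(\mathbf x)^*b(\boldsymbol\theta)\Lambda(\mathbf x)\bigr)\,d\mathbf x,\qquad \widehat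 N_0(\boldsymbol\theta)=\sum_j\widehat P_j(\boldsymbol\theta)\widehat N(\boldsymbol\theta)\widehat P_j(\boldsymbol\theta),$$ where $\widehat P_j(\boldsymbol\theta)$ are the orthogonal projections of $\mathbb C^n$ onto the eigenspaces of the Hermitian matrix $\widehat S(\boldsymbol\theta)$ corresponding to its distinct eigenvalues. Let $\mathcal H_0=-\Delta$ in $L_2(\mathbb R^d;\mathbb C^n)$. **Theorem.** Suppose that $\widehat N_0(\boldsymbol\theta_0)\ne0$ for some $\boldsymbol\theta_0\in\mathbb S^{d-1}$. Let $0\ne\tau\in\mathbb R$ and $0\le s<2$. Then there does not exist a constant $C(\tau)>0$ such that the estimate $$\bigl\|\bigl(\cos(\tau\widehat{\mathcal A}_\varepsilon^{1/2})-\cos(\tau(\widehat{\mathcal A}^0)^{1/2})\bigr)(\mathcal H_0+I)^{-s/2}\bigr\|_{L_2(\mathbb R^d)\to L_2(\mathbb R^d)}\le C(\tau)\,\varepsilon$$ holds for all sufficiently small $\varepsilon>0$. -/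

import Mathlib

open MeasureTheory Filter Topology Matrix
open scoped ContDiff ENNReal InnerProductSpace ComplexOrder

noncomputable section

/-! ### Functions of a nonnegative selfadjoint operator -/

section FunctionalCalculus

variable {H : Type*} [NormedAddCommGroup H] [InnerProductSpace ℂ H] [CompleteSpace H]

/-- The resolvent `(A + I)⁻¹` as a bounded operator: `(A + I)⁻¹ f = u` if and only if
`u ∈ Dom A` and `A u = f - u`. (The value is `0` if there is no such bounded operator.) -/
def resolventNegOne (A : H →ₗ.[ℂ] H) : H →L[ℂ] H :=
  open Classical in
  if h : ∃ R : H →L[ℂ] H, ∀ f u : H, R f = u ↔ (u, f - u) ∈ A.graph then h.choose else 0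

/-- The operator `φ(A)` for a selfadjoint operator `A ≥ 0` and a bounded function `φ` that is
continuous on `[0, ∞)`.

Put `R = (A + I)⁻¹`, a selfadjoint operator with spectrum in `[0, 1]`. As `λ = r⁻¹ - 1` when
`r = (λ + 1)⁻¹`, the operator `φ(A) R` is `ψ(R)`, where `ψ(r) = r φ(r⁻¹ - 1)` for `0 < r ≤ 1`
and `ψ(0) = 0`. The function `ψ` is continuous on `[0, 1]`, so that `ψ(R)` is given by the
continuous functional calculus of the bounded operator `R`; and the range of `R` is dense, so
that `φ(A)` is the only bounded operator `T` with `T R = ψ(R)`. -/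
def boundedCalculus (A : H →ₗ.[ℂ] H) (φ : ℝ → ℝ) : H →L[ℂ] H :=
  open Classical in
  if h : ∃ T : H →L[ℂ] H,
      T ∘L resolventNegOne A = cfc (fun r : ℝ => r * φ (r⁻¹ - 1)) (resolventNegOne A)
    then h.choose else 0

/-- `cos (τ A^{1/2})` for a selfadjoint operator `A ≥ 0`. -/
def cosSqrt (A : H →ₗ.[ℂ] H) (τ : ℝ) : H →L[ℂ] H :=
  boundedCalculus A fun l => Real.cos (τ * √l)

/-- `(A + I)^{-s/2}` for a selfadjoint operator `A ≥ 0` and `s ≥ 0`. -/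
def smoothing (A : H →ₗ.[ℂ] H) (s : ℝ) : H →L[ℂ] H :=
  boundedCalculus A fun l => (1 + l) ^ (-s / 2)

end FunctionalCalculus

/-! ### Weak derivatives -/

/-- `Du 0, …, Du (d-1)` are the weak partial derivatives `∂₁u, …, ∂_d u` on `ℝᵈ`. -/
structure HasWeakGradient {d : ℕ} {F : Type*} [NormedAddCommGroup F] [NormedSpace ℝ F]
    (u : EuclideanSpace ℝ (Fin d) → F) (Du : Fin d → EuclideanSpace ℝ (Fin d) → F) : Prop where
  locallyIntegrable : LocallyIntegrable u volume
  locallyIntegrable_deriv : ∀ l, LocallyIntegrable (Du l) volume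
  integral_eq : ∀ (l : Fin d) (φ : EuclideanSpace ℝ (Fin d) → ℝ), ContDiff ℝ ∞ φ →
    HasCompactSupport φ →
      ∫ x, fderiv ℝ φ x (EuclideanSpace.single l 1) • u x = -∫ x, φ x • Du l x

namespace HasWeakGradient

variable {d : ℕ} {F : Type*} [NormedAddCommGroup F] [NormedSpace ℝ F]
  {u v : EuclideanSpace ℝ (Fin d) → F} {Du Dv : Fin d → EuclideanSpace ℝ (Fin d) → F}

theorem congr (h : HasWeakGradient u Du) (hu : u =ᵐ[volume] v)
    (hD : ∀ l, Du l =ᵐ[volume] Dv l) : HasWeakGradient v Dv where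
  locallyIntegrable := h.locallyIntegrable.congr hu
  locallyIntegrable_deriv l := (h.locallyIntegrable_deriv l).congr (hD l)
  integral_eq l φ h1 h2 := by
    have e1 : ∫ x, fderiv ℝ φ x (EuclideanSpace.single l 1) • v x =
        ∫ x, fderiv ℝ φ x (EuclideanSpace.single l 1) • u x :=
      integral_congr_ae (hu.mono fun x hx => by simp only [hx])
    have e2 : ∫ x, φ x • Dv l x = ∫ x, φ x • Du l x :=
      integral_congr_ae ((hD l).mono fun x hx => by simp only [hx])
    rw [e1, e2, h.integral_eq l φ h1 h2]

theorem integrable_left (hu : LocallyIntegrable u volume) (l : Fin d)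
    {φ : EuclideanSpace ℝ (Fin d) → ℝ} (h1 : ContDiff ℝ ∞ φ) (h2 : HasCompactSupport φ) :
    Integrable (fun x => fderiv ℝ φ x (EuclideanSpace.single l 1) • u x) volume :=
  hu.integrable_smul_left_of_hasCompactSupport
    ((h1.continuous_fderiv (by simp)).clm_apply continuous_const)
    (h2.fderiv_apply ℝ _)

theorem add (hu : HasWeakGradient u Du) (hv : HasWeakGradient v Dv) :
    HasWeakGradient (u + v) (Du + Dv) where
  locallyIntegrable := hu.locallyIntegrable.add hv.locallyIntegrable
  locallyIntegrable_deriv l := (hu.locallyIntegrable_deriv l).add (hv.locallyIntegrable_deriv l)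
  integral_eq l φ h1 h2 := by
    have i1 := (hu.locallyIntegrable_deriv l).integrable_smul_left_of_hasCompactSupport
      h1.continuous h2
    have i2 := (hv.locallyIntegrable_deriv l).integrable_smul_left_of_hasCompactSupport
      h1.continuous h2
    simp only [Pi.add_apply, smul_add]
    rw [integral_add (integrable_left hu.locallyIntegrable l h1 h2)
      (integrable_left hv.locallyIntegrable l h1 h2), integral_add i1 i2,
      hu.integral_eq l φ h1 h2, hv.integral_eq l φ h1 h2]
    abel

theorem smul [NormedSpace ℂ F] (c : ℂ) (hu : HasWeakGradient u Du) :
    HasWeakGradient (c • u) (c • Du) where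
  locallyIntegrable := hu.locallyIntegrable.smul c
  locallyIntegrable_deriv l := (hu.locallyIntegrable_deriv l).smul c
  integral_eq l φ h1 h2 := by
    have h := congrArg (fun y => c • y) (hu.integral_eq l φ h1 h2)
    simp only [smul_neg, ← integral_smul] at h
    simp only [Pi.smul_apply]
    simp_rw [smul_comm _ c]
    exact h

theorem zero : HasWeakGradient (0 : EuclideanSpace ℝ (Fin d) → F) 0 where
  locallyIntegrable := locallyIntegrable_zero
  locallyIntegrable_deriv _ := locallyIntegrable_zero
  integral_eq l φ h1 h2 := by simp

theorem ae_eq_zero [CompleteSpace F] (h : HasWeakGradient u Du) (hu : u =ᵐ[volume] 0)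
    (l : Fin d) : Du l =ᵐ[volume] 0 := by
  refine ae_eq_zero_of_integral_contDiff_smul_eq_zero (h.locallyIntegrable_deriv l)
    fun φ h1 h2 => ?_
  have h3 : ∫ x, fderiv ℝ φ x (EuclideanSpace.single l 1) • u x = 0 := by
    rw [← integral_zero (EuclideanSpace ℝ (Fin d)) F]
    exact integral_congr_ae (hu.mono fun x hx => by simp [hx])
  rw [h.integral_eq l φ h1 h2, neg_eq_zero] at h3
  exact h3

end HasWeakGradient

/-! ### The differential operators in `L₂(ℝᵈ; ℂⁿ)` -/

/-- `L₂(ℝᵈ; ℂ^κ)`. -/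
abbrev L2 (d : ℕ) (κ : Type*) [Fintype κ] : Type _ :=
  Lp (EuclideanSpace ℂ κ) 2 (volume : Measure (EuclideanSpace ℝ (Fin d)))

section Operators

variable {d : ℕ} {ι κ : Type*} [Fintype ι] [Fintype κ]

/-- The value `b(D)u = ∑ₗ bₗ Dₗ u`, where `Dₗ = -i ∂ₗ`, at a point where `∂ₗ u` equals `p l`. -/
def symbolD (b : Fin d → Matrix κ ι ℂ) (p : Fin d → ι → ℂ) : κ → ℂ :=
  ∑ l, b l *ᵥ (-Complex.I • p l)

/-- The graph of `b(D) : L₂(ℝᵈ; ℂ^ι) → L₂(ℝᵈ; ℂ^κ)` with domain `H¹(ℝᵈ; ℂ^ι)`. -/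
def firstOrderGraph (b : Fin d → Matrix κ ι ℂ) : Submodule ℂ (L2 d ι × L2 d κ) where
  carrier := {z | ∃ Du : Fin d → L2 d ι, HasWeakGradient z.1 (fun l => Du l) ∧
    ∀ᵐ x, (z.2 x).ofLp = symbolD b fun l => (Du l x).ofLp}
  add_mem' := by
    rintro ⟨u, p⟩ ⟨v, q⟩ ⟨Du, hu, hp⟩ ⟨Dv, hv, hq⟩
    refine ⟨Du + Dv, (hu.add hv).congr (Lp.coeFn_add u v).symm
      fun l => (Lp.coeFn_add (Du l) (Dv l)).symm, ?_⟩
    have hD := ae_all_iff.2 fun l => Lp.coeFn_add (Du l) (Dv l)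
    filter_upwards [hp, hq, Lp.coeFn_add p q, hD] with x h1 h2 h3 h4
    simp only [Prod.mk_add_mk, h3, Pi.add_apply, WithLp.ofLp_add, h1, h2, h4, symbolD, smul_add,
      Matrix.mulVec_add, Finset.sum_add_distrib]
  zero_mem' := by
    refine ⟨0, HasWeakGradient.zero.congr (Lp.coeFn_zero _ _ _).symm
      fun l => (Lp.coeFn_zero _ _ _).symm, ?_⟩
    simp [symbolD]
  smul_mem' := by
    rintro c ⟨u, p⟩ ⟨Du, hu, hp⟩
    refine ⟨c • Du, (hu.smul c).congr (Lp.coeFn_smul c u).symm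
      fun l => (Lp.coeFn_smul c (Du l)).symm, ?_⟩
    have hD := ae_all_iff.2 fun l => Lp.coeFn_smul c (Du l)
    filter_upwards [hp, Lp.coeFn_smul c p, hD] with x h1 h3 h4
    simp only [Prod.smul_mk, h3, Pi.smul_apply, WithLp.ofLp_smul, h1, h4, symbolD,
      smul_comm _ c, Matrix.mulVec_smul, Finset.smul_sum]

/-- `b(D) : L₂(ℝᵈ; ℂ^ι) → L₂(ℝᵈ; ℂ^κ)` with domain `H¹(ℝᵈ; ℂ^ι)`. -/
def firstOrder (b : Fin d → Matrix κ ι ℂ) : L2 d ι →ₗ.[ℂ] L2 d κ :=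
  (firstOrderGraph b).toLinearPMap

theorem graph_firstOrder (b : Fin d → Matrix κ ι ℂ) :
    (firstOrder b).graph = firstOrderGraph b := by
  refine Submodule.toLinearPMap_graph_eq _ ?_
  rintro ⟨u, p⟩ ⟨Du, hu, hp⟩ (rfl : u = 0)
  have hD := ae_all_iff.2 fun l => hu.ae_eq_zero (Lp.coeFn_zero _ _ _) l
  refine Lp.ext ?_
  filter_upwards [hp, hD, Lp.coeFn_zero (EuclideanSpace ℂ κ) 2 volume] with x h1 h2 h3
  refine WithLp.ofLp_injective 2 ?_
  rw [h1, h3]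
  simp [symbolD, h2]

theorem mem_firstOrder_domain_of_hasWeakGradient (b : Fin d → Matrix κ ι ℂ) {u : L2 d ι}
    {Du : Fin d → L2 d ι} (h : HasWeakGradient u fun l => Du l) : u ∈ (firstOrder b).domain := by
  classical
  have hm : MemLp (fun x => ∑ l, Matrix.toEuclideanLin (b l) (-Complex.I • Du l x)) 2
      (volume : Measure (EuclideanSpace ℝ (Fin d))) :=
    memLp_finsetSum _ fun l _ =>
      (Matrix.toEuclideanLin (b l)).toContinuousLinearMap.comp_memLp'
        (f := fun x => -Complex.I • Du l x) ((Lp.memLp (Du l)).const_smul (-Complex.I))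
  refine Submodule.mem_map.2 ⟨(u, hm.toLp _), ⟨Du, h, ?_⟩, rfl⟩
  filter_upwards [hm.coeFn_toLp] with x hx
  change (hm.toLp _ x).ofLp = _
  rw [hx]
  simp [symbolD, WithLp.ofLp_sum, Matrix.mulVec_neg, Matrix.mulVec_smul]

theorem dense_firstOrder_domain (b : Fin d → Matrix κ ι ℂ) :
    Dense ((firstOrder b).domain : Set (L2 d ι)) := by
  refine (SchwartzMap.denseRange_toLpCLM (E := EuclideanSpace ℝ (Fin d))
    (F := EuclideanSpace ℂ ι) (p := 2) (μ := volume) (by simp)).mono ?_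
  rintro _ ⟨f, rfl⟩
  refine mem_firstOrder_domain_of_hasWeakGradient b
    (Du := fun l => (LineDeriv.lineDerivOp (EuclideanSpace.single l (1 : ℝ)) f).toLp 2 volume) ?_
  refine HasWeakGradient.congr (u := f)
    (Du := fun l => LineDeriv.lineDerivOp (EuclideanSpace.single l (1 : ℝ)) f)
    ⟨f.continuous.locallyIntegrable, fun l => (SchwartzMap.continuous _).locallyIntegrable,
      fun l φ h1 h2 => ?_⟩ (f.coeFn_toLp 2 volume).symm
    fun l => (SchwartzMap.coeFn_toLp _ 2 volume).symm
  have hf := f.continuous.locallyIntegrable (μ := volume)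
  have hD := (SchwartzMap.continuous
    (LineDeriv.lineDerivOp (EuclideanSpace.single l (1 : ℝ)) f)).locallyIntegrable (μ := volume)
  have i2 := hD.integrable_smul_left_of_hasCompactSupport h1.continuous h2
  simp only [SchwartzMap.lineDerivOp_apply_eq_fderiv] at i2 ⊢
  rw [integral_smul_fderiv_eq_neg_fderiv_smul_of_integrable
    (HasWeakGradient.integrable_left hf l h1 h2) i2
    (hf.integrable_smul_left_of_hasCompactSupport h1.continuous h2)
    (fun x _ => (h1.differentiable (by simp)).differentiableAt)
    (fun x _ => f.differentiableAt), neg_neg]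

/-- The graph of the operator `b(D)* g(x) b(D)` generated by the form
`(g b(D)u, b(D)v)`, `u, v ∈ H¹(ℝᵈ; ℂ^ι)`: the pairs `(u, w)` with `u ∈ H¹` such that
`(g b(D)u, b(D)v) = (w, v)` for all `v ∈ H¹`. -/
def divFormGraph (b : Fin d → Matrix κ ι ℂ) (g : EuclideanSpace ℝ (Fin d) → Matrix κ κ ℂ) :
    Submodule ℂ (L2 d ι × L2 d ι) where
  carrier := {z | ∃ (hz : z.1 ∈ (firstOrder b).domain) (q : L2 d κ),
    (∀ᵐ x, (q x).ofLp = g x *ᵥ ((firstOrder b ⟨z.1, hz⟩) x).ofLp) ∧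
    ∀ v : (firstOrder b).domain, ⟪firstOrder b v, q⟫_ℂ = ⟪(v : L2 d ι), z.2⟫_ℂ}
  add_mem' := by
    rintro ⟨u, w⟩ ⟨u', w'⟩ ⟨hu, q, hq, h⟩ ⟨hu', q', hq', h'⟩
    refine ⟨add_mem hu hu', q + q', ?_, fun v => by
      simp only [Prod.mk_add_mk, inner_add_right, h v, h' v]⟩
    have e : firstOrder b ⟨u + u', add_mem hu hu'⟩ = firstOrder b ⟨u, hu⟩ + firstOrder b ⟨u', hu'⟩ :=
      (firstOrder b).map_add ⟨u, hu⟩ ⟨u', hu'⟩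
    simp only [Prod.mk_add_mk, e]
    filter_upwards [hq, hq', Lp.coeFn_add q q',
      Lp.coeFn_add (firstOrder b ⟨u, hu⟩) (firstOrder b ⟨u', hu'⟩)] with x h1 h2 h3 h4
    simp only [h3, h4, Pi.add_apply, WithLp.ofLp_add, h1, h2, Matrix.mulVec_add]
  zero_mem' := by
    refine ⟨zero_mem _, 0, ?_, fun v => by simp⟩
    have e : firstOrder b ⟨0, zero_mem _⟩ = 0 := (firstOrder b).map_zero
    simp only [Prod.fst_zero, e]
    simp
  smul_mem' := by
    rintro c ⟨u, w⟩ ⟨hu, q, hq, h⟩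
    refine ⟨Submodule.smul_mem _ c hu, c • q, ?_, fun v => by
      simp only [Prod.smul_mk, inner_smul_right, h v]⟩
    have e : firstOrder b ⟨c • u, Submodule.smul_mem _ c hu⟩ = c • firstOrder b ⟨u, hu⟩ :=
      (firstOrder b).map_smul c ⟨u, hu⟩
    simp only [Prod.smul_mk, e]
    filter_upwards [hq, Lp.coeFn_smul c q, Lp.coeFn_smul c (firstOrder b ⟨u, hu⟩)] with x h1 h3 h4
    simp only [h3, h4, Pi.smul_apply, WithLp.ofLp_smul, h1, Matrix.mulVec_smul]

/-- The operator `b(D)* g(x) b(D)` in `L₂(ℝᵈ; ℂ^ι)`. -/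
def divForm (b : Fin d → Matrix κ ι ℂ) (g : EuclideanSpace ℝ (Fin d) → Matrix κ κ ℂ) :
    L2 d ι →ₗ.[ℂ] L2 d ι :=
  (divFormGraph b g).toLinearPMap

theorem graph_divForm (b : Fin d → Matrix κ ι ℂ) (g : EuclideanSpace ℝ (Fin d) → Matrix κ κ ℂ) :
    (divForm b g).graph = divFormGraph b g := by
  refine Submodule.toLinearPMap_graph_eq _ ?_
  rintro ⟨u, w⟩ ⟨hu, q, hq, h⟩ (rfl : u = 0)
  have e : firstOrder b ⟨0, hu⟩ = 0 := (firstOrder b).map_zero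
  have hq0 : q = 0 := by
    refine Lp.ext ?_
    simp only [e] at hq
    filter_upwards [hq] with x h1
    refine WithLp.ofLp_injective 2 ?_
    rw [h1]
    simp
  refine (dense_firstOrder_domain b).eq_zero_of_inner_right ℂ fun v hv => ?_
  rw [← h ⟨v, hv⟩, hq0, inner_zero_right]

/-- The coefficients of the gradient `u ↦ (D₁u, …, D_d u)` on `ℂ^ι`-valued functions. -/
def gradCoeff (d : ℕ) (ι : Type*) [DecidableEq ι] : Fin d → Matrix (Fin d × ι) ι ℂ :=
  fun l => Matrix.of fun p i => if p.1 = l ∧ p.2 = i then 1 else 0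

/-- `H₀ = -Δ` in `L₂(ℝᵈ; ℂ^ι)`. -/
def negLaplacian (d : ℕ) (ι : Type*) [Fintype ι] [DecidableEq ι] : L2 d ι →ₗ.[ℂ] L2 d ι :=
  divForm (gradCoeff d ι) fun _ => 1

/-- The symbol `b(ξ) = ∑ₗ ξₗ bₗ`. -/
def symbol (b : Fin d → Matrix κ ι ℂ) (ξ : EuclideanSpace ℝ (Fin d)) : Matrix κ ι ℂ :=
  ∑ l, (ξ l : ℂ) • b l

end Operators

/-! ### The cell problem and the effective characteristics -/

section Effective

variable {d n m : ℕ}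

/-- `u` is the `Γ`-periodic extension of a function of class `H̃¹(Ω; ℂⁿ)`, where `Γ` is the lattice
generated by `a` and `Ω` is its cell, and `Du` are the partial derivatives of `u`. -/
structure PeriodicH1 (a : Module.Basis (Fin d) ℝ (EuclideanSpace ℝ (Fin d)))
    (u : EuclideanSpace ℝ (Fin d) → Fin n → ℂ)
    (Du : Fin d → EuclideanSpace ℝ (Fin d) → Fin n → ℂ) : Prop where
  periodic : ∀ j x, u (x + a j) = u x
  weakGradient : HasWeakGradient u Du
  memLp : MemLp u 2 (volume.restrict (ZSpan.fundamentalDomain a))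
  memLp_deriv : ∀ l, MemLp (Du l) 2 (volume.restrict (ZSpan.fundamentalDomain a))

/-- `b(D)Λ + 1_m` for an `(n × m)`-matrix-valued `Λ` with the partial derivatives `DΛ`. -/
def fluxFactor (b : Fin d → Matrix (Fin m) (Fin n) ℂ)
    (DΛ : Fin d → EuclideanSpace ℝ (Fin d) → Matrix (Fin n) (Fin m) ℂ)
    (x : EuclideanSpace ℝ (Fin d)) : Matrix (Fin m) (Fin m) ℂ :=
  ∑ l, b l * (-Complex.I • DΛ l x) + 1

/-- `Λ` (with the partial derivatives `DΛ`) is the `Γ`-periodic weak solution of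
`b(D)* g(x) (b(D)Λ(x) + 1_m) = 0`, `∫_Ω Λ dx = 0`. -/
structure IsCellSolution (a : Module.Basis (Fin d) ℝ (EuclideanSpace ℝ (Fin d)))
    (b : Fin d → Matrix (Fin m) (Fin n) ℂ)
    (g : EuclideanSpace ℝ (Fin d) → Matrix (Fin m) (Fin m) ℂ)
    (Λ : EuclideanSpace ℝ (Fin d) → Matrix (Fin n) (Fin m) ℂ)
    (DΛ : Fin d → EuclideanSpace ℝ (Fin d) → Matrix (Fin n) (Fin m) ℂ) : Prop where
  periodicH1 : ∀ k, PeriodicH1 a (fun x i => Λ x i k) fun l x i => DΛ l x i k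
  weak_eq : ∀ k v Dv, PeriodicH1 a v Dv →
    ∫ x in ZSpan.fundamentalDomain a,
      star (symbolD b fun l => Dv l x) ⬝ᵥ (fun j => (g x * fluxFactor b DΛ x) j k) = 0
  mean_zero : ∀ i k, ∫ x in ZSpan.fundamentalDomain a, Λ x i k = 0

/-- The solution `Λ` of the cell problem together with its partial derivatives. -/
def cellSolution (a : Module.Basis (Fin d) ℝ (EuclideanSpace ℝ (Fin d)))
    (b : Fin d → Matrix (Fin m) (Fin n) ℂ)
    (g : EuclideanSpace ℝ (Fin d) → Matrix (Fin m) (Fin m) ℂ) :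
    (EuclideanSpace ℝ (Fin d) → Matrix (Fin n) (Fin m) ℂ) ×
      (Fin d → EuclideanSpace ℝ (Fin d) → Matrix (Fin n) (Fin m) ℂ) :=
  open Classical in
  if h : ∃ Z : (EuclideanSpace ℝ (Fin d) → Matrix (Fin n) (Fin m) ℂ) ×
      (Fin d → EuclideanSpace ℝ (Fin d) → Matrix (Fin n) (Fin m) ℂ),
      IsCellSolution a b g Z.1 Z.2
    then h.choose else 0

/-- The mean value `|Ω|⁻¹ ∫_Ω M(x) dx` of a matrix-valued function over the cell. -/
def cellMean (a : Module.Basis (Fin d) ℝ (EuclideanSpace ℝ (Fin d)))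
    (M : EuclideanSpace ℝ (Fin d) → Matrix (Fin m) (Fin m) ℂ) : Matrix (Fin m) (Fin m) ℂ :=
  Matrix.of fun i j =>
    ((volume.real (ZSpan.fundamentalDomain a) : ℝ) : ℂ)⁻¹ *
      ∫ x in ZSpan.fundamentalDomain a, M x i j

variable (a : Module.Basis (Fin d) ℝ (EuclideanSpace ℝ (Fin d)))
  (b : Fin d → Matrix (Fin m) (Fin n) ℂ)
  (g : EuclideanSpace ℝ (Fin d) → Matrix (Fin m) (Fin m) ℂ)

/-- `g̃(x) = g(x) (b(D)Λ(x) + 1_m)`. -/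
def gTilde (x : EuclideanSpace ℝ (Fin d)) : Matrix (Fin m) (Fin m) ℂ :=
  g x * fluxFactor b (cellSolution a b g).2 x

/-- The effective matrix `g⁰ = |Ω|⁻¹ ∫_Ω g̃(x) dx`. -/
def effectiveMatrix : Matrix (Fin m) (Fin m) ℂ :=
  cellMean a (gTilde a b g)

/-- The germ `Ŝ(θ) = b(θ)* g⁰ b(θ)`. -/
def germ (θ : EuclideanSpace ℝ (Fin d)) : Matrix (Fin n) (Fin n) ℂ :=
  (symbol b θ)ᴴ * effectiveMatrix a b g * symbol b θ

/-- `L(θ) = |Ω|⁻¹ ∫_Ω (Λ(x)* b(θ)* g̃(x) + g̃(x)* b(θ) Λ(x)) dx`. -/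
def matrixL (θ : EuclideanSpace ℝ (Fin d)) : Matrix (Fin m) (Fin m) ℂ :=
  cellMean a fun x =>
    ((cellSolution a b g).1 x)ᴴ * (symbol b θ)ᴴ * gTilde a b g x +
      (gTilde a b g x)ᴴ * symbol b θ * (cellSolution a b g).1 x

/-- `N̂(θ) = b(θ)* L(θ) b(θ)`. -/
def matrixN (θ : EuclideanSpace ℝ (Fin d)) : Matrix (Fin n) (Fin n) ℂ :=
  (symbol b θ)ᴴ * matrixL a b g θ * symbol b θ

/-- `N̂₀(θ) = ∑_γ P_γ N̂(θ) P_γ`, where `γ` runs through the distinct eigenvalues of the germ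
`Ŝ(θ)` and `P_γ` is the orthogonal projection of `ℂⁿ` onto the eigenspace of `γ`. (The space
`ℂⁿ` is identified with the space of constant functions on the cell.) -/
def operatorN0 (θ : EuclideanSpace ℝ (Fin d)) :
    EuclideanSpace ℂ (Fin n) →ₗ[ℂ] EuclideanSpace ℂ (Fin n) :=
  ∑ γ : Module.End.Eigenvalues (Matrix.toEuclideanLin (germ a b g θ)),
    (Module.End.eigenspace (Matrix.toEuclideanLin (germ a b g θ)) γ.1).starProjection.toLinearMap ∘ₗ
      Matrix.toEuclideanLin (matrixN a b g θ) ∘ₗ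
      (Module.End.eigenspace (Matrix.toEuclideanLin (germ a b g θ)) γ.1).starProjection.toLinearMap

end Effective

end

/-! The assumed estimate is tested on corrected plane waves. Let `η` be an eigenvector of the germ
at `θ₀` with eigenvalue `γ > 0`, and let `μ = ⟨N̂(θ₀)η, η⟩`. The condition `N̂₀(θ₀) ≠ 0` yields such
an `η` with `μ ≠ 0`, because the compression of an operator to a complex subspace is determined by
its quadratic form. Multiplicities of eigenvalues therefore play no role, and neither a
Floquet–Bloch decomposition nor analytic perturbation theory is needed.

Let `f = e^{ik⟨θ₀,x⟩} η` and `u = e^{ik⟨θ₀,x⟩}(η + εk v(x/ε))` with `v = Λ b(θ₀)η`. The wave `f` is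
a generalized eigenfunction of the effective operator and of `H₀`, with eigenvalues `γk²` and `k²`.
For the oscillating operator, `u` satisfies the eigenvalue equation up to `O(ε)` in the dual of
`H¹`, while the mean value of the form of that operator minus `γk²` on `u` is `εk³μ + O(ε²)`. The
quadratic form of a function of an operator at an approximate eigenvector is given by the first
order Taylor expansion, with an error quadratic in the residual. So the form of `cos(τ A_ε^{1/2}) -
cos(τ√γ k)` on `u` is `-ε τ sin(τ√γ k) k²μ/(2√γ) + O(ε²)`.

In this form one copy of `u` may be replaced by `f` at the cost `O(ε²)`, since both `u - f` and the
residual are `O(ε)`. On `f` the effective cosine and the smoothing factor act as numbers. Dividing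
by `ε` and letting `ε → 0`, the assumed estimate would bound `(1 + k²)^{-s/2} k² |sin(τ√γ k)| |μ|`
by a constant independent of `k`. Along frequencies with `|sin(τ√γ k)| = 1` this quantity grows like
`k^{2-s}`, a contradiction.

Plane waves are not square integrable, so they are multiplied by a cutoff `χ(δx)`. Norms are
normalized by `δ^{d/2}`, and `δ → 0` is taken before `ε → 0`, with `k` fixed. The argument rests on
`norm_inner_boundedCalculus_sub_le` (second order formula for `φ(A)`), `resolvent_quasimode` (from
the weak residual to the resolvent), `norm_integral_residual_le` (size of the residual),
`exists_meanEnergy_eq` (expansion of the energy), `norm_inner_sub_smul_le` (comparison of the two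
cosines) and `exists_frequency`; they are combined in `IsCorrector.not_exists_bound`. -/

/-! ### Bounded functions of a nonnegative selfadjoint operator -/

section AbstractCalculus

variable {H : Type*} [NormedAddCommGroup H] [InnerProductSpace ℂ H]

/-- A symmetric nonnegative operator `A` such that `A + I` is surjective. -/
structure IsNonnegSelfAdjoint (A : H →ₗ.[ℂ] H) : Prop where
  exists_add : ∀ f : H, ∃ u, (u, f - u) ∈ A.graph
  symm : ∀ x ∈ A.graph, ∀ y ∈ A.graph, ⟪x.1, y.2⟫_ℂ = ⟪x.2, y.1⟫_ℂ
  nonneg : ∀ x ∈ A.graph, 0 ≤ (⟪x.1, x.2⟫_ℂ).re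

namespace IsNonnegSelfAdjoint

variable {A : H →ₗ.[ℂ] H}

theorem norm_sq_le (hA : IsNonnegSelfAdjoint A) {u f : H} (h : (u, f - u) ∈ A.graph) :
    ‖u‖ ^ 2 ≤ (⟪u, f⟫_ℂ).re := by
  have h1 := hA.nonneg _ h
  simp only [inner_sub_right, Complex.sub_re] at h1
  have h2 : (⟪u, u⟫_ℂ).re = ‖u‖ ^ 2 := inner_self_eq_norm_sq (𝕜 := ℂ) u
  linarith

theorem norm_le (hA : IsNonnegSelfAdjoint A) {u f : H} (h : (u, f - u) ∈ A.graph) :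
    ‖u‖ ≤ ‖f‖ := by
  have h1 := hA.norm_sq_le h
  have h2 : (⟪u, f⟫_ℂ).re ≤ ‖u‖ * ‖f‖ := (Complex.re_le_norm _).trans (norm_inner_le_norm u f)
  by_contra! h3
  have : 0 ≤ ‖f‖ := norm_nonneg f
  nlinarith

theorem eq_of_mem (hA : IsNonnegSelfAdjoint A) {u v f : H} (h : (u, f - u) ∈ A.graph)
    (h' : (v, f - v) ∈ A.graph) : u = v := by
  have h1 : (u - v, (0 : H) - (u - v)) ∈ A.graph := by
    have := A.graph.sub_mem h h'
    simpa using this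
  simpa [sub_eq_zero] using hA.norm_le h1

/-- Surjectivity of `A + I` gives solutions, and the contraction estimate makes them unique, linear
and bounded in the data. This excludes the default value `0` in `resolventNegOne`. -/
theorem exists_resolvent (hA : IsNonnegSelfAdjoint A) :
    ∃ R : H →L[ℂ] H, ∀ f u : H, R f = u ↔ (u, f - u) ∈ A.graph := by
  choose R hR using hA.exists_add
  refine ⟨LinearMap.mkContinuous
    { toFun := R
      map_add' := fun f g => hA.eq_of_mem (hR (f + g)) ?_
      map_smul' := fun c f => hA.eq_of_mem (hR (c • f)) ?_ } 1 fun f => ?_, fun f u => ⟨?_, ?_⟩⟩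
  · have := A.graph.add_mem (hR f) (hR g)
    rwa [Prod.mk_add_mk, sub_add_sub_comm] at this
  · have := A.graph.smul_mem c (hR f)
    rwa [Prod.smul_mk, smul_sub] at this
  · simpa using hA.norm_le (hR f)
  · rintro rfl
    exact hR f
  · exact fun h => hA.eq_of_mem (hR f) h

theorem resolvent_eq_iff (hA : IsNonnegSelfAdjoint A) (f u : H) :
    resolventNegOne A f = u ↔ (u, f - u) ∈ A.graph := by
  rw [resolventNegOne, dif_pos hA.exists_resolvent]
  exact hA.exists_resolvent.choose_spec f u

theorem resolvent_mem (hA : IsNonnegSelfAdjoint A) (f : H) :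
    (resolventNegOne A f, f - resolventNegOne A f) ∈ A.graph :=
  (hA.resolvent_eq_iff f _).1 rfl

theorem norm_resolvent_apply_le (hA : IsNonnegSelfAdjoint A) (f : H) :
    ‖resolventNegOne A f‖ ≤ ‖f‖ :=
  hA.norm_le (hA.resolvent_mem f)

theorem isPositive_resolvent (hA : IsNonnegSelfAdjoint A) : (resolventNegOne A).IsPositive := by
  refine ⟨fun f g => ?_, fun f => ?_⟩
  · have h := hA.symm _ (hA.resolvent_mem f) _ (hA.resolvent_mem g)
    simp only [inner_sub_left, inner_sub_right] at h
    have h' := (sub_left_inj.1 h).symm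
    exact h'.symm
  · have h := hA.norm_sq_le (hA.resolvent_mem f)
    exact (sq_nonneg _).trans h

theorem resolvent_eq_zero (hA : IsNonnegSelfAdjoint A) {f : H} (h : resolventNegOne A f = 0) :
    f = 0 := by
  have h1 := (hA.resolvent_eq_iff f 0).1 h
  rw [sub_zero] at h1
  exact A.graph_fst_eq_zero_snd h1 rfl

variable [CompleteSpace H]

theorem spectrum_resolvent_subset (hA : IsNonnegSelfAdjoint A) :
    spectrum ℝ (resolventNegOne A) ⊆ Set.Icc 0 1 := by
  intro r hr
  refine ⟨spectrum_nonneg_of_nonneg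
    ((ContinuousLinearMap.nonneg_iff_isPositive _).2 hA.isPositive_resolvent) hr, ?_⟩
  rcases subsingleton_or_nontrivial (H →L[ℂ] H) with h | h
  · simp [spectrum.of_subsingleton] at hr
  · have h1 : ‖r‖ ≤ ‖resolventNegOne A‖ := spectrum.norm_le_norm_of_mem hr
    have h2 : ‖resolventNegOne A‖ ≤ 1 :=
      ContinuousLinearMap.opNorm_le_bound _ zero_le_one
        fun f => by simpa using hA.norm_resolvent_apply_le f
    exact (le_abs_self r).trans (h1.trans h2)

theorem isSelfAdjoint_resolvent (hA : IsNonnegSelfAdjoint A) :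
    IsSelfAdjoint (resolventNegOne A) :=
  hA.isPositive_resolvent.isSelfAdjoint

/-- The resolvent is selfadjoint, so a vector orthogonal to its range lies in its kernel, which is
trivial because `A` is single valued. -/
theorem denseRange_resolvent (hA : IsNonnegSelfAdjoint A) : DenseRange (resolventNegOne A) := by
  have h : Dense ((LinearMap.range (resolventNegOne A).toLinearMap : Submodule ℂ H) : Set H) := by
    rw [Submodule.dense_iff_topologicalClosure_eq_top, Submodule.topologicalClosure_eq_top_iff,
      Submodule.eq_bot_iff]
    intro f hf
    refine hA.resolvent_eq_zero (ext_inner_left ℂ fun g => ?_)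
    rw [inner_zero_right]
    have h1 : ⟪resolventNegOne A g, f⟫_ℂ = 0 :=
      Submodule.inner_right_of_mem_orthogonal (LinearMap.mem_range_self _ g) hf
    rw [← h1]
    exact (hA.isPositive_resolvent.isSymmetric g f).symm
  exact h

/-- The functional calculus of the resolvent respects pointwise bounds on `[0, 1]`. -/
theorem norm_cfc_resolvent_apply_le (hA : IsNonnegSelfAdjoint A) {f h : ℝ → ℝ}
    (hf : ContinuousOn f (Set.Icc 0 1)) (hh : ContinuousOn h (Set.Icc 0 1))
    (hfh : ∀ r ∈ Set.Icc (0 : ℝ) 1, |f r| ≤ |h r|) (v : H) :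
    ‖cfc f (resolventNegOne A) v‖ ≤ ‖cfc h (resolventNegOne A) v‖ := by
  have hs := hA.spectrum_resolvent_subset
  -- For real `f` the operator `f(R)` is selfadjoint, so `‖f(R)v‖²` is the quadratic form of
  -- `f²(R)`, and the monotonicity of the calculus applies.
  have key : ∀ f : ℝ → ℝ, ContinuousOn f (Set.Icc 0 1) →
      ‖cfc f (resolventNegOne A) v‖ ^ 2 =
        (⟪cfc (fun r => f r * f r) (resolventNegOne A) v, v⟫_ℂ).re := by
    intro f hf
    have h1 : IsSelfAdjoint (cfc f (resolventNegOne A)) := cfc_predicate f _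
    rw [cfc_mul f f _ (hf.mono hs) (hf.mono hs), mul_apply_eq_comp,
      h1.isSymmetric.apply_clm]
    exact (inner_self_eq_norm_sq (𝕜 := ℂ) _).symm
  have h2 : cfc (fun r => f r * f r) (resolventNegOne A) ≤
      cfc (fun r => h r * h r) (resolventNegOne A) :=
    cfc_mono (fun r hr => by
      have := hfh r (hs hr)
      rw [← abs_mul_abs_self (f r), ← abs_mul_abs_self (h r)]
      exact mul_self_le_mul_self (abs_nonneg _) this)
      ((hf.mul hf).mono hs) ((hh.mul hh).mono hs)
  have h3 := ((ContinuousLinearMap.le_def _ _).1 h2).re_inner_nonneg_left v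
  rw [_root_.sub_apply, inner_sub_left, map_sub] at h3
  refine le_of_sq_le_sq ?_ (norm_nonneg _)
  rw [key f hf, key h hh]
  simpa using h3

end IsNonnegSelfAdjoint

/-- `r ↦ r φ(r⁻¹ - 1)` is continuous on `[0, 1]` for a bounded continuous `φ`. -/
theorem continuousOn_mul_comp_inv_sub_one {φ : ℝ → ℝ} {M : ℝ}
    (hc : ContinuousOn φ (Set.Ici 0)) (hM : ∀ x, 0 ≤ x → |φ x| ≤ M) :
    ContinuousOn (fun r : ℝ => r * φ (r⁻¹ - 1)) (Set.Icc 0 1) := by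
  have hmem : ∀ r : ℝ, 0 < r → r ≤ 1 → 0 ≤ r⁻¹ - 1 := fun r h0 h1 =>
    sub_nonneg.2 ((one_le_inv₀ h0).2 h1)
  intro r hr
  rcases hr.1.eq_or_lt with h | h
  -- Since `0⁻¹ = 0`, the value at `r = 0` is `0 * φ (-1) = 0`, whatever `φ` does outside `[0, ∞)`;
  -- the bound `|r| M` gives continuity there.
  · subst h
    rw [ContinuousWithinAt, zero_mul]
    refine squeeze_zero_norm' (a := fun r : ℝ => |r| * M) ?_ ?_
    · refine eventually_nhdsWithin_of_forall fun x hx => ?_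
      rw [Real.norm_eq_abs, abs_mul]
      rcases hx.1.eq_or_lt with h | h
      · simp [← h]
      · exact mul_le_mul_of_nonneg_left (hM _ (hmem x h hx.2)) (abs_nonneg _)
    · have : Continuous fun r : ℝ => |r| * M := by fun_prop
      simpa using (this.tendsto 0).mono_left nhdsWithin_le_nhds
  · have h1 : ContinuousWithinAt φ (Set.Ici 0) (r⁻¹ - 1) := hc _ (hmem r h hr.2)
    have h2 : ContinuousWithinAt (fun r : ℝ => r⁻¹ - 1) (Set.Ioc 0 1) r :=
      ((continuousAt_inv₀ h.ne').sub continuousAt_const).continuousWithinAt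
    have h3 : ContinuousWithinAt (fun r : ℝ => φ (r⁻¹ - 1)) (Set.Ioc 0 1) r :=
      ContinuousWithinAt.comp (f := fun r : ℝ => r⁻¹ - 1) h1 h2 fun x hx => hmem x hx.1 hx.2
    have h4 : ContinuousWithinAt (fun r : ℝ => r * φ (r⁻¹ - 1)) (Set.Ioc 0 1) r :=
      continuousWithinAt_id.mul h3
    refine h4.mono_of_mem_nhdsWithin ?_
    filter_upwards [self_mem_nhdsWithin, nhdsWithin_le_nhds (lt_mem_nhds h)] with x hx hx'
    exact ⟨hx', hx.2⟩

namespace IsNonnegSelfAdjoint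

variable [CompleteSpace H] {A : H →ₗ.[ℂ] H} {φ : ℝ → ℝ} {M : ℝ}

/-- The pointwise bound `|r φ(r⁻¹ - 1)| ≤ M r` passes to the operators. It makes the map `Rv ↦
ψ(R)v` well defined and bounded on the range of `R`. -/
theorem norm_cfc_mul_le (hA : IsNonnegSelfAdjoint A) (hc : ContinuousOn φ (Set.Ici 0))
    (hM : ∀ x, 0 ≤ x → |φ x| ≤ M) (v : H) :
    ‖cfc (fun r : ℝ => r * φ (r⁻¹ - 1)) (resolventNegOne A) v‖ ≤ M * ‖resolventNegOne A v‖ := by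
  have hM0 : 0 ≤ M := (abs_nonneg _).trans (hM 0 le_rfl)
  refine (hA.norm_cfc_resolvent_apply_le (h := fun r => M * r)
    (continuousOn_mul_comp_inv_sub_one hc hM) (by fun_prop) (fun r hr => ?_) v).trans ?_
  · rw [abs_mul, abs_mul, mul_comm, abs_of_nonneg hM0]
    rcases hr.1.eq_or_lt with h | h
    · simp [← h]
    · exact mul_le_mul_of_nonneg_right
        (hM _ (sub_nonneg.2 ((one_le_inv₀ h).2 hr.2))) (abs_nonneg _)
  · rw [cfc_const_mul_id M _ hA.isSelfAdjoint_resolvent, _root_.smul_apply, norm_smul,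
      Real.norm_of_nonneg hM0]

/-- The bounded map `Rv ↦ ψ(R)v` extends from the dense range of `R`, so the default value in
`boundedCalculus` is excluded. All properties of `φ(A)` below are proved on this range and extended
by density. -/
theorem boundedCalculus_resolvent (hA : IsNonnegSelfAdjoint A) (hc : ContinuousOn φ (Set.Ici 0))
    (hM : ∀ x, 0 ≤ x → |φ x| ≤ M) (v : H) :
    boundedCalculus A φ (resolventNegOne A v) =
      cfc (fun r : ℝ => r * φ (r⁻¹ - 1)) (resolventNegOne A) v := by
  have h : ∃ T : H →L[ℂ] H,
      T ∘L resolventNegOne A = cfc (fun r : ℝ => r * φ (r⁻¹ - 1)) (resolventNegOne A) := by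
    refine ⟨(cfc (fun r : ℝ => r * φ (r⁻¹ - 1)) (resolventNegOne A)).toLinearMap.extendOfNorm
      (resolventNegOne A).toLinearMap, ContinuousLinearMap.ext fun v => ?_⟩
    exact LinearMap.extendOfNorm_eq hA.denseRange_resolvent ⟨M, hA.norm_cfc_mul_le hc hM⟩ v
  rw [boundedCalculus, dif_pos h]
  exact DFunLike.congr_fun h.choose_spec v

theorem norm_boundedCalculus_apply_le (hA : IsNonnegSelfAdjoint A)
    (hc : ContinuousOn φ (Set.Ici 0)) (hM : ∀ x, 0 ≤ x → |φ x| ≤ M) (v : H) :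
    ‖boundedCalculus A φ v‖ ≤ M * ‖v‖ := by
  refine hA.denseRange_resolvent.induction_on v (isClosed_le (by fun_prop) (by fun_prop))
    fun f => ?_
  rw [hA.boundedCalculus_resolvent hc hM]
  exact hA.norm_cfc_mul_le hc hM f

/-- On the range of `R` the identity reduces to `ψ(R)` and `R` being selfadjoint and commuting. -/
theorem boundedCalculus_inner (hA : IsNonnegSelfAdjoint A)
    (hc : ContinuousOn φ (Set.Ici 0)) (hM : ∀ x, 0 ≤ x → |φ x| ≤ M) (u v : H) :
    ⟪boundedCalculus A φ u, v⟫_ℂ = ⟪u, boundedCalculus A φ v⟫_ℂ := by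
  refine hA.denseRange_resolvent.induction_on₂ (p := fun u v =>
    ⟪boundedCalculus A φ u, v⟫_ℂ = ⟪u, boundedCalculus A φ v⟫_ℂ)
    (isClosed_eq (by fun_prop) (by fun_prop)) (fun f g => ?_) u v
  rw [hA.boundedCalculus_resolvent hc hM, hA.boundedCalculus_resolvent hc hM]
  have h1 : Commute (cfc (fun r : ℝ => r * φ (r⁻¹ - 1)) (resolventNegOne A))
      (resolventNegOne A) := by
    conv => arg 2; rw [← cfc_id ℝ (resolventNegOne A) hA.isSelfAdjoint_resolvent]
    exact cfc_commute_cfc _ _ _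
  have h2 : IsSelfAdjoint (cfc (fun r : ℝ => r * φ (r⁻¹ - 1)) (resolventNegOne A)) :=
    cfc_predicate _ _
  rw [← h2.isSymmetric.apply_clm, ← mul_apply_eq_comp, h1.eq,
    mul_apply_eq_comp]
  exact (hA.isPositive_resolvent.isSymmetric _ _).symm

/-- An approximate eigenvector of the resolvent is one of `φ(A)`. -/
theorem norm_boundedCalculus_sub_le (hA : IsNonnegSelfAdjoint A)
    (hc : ContinuousOn φ (Set.Ici 0)) (hM : ∀ x, 0 ≤ x → |φ x| ≤ M) {l K : ℝ} (hl : 0 ≤ l)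
    (hK : ∀ x, 0 ≤ x → |φ x - φ l| ≤ K * |(1 + x)⁻¹ - (1 + l)⁻¹|) (v : H) :
    ‖boundedCalculus A φ v - φ l • v‖ ≤
      (1 + l) * (K + 2 * M) * ‖resolventNegOne A v - (1 + l)⁻¹ • v‖ := by
  set R := resolventNegOne A with hR
  set T := boundedCalculus A φ with hT
  have hs := hA.spectrum_resolvent_subset
  have hsa := hA.isSelfAdjoint_resolvent
  have hcont := continuousOn_mul_comp_inv_sub_one hc hM
  -- The hypothesis at the point `l + 1`, where the resolvent difference is nonzero, forces the sign
  -- of `K`.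
  have hK0 : 0 ≤ K := by
    have h1 := hK (l + 1) (by linarith)
    have h2 : |(1 + (l + 1))⁻¹ - (1 + l)⁻¹| > 0 := by
      refine abs_pos.2 (sub_ne_zero.2 fun h => ?_)
      have := inv_injective h
      linarith
    exact (mul_nonneg_iff_of_pos_right h2).1 ((abs_nonneg _).trans h1)
  have h1 : T (R v) - φ l • R v =
      cfc (fun r : ℝ => r * φ (r⁻¹ - 1) - φ l * r) R v := by
    rw [cfc_sub (fun r : ℝ => r * φ (r⁻¹ - 1)) (fun r => φ l * r) R (hcont.mono hs)
      (by fun_prop), cfc_const_mul_id (φ l) R hsa, _root_.sub_apply,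
      ← hA.boundedCalculus_resolvent hc hM]
    rfl
  have h2 : ‖T (R v) - φ l • R v‖ ≤ K * ‖R v - (1 + l)⁻¹ • v‖ := by
    rw [h1]
    refine (hA.norm_cfc_resolvent_apply_le (h := fun r => K * r - K * (1 + l)⁻¹) ?_ (by fun_prop)
      (fun r hr => ?_) v).trans ?_
    · exact hcont.sub (by fun_prop)
    · rw [← mul_sub, abs_mul, abs_of_nonneg hK0, mul_comm (φ l), ← mul_sub, abs_mul,
        abs_of_nonneg hr.1]
      rcases hr.1.eq_or_lt with h | h
      · rw [← h, zero_mul]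
        positivity
      · have h3 := hK _ (sub_nonneg.2 ((one_le_inv₀ h).2 hr.2))
        rw [add_sub_cancel, inv_inv] at h3
        exact (mul_le_of_le_one_left (abs_nonneg _) hr.2).trans h3
    · rw [cfc_sub (fun r : ℝ => K * r) (fun _ => K * (1 + l)⁻¹) R (by fun_prop) (by fun_prop),
        cfc_const_mul_id K R hsa, cfc_const _ R hsa, _root_.sub_apply,
        Algebra.algebraMap_eq_smul_one, _root_.smul_apply,
        _root_.smul_apply, one_apply_eq_self, mul_smul, ← smul_sub,
        norm_smul, Real.norm_of_nonneg hK0]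
  have h3 : ‖T (R v - (1 + l)⁻¹ • v)‖ ≤ M * ‖R v - (1 + l)⁻¹ • v‖ :=
    hA.norm_boundedCalculus_apply_le hc hM _
  have h4 : ‖φ l • (R v - (1 + l)⁻¹ • v)‖ ≤ M * ‖R v - (1 + l)⁻¹ • v‖ := by
    rw [norm_smul]
    exact mul_le_mul_of_nonneg_right (hM l hl) (norm_nonneg _)
  -- From `v = (1 + l)(Rv - (Rv - (1 + l)⁻¹v))`: on `Rv` the calculus of `R` applies, and the other
  -- part is already as small as the residual.
  have h5 : T v - φ l • v = (1 + l) • ((T (R v) - φ l • R v) - T (R v - (1 + l)⁻¹ • v) +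
      φ l • (R v - (1 + l)⁻¹ • v)) := by
    have h6 : T ((1 + l)⁻¹ • v) = (1 + l)⁻¹ • T v := T.map_smul_of_tower _ _
    have h7 : (1 + l) ≠ 0 := by positivity
    rw [map_sub, h6, smul_sub (φ l), smul_comm (φ l)]
    have : T (R v) - φ l • R v - (T (R v) - (1 + l)⁻¹ • T v) +
      (φ l • R v - (1 + l)⁻¹ • φ l • v) = (1 + l)⁻¹ • (T v - φ l • v) := by
      rw [smul_sub]; abel
    rw [this, smul_smul, mul_inv_cancel₀ h7, one_smul]
  rw [h5, norm_smul, Real.norm_of_nonneg (by positivity), mul_assoc]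
  refine mul_le_mul_of_nonneg_left ?_ (by positivity)
  calc _ ≤ ‖T (R v) - φ l • R v‖ + ‖T (R v - (1 + l)⁻¹ • v)‖ +
        ‖φ l • (R v - (1 + l)⁻¹ • v)‖ := (norm_add_le _ _).trans (by gcongr; exact norm_sub_le _ _)
    _ ≤ _ := by linarith

end IsNonnegSelfAdjoint

/-! ### The cosine and the power -/

/-- For `x ≤ 2l + 1` the Lipschitz bound `|√x - √l| ≤ |x - l|/√l` suffices, because `1 + x` is then
at most `2(1 + l)`. For larger `x` the ratio `(x - l)/(1 + x)` is at least `1/2`, and the trivial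
bound `2` for the difference of cosines is absorbed. -/
theorem abs_cos_sqrt_sub_le (τ : ℝ) {l : ℝ} (hl : 0 < l) {x : ℝ} (hx : 0 ≤ x) :
    |Real.cos (τ * √x) - Real.cos (τ * √l)| ≤
      (2 * |τ| * (1 + l) ^ 2 / √l + 4 * (1 + l)) * |(1 + x)⁻¹ - (1 + l)⁻¹| := by
  have e : |(1 + x)⁻¹ - (1 + l)⁻¹| = |x - l| / ((1 + x) * (1 + l)) := by
    have : (1 + x)⁻¹ - (1 + l)⁻¹ = (l - x) / ((1 + x) * (1 + l)) := by
      field_simp; ring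
    rw [this, abs_div, abs_sub_comm, abs_of_pos (by positivity : (0:ℝ) < (1 + x) * (1 + l))]
  have hsl : 0 < √l := Real.sqrt_pos.2 hl
  rw [e, add_mul]
  rcases le_or_gt x (2 * l + 1) with h | h
  · have h1 : |Real.cos (τ * √x) - Real.cos (τ * √l)| ≤ |τ| * (|x - l| / √l) := by
      refine (Real.abs_cos_sub_cos_le _ _).trans ?_
      rw [← mul_sub, abs_mul]
      refine mul_le_mul_of_nonneg_left ?_ (abs_nonneg _)
      rw [le_div_iff₀ hsl]
      have h2 : x - l = (√x - √l) * (√x + √l) := by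
        nlinarith [Real.sq_sqrt hx, Real.sq_sqrt hl.le]
      rw [h2, abs_mul, abs_of_nonneg (by positivity : 0 ≤ √x + √l)]
      gcongr
      linarith [Real.sqrt_nonneg x]
    refine h1.trans (le_add_of_le_of_nonneg ?_ (by positivity))
    have h3 : 1 ≤ 2 * (1 + l) ^ 2 / ((1 + x) * (1 + l)) := by
      rw [le_div_iff₀ (by positivity)]
      nlinarith
    calc |τ| * (|x - l| / √l) = |τ| * (|x - l| / √l) * 1 := (mul_one _).symm
      _ ≤ |τ| * (|x - l| / √l) * (2 * (1 + l) ^ 2 / ((1 + x) * (1 + l))) := by gcongr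
      _ = _ := by field_simp
  · have h1 : |Real.cos (τ * √x) - Real.cos (τ * √l)| ≤ 2 := by
      rw [abs_le]
      constructor <;> linarith [Real.cos_le_one (τ * √x), Real.cos_le_one (τ * √l),
        Real.neg_one_le_cos (τ * √x), Real.neg_one_le_cos (τ * √l)]
    refine h1.trans (le_add_of_nonneg_of_le (by positivity) ?_)
    rw [abs_of_pos (by linarith), mul_div_assoc', le_div_iff₀ (by positivity)]
    nlinarith

/-- Written as `r · r^(p-1)`, the power has a factor that decreases in `r`, so the slope of the
chord from `r₀` is at most `r₀^(p-1)`. -/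
theorem abs_rpow_sub_rpow_le {p : ℝ} (h0 : 0 ≤ p) (h1 : p ≤ 1) {r r₀ : ℝ} (hr : 0 < r)
    (hr₀ : 0 < r₀) : |r ^ p - r₀ ^ p| ≤ r₀ ^ (p - 1) * |r - r₀| := by
  have e : ∀ r : ℝ, 0 < r → r ^ p = r * r ^ (p - 1) := fun r hr => by
    rw [Real.rpow_sub_one hr.ne']; field_simp
  have hm : ∀ {a b : ℝ}, 0 < a → a ≤ b → b ^ (p - 1) ≤ a ^ (p - 1) := fun ha hab =>
    Real.rpow_le_rpow_of_nonpos ha hab (by linarith)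
  rcases le_total r r₀ with h | h
  · rw [abs_of_nonpos (sub_nonpos.2 (Real.rpow_le_rpow hr.le h h0)),
      abs_of_nonpos (sub_nonpos.2 h), e r hr, e r₀ hr₀]
    nlinarith [hm hr h]
  · rw [abs_of_nonneg (sub_nonneg.2 (Real.rpow_le_rpow hr₀.le h h0)),
      abs_of_nonneg (sub_nonneg.2 h), e r hr, e r₀ hr₀]
    nlinarith [hm hr₀ h]

/-- In the resolvent variable `r = (1 + x)⁻¹` the function is the power `r^(s/2)`, with exponent
between `0` and `1`. -/
theorem abs_one_add_rpow_sub_le {s : ℝ} (h0 : 0 ≤ s) (h2 : s ≤ 2) {l x : ℝ} (hl : 0 ≤ l)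
    (hx : 0 ≤ x) :
    |(1 + x) ^ (-s / 2) - (1 + l) ^ (-s / 2)| ≤
      (1 + l)⁻¹ ^ (s / 2 - 1) * |(1 + x)⁻¹ - (1 + l)⁻¹| := by
  have e : ∀ y : ℝ, 0 ≤ y → (1 + y) ^ (-s / 2) = (1 + y)⁻¹ ^ (s / 2) := fun y hy => by
    rw [Real.inv_rpow (by positivity), ← Real.rpow_neg (by positivity), neg_div]
  rw [e x hx, e l hl]
  exact abs_rpow_sub_rpow_le (by positivity) (by linarith) (by positivity) (by positivity)

namespace IsNonnegSelfAdjoint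

variable [CompleteSpace H] {A : H →ₗ.[ℂ] H}

theorem norm_cosSqrt_apply_le (hA : IsNonnegSelfAdjoint A) (τ : ℝ) (v : H) :
    ‖cosSqrt A τ v‖ ≤ ‖v‖ := by
  simpa only [one_mul] using! hA.norm_boundedCalculus_apply_le (φ := fun l => Real.cos (τ * √l)) (M := 1)
    (by fun_prop) (fun x _ => Real.abs_cos_le_one _) v

theorem cosSqrt_inner (hA : IsNonnegSelfAdjoint A) (τ : ℝ) (u v : H) :
    ⟪cosSqrt A τ u, v⟫_ℂ = ⟪u, cosSqrt A τ v⟫_ℂ :=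
  hA.boundedCalculus_inner (φ := fun l => Real.cos (τ * √l)) (M := 1)
    (by fun_prop) (fun x _ => Real.abs_cos_le_one _) u v

theorem norm_cosSqrt_sub_le (hA : IsNonnegSelfAdjoint A) (τ : ℝ) {l : ℝ} (hl : 0 < l) (v : H) :
    ‖cosSqrt A τ v - Real.cos (τ * √l) • v‖ ≤
      (1 + l) * (2 * |τ| * (1 + l) ^ 2 / √l + 4 * (1 + l) + 2) *
        ‖resolventNegOne A v - (1 + l)⁻¹ • v‖ := by
  have := hA.norm_boundedCalculus_sub_le (φ := fun l => Real.cos (τ * √l)) (M := 1)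
    (by fun_prop) (fun x _ => Real.abs_cos_le_one _) hl.le
    (fun x hx => abs_cos_sqrt_sub_le τ hl hx) v
  rwa [mul_one] at this

theorem norm_smoothing_sub_le (hA : IsNonnegSelfAdjoint A) {s : ℝ} (h0 : 0 ≤ s) (h2 : s ≤ 2)
    {l : ℝ} (hl : 0 ≤ l) (v : H) :
    ‖smoothing A s v - (1 + l) ^ (-s / 2) • v‖ ≤
      (1 + l) * ((1 + l)⁻¹ ^ (s / 2 - 1) + 2) * ‖resolventNegOne A v - (1 + l)⁻¹ • v‖ := by
  have hc : ContinuousOn (fun l : ℝ => (1 + l) ^ (-s / 2)) (Set.Ici 0) := fun x hx =>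
    ((continuousAt_const.add continuousAt_id).rpow_const
      (Or.inl (by have : (0 : ℝ) ≤ x := hx; change (1 : ℝ) + x ≠ 0; positivity))).continuousWithinAt
  have := hA.norm_boundedCalculus_sub_le (φ := fun l : ℝ => (1 + l) ^ (-s / 2)) (M := 1) hc
    (fun x hx => by
      rw [abs_of_nonneg (by positivity)]
      exact Real.rpow_le_one_of_one_le_of_nonpos (by linarith) (by linarith)) hl
    (fun x hx => abs_one_add_rpow_sub_le h0 h2 hl hx) v
  rwa [mul_one] at this

end IsNonnegSelfAdjoint

end AbstractCalculus

/-! ### Weak gradients -/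

namespace HasWeakGradient

section Real

variable {d : ℕ} {F F' : Type*} [NormedAddCommGroup F] [NormedSpace ℝ F]
  [NormedAddCommGroup F'] [NormedSpace ℝ F']
  {u : EuclideanSpace ℝ (Fin d) → F} {Du : Fin d → EuclideanSpace ℝ (Fin d) → F}

theorem integrable_right (h : HasWeakGradient u Du) (l : Fin d)
    {φ : EuclideanSpace ℝ (Fin d) → ℝ} (h1 : Continuous φ) (h2 : HasCompactSupport φ) :
    Integrable (fun x => φ x • Du l x) volume :=
  (h.locallyIntegrable_deriv l).integrable_smul_left_of_hasCompactSupport h1 h2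

theorem locallyIntegrable_clm_comp {f : EuclideanSpace ℝ (Fin d) → F}
    (hf : LocallyIntegrable f volume) (L : F →L[ℝ] F') :
    LocallyIntegrable (fun x => L (f x)) volume := fun x => by
  obtain ⟨s, hs, h⟩ := hf x
  exact ⟨s, hs, L.integrable_comp h⟩

/-- Weak derivatives commute with linear maps of the values. -/
theorem clm_comp [CompleteSpace F] [CompleteSpace F'] (h : HasWeakGradient u Du) (L : F →L[ℝ] F') :
    HasWeakGradient (fun x => L (u x)) fun l x => L (Du l x) where
  locallyIntegrable := locallyIntegrable_clm_comp h.locallyIntegrable L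
  locallyIntegrable_deriv l := locallyIntegrable_clm_comp (h.locallyIntegrable_deriv l) L
  integral_eq l φ h1 h2 := by
    have e := congrArg L (h.integral_eq l φ h1 h2)
    rw [map_neg, ← L.integral_comp_comm (integrable_left h.locallyIntegrable l h1 h2),
      ← L.integral_comp_comm (h.integrable_right l h1.continuous h2)] at e
    simpa only [map_smul] using e

/-- A continuously differentiable function has its classical partial derivatives as weak ones. -/
theorem of_contDiff {f : EuclideanSpace ℝ (Fin d) → F} (hf : ContDiff ℝ 1 f) :
    HasWeakGradient f fun l x => fderiv ℝ f x (EuclideanSpace.single l 1) where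
  locallyIntegrable := hf.continuous.locallyIntegrable
  locallyIntegrable_deriv l :=
    ((hf.continuous_fderiv (by simp)).clm_apply continuous_const).locallyIntegrable
  integral_eq l φ h1 h2 := by
    have i1 := hf.continuous.locallyIntegrable (μ := volume)
    have i2 := ((hf.continuous_fderiv (by simp)).clm_apply
      (continuous_const (y := EuclideanSpace.single l (1 : ℝ)))).locallyIntegrable (μ := volume)
    rw [integral_smul_fderiv_eq_neg_fderiv_smul_of_integrable (integrable_left i1 l h1 h2)
      (i2.integrable_smul_left_of_hasCompactSupport h1.continuous h2)
      (i1.integrable_smul_left_of_hasCompactSupport h1.continuous h2)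
      (fun x _ => (h1.differentiable (by simp)).differentiableAt)
      (fun x _ => (hf.differentiable (by simp)).differentiableAt), neg_neg]

/-- Two weak gradients of the same function agree almost everywhere. -/
theorem ae_eq_of_ae_eq [CompleteSpace F] {v : EuclideanSpace ℝ (Fin d) → F}
    {Dv : Fin d → EuclideanSpace ℝ (Fin d) → F} (hu : HasWeakGradient u Du)
    (hv : HasWeakGradient v Dv) (huv : u =ᵐ[volume] v) (l : Fin d) : Du l =ᵐ[volume] Dv l := by
  have e : ∀ f : EuclideanSpace ℝ (Fin d) → F, (-ContinuousLinearMap.id ℝ F) ∘ f = -f := fun f => rfl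
  have h := (hu.add (hv.clm_comp (-ContinuousLinearMap.id ℝ F))).ae_eq_zero
    (by filter_upwards [huv] with x hx; simp [hx]) l
  filter_upwards [h] with x hx
  simpa [← sub_eq_add_neg, sub_eq_zero] using hx

end Real

section Complex

variable {d : ℕ} {F : Type*} [NormedAddCommGroup F] [NormedSpace ℂ F]
  {u : EuclideanSpace ℝ (Fin d) → F} {Du : Fin d → EuclideanSpace ℝ (Fin d) → F}

/-- The definition of weak derivatives with complex-valued test functions. -/
theorem integral_eq_complex (h : HasWeakGradient u Du) (l : Fin d)
    {ψ : EuclideanSpace ℝ (Fin d) → ℂ} (h1 : ContDiff ℝ ∞ ψ) (h2 : HasCompactSupport ψ) :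
    ∫ x, fderiv ℝ ψ x (EuclideanSpace.single l 1) • u x = -∫ x, ψ x • Du l x := by
  have r1 : ContDiff ℝ ∞ fun x => (ψ x).re := Complex.reCLM.contDiff.comp h1
  have m1 : ContDiff ℝ ∞ fun x => (ψ x).im := Complex.imCLM.contDiff.comp h1
  have r2 : HasCompactSupport fun x => (ψ x).re := h2.comp_left (g := Complex.re) rfl
  have m2 : HasCompactSupport fun x => (ψ x).im := h2.comp_left (g := Complex.im) rfl
  have dψ : ∀ x, DifferentiableAt ℝ ψ x := fun x => h1.differentiable (by simp) x
  have e : ∀ (z : ℂ) (w : F), z • w = z.re • w + Complex.I • (z.im • w) := fun z w => by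
    rw [← Complex.coe_smul, ← Complex.coe_smul, smul_smul, ← add_smul, mul_comm, Complex.re_add_im]
  have er : ∀ x, fderiv ℝ (fun x => (ψ x).re) x (EuclideanSpace.single l 1) =
      (fderiv ℝ ψ x (EuclideanSpace.single l 1)).re := fun x => by
    have := (Complex.reCLM.hasFDerivAt.comp x (dψ x).hasFDerivAt).fderiv
    exact DFunLike.congr_fun this _
  have em : ∀ x, fderiv ℝ (fun x => (ψ x).im) x (EuclideanSpace.single l 1) =
      (fderiv ℝ ψ x (EuclideanSpace.single l 1)).im := fun x => by
    have := (Complex.imCLM.hasFDerivAt.comp x (dψ x).hasFDerivAt).fderiv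
    exact DFunLike.congr_fun this _
  have ir := h.integral_eq l _ r1 r2
  have im := h.integral_eq l _ m1 m2
  have lr := integrable_left h.locallyIntegrable l r1 r2
  have lm := integrable_left h.locallyIntegrable l m1 m2
  simp only [er, em] at ir im lr lm
  have lm' : Integrable (fun x => Complex.I • ((fderiv ℝ ψ x (EuclideanSpace.single l 1)).im • u x))
      volume := lm.smul Complex.I
  have rm' : Integrable (fun x => Complex.I • ((ψ x).im • Du l x)) volume :=
    (h.integrable_right l m1.continuous m2).smul Complex.I
  calc _ = ∫ x, ((fderiv ℝ ψ x (EuclideanSpace.single l 1)).re • u x +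
        Complex.I • ((fderiv ℝ ψ x (EuclideanSpace.single l 1)).im • u x)) :=
      integral_congr_ae (.of_forall fun x => e _ _)
    _ = -∫ x, ((ψ x).re • Du l x + Complex.I • ((ψ x).im • Du l x)) := by
      rw [integral_add lr lm', integral_smul, ir, im,
        integral_add (h.integrable_right l r1.continuous r2) rm', integral_smul,
        smul_neg, neg_add]
    _ = _ := by
      congr 1
      exact integral_congr_ae (.of_forall fun x => (e _ _).symm)

theorem locallyIntegrable_smul {f : EuclideanSpace ℝ (Fin d) → F}
    (hf : LocallyIntegrable f volume) {c : EuclideanSpace ℝ (Fin d) → ℂ} (hc : Continuous c) :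
    LocallyIntegrable (fun x => c x • f x) volume := by
  rw [locallyIntegrable_iff]
  intro k hk
  exact (hf.integrableOn_isCompact hk).continuousOn_smul hc.continuousOn hk

/-- The Leibniz rule for the product with a smooth function. -/
theorem smul_contDiff (h : HasWeakGradient u Du) {c : EuclideanSpace ℝ (Fin d) → ℂ}
    (hc : ContDiff ℝ ∞ c) :
    HasWeakGradient (fun x => c x • u x) fun l x =>
      c x • Du l x + fderiv ℝ c x (EuclideanSpace.single l 1) • u x where
  locallyIntegrable := locallyIntegrable_smul h.locallyIntegrable hc.continuous
  locallyIntegrable_deriv l :=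
    (locallyIntegrable_smul (h.locallyIntegrable_deriv l) hc.continuous).add
      (locallyIntegrable_smul h.locallyIntegrable
        ((hc.continuous_fderiv (by simp)).clm_apply continuous_const))
  integral_eq l φ h1 h2 := by
    have dc : ∀ x, DifferentiableAt ℝ c x := fun x => hc.differentiable (by simp) x
    have dφ : ∀ x, DifferentiableAt ℝ φ x := fun x => h1.differentiable (by simp) x
    -- The product `φ c` is used as a complex test function for `u`; the derivative falling on `c`
    -- is the additional term of the Leibniz rule.
    have t1 : ContDiff ℝ ∞ fun x => φ x • c x := h1.smul hc
    have t2 : HasCompactSupport fun x => φ x • c x := h2.smul_right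
    have hD : ∀ x, fderiv ℝ (fun x => φ x • c x) x (EuclideanSpace.single l 1) =
        φ x • fderiv ℝ c x (EuclideanSpace.single l 1) +
          fderiv ℝ φ x (EuclideanSpace.single l 1) • c x := fun x => by
      rw [fderiv_fun_smul (dφ x) (dc x)]
      simp
    have e := h.integral_eq_complex l t1 t2
    simp only [hD, add_smul, smul_assoc] at e
    have i0 := (locallyIntegrable_smul h.locallyIntegrable
      ((hc.continuous_fderiv (by simp)).clm_apply
      (continuous_const (y := EuclideanSpace.single l (1 : ℝ))))
      ).integrable_smul_left_of_hasCompactSupport h1.continuous h2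
    have i1 := integrable_left (locallyIntegrable_smul h.locallyIntegrable hc.continuous) l h1 h2
    have i2 := (locallyIntegrable_smul (h.locallyIntegrable_deriv l)
      hc.continuous).integrable_smul_left_of_hasCompactSupport h1.continuous h2
    rw [integral_add i0 i1] at e
    simp only [smul_add]
    rw [integral_add i2 i0, neg_add, ← e]
    abel

end Complex

end HasWeakGradient

/-! ### Smooth cutoff functions -/

section Cutoff

/-- A smooth function with compact support which is `1` near the origin. -/
noncomputable def cutoff (d : ℕ) : EuclideanSpace ℝ (Fin d) → ℝ :=
  (⟨1, 2, by norm_num, by norm_num⟩ : ContDiffBump (0 : EuclideanSpace ℝ (Fin d)))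

variable {d : ℕ}

theorem contDiff_cutoff {k : ℕ∞} : ContDiff ℝ k (cutoff d) := ContDiffBump.contDiff _

theorem continuous_cutoff : Continuous (cutoff d) := ContDiffBump.continuous _

theorem hasCompactSupport_cutoff : HasCompactSupport (cutoff d) := ContDiffBump.hasCompactSupport _

theorem cutoff_nonneg (x : EuclideanSpace ℝ (Fin d)) : 0 ≤ cutoff d x := ContDiffBump.nonneg _

theorem cutoff_le_one (x : EuclideanSpace ℝ (Fin d)) : cutoff d x ≤ 1 := ContDiffBump.le_one _

theorem cutoff_zero : cutoff d 0 = 1 :=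
  ContDiffBump.one_of_mem_closedBall _ (by simp)

theorem contDiff_cutoff_smul (δ : ℝ) {k : ℕ∞} : ContDiff ℝ k fun x => cutoff d (δ • x) :=
  contDiff_cutoff.comp (contDiff_const_smul δ)

theorem hasCompactSupport_cutoff_smul {δ : ℝ} (hδ : δ ≠ 0) :
    HasCompactSupport fun x => cutoff d (δ • x) :=
  hasCompactSupport_cutoff.comp_smul hδ

theorem fderiv_cutoff_smul (δ : ℝ) (x v : EuclideanSpace ℝ (Fin d)) :
    fderiv ℝ (fun x => cutoff d (δ • x)) x v = δ * fderiv ℝ (cutoff d) (δ • x) v := by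
  have h1 : HasFDerivAt (cutoff d) (fderiv ℝ (cutoff d) (δ • x)) (δ • x) :=
    (contDiff_cutoff.differentiable (n := ((1 : ℕ∞) : WithTop ℕ∞)) (by simp) _).hasFDerivAt
  have h2 : HasFDerivAt (fun x : EuclideanSpace ℝ (Fin d) => δ • x)
      (δ • ContinuousLinearMap.id ℝ _) x := (hasFDerivAt_id x).const_smul δ
  exact (DFunLike.congr_fun (HasFDerivAt.comp x h1 h2).fderiv v).trans (by simp)

theorem exists_norm_fderiv_cutoff_le (d : ℕ) :
    ∃ C : ℝ, 0 ≤ C ∧ ∀ x, ‖fderiv ℝ (cutoff d) x‖ ≤ C := by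
  obtain ⟨C, hC⟩ := (contDiff_cutoff.continuous_fderiv
    (n := ((1 : ℕ∞) : WithTop ℕ∞)) (by simp)).bounded_above_of_compact_support
    (hasCompactSupport_cutoff (d := d).fderiv ℝ)
  exact ⟨C, (norm_nonneg _).trans (hC 0), hC⟩

end Cutoff

/-! ### The Fourier transform of weak derivatives -/

section Fourier

open scoped FourierTransform SchwartzMap LineDeriv

variable {d : ℕ} {ι κ : Type*} [Fintype ι] [Fintype κ]

/-- Weak derivatives in `L₂` may be tested against Schwartz functions. -/
theorem HasWeakGradient.integral_eq_schwartz {u : L2 d ι} {Du : Fin d → L2 d ι}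
    (h : HasWeakGradient u fun l => Du l) (l : Fin d) (g : 𝓢(EuclideanSpace ℝ (Fin d), ℂ)) :
    ∫ x, fderiv ℝ g x (EuclideanSpace.single l 1) • u x = -∫ x, g x • Du l x := by
  obtain ⟨C, hC0, hC⟩ := exists_norm_fderiv_cutoff_le d
  set e : EuclideanSpace ℝ (Fin d) := EuclideanSpace.single l 1 with he
  have hδ : Tendsto (fun N : ℕ => ((N : ℝ) + 1)⁻¹) atTop (𝓝 0) :=
    tendsto_inv_atTop_zero.comp (tendsto_natCast_atTop_atTop.atTop_add tendsto_const_nhds)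
  have hδ1 : ∀ N : ℕ, |((N : ℝ) + 1)⁻¹| ≤ 1 := fun N => by
    rw [abs_of_pos (by positivity)]
    exact inv_le_one_of_one_le₀ (by linarith [(Nat.cast_nonneg N : (0 : ℝ) ≤ N)])
  have hδx : ∀ x : EuclideanSpace ℝ (Fin d),
      Tendsto (fun N : ℕ => cutoff d (((N : ℝ) + 1)⁻¹ • x)) atTop (𝓝 1) := fun x => by
    have := (continuous_cutoff (d := d)).tendsto 0
    rw [cutoff_zero] at this
    refine this.comp ?_
    simpa using hδ.smul_const x
  have dg : ∀ x, DifferentiableAt ℝ g x := fun x => g.differentiableAt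
  have hD : ∀ (N : ℕ) x, fderiv ℝ (fun x => cutoff d (((N : ℝ) + 1)⁻¹ • x) • g x) x e =
      cutoff d (((N : ℝ) + 1)⁻¹ • x) • fderiv ℝ g x e +
        (((N : ℝ) + 1)⁻¹ * fderiv ℝ (cutoff d) (((N : ℝ) + 1)⁻¹ • x) e) • g x := fun N x => by
    rw [fderiv_fun_smul ((contDiff_cutoff_smul _).differentiable
      (n := ((1 : ℕ∞) : WithTop ℕ∞)) (by simp) x) (dg x)]
    simp [← fderiv_cutoff_smul]
  have hg2 : MemLp g 2 (volume : Measure (EuclideanSpace ℝ (Fin d))) := g.memLp 2 volume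
  have hdg : MemLp (fun x => fderiv ℝ g x e) 2 (volume : Measure (EuclideanSpace ℝ (Fin d))) :=
    (LineDeriv.lineDerivOp e g).memLp 2 volume
  have iu : ∀ {f : EuclideanSpace ℝ (Fin d) → ℂ} (w : L2 d ι), MemLp f 2 volume →
      Integrable (fun x => ‖f x‖ * ‖w x‖) volume := fun w hf =>
    hf.norm.integrable_mul (Lp.memLp w).norm
  have gcont : Continuous g := g.continuous
  have dgcont : Continuous fun x => fderiv ℝ g x e :=
    (LineDeriv.lineDerivOp e g).continuous
  -- The truncated function `χ(x/(N+1)) g` is an admissible test function. The derivative of the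
  -- truncation is `O(1/(N+1))`, and dominated convergence removes the truncation on both sides.
  have key : ∀ N : ℕ, ∫ x, fderiv ℝ (fun x => cutoff d (((N : ℝ) + 1)⁻¹ • x) • g x) x e • u x =
      -∫ x, (cutoff d (((N : ℝ) + 1)⁻¹ • x) • g x) • Du l x := fun N =>
    h.integral_eq_complex l ((contDiff_cutoff_smul _).smul (g.smooth ⊤))
      ((hasCompactSupport_cutoff_smul (by positivity)).smul_right)
  have L1 : Tendsto (fun N : ℕ =>
      ∫ x, fderiv ℝ (fun x => cutoff d (((N : ℝ) + 1)⁻¹ • x) • g x) x e • u x) atTop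
      (𝓝 (∫ x, fderiv ℝ g x e • u x)) := by
    refine tendsto_integral_filter_of_dominated_convergence
      (fun x => ‖fderiv ℝ g x e‖ * ‖u x‖ + C * ‖e‖ * (‖g x‖ * ‖u x‖)) ?_ ?_
      ((iu u hdg).add ((iu u hg2).const_mul _)) ?_
    · refine .of_forall fun N => ?_
      have hc : Continuous fun x =>
          fderiv ℝ (fun x => cutoff d (((N : ℝ) + 1)⁻¹ • x) • g x) x e :=
        (((contDiff_cutoff_smul _).smul (g.smooth ⊤)).continuous_fderiv
          (n := ((⊤ : ℕ∞) : WithTop ℕ∞)) (by simp)).clm_apply continuous_const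
      exact hc.aestronglyMeasurable.smul (Lp.aestronglyMeasurable u)
    · refine .of_forall fun N => .of_forall fun x => ?_
      rw [hD, norm_smul, ← mul_assoc, ← add_mul]
      refine mul_le_mul_of_nonneg_right ((norm_add_le _ _).trans (add_le_add ?_ ?_)) (norm_nonneg _)
      · rw [norm_smul, Real.norm_of_nonneg (cutoff_nonneg _)]
        exact mul_le_of_le_one_left (norm_nonneg _) (cutoff_le_one _)
      · rw [norm_smul]
        refine mul_le_mul_of_nonneg_right ?_ (norm_nonneg _)
        rw [norm_mul]
        calc _ ≤ 1 * (C * ‖e‖) := mul_le_mul (hδ1 N)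
              (ContinuousLinearMap.le_of_opNorm_le _ (hC _) _) (norm_nonneg _) zero_le_one
          _ = _ := one_mul _
    · refine .of_forall fun x => ?_
      simp only [hD]
      refine Tendsto.smul_const ?_ _
      have h0 : Tendsto (fun N : ℕ => ((N : ℝ) + 1)⁻¹ *
          fderiv ℝ (cutoff d) (((N : ℝ) + 1)⁻¹ • x) e) atTop (𝓝 0) := by
        refine squeeze_zero_norm (a := fun N : ℕ => ((N : ℝ) + 1)⁻¹ * (C * ‖e‖)) (fun N => ?_)
          (by simpa using hδ.mul_const (C * ‖e‖))
        rw [norm_mul, Real.norm_of_nonneg (by positivity)]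
        exact mul_le_mul_of_nonneg_left (ContinuousLinearMap.le_of_opNorm_le _ (hC _) _)
          (by positivity)
      simpa using ((hδx x).smul_const (fderiv ℝ g x e)).add (h0.smul_const (g x))
  have L2 : Tendsto (fun N : ℕ => -∫ x, (cutoff d (((N : ℝ) + 1)⁻¹ • x) • g x) • Du l x) atTop
      (𝓝 (-∫ x, g x • Du l x)) := by
    refine Tendsto.neg (tendsto_integral_filter_of_dominated_convergence
      (fun x => ‖g x‖ * ‖Du l x‖) ?_ ?_ (iu _ hg2) ?_)
    · refine .of_forall fun N => ?_
      have hc : Continuous fun x => cutoff d (((N : ℝ) + 1)⁻¹ • x) • g x :=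
        (continuous_cutoff.comp (continuous_const_smul _)).smul gcont
      exact hc.aestronglyMeasurable.smul (Lp.aestronglyMeasurable _)
    · refine .of_forall fun N => .of_forall fun x => ?_
      rw [norm_smul, norm_smul, Real.norm_of_nonneg (cutoff_nonneg _)]
      exact mul_le_mul_of_nonneg_right
        (mul_le_of_le_one_left (norm_nonneg _) (cutoff_le_one _)) (norm_nonneg _)
    · refine .of_forall fun x => ?_
      simpa using ((hδx x).smul_const (g x)).smul_const (Du l x)
  simp only [key] at L1
  exact tendsto_nhds_unique L1 L2

/-- The Fourier transform turns weak derivatives into multiplications. -/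
theorem HasWeakGradient.fourier {u : L2 d ι} {Du : Fin d → L2 d ι}
    (h : HasWeakGradient u fun l => Du l) (l : Fin d) :
    ∀ᵐ ξ, (𝓕 (Du l)) ξ = ((2 * Real.pi * ξ l : ℝ) * Complex.I) • (𝓕 u) ξ := by
  set e : EuclideanSpace ℝ (Fin d) := EuclideanSpace.single l 1 with he
  -- The weak derivative is a distributional one, and the rule `𝓕 ∂ₗ = 2πi ξₗ 𝓕` holds for tempered
  -- distributions. Testing with compactly supported functions then gives the identity almost
  -- everywhere.
  have h1 : LineDeriv.lineDerivOp e (Lp.toTemperedDistribution u) =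
      Lp.toTemperedDistribution (Du l) := by
    ext g : 1
    rw [TemperedDistribution.lineDerivOp_apply_apply, Lp.toTemperedDistribution_apply,
      Lp.toTemperedDistribution_apply]
    have := neg_eq_iff_eq_neg.2 (h.integral_eq_schwartz l g)
    rw [← this, ← integral_neg]
    refine integral_congr_ae (.of_forall fun x => ?_)
    change (-fderiv ℝ g x e) • u x = -(fderiv ℝ g x e • u x)
    rw [neg_smul]
  have h2 := congrArg (fun T : 𝓢'(EuclideanSpace ℝ (Fin d), EuclideanSpace ℂ ι) => 𝓕 T) h1
  simp only [TemperedDistribution.fourier_lineDerivOp_eq,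
    Lp.fourier_toTemperedDistribution_eq] at h2
  have hli : LocallyIntegrable (fun ξ : EuclideanSpace ℝ (Fin d) => (𝓕 (Du l)) ξ -
      ((2 * Real.pi * ξ l : ℝ) * Complex.I) • (𝓕 u) ξ) volume := by
    have h1 := (Lp.memLp (𝓕 (Du l))).locallyIntegrable one_le_two
    have h2 := HasWeakGradient.locallyIntegrable_smul
      ((Lp.memLp (𝓕 u)).locallyIntegrable one_le_two)
      (c := fun ξ => (2 * Real.pi * ξ l : ℝ) * Complex.I) (by fun_prop)
    exact h1.sub h2
  have h3 := ae_eq_zero_of_integral_contDiff_smul_eq_zero hli fun φ p1 p2 => ?_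
  · filter_upwards [h3] with ξ hξ
    exact sub_eq_zero.1 hξ
  have q1 : HasCompactSupport (Complex.ofRealCLM ∘ φ) := p2.comp_left rfl
  have q2 : ContDiff ℝ ∞ (Complex.ofRealCLM ∘ φ) := Complex.ofRealCLM.contDiff.comp p1
  have h4 := DFunLike.congr_fun h2 (q1.toSchwartzMap q2)
  have htg : (fun ξ : EuclideanSpace ℝ (Fin d) => ((inner ℝ ξ e : ℝ) : ℂ)).HasTemperateGrowth := by
    fun_prop
  have e1 : ((2 * Real.pi * Complex.I) • TemperedDistribution.smulLeftCLM (EuclideanSpace ℂ ι)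
      (fun x => ((inner ℝ x e : ℝ) : ℂ)) (Lp.toTemperedDistribution (𝓕 u)))
      (q1.toSchwartzMap q2) = (2 * Real.pi * Complex.I) •
        ∫ ξ, (((inner ℝ ξ e : ℝ) : ℂ) * φ ξ) • (𝓕 u) ξ := by
    change (2 * Real.pi * Complex.I) • (TemperedDistribution.smulLeftCLM (EuclideanSpace ℂ ι)
      (fun x => ((inner ℝ x e : ℝ) : ℂ)) (Lp.toTemperedDistribution (𝓕 u)))
      (q1.toSchwartzMap q2) = _
    rw [TemperedDistribution.smulLeftCLM_apply_apply, Lp.toTemperedDistribution_apply]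
    simp [SchwartzMap.smulLeftCLM_apply_apply htg]
  rw [e1, Lp.toTemperedDistribution_apply, ← integral_smul] at h4
  have i1 : Integrable (fun ξ => φ ξ • (𝓕 (Du l)) ξ) volume :=
    ((Lp.memLp (𝓕 (Du l))).locallyIntegrable
      one_le_two).integrable_smul_left_of_hasCompactSupport p1.continuous p2
  have i2 : Integrable (fun ξ : EuclideanSpace ℝ (Fin d) => φ ξ •
      (((2 * Real.pi * ξ l : ℝ) * Complex.I) • (𝓕 u) ξ)) volume :=
    (HasWeakGradient.locallyIntegrable_smul ((Lp.memLp (𝓕 u)).locallyIntegrable one_le_two)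
      (by fun_prop)).integrable_smul_left_of_hasCompactSupport p1.continuous p2
  simp only [smul_sub]
  rw [integral_sub i1 i2, sub_eq_zero]
  refine Eq.trans ?_ (h4.symm.trans ?_)
  · refine integral_congr_ae (.of_forall fun ξ => ?_)
    simp
  · refine integral_congr_ae (.of_forall fun ξ => ?_)
    simp only [he, EuclideanSpace.inner_single_right]
    rw [← Complex.coe_smul, smul_smul, smul_smul]
    congr 1
    push_cast
    simp
    ring

end Fourier

/-! ### Coercive problems on closed subspaces -/

/-- The Lax–Milgram argument for the compression of `T` to `W`: a lower bound for the modulus of the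
quadratic form makes the compression invertible. -/
theorem exists_weak_solution {E : Type*} [NormedAddCommGroup E] [InnerProductSpace ℂ E]
    [CompleteSpace E] (W : Submodule ℂ E) (hW : IsClosed (W : Set E)) (T : E →L[ℂ] E) {c : ℝ}
    (hc : 0 < c) (h : ∀ x ∈ W, c * ‖x‖ ^ 2 ≤ ‖⟪x, T x⟫_ℂ‖) (f : E) :
    ∃ x ∈ W, ∀ y ∈ W, ⟪y, T x⟫_ℂ = ⟪y, f⟫_ℂ := by
  have : CompleteSpace W := hW.completeSpace_coe
  have key : ∀ (y : W) (v : E), ⟪y, W.orthogonalProjectionOnto v⟫_ℂ = ⟪(y : E), v⟫_ℂ := fun y v => by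
    rw [Submodule.inner_orthogonalProjectionOnto_eq_of_mem_left]
  have hu : IsUnit (W.orthogonalProjectionOnto ∘L T ∘L W.subtypeL) := by
    refine ContinuousLinearMap.isUnit_of_forall_le_norm_inner_map _ (c := ⟨c, hc.le⟩) hc fun x => ?_
    rw [norm_inner_symm]
    change ‖x‖ ^ 2 * c ≤ ‖⟪x, W.orthogonalProjectionOnto (T x)⟫_ℂ‖
    rw [key, mul_comm]
    exact h x x.2
  obtain ⟨x, hx⟩ := (ContinuousLinearMap.isUnit_iff_bijective.1 hu).2 (W.orthogonalProjectionOnto f)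
  refine ⟨x, x.2, fun y hy => ?_⟩
  rw [← key ⟨y, hy⟩, ← key ⟨y, hy⟩, ← hx]
  rfl

/-! ### Matrices and jets -/

section Jets

variable {d : ℕ} {ι κ : Type*} [Fintype ι] [Fintype κ]

/-- The operator of multiplication by a matrix. -/
noncomputable def matCLM : Matrix κ ι ℂ →ₗ[ℂ] EuclideanSpace ℂ ι →L[ℂ] EuclideanSpace ℂ κ where
  toFun M := LinearMap.toContinuousLinearMap
    { toFun := fun v => WithLp.toLp 2 (M *ᵥ v.ofLp)
      map_add' := fun v w => by simp [Matrix.mulVec_add]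
      map_smul' := fun c v => by simp [Matrix.mulVec_smul] }
  map_add' M N := by ext v; simp [Matrix.add_mulVec]
  map_smul' c M := by ext v; simp [Matrix.smul_mulVec]

@[simp]
theorem ofLp_matCLM (M : Matrix κ ι ℂ) (v : EuclideanSpace ℂ ι) :
    (matCLM M v).ofLp = M *ᵥ v.ofLp := rfl

theorem inner_eq_dotProduct (v w : EuclideanSpace ℂ ι) :
    ⟪v, w⟫_ℂ = star v.ofLp ⬝ᵥ w.ofLp := by
  rw [EuclideanSpace.inner_eq_star_dotProduct, dotProduct_comm]

theorem inner_matCLM_left (M : Matrix κ ι ℂ) (v : EuclideanSpace ℂ ι) (w : EuclideanSpace ℂ κ) :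
    ⟪matCLM M v, w⟫_ℂ = ⟪v, matCLM Mᴴ w⟫_ℂ := by
  rw [inner_eq_dotProduct, inner_eq_dotProduct, ofLp_matCLM, ofLp_matCLM, star_mulVec,
    dotProduct_mulVec]

theorem matCLM_mul {ρ : Type*} [Fintype ρ] (M : Matrix ρ κ ℂ) (N : Matrix κ ι ℂ)
    (v : EuclideanSpace ℂ ι) : matCLM (M * N) v = matCLM M (matCLM N v) := by
  refine WithLp.ofLp_injective 2 ?_
  simp [Matrix.mulVec_mulVec]

/-- The values of `u, ∂₁u, …, ∂_d u` for a `ℂ^ι`-valued function `u`. -/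
abbrev Jet (d : ℕ) (ι : Type*) : Type _ := EuclideanSpace ℂ (Option (Fin d) × ι)

/-- A component of a jet: `none` stands for the function, `some l` for its `l`th derivative. -/
noncomputable def jetComp (o : Option (Fin d)) : Jet d ι →L[ℂ] EuclideanSpace ℂ ι :=
  LinearMap.toContinuousLinearMap
    { toFun := fun v => WithLp.toLp 2 fun i => v (o, i)
      map_add' := fun _ _ => rfl
      map_smul' := fun _ _ => rfl }

theorem jetComp_apply (o : Option (Fin d)) (v : Jet d ι) (i : ι) : jetComp o v i = v (o, i) := rfl

/-- The jet with a single nonzero component. -/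
noncomputable def jetIncl (o : Option (Fin d)) : EuclideanSpace ℂ ι →L[ℂ] Jet d ι :=
  LinearMap.toContinuousLinearMap
    { toFun := fun v => WithLp.toLp 2 fun p => if p.1 = o then v p.2 else 0
      map_add' := fun v w => by ext p; by_cases h : p.1 = o <;> simp [h]
      map_smul' := fun c v => by ext p; by_cases h : p.1 = o <;> simp [h] }

theorem jetIncl_apply (o : Option (Fin d)) (v : EuclideanSpace ℂ ι) (p : Option (Fin d) × ι) :
    jetIncl o v p = if p.1 = o then v p.2 else 0 := rfl

theorem jetComp_jetIncl (o o' : Option (Fin d)) (v : EuclideanSpace ℂ ι) :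
    jetComp o (jetIncl o' v) = if o = o' then v else 0 := by
  ext i
  rw [jetComp_apply, jetIncl_apply]
  split_ifs <;> rfl

theorem sum_jetIncl_jetComp (v : Jet d ι) : ∑ o, jetIncl o (jetComp o v) = v := by
  ext ⟨o, i⟩
  simp only [WithLp.ofLp_sum, Finset.sum_apply, jetIncl_apply, jetComp_apply]
  rw [Finset.sum_ite_eq, if_pos (Finset.mem_univ _)]

theorem norm_jetIncl (o : Option (Fin d)) (v : EuclideanSpace ℂ ι) : ‖jetIncl o v‖ = ‖v‖ := by
  rw [EuclideanSpace.norm_eq, EuclideanSpace.norm_eq, Fintype.sum_prod_type,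
    Finset.sum_eq_single o]
  · simp [jetIncl_apply]
  · intro o' _ h
    simp [jetIncl_apply, h]
  · simp

theorem norm_jetComp_le (o : Option (Fin d)) (v : Jet d ι) : ‖jetComp o v‖ ≤ ‖v‖ := by
  rw [EuclideanSpace.norm_eq, EuclideanSpace.norm_eq, Fintype.sum_prod_type]
  refine Real.sqrt_le_sqrt ?_
  exact Finset.single_le_sum (f := fun o => ∑ i, ‖v (o, i)‖ ^ 2)
    (fun _ _ => Finset.sum_nonneg fun _ _ => sq_nonneg _) (Finset.mem_univ o)

/-- The value of `b(D)u` in terms of the jet of `u`. -/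
noncomputable def jetSymbol (b : Fin d → Matrix κ ι ℂ) : Jet d ι →L[ℂ] EuclideanSpace ℂ κ :=
  ∑ l, (-Complex.I) • (matCLM (b l) ∘L jetComp (some l))

theorem ofLp_jetSymbol (b : Fin d → Matrix κ ι ℂ) (v : Jet d ι) :
    (jetSymbol b v).ofLp = symbolD b fun l => (jetComp (some l) v).ofLp := by
  simp only [jetSymbol, symbolD, _root_.sum_apply, WithLp.ofLp_sum, _root_.smul_apply, Matrix.mulVec_smul,
    WithLp.ofLp_smul, ContinuousLinearMap.comp_apply, ofLp_matCLM]

end Jets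

/-! ### Jets of class `L₂` -/

section LpJets

variable {α : Type*} [MeasurableSpace α] {μ : Measure α}
  {d : ℕ} {ι κ : Type*} [Fintype ι] [Fintype κ]

theorem ae_compLpL {E F : Type*} [NormedAddCommGroup E] [NormedSpace ℂ E]
    [NormedAddCommGroup F] [NormedSpace ℂ F] (L : E →L[ℂ] F) (f : Lp E 2 μ) :
    ∀ᵐ x ∂μ, L.compLpL 2 μ f x = L (f x) :=
  L.coeFn_compLpL f

theorem norm_compLpL_apply_le {E F : Type*} [NormedAddCommGroup E] [NormedSpace ℂ E]
    [NormedAddCommGroup F] [NormedSpace ℂ F] (L : E →L[ℂ] F) {C : ℝ} (h : ∀ v, ‖L v‖ ≤ C * ‖v‖)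
    (f : Lp E 2 μ) : ‖L.compLpL 2 μ f‖ ≤ C * ‖f‖ := by
  refine Lp.norm_le_mul_norm_of_ae_le_mul ?_
  filter_upwards [ae_compLpL L f] with x hx
  rw [hx]
  exact h _

/-- A component of a jet of class `L₂`. -/
noncomputable def compL (μ : Measure α) (o : Option (Fin d)) :
    Lp (Jet d ι) 2 μ →L[ℂ] Lp (EuclideanSpace ℂ ι) 2 μ := (jetComp o).compLpL 2 μ

theorem ae_compL (z : Lp (Jet d ι) 2 μ) :
    ∀ᵐ x ∂μ, ∀ o, compL μ o z x = jetComp o (z x) :=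
  ae_all_iff.2 fun o => by
    have h := ae_compLpL (jetComp o) z
    exact h

/-- The jet of class `L₂` with a single nonzero component. -/
noncomputable def inclL (μ : Measure α) (o : Option (Fin d)) :
    Lp (EuclideanSpace ℂ ι) 2 μ →L[ℂ] Lp (Jet d ι) 2 μ := (jetIncl o).compLpL 2 μ

theorem ae_inclL (o : Option (Fin d)) (f : Lp (EuclideanSpace ℂ ι) 2 μ) :
    ∀ᵐ x ∂μ, inclL μ o f x = jetIncl o (f x) := by
  have h := ae_compLpL (jetIncl (d := d) o) f
  exact h

/-- `b(D)u` in terms of the jet of `u`. -/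
noncomputable def symbolL (μ : Measure α) (b : Fin d → Matrix κ ι ℂ) :
    Lp (Jet d ι) 2 μ →L[ℂ] Lp (EuclideanSpace ℂ κ) 2 μ := (jetSymbol b).compLpL 2 μ

theorem ae_symbolL (b : Fin d → Matrix κ ι ℂ) (z : Lp (Jet d ι) 2 μ) :
    ∀ᵐ x ∂μ, symbolL μ b z x = jetSymbol b (z x) := by
  have h := ae_compLpL (jetSymbol b) z
  exact h

theorem compL_inclL (o o' : Option (Fin d)) (f : Lp (EuclideanSpace ℂ ι) 2 μ) :
    compL μ o (inclL μ o' f) = if o = o' then f else 0 := by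
  refine Lp.ext ?_
  have h : (if o = o' then f else 0 : Lp (EuclideanSpace ℂ ι) 2 μ) =ᵐ[μ]
      fun x => if o = o' then f x else 0 := by
    split_ifs
    · rfl
    · exact Lp.coeFn_zero _ _ _
  filter_upwards [ae_compL (inclL μ o' f), ae_inclL o' f, h] with x h1 h2 h3
  rw [h1, h2, h3, jetComp_jetIncl]

/-- The jet of class `L₂` with the given components. -/
noncomputable def lpJet (f : Option (Fin d) → Lp (EuclideanSpace ℂ ι) 2 μ) :
    Lp (Jet d ι) 2 μ := ∑ o, inclL μ o (f o)

theorem compL_lpJet (f : Option (Fin d) → Lp (EuclideanSpace ℂ ι) 2 μ) (o : Option (Fin d)) :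
    compL μ o (lpJet f) = f o := by
  rw [lpJet, map_sum]
  simp only [compL_inclL]
  rw [Finset.sum_ite_eq, if_pos (Finset.mem_univ o)]

theorem sum_compLpL_compLpL {E F O : Type*} [Fintype O] [NormedAddCommGroup E] [NormedSpace ℂ E]
    [NormedAddCommGroup F] [NormedSpace ℂ F] (L : O → E →L[ℂ] F) (P : O → F →L[ℂ] E)
    (h : ∀ v, ∑ o, L o (P o v) = v) (z : Lp F 2 μ) :
    ∑ o, (L o).compLpL 2 μ ((P o).compLpL 2 μ z) = z := by
  refine Lp.ext ?_
  have h1 := ae_all_iff.2 fun o => ae_compLpL (L o) ((P o).compLpL 2 μ z)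
  have h2 := ae_all_iff.2 fun o => ae_compLpL (P o) z
  filter_upwards [h1, h2, Lp.coeFn_finsetSum Finset.univ
    fun o => (L o).compLpL 2 μ ((P o).compLpL 2 μ z)] with x h1 h2 h3
  rw [h3, Finset.sum_apply]
  simp only [h1, h2, h]

theorem lpJet_compL (z : Lp (Jet d ι) 2 μ) : lpJet (fun o => compL μ o z) = z :=
  sum_compLpL_compLpL _ _ sum_jetIncl_jetComp z

theorem norm_inclL_le (o : Option (Fin d)) (f : Lp (EuclideanSpace ℂ ι) 2 μ) :
    ‖inclL μ o f‖ ≤ ‖f‖ := by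
  have := norm_compLpL_apply_le (μ := μ) (jetIncl (d := d) (ι := ι) o) (C := 1)
    (fun v => by rw [norm_jetIncl, one_mul]) f
  rwa [one_mul] at this

theorem norm_compL_le (o : Option (Fin d)) (z : Lp (Jet d ι) 2 μ) : ‖compL μ o z‖ ≤ ‖z‖ := by
  have := norm_compLpL_apply_le (μ := μ) (jetComp (d := d) (ι := ι) o) (C := 1)
    (fun v => by rw [one_mul]; exact norm_jetComp_le o v) z
  rwa [one_mul] at this

theorem norm_lpJet_le (f : Option (Fin d) → Lp (EuclideanSpace ℂ ι) 2 μ) :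
    ‖lpJet f‖ ≤ ∑ o, ‖f o‖ :=
  (norm_sum_le _ _).trans (Finset.sum_le_sum fun o _ => norm_inclL_le o _)

theorem norm_le_sum_compL (z : Lp (Jet d ι) 2 μ) :
    ‖z‖ ≤ ‖compL μ none z‖ + ∑ l, ‖compL μ (some l) z‖ := by
  have h := norm_lpJet_le fun o => compL μ o z
  rwa [lpJet_compL, Fintype.sum_option] at h

end LpJets

/-! ### Coefficients -/

section Coefficients

variable {α : Type*} [MeasurableSpace α] {μ : Measure α} {κ : Type*} [Fintype κ]

/-- `g` is measurable with Hermitian values between `c₁` and `c₂`. -/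
structure IsEllipticCoeff (μ : Measure α) (g : α → Matrix κ κ ℂ) (c₁ c₂ : ℝ) : Prop where
  pos : 0 < c₁
  measurable : ∀ i j, AEStronglyMeasurable (fun x => g x i j) μ
  hermitian : ∀ᵐ x ∂μ, (g x).IsHermitian
  lower : ∀ᵐ x ∂μ, ∀ v, c₁ * ‖v‖ ^ 2 ≤ (⟪v, matCLM (g x) v⟫_ℂ).re
  upper : ∀ᵐ x ∂μ, ∀ v, ‖matCLM (g x) v‖ ≤ c₂ * ‖v‖

namespace IsEllipticCoeff

variable {g : α → Matrix κ κ ℂ} {c₁ c₂ : ℝ}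

theorem aestronglyMeasurable_mul (h : IsEllipticCoeff μ g c₁ c₂) {f : α → EuclideanSpace ℂ κ}
    (hf : AEStronglyMeasurable f μ) : AEStronglyMeasurable (fun x => matCLM (g x) (f x)) μ := by
  have hm : AEMeasurable (fun x => matCLM (g x) (f x)) μ := by
    have h1 : AEMeasurable (fun x => (matCLM (g x) (f x)).ofLp) μ := by
      refine aemeasurable_pi_iff.2 fun i => ?_
      simp only [ofLp_matCLM, Matrix.mulVec, dotProduct]
      refine Finset.aemeasurable_fun_sum _ fun j _ => (h.measurable i j).aemeasurable.mul ?_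
      exact ((EuclideanSpace.proj j).continuous.comp_aestronglyMeasurable hf).aemeasurable
    exact (WithLp.measurable_toLp 2 _).comp_aemeasurable h1
  exact hm.aestronglyMeasurable

theorem memLp_mul (h : IsEllipticCoeff μ g c₁ c₂) {f : α → EuclideanSpace ℂ κ}
    (hf : MemLp f 2 μ) : MemLp (fun x => matCLM (g x) (f x)) 2 μ :=
  hf.of_le_mul (h.aestronglyMeasurable_mul hf.1) (h.upper.mono fun x hx => hx (f x))

theorem restrict (h : IsEllipticCoeff μ g c₁ c₂) (s : Set α) :
    IsEllipticCoeff (μ.restrict s) g c₁ c₂ where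
  pos := h.pos
  measurable i j := (h.measurable i j).restrict
  hermitian := ae_restrict_of_ae h.hermitian
  lower := ae_restrict_of_ae h.lower
  upper := ae_restrict_of_ae h.upper

/-- Multiplication by a coefficient as an operator in `L₂`. -/
noncomputable def mulL (h : IsEllipticCoeff μ g c₁ c₂) :
    Lp (EuclideanSpace ℂ κ) 2 μ →L[ℂ] Lp (EuclideanSpace ℂ κ) 2 μ :=
  LinearMap.mkContinuous
    { toFun := fun f => (h.memLp_mul (Lp.memLp f)).toLp _
      map_add' := fun f f' => by
        refine Lp.ext ?_
        filter_upwards [(h.memLp_mul (Lp.memLp (f + f'))).coeFn_toLp,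
          (h.memLp_mul (Lp.memLp f)).coeFn_toLp, (h.memLp_mul (Lp.memLp f')).coeFn_toLp,
          Lp.coeFn_add f f', Lp.coeFn_add ((h.memLp_mul (Lp.memLp f)).toLp _)
            ((h.memLp_mul (Lp.memLp f')).toLp _)] with x h1 h2 h3 h4 h5
        rw [h1, h5, Pi.add_apply, h2, h3, h4, Pi.add_apply, map_add]
      map_smul' := fun c f => by
        refine Lp.ext ?_
        filter_upwards [(h.memLp_mul (Lp.memLp (c • f))).coeFn_toLp,
          (h.memLp_mul (Lp.memLp f)).coeFn_toLp, Lp.coeFn_smul c f,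
          Lp.coeFn_smul c ((h.memLp_mul (Lp.memLp f)).toLp _)] with x h1 h2 h3 h4
        rw [h1, RingHom.id_apply, h4, Pi.smul_apply, h2, h3, Pi.smul_apply, map_smul] }
    c₂ fun f => by
      refine Lp.norm_le_mul_norm_of_ae_le_mul ?_
      filter_upwards [(h.memLp_mul (Lp.memLp f)).coeFn_toLp, h.upper] with x h1 h2
      exact (congrArg norm h1).le.trans (h2 _)

theorem coeFn_mulL (h : IsEllipticCoeff μ g c₁ c₂) (f : Lp (EuclideanSpace ℂ κ) 2 μ) :
    h.mulL f =ᵐ[μ] fun x => matCLM (g x) (f x) :=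
  (h.memLp_mul (Lp.memLp f)).coeFn_toLp

theorem inner_mulL (h : IsEllipticCoeff μ g c₁ c₂) (f f' : Lp (EuclideanSpace ℂ κ) 2 μ) :
    ⟪f, h.mulL f'⟫_ℂ = ⟪h.mulL f, f'⟫_ℂ := by
  rw [L2.inner_def, L2.inner_def]
  refine integral_congr_ae ?_
  filter_upwards [h.coeFn_mulL f, h.coeFn_mulL f', h.hermitian] with x h1 h2 h3
  rw [h1, h2, inner_matCLM_left, h3.eq]

theorem le_inner_mulL (h : IsEllipticCoeff μ g c₁ c₂) (f : Lp (EuclideanSpace ℂ κ) 2 μ) :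
    c₁ * ‖f‖ ^ 2 ≤ (⟪f, h.mulL f⟫_ℂ).re := by
  have h0 : ‖f‖ ^ 2 = (⟪f, f⟫_ℂ).re := (inner_self_eq_norm_sq (𝕜 := ℂ) f).symm
  have i1 := L2.integrable_inner (𝕜 := ℂ) f f
  have i2 := L2.integrable_inner (𝕜 := ℂ) f (h.mulL f)
  rw [h0, L2.inner_def, L2.inner_def, ← Complex.reCLM_apply, ← Complex.reCLM_apply,
    ← Complex.reCLM.integral_comp_comm i1, ← Complex.reCLM.integral_comp_comm i2,
    ← integral_const_mul]
  refine integral_mono_ae ((Complex.reCLM.integrable_comp i1).const_mul _)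
    (Complex.reCLM.integrable_comp i2) ?_
  filter_upwards [h.coeFn_mulL f, h.lower] with x h1 h2
  simp only [Complex.reCLM_apply, h1]
  refine le_trans (le_of_eq ?_) (h2 (f x))
  congr 1
  exact inner_self_eq_norm_sq (𝕜 := ℂ) (f x)

end IsEllipticCoeff

end Coefficients

/-! ### The space `H¹(ℝᵈ)` and the operators `b(D)* g b(D)` -/

section WholeSpace

open scoped FourierTransform SchwartzMap LineDeriv

variable {d : ℕ} {ι κ : Type*} [Fintype ι] [Fintype κ]

/-- The symbol of `b(D)` is bounded below. -/
structure IsEllipticSymbol (b : Fin d → Matrix κ ι ℂ) (c : ℝ) : Prop where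
  pos : 0 < c
  le : ∀ ξ v, c * ‖ξ‖ * ‖v‖ ≤ ‖matCLM (symbol b ξ) v‖

/-- The jets of class `L₂` on `ℝᵈ`. -/
abbrev JetL2 (d : ℕ) (ι : Type*) [Fintype ι] : Type _ :=
  Lp (Jet d ι) 2 (volume : Measure (EuclideanSpace ℝ (Fin d)))

/-- The jets of the functions from `H¹(ℝᵈ; ℂ^ι)`. -/
def sobolevJets (d : ℕ) (ι : Type*) [Fintype ι] :
    Submodule ℂ (JetL2 d ι) where
  carrier := {z | HasWeakGradient (compL volume none z) fun l => compL volume (some l) z}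
  add_mem' := by
    intro z w hz hw
    simp only [Set.mem_ofPred_eq, map_add] at *
    exact (hz.add hw).congr (Lp.coeFn_add _ _).symm fun l => (Lp.coeFn_add _ _).symm
  zero_mem' := by
    simp only [Set.mem_ofPred_eq, map_zero]
    exact HasWeakGradient.zero.congr (Lp.coeFn_zero _ _ _).symm fun l => (Lp.coeFn_zero _ _ _).symm
  smul_mem' := by
    intro c z hz
    simp only [Set.mem_ofPred_eq, map_smul] at *
    exact (hz.smul c).congr (Lp.coeFn_smul _ _).symm
      fun l => (Lp.coeFn_smul c (compL volume (some l) z)).symm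

theorem mem_sobolevJets {z : JetL2 d ι} :
    z ∈ sobolevJets d ι ↔
      HasWeakGradient (compL volume none z) fun l => compL volume (some l) z := Iff.rfl

theorem continuous_integral_smul {α F : Type*} [MeasurableSpace α] {μ : Measure α}
    [NormedAddCommGroup F] [NormedSpace ℝ F] [CompleteSpace F] {ψ : α → ℝ}
    (hψ : MemLp ψ 2 μ) : Continuous fun f : Lp F 2 μ => ∫ x, ψ x • f x ∂μ := by
  have h : ∀ f : Lp F 2 μ, ∫ x, ψ x • f x ∂μ =
      (ContinuousLinearMap.lsmul ℝ ℝ : ℝ →L[ℝ] F →L[ℝ] F).lpPairing μ 2 2 (hψ.toLp ψ) f := by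
    intro f
    rw [ContinuousLinearMap.lpPairing_eq_integral]
    refine integral_congr_ae ?_
    filter_upwards [hψ.coeFn_toLp] with x hx
    rw [hx]
    rfl
  simp only [h]
  exact ContinuousLinearMap.continuous _

theorem hasWeakGradient_lp_iff {u : L2 d ι} {Du : Fin d → L2 d ι} :
    HasWeakGradient u (fun l => Du l) ↔ ∀ (l : Fin d) (φ : EuclideanSpace ℝ (Fin d) → ℝ),
      ContDiff ℝ ∞ φ → HasCompactSupport φ →
      ∫ x, fderiv ℝ φ x (EuclideanSpace.single l 1) • u x = -∫ x, φ x • Du l x :=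
  ⟨fun h => h.integral_eq, fun h => ⟨(Lp.memLp u).locallyIntegrable one_le_two,
    fun l => (Lp.memLp (Du l)).locallyIntegrable one_le_two, h⟩⟩

/-- Storing a function together with its derivatives as one `L₂` function turns `H¹` into a subspace
of a Hilbert space. It is closed since each weak derivative identity is a continuous condition on
the jet. -/
theorem isClosed_sobolevJets : IsClosed (sobolevJets d ι : Set (JetL2 d ι)) := by
  have h : (sobolevJets d ι : Set (JetL2 d ι)) =
      ⋂ (l : Fin d) (φ : EuclideanSpace ℝ (Fin d) → ℝ) (_ : ContDiff ℝ ∞ φ)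
        (_ : HasCompactSupport φ), {z | ∫ x, fderiv ℝ φ x (EuclideanSpace.single l 1) •
          compL volume none z x = -∫ x, φ x • compL volume (some l) z x} := by
    ext z
    simp only [Set.mem_iInter, Set.mem_ofPred_eq]
    exact hasWeakGradient_lp_iff
  rw [h]
  refine isClosed_iInter fun l => isClosed_iInter fun φ => isClosed_iInter fun h1 =>
    isClosed_iInter fun h2 => isClosed_eq ?_ ?_
  · have hc : Continuous fun x => fderiv ℝ φ x (EuclideanSpace.single l 1) :=
      (h1.continuous_fderiv (by simp)).clm_apply continuous_const
    exact (continuous_integral_smul (hc.memLp_of_hasCompactSupport (h2.fderiv_apply ℝ _))).comp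
      (compL volume none).continuous
  · exact ((continuous_integral_smul (h1.continuous.memLp_of_hasCompactSupport h2)).comp
      (compL volume (some l)).continuous).neg

theorem mem_firstOrderGraph_iff (b : Fin d → Matrix κ ι ℂ) {u : L2 d ι} {p : L2 d κ} :
    (u, p) ∈ firstOrderGraph b ↔
      ∃ z ∈ sobolevJets d ι, compL volume none z = u ∧ symbolL volume b z = p := by
  constructor
  · rintro ⟨Du, hu, hp⟩
    set z : JetL2 d ι :=
      lpJet fun o => o.elim u Du with hz
    have hn : compL volume none z = u := compL_lpJet _ _
    have hs : ∀ l, compL volume (some l) z = Du l := fun l => compL_lpJet _ _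
    refine ⟨z, ?_, hn, ?_⟩
    · rw [mem_sobolevJets, hn]
      simp only [hs]
      exact hu
    · refine Lp.ext ?_
      filter_upwards [ae_symbolL b z, hp, ae_compL z] with x h2 h3 h4
      refine WithLp.ofLp_injective 2 ?_
      rw [h2, h3, ofLp_jetSymbol]
      congr 1
      ext1 l
      rw [← h4, ← hs l]
  · rintro ⟨z, hz, rfl, rfl⟩
    refine ⟨fun l => compL volume (some l) z, hz, ?_⟩
    filter_upwards [ae_symbolL b z, ae_compL z] with x h2 h4
    rw [h2, ofLp_jetSymbol]
    simp only [h4]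

theorem firstOrder_compL (b : Fin d → Matrix κ ι ℂ) {z : Lp (Jet d ι) 2 volume}
    (hz : z ∈ sobolevJets d ι) (h : compL volume none z ∈ (firstOrder b).domain) :
    firstOrder b ⟨compL volume none z, h⟩ = symbolL volume b z := by
  have h1 : (compL volume none z, symbolL volume b z) ∈ (firstOrder b).graph := by
    rw [graph_firstOrder]
    exact (mem_firstOrderGraph_iff b).2 ⟨z, hz, rfl, rfl⟩
  obtain ⟨y, hy1, hy2⟩ := (LinearPMap.mem_graph_iff _).1 h1
  refine Eq.trans ?_ hy2
  congr 1
  exact Subtype.ext hy1.symm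

theorem compL_mem_domain (b : Fin d → Matrix κ ι ℂ) {z : Lp (Jet d ι) 2 volume}
    (hz : z ∈ sobolevJets d ι) : compL volume none z ∈ (firstOrder b).domain :=
  mem_firstOrder_domain_of_hasWeakGradient b hz

theorem exists_jet_of_mem_domain (b : Fin d → Matrix κ ι ℂ) {u : L2 d ι}
    (hu : u ∈ (firstOrder b).domain) : ∃ z ∈ sobolevJets d ι, compL volume none z = u := by
  have h1 : (u, firstOrder b ⟨u, hu⟩) ∈ (firstOrder b).graph :=
    (firstOrder b).mem_graph ⟨u, hu⟩
  rw [graph_firstOrder] at h1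
  obtain ⟨z, hz, h2, -⟩ := (mem_firstOrderGraph_iff b).1 h1
  exact ⟨z, hz, h2⟩

/-- The operator in terms of jets: the form becomes a bounded form on one fixed Hilbert space,
restricted to the closed subspace `sobolevJets`. -/
theorem mem_divFormGraph_iff (b : Fin d → Matrix κ ι ℂ)
    {g : EuclideanSpace ℝ (Fin d) → Matrix κ κ ℂ} {c₁ c₂ : ℝ}
    (hg : IsEllipticCoeff volume g c₁ c₂) {u w : L2 d ι} :
    (u, w) ∈ divFormGraph b g ↔ ∃ z ∈ sobolevJets d ι, compL volume none z = u ∧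
      ∀ y ∈ sobolevJets d ι,
        ⟪symbolL volume b y, hg.mulL (symbolL volume b z)⟫_ℂ = ⟪compL volume none y, w⟫_ℂ := by
  constructor
  · rintro ⟨hu, q, hq, h⟩
    obtain ⟨z, hz, rfl⟩ := exists_jet_of_mem_domain b hu
    refine ⟨z, hz, rfl, fun y hy => ?_⟩
    have h1 := h ⟨_, compL_mem_domain b hy⟩
    rw [firstOrder_compL b hy] at h1
    rw [← h1]
    congr 1
    refine Lp.ext ?_
    rw [firstOrder_compL b hz] at hq
    filter_upwards [hg.coeFn_mulL (symbolL volume b z), hq] with x h2 h3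
    rw [h2]
    exact WithLp.ofLp_injective 2 h3.symm
  · rintro ⟨z, hz, rfl, h⟩
    refine ⟨compL_mem_domain b hz, hg.mulL (symbolL volume b z), ?_, ?_⟩
    · rw [firstOrder_compL b hz]
      filter_upwards [hg.coeFn_mulL (symbolL volume b z)] with x h2
      rw [h2, ofLp_matCLM]
    · rintro ⟨v, hv⟩
      obtain ⟨y, hy, rfl⟩ := exists_jet_of_mem_domain b hv
      rw [firstOrder_compL b hy]
      exact h y hy

/-- A constant linear map of the values commutes with integration, hence with the Fourier transform
of tempered distributions, into which `L₂` embeds injectively. -/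
theorem fourier_compLpL (L : EuclideanSpace ℂ ι →L[ℂ] EuclideanSpace ℂ κ) (f : L2 d ι) :
    𝓕 (L.compLpL 2 volume f) = L.compLpL 2 volume (𝓕 f) := by
  have h : ∀ (f : L2 d ι) (g : 𝓢(EuclideanSpace ℝ (Fin d), ℂ)),
      Lp.toTemperedDistribution (L.compLpL 2 volume f) g = L (Lp.toTemperedDistribution f g) := by
    intro f g
    have hi : Integrable (fun x => g x • f x) volume :=
      memLp_one_iff_integrable.1 ((Lp.memLp f).smul (g.memLp 2 volume))
    rw [Lp.toTemperedDistribution_apply, Lp.toTemperedDistribution_apply,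
      ← L.integral_comp_comm hi]
    refine integral_congr_ae ?_
    filter_upwards [ae_compLpL L f] with x hx
    rw [hx, map_smul]
  have h1 : Lp.toTemperedDistribution (𝓕 (L.compLpL 2 volume f)) =
      Lp.toTemperedDistribution (L.compLpL 2 volume (𝓕 f)) := by
    refine DFunLike.ext _ _ fun g => ?_
    rw [h, ← Lp.fourier_toTemperedDistribution_eq, ← Lp.fourier_toTemperedDistribution_eq]
    rw [TemperedDistribution.fourier_apply, TemperedDistribution.fourier_apply, h]
  exact LinearMap.ker_eq_bot.1 (Lp.ker_toTemperedDistributionCLM_eq_bot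
    (F := EuclideanSpace ℂ κ) (μ := (volume : Measure (EuclideanSpace ℝ (Fin d)))) (p := 2)) h1

theorem fourier_compL (o : Option (Fin d))
    (z : JetL2 d ι) :
    𝓕 (compL volume o z) = compL volume o (𝓕 z) :=
  fourier_compLpL (jetComp o) z

/-- Weak derivatives are controlled by `b(D)u` if the symbol is elliptic. -/
theorem IsEllipticSymbol.norm_compL_le {b : Fin d → Matrix κ ι ℂ} {c : ℝ}
    (hb : IsEllipticSymbol b c) {z : Lp (Jet d ι) 2 volume} (hz : z ∈ sobolevJets d ι)
    (l : Fin d) : c * ‖compL volume (some l) z‖ ≤ ‖symbolL volume b z‖ := by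
  have e1 : ‖compL volume (some l) z‖ = ‖compL volume (some l) (𝓕 z)‖ := by
    rw [← Lp.norm_fourier_eq, fourier_compL]
  have e2 : ‖symbolL volume b z‖ = ‖symbolL volume b (𝓕 z)‖ := by
    rw [← Lp.norm_fourier_eq, symbolL, fourier_compLpL]
  rw [e1, e2, ← Real.norm_of_nonneg hb.pos.le, ← Complex.norm_real, ← norm_smul]
  refine Lp.norm_le_norm_of_ae_le ?_
  have h1 := ae_all_iff.2 fun l => (mem_sobolevJets.1 hz).fourier l
  simp only [fourier_compL] at h1
  filter_upwards [h1, ae_compL (𝓕 z), ae_symbolL b (𝓕 z),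
    Lp.coeFn_smul (c : ℂ) (compL volume (some l) (𝓕 z))] with ξ h1 h2 h4 h5
  have h6 : ∀ l, jetComp (some l) ((𝓕 z) ξ) =
      ((2 * Real.pi * ξ l : ℝ) * Complex.I) • jetComp none ((𝓕 z) ξ) := fun l => by
    rw [← h2, ← h2, h1]
  rw [h5, h4, Pi.smul_apply, h2, h6]
  -- On the Fourier side `∂ₗ` is multiplication by `2πi ξₗ`, and `(-i)(2πi ξₗ) = 2π ξₗ`, so `b(D)`
  -- acts as the matrix `2π b(ξ)`.
  have h7 : jetSymbol b ((𝓕 z) ξ) =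
      ((2 * Real.pi : ℝ) : ℂ) • matCLM (symbol b ξ) (jetComp none ((𝓕 z) ξ)) := by
    simp only [jetSymbol, symbol, map_sum, map_smul, _root_.sum_apply, _root_.smul_apply,
      ContinuousLinearMap.comp_apply, h6, Finset.smul_sum, smul_smul]
    refine Finset.sum_congr rfl fun l _ => ?_
    congr 1
    push_cast
    linear_combination (-2 * Real.pi * ξ l : ℂ) * Complex.I_mul_I
  rw [h7, norm_smul, norm_smul, norm_smul, norm_mul, Complex.norm_I, Complex.norm_real,
    Complex.norm_real, Complex.norm_real, mul_one, norm_mul, Real.norm_of_nonneg hb.pos.le,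
    Real.norm_of_nonneg Real.two_pi_pos.le]
  have h8 := hb.le ξ (jetComp none ((𝓕 z) ξ))
  have h9 : ‖ξ l‖ ≤ ‖ξ‖ := PiLp.norm_apply_le ξ l
  calc _ = 2 * Real.pi * (c * ‖ξ l‖ * ‖jetComp none ((𝓕 z) ξ)‖) := by ring
    _ ≤ 2 * Real.pi * (c * ‖ξ‖ * ‖jetComp none ((𝓕 z) ξ)‖) := by
      have := hb.pos
      gcongr
    _ ≤ _ := by gcongr

end WholeSpace

/-! ### The energy inequality and the selfadjointness of `b(D)* g b(D)`. -/

section WholeSpaceOperators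

open scoped FourierTransform SchwartzMap LineDeriv

variable {d : ℕ} {ι κ : Type*} [Fintype ι] [Fintype κ]

/-- The constant of the energy estimate for the form of `b(D)* g b(D) + I`. -/
noncomputable def energyConst (d : ℕ) (c c₁ : ℝ) : ℝ := (2 + 2 * (d / c) ^ 2 / c₁)⁻¹

theorem energyConst_pos {c c₁ : ℝ} (h₁ : 0 < c₁) : 0 < energyConst d c c₁ := by
  rw [energyConst]
  positivity

/-- Ellipticity bounds each of the `d` derivatives by `c⁻¹‖b(D)u‖`, so that `‖z‖ ≤ A + (d/c)B`;
squaring produces the constant `energyConst`. -/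
theorem IsEllipticSymbol.norm_sq_le {b : Fin d → Matrix κ ι ℂ} {c : ℝ}
    (hb : IsEllipticSymbol b c) {c₁ : ℝ} (h₁ : 0 < c₁) {z : JetL2 d ι} (hz : z ∈ sobolevJets d ι) :
    energyConst d c c₁ * ‖z‖ ^ 2 ≤ ‖compL volume none z‖ ^ 2 + c₁ * ‖symbolL volume b z‖ ^ 2 := by
  have hc := hb.pos
  set A := ‖compL volume none z‖
  set B := ‖symbolL volume b z‖
  have h1 : ‖z‖ ≤ A + d / c * B := by
    refine (norm_le_sum_compL z).trans (add_le_add le_rfl ?_)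
    calc ∑ l, ‖compL volume (some l) z‖ ≤ ∑ _l : Fin d, B / c :=
          Finset.sum_le_sum fun l _ => by
            rw [le_div_iff₀ hc, mul_comm]
            exact hb.norm_compL_le hz l
      _ = _ := by simp; ring
  have h2 : ‖z‖ ^ 2 ≤ (2 + 2 * (d / c) ^ 2 / c₁) * (A ^ 2 + c₁ * B ^ 2) := by
    calc ‖z‖ ^ 2 ≤ (A + d / c * B) ^ 2 := by gcongr
      _ ≤ 2 * A ^ 2 + 2 * (d / c) ^ 2 * B ^ 2 := by nlinarith [sq_nonneg (A - d / c * B)]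
      -- The nonnegative terms are added to make the right-hand side factor into the product that
      -- follows.
      _ ≤ 2 * A ^ 2 + 2 * (d / c) ^ 2 * B ^ 2 + (2 * c₁ * B ^ 2 + 2 * (d / c) ^ 2 / c₁ * A ^ 2) :=
        le_add_of_nonneg_right (by positivity)
      _ = _ := by field_simp; ring
  rw [energyConst, inv_mul_le_iff₀ (by positivity)]
  exact h2

/-- The operator `b(D)* g b(D)` is selfadjoint and nonnegative. -/
theorem isNonnegSelfAdjoint_divForm {b : Fin d → Matrix κ ι ℂ} {c : ℝ}
    (hb : IsEllipticSymbol b c) {g : EuclideanSpace ℝ (Fin d) → Matrix κ κ ℂ} {c₁ c₂ : ℝ}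
    (hg : IsEllipticCoeff volume g c₁ c₂) : IsNonnegSelfAdjoint (divForm b g) where
  exists_add f := by
    set P : JetL2 d ι →L[ℂ] L2 d ι := compL volume none
    set S : JetL2 d ι →L[ℂ] L2 d κ := symbolL volume b
    have hT : ∀ y z, ⟪y, (P.adjoint ∘L P + S.adjoint ∘L hg.mulL ∘L S) z⟫_ℂ =
        ⟪P y, P z⟫_ℂ + ⟪S y, hg.mulL (S z)⟫_ℂ := fun y z => by
      rw [_root_.add_apply, inner_add_right, ContinuousLinearMap.comp_apply,
        ContinuousLinearMap.comp_apply, ContinuousLinearMap.comp_apply,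
        ContinuousLinearMap.adjoint_inner_right, ContinuousLinearMap.adjoint_inner_right]
    -- The form `(u, v) + (g b(D)u, b(D)v)` is coercive on `H¹`; solving its weak equation with
    -- right-hand side `f` inverts `A + I`.
    obtain ⟨z, hz, h⟩ := exists_weak_solution (sobolevJets d ι) isClosed_sobolevJets
      (P.adjoint ∘L P + S.adjoint ∘L hg.mulL ∘L S) (energyConst_pos (d := d) (c := c) hg.pos)
      (fun z hz => by
        refine (hb.norm_sq_le hg.pos hz).trans ((le_trans ?_ (Complex.re_le_norm _)))
        rw [hT, Complex.add_re]
        exact add_le_add (inner_self_eq_norm_sq (𝕜 := ℂ) (P z)).ge (hg.le_inner_mulL _))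
      (P.adjoint f)
    refine ⟨P z, ?_⟩
    rw [graph_divForm, mem_divFormGraph_iff b hg]
    refine ⟨z, hz, rfl, fun y hy => ?_⟩
    have := h y hy
    rw [hT, ContinuousLinearMap.adjoint_inner_right] at this
    rw [inner_sub_right, ← this]
    ring
  symm := by
    rintro ⟨u, w⟩ hx ⟨u', w'⟩ hy
    rw [graph_divForm, mem_divFormGraph_iff b hg] at hx hy
    obtain ⟨z, hz, rfl, h⟩ := hx
    obtain ⟨z', hz', rfl, h'⟩ := hy
    change ⟪compL volume none z, w'⟫_ℂ = ⟪w, compL volume none z'⟫_ℂ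
    rw [← h' z hz, ← inner_conj_symm w, ← h z' hz', inner_conj_symm, hg.inner_mulL]
  nonneg := by
    rintro ⟨u, w⟩ hx
    rw [graph_divForm, mem_divFormGraph_iff b hg] at hx
    obtain ⟨z, hz, rfl, h⟩ := hx
    change 0 ≤ (⟪compL volume none z, w⟫_ℂ).re
    rw [← h z hz]
    exact le_trans (by have := hg.pos; positivity) (hg.le_inner_mulL _)

/-! ### Density of the Schwartz functions -/

/-- The jet of a Schwartz function. -/
noncomputable def schwartzJet (V : 𝓢(EuclideanSpace ℝ (Fin d), EuclideanSpace ℂ ι)) : JetL2 d ι :=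
  lpJet fun o => o.elim (V.toLp 2 volume)
    fun l => (LineDeriv.lineDerivOp (EuclideanSpace.single l (1 : ℝ)) V).toLp 2 volume

theorem compL_none_schwartzJet (V : 𝓢(EuclideanSpace ℝ (Fin d), EuclideanSpace ℂ ι)) :
    compL volume none (schwartzJet V) = V.toLp 2 volume := compL_lpJet _ _

theorem compL_some_schwartzJet (V : 𝓢(EuclideanSpace ℝ (Fin d), EuclideanSpace ℂ ι)) (l : Fin d) :
    compL volume (some l) (schwartzJet V) =
      (LineDeriv.lineDerivOp (EuclideanSpace.single l (1 : ℝ)) V).toLp 2 volume :=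
  compL_lpJet _ _

theorem schwartzJet_mem (V : 𝓢(EuclideanSpace ℝ (Fin d), EuclideanSpace ℂ ι)) :
    schwartzJet V ∈ sobolevJets d ι := by
  rw [mem_sobolevJets, compL_none_schwartzJet]
  simp only [compL_some_schwartzJet]
  have h : ∀ l : Fin d, (fun x => fderiv ℝ V x (EuclideanSpace.single l 1)) =ᵐ[volume]
      (LineDeriv.lineDerivOp (EuclideanSpace.single l (1 : ℝ)) V).toLp 2 volume := fun l =>
    ((LineDeriv.lineDerivOp (EuclideanSpace.single l (1 : ℝ)) V).coeFn_toLp 2 volume).symm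
  exact (HasWeakGradient.of_contDiff (V.smooth 1)).congr (V.coeFn_toLp 2 volume).symm h

theorem schwartzJet_add (V W : 𝓢(EuclideanSpace ℝ (Fin d), EuclideanSpace ℂ ι)) :
    schwartzJet (V + W) = schwartzJet V + schwartzJet W := by
  rw [schwartzJet, schwartzJet, schwartzJet, lpJet, lpJet, lpJet, ← Finset.sum_add_distrib]
  refine Finset.sum_congr rfl fun o _ => ?_
  rw [← map_add]
  congr 1
  cases o with
  | none => exact map_add (SchwartzMap.toLpCLM ℂ (EuclideanSpace ℂ ι) 2 volume) V W
  | some l =>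
    simp only [Option.elim, LineDeriv.lineDerivOp_add]
    exact map_add (SchwartzMap.toLpCLM ℂ (EuclideanSpace ℂ ι) 2 volume) _ _

theorem schwartzJet_smul (c : ℂ) (V : 𝓢(EuclideanSpace ℝ (Fin d), EuclideanSpace ℂ ι)) :
    schwartzJet (c • V) = c • schwartzJet V := by
  rw [schwartzJet, schwartzJet, lpJet, lpJet, Finset.smul_sum]
  refine Finset.sum_congr rfl fun o _ => ?_
  rw [← map_smul]
  congr 1
  cases o with
  | none => exact map_smul (SchwartzMap.toLpCLM ℂ (EuclideanSpace ℂ ι) 2 volume) c V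
  | some l =>
    simp only [Option.elim, LineDeriv.lineDerivOp_smul]
    exact map_smul (SchwartzMap.toLpCLM ℂ (EuclideanSpace ℂ ι) 2 volume) c _

theorem ae_fourier_jet {z : JetL2 d ι} (hz : z ∈ sobolevJets d ι) :
    ∀ᵐ ξ, ∀ l, jetComp (some l) ((𝓕 z) ξ) =
      ((2 * Real.pi * ξ l : ℝ) * Complex.I) • jetComp none ((𝓕 z) ξ) := by
  have h1 := ae_all_iff.2 fun l => (mem_sobolevJets.1 hz).fourier l
  simp only [fourier_compL] at h1
  filter_upwards [h1, ae_compL (𝓕 z)] with ξ h1 h2 l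
  rw [← h2, ← h2, h1]

theorem inner_jet (v w : Jet d ι) :
    ⟪v, w⟫_ℂ = ∑ o, ⟪jetComp o v, jetComp o w⟫_ℂ := by
  simp only [PiLp.inner_apply, Fintype.sum_prod_type]
  rfl

/-- This is the density of the Schwartz functions in `H¹`. On the Fourier side the product of jets
has the weight `1 + |2πξ|²`, which never vanishes, and the transform of a Schwartz function may be
any smooth function with compact support. -/
theorem eq_zero_of_inner_schwartzJet {z : JetL2 d ι} (hz : z ∈ sobolevJets d ι)
    (h : ∀ V, ⟪schwartzJet V, z⟫_ℂ = 0) : z = 0 := by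
  have key : ∀ᵐ ξ, (((1 + ∑ l, (2 * Real.pi * ξ l) ^ 2 : ℝ) : ℂ)) • (compL volume none (𝓕 z)) ξ
      = 0 := by
    have hli : LocallyIntegrable (fun ξ : EuclideanSpace ℝ (Fin d) =>
        (((1 + ∑ l, (2 * Real.pi * ξ l) ^ 2 : ℝ) : ℂ)) • (compL volume none (𝓕 z)) ξ) volume :=
      HasWeakGradient.locallyIntegrable_smul ((Lp.memLp (compL volume none (𝓕 z))).locallyIntegrable
        one_le_two) (c := fun ξ => ((1 + ∑ l, (2 * Real.pi * ξ l) ^ 2 : ℝ) : ℂ)) (by fun_prop)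
    refine ae_eq_zero_of_integral_contDiff_smul_eq_zero hli fun φ p1 p2 => ?_
    have hi := hli.integrable_smul_left_of_hasCompactSupport p1.continuous p2
    refine ext_inner_left ℂ fun v => ?_
    rw [inner_zero_right]
    have q1 : HasCompactSupport fun ξ => (φ ξ : ℂ) • v :=
      (p2.comp_left (g := fun r : ℝ => (r : ℂ) • v) (by simp))
    have q2 : ContDiff ℝ ∞ fun ξ => (φ ξ : ℂ) • v :=
      (Complex.ofRealCLM.contDiff.comp p1).smul contDiff_const
    -- `V` is chosen so that its Fourier transform is the test function `φ` times the fixed vector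
    -- `v`.
    set V := 𝓕⁻ (q1.toSchwartzMap q2) with hV
    have e1 := h V
    rw [← Lp.inner_fourier_eq, L2.inner_def] at e1
    have e2 : compL volume none (𝓕 (schwartzJet V)) = (q1.toSchwartzMap q2).toLp 2 volume := by
      rw [← fourier_compL, compL_none_schwartzJet, SchwartzMap.toLp_fourier_eq, hV,
        FourierTransform.fourier_fourierInv_eq]
    rw [← integral_inner hi, ← e1]
    refine integral_congr_ae ?_
    filter_upwards [ae_fourier_jet hz, ae_fourier_jet (schwartzJet_mem V),
      ae_compL (𝓕 (schwartzJet V)), ae_compL (𝓕 z),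
      (q1.toSchwartzMap q2).coeFn_toLp 2 volume] with ξ h1 h2 h3 h4 h5
    have h6 : jetComp none ((𝓕 (schwartzJet V)) ξ) = (φ ξ : ℂ) • v := by
      rw [← h3, e2, h5]
      rfl
    have h7 : ∀ o, ⟪jetComp o ((𝓕 (schwartzJet V)) ξ), jetComp o ((𝓕 z) ξ)⟫_ℂ =
        ((o.elim 1 fun l => (2 * Real.pi * ξ l) ^ 2 : ℝ) : ℂ) *
          ((φ ξ : ℂ) * ⟪v, jetComp none ((𝓕 z) ξ)⟫_ℂ) := by
      intro o
      cases o with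
      | none => simp [h6]
      | some l =>
        rw [h1, h2, h6]
        simp only [inner_smul_left, inner_smul_right, map_mul, Complex.conj_ofReal, Complex.conj_I,
          Option.elim]
        push_cast
        linear_combination (-(2 * Real.pi * ξ l : ℂ) ^ 2 * (φ ξ) * ⟪v, jetComp none ((𝓕 z) ξ)⟫_ℂ) *
          Complex.I_mul_I
    rw [inner_jet, h4, ← Complex.coe_smul, inner_smul_right, inner_smul_right]
    simp only [h7]
    rw [← Finset.sum_mul, ← Complex.ofReal_sum, Fintype.sum_option]
    simp only [Option.elim]
    ring
  have h0 : 𝓕 z = 0 := by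
    refine Lp.ext ?_
    filter_upwards [key, ae_fourier_jet hz, ae_compL (𝓕 z),
      Lp.coeFn_zero (Jet d ι) 2 volume] with ξ h1 h2 h3 h4
    rw [h4, Pi.zero_apply]
    have h5 : jetComp none ((𝓕 z) ξ) = 0 := by
      rw [← h3]
      refine (smul_eq_zero.1 h1).resolve_left ?_
      refine Complex.ofReal_ne_zero.2 (ne_of_gt ?_)
      positivity
    refine (sum_jetIncl_jetComp ((𝓕 z) ξ)).symm.trans ?_
    refine Finset.sum_eq_zero fun o _ => ?_
    cases o with
    | none => rw [h5, map_zero]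
    | some l => rw [h2, h5, smul_zero, map_zero]
  rw [← norm_eq_zero, ← Lp.norm_fourier_eq, h0, norm_zero]

/-- Estimates of functionals on `H¹(ℝᵈ)` may be checked on Schwartz functions. -/
theorem norm_inner_le_of_schwartzJet {r : JetL2 d ι} {C : ℝ}
    (h : ∀ V, ‖⟪schwartzJet V, r⟫_ℂ‖ ≤ C * ‖schwartzJet V‖) {z : JetL2 d ι}
    (hz : z ∈ sobolevJets d ι) : ‖⟪z, r⟫_ℂ‖ ≤ C * ‖z‖ := by
  let K : Submodule ℂ (JetL2 d ι) := LinearMap.range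
    ({ toFun := schwartzJet, map_add' := schwartzJet_add, map_smul' := schwartzJet_smul } :
      𝓢(EuclideanSpace ℝ (Fin d), EuclideanSpace ℂ ι) →ₗ[ℂ] JetL2 d ι)
  have hKW : K.topologicalClosure ≤ sobolevJets d ι :=
    Submodule.topologicalClosure_minimal _ (by rintro _ ⟨V, rfl⟩; exact schwartzJet_mem V)
      isClosed_sobolevJets
  have hc : CompleteSpace K.topologicalClosure :=
    K.isClosed_topologicalClosure.completeSpace_coe
  have hz' : z ∈ K.topologicalClosure := by
    have h1 : z - K.topologicalClosure.starProjection z ∈ K.topologicalClosureᗮ :=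
      Submodule.sub_starProjection_mem_orthogonal z
    -- The projection error belongs to `H¹` and is orthogonal to all Schwartz jets, hence it
    -- vanishes.
    have h2 : z - K.topologicalClosure.starProjection z ∈ sobolevJets d ι :=
      sub_mem hz (hKW (Submodule.starProjection_apply_mem _ _))
    have h3 := eq_zero_of_inner_schwartzJet h2 fun V =>
      h1 _ (K.le_topologicalClosure ⟨V, rfl⟩)
    rw [sub_eq_zero.1 h3]
    exact Submodule.starProjection_apply_mem _ _
  have hcl : IsClosed {z : JetL2 d ι | ‖⟪z, r⟫_ℂ‖ ≤ C * ‖z‖} :=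
    isClosed_le (by fun_prop) (by fun_prop)
  have hsub : (K : Set (JetL2 d ι)) ⊆ {z : JetL2 d ι | ‖⟪z, r⟫_ℂ‖ ≤ C * ‖z‖} := by
    rintro _ ⟨V, rfl⟩
    exact h V
  exact closure_minimal hsub hcl hz'

end WholeSpaceOperators

/-! ### Quadratic forms of functions of an operator near an approximate eigenvalue -/

section SecondOrder

variable {H : Type*} [NormedAddCommGroup H] [InnerProductSpace ℂ H] [CompleteSpace H]

namespace IsNonnegSelfAdjoint

variable {A : H →ₗ.[ℂ] H} {φ : ℝ → ℝ} {M : ℝ}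

/-- Since `-K h² ≤ f ≤ K h²` on the spectrum, the same order holds for the quadratic forms, and the
form of `f(R)` is real. Working with forms rather than norms is what makes the error quadratic. -/
theorem norm_inner_cfc_resolvent_le (hA : IsNonnegSelfAdjoint A) {f h : ℝ → ℝ}
    (hf : ContinuousOn f (Set.Icc 0 1)) (hh : ContinuousOn h (Set.Icc 0 1)) {K : ℝ}
    (hfh : ∀ r ∈ Set.Icc (0 : ℝ) 1, |f r| ≤ K * h r ^ 2) (v : H) :
    ‖⟪v, cfc f (resolventNegOne A) v⟫_ℂ‖ ≤ K * ‖cfc h (resolventNegOne A) v‖ ^ 2 := by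
  have hs := hA.spectrum_resolvent_subset
  set R := resolventNegOne A
  have hp : ContinuousOn (fun r => K * (h r * h r)) (spectrum ℝ R) :=
    ((hh.mul hh).const_smul K).mono hs
  have e1 : (⟪v, cfc (fun r => K * (h r * h r)) R v⟫_ℂ).re = K * ‖cfc h R v‖ ^ 2 := by
    have h1 : IsSelfAdjoint (cfc h R) := cfc_predicate h _
    rw [cfc_const_mul K (fun r => h r * h r) R ((hh.mul hh).mono hs),
      cfc_mul h h _ (hh.mono hs) (hh.mono hs), _root_.smul_apply, mul_apply_eq_comp,
      ← Complex.coe_smul, inner_smul_right, Complex.re_ofReal_mul]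
    congr 1
    have h2 : ⟪v, cfc h R (cfc h R v)⟫_ℂ = ⟪cfc h R v, cfc h R v⟫_ℂ :=
      (h1.isSymmetric _ _).symm
    rw [h2]
    exact inner_self_eq_norm_sq (𝕜 := ℂ) _
  have key : ∀ F : ℝ → ℝ, ContinuousOn F (spectrum ℝ R) →
      (∀ r ∈ Set.Icc (0 : ℝ) 1, F r ≤ K * h r ^ 2) →
      (⟪v, cfc F R v⟫_ℂ).re ≤ K * ‖cfc h R v‖ ^ 2 := by
    intro F hF hle
    have h2 : cfc F R ≤ cfc (fun r => K * (h r * h r)) R :=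
      cfc_mono (fun r hr => (hle r (hs hr)).trans_eq (by ring)) hF hp
    have h3 := ((ContinuousLinearMap.le_def _ _).1 h2).re_inner_nonneg_right v
    rw [_root_.sub_apply, inner_sub_right, map_sub] at h3
    rw [← e1]
    simpa using h3
  have hsa : IsSelfAdjoint (cfc f R) := cfc_predicate f _
  have him : (⟪v, cfc f R v⟫_ℂ).im = 0 := hsa.isSymmetric.im_inner_self_apply v
  rw [show ⟪v, cfc f R v⟫_ℂ = ((⟪v, cfc f R v⟫_ℂ).re : ℂ) from
    Complex.ext rfl (by simpa using him), Complex.norm_real, Real.norm_eq_abs, abs_le]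
  constructor
  · have := key (fun r => -f r) (hf.neg.mono hs) fun r hr => (neg_le_abs _).trans (hfh r hr)
    rw [cfc_neg, _root_.neg_apply, inner_neg_right, Complex.neg_re] at this
    linarith
  · exact key f (hf.mono hs) fun r hr => (le_abs_self _).trans (hfh r hr)

/-- The quadratic form of `φ(A)` at an approximate eigenvector of the resolvent is determined up
to the square of the error by the first order expansion of `φ`. -/
theorem norm_inner_boundedCalculus_sub_le (hA : IsNonnegSelfAdjoint A)
    (hc : ContinuousOn φ (Set.Ici 0)) (hM : ∀ x, 0 ≤ x → |φ x| ≤ M) {l c K : ℝ}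
    (hK : ∀ x, 0 ≤ x → |φ x - φ l - c * ((1 + x)⁻¹ - (1 + l)⁻¹)| ≤
      K * ((1 + x)⁻¹ - (1 + l)⁻¹) ^ 2) (v : H) :
    ‖⟪v, boundedCalculus A φ v - φ l • v - c • (resolventNegOne A v - (1 + l)⁻¹ • v)⟫_ℂ‖ ≤
      K * ‖resolventNegOne A v - (1 + l)⁻¹ • v‖ ^ 2 := by
  have hs := hA.spectrum_resolvent_subset
  have hsa := hA.isSelfAdjoint_resolvent
  set R := resolventNegOne A with hR
  set T := boundedCalculus A φ with hT
  set ρ := (1 + l)⁻¹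
  have hcont := continuousOn_mul_comp_inv_sub_one hc hM
  -- It suffices to take `v = Ru`, where `φ(A)` is expressed by the calculus of `R`. Both sides then
  -- acquire the factor `r²`, and the hypothesis on `φ` multiplied by `r²` is the required pointwise
  -- bound.
  refine hA.denseRange_resolvent.induction_on v (isClosed_le (by fun_prop) (by fun_prop))
    fun u => ?_
  have hlin : ∀ w : H, cfc (fun r : ℝ => r - ρ) R w = R w - ρ • w := fun w => by
    rw [cfc_sub (fun r : ℝ => r) (fun _ => ρ) R (by fun_prop) (by fun_prop),
      cfc_id' ℝ R hsa, cfc_const _ R hsa, _root_.sub_apply,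
      Algebra.algebraMap_eq_smul_one, _root_.smul_apply, one_apply_eq_self]
  have h1 : ∀ F : ℝ → ℝ, ContinuousOn F (spectrum ℝ R) →
      cfc (fun r => F r * r) R u = cfc F R (R u) := fun F hF => by
    rw [cfc_mul F (fun r => r) R hF (by fun_prop), cfc_id' ℝ R hsa, mul_apply_eq_comp]
  have h2 : T (R u) - φ l • R u - c • (R (R u) - ρ • R u) =
      cfc (fun r : ℝ => r * φ (r⁻¹ - 1) - φ l * r - c * ((r - ρ) * r)) R u := by
    rw [cfc_sub (fun r : ℝ => r * φ (r⁻¹ - 1) - φ l * r) (fun r => c * ((r - ρ) * r)) R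
      ((hcont.mono hs).sub (by fun_prop)) (by fun_prop),
      cfc_sub (fun r : ℝ => r * φ (r⁻¹ - 1)) (fun r => φ l * r) R (hcont.mono hs)
      (by fun_prop), cfc_const_mul_id (φ l) R hsa, cfc_const_mul c _ R (by fun_prop),
      _root_.sub_apply, _root_.sub_apply, _root_.smul_apply, _root_.smul_apply,
      ← hA.boundedCalculus_resolvent hc hM, h1 (fun r => r - ρ) (by fun_prop), hlin]
  have h3 : ⟪R u, T (R u) - φ l • R u - c • (R (R u) - ρ • R u)⟫_ℂ =
      ⟪u, cfc (fun r : ℝ => (r * φ (r⁻¹ - 1) - φ l * r - c * ((r - ρ) * r)) * r) R u⟫_ℂ := by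
    rw [h2, cfc_mul _ (fun r => r) R _ (by fun_prop), cfc_id' ℝ R hsa]
    · have hcomm : Commute (cfc (fun r : ℝ => r * φ (r⁻¹ - 1) - φ l * r - c * ((r - ρ) * r)) R)
          R := by
        conv => arg 2; rw [← cfc_id ℝ R hsa]
        exact cfc_commute_cfc _ _ _
      rw [hcomm.eq, mul_apply_eq_comp]
      exact hsa.isSymmetric _ _
    · exact ((hcont.mono hs).sub (by fun_prop)).sub (by fun_prop)
  rw [h3, ← hlin, ← h1 (fun r => r - ρ) (by fun_prop)]
  refine hA.norm_inner_cfc_resolvent_le (h := fun r => (r - ρ) * r)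
    (((hcont.sub (by fun_prop)).sub (by fun_prop)).mul (by fun_prop)) (by fun_prop)
    (fun r hr => ?_) u
  rcases hr.1.eq_or_lt with h | h
  · simp [← h]
  · have h4 := hK _ (sub_nonneg.2 ((one_le_inv₀ h).2 hr.2))
    rw [add_sub_cancel, inv_inv] at h4
    have h5 : (r * φ (r⁻¹ - 1) - φ l * r - c * ((r - ρ) * r)) * r =
        (φ (r⁻¹ - 1) - φ l - c * (r - ρ)) * r ^ 2 := by ring
    change |(r * φ (r⁻¹ - 1) - φ l * r - c * ((r - ρ) * r)) * r| ≤ _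
    rw [h5, abs_mul, abs_of_nonneg (sq_nonneg r), mul_pow, ← mul_assoc]
    exact mul_le_mul_of_nonneg_right h4 (sq_nonneg r)

end IsNonnegSelfAdjoint

/-- A function with a second derivative at a point differs from its first order expansion by a
quadratic term. -/
theorem exists_abs_sub_taylor_le {G : ℝ → ℝ} {r₀ : ℝ} (hG : ContDiffAt ℝ 2 G r₀) :
    ∃ K η : ℝ, 0 < η ∧ ∀ r, |r - r₀| < η →
      |G r - G r₀ - deriv G r₀ * (r - r₀)| ≤ K * (r - r₀) ^ 2 := by
  have h1 : ContDiffAt ℝ 1 (deriv G) r₀ := by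
    have := (hG.fderiv_right (m := 1) (by norm_num)).clm_apply (contDiffAt_const (c := (1 : ℝ)))
    simpa using! this
  obtain ⟨K, t, ht, hK⟩ := h1.exists_lipschitzOnWith
  have h2 : ∀ᶠ r in 𝓝 r₀, DifferentiableAt ℝ G r :=
    (hG.eventually (by simp)).mono fun r hr => hr.differentiableAt (by simp)
  obtain ⟨η, hη, hball⟩ := Metric.mem_nhds_iff.1 (inter_mem ht h2)
  refine ⟨K, η, hη, fun r hr => ?_⟩
  have h0 : r₀ ∈ t := mem_of_mem_nhds ht
  have hmem : ∀ x ∈ Set.uIcc r₀ r, x ∈ t ∧ DifferentiableAt ℝ G x ∧ |x - r₀| ≤ |r - r₀| := by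
    intro x hx
    have h3 := Set.abs_sub_left_of_mem_uIcc hx
    have h4 : x ∈ Metric.ball r₀ η := by
      rw [Metric.mem_ball, Real.dist_eq]
      exact h3.trans_lt hr
    exact ⟨(hball h4).1, (hball h4).2, h3⟩
  -- The mean value inequality for `G(x) - G'(r₀)x`, whose derivative is at most `K|r - r₀|` between
  -- `r₀` and `r` by the Lipschitz continuity of `G'`.
  have h5 := (convex_uIcc r₀ r).norm_image_sub_le_of_norm_hasDerivWithin_le
    (f := fun x => G x - deriv G r₀ * x) (f' := fun x => deriv G x - deriv G r₀)
    (C := K * |r - r₀|) (fun x hx => ?_) (fun x hx => ?_) Set.left_mem_uIcc Set.right_mem_uIcc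
  · rw [Real.norm_eq_abs, Real.norm_eq_abs, mul_assoc, abs_mul_abs_self] at h5
    calc _ = |G r - deriv G r₀ * r - (G r₀ - deriv G r₀ * r₀)| := by congr 1; ring
      _ ≤ _ := h5.trans_eq (by ring)
  · have := ((hmem x hx).2.1.hasDerivAt.sub ((hasDerivAt_id x).const_mul (deriv G r₀)))
    simpa using! this.hasDerivWithinAt
  · have := hK.dist_le_mul x (hmem x hx).1 r₀ h0
    rw [Real.dist_eq, Real.dist_eq] at this
    exact this.trans (mul_le_mul_of_nonneg_left (hmem x hx).2.2 K.2)

/-- As a function of `r = (1 + x)⁻¹` the cosine is smooth near `ρ = (1 + l)⁻¹` because `l > 0`. The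
coefficient of the linear term is its derivative there: the minus signs from differentiating the
cosine and `r⁻¹` cancel. -/
theorem exists_abs_cos_sqrt_sub_taylor_le (τ : ℝ) {l : ℝ} (hl : 0 < l) :
    ∃ K : ℝ, 0 ≤ K ∧ ∀ x, 0 ≤ x → |Real.cos (τ * √x) - Real.cos (τ * √l) -
      (τ * Real.sin (τ * √l) * (1 + l) ^ 2 / (2 * √l)) * ((1 + x)⁻¹ - (1 + l)⁻¹)| ≤
      K * ((1 + x)⁻¹ - (1 + l)⁻¹) ^ 2 := by
  set G : ℝ → ℝ := fun r => Real.cos (τ * √(r⁻¹ - 1)) with hG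
  set ρ := (1 + l)⁻¹ with hρ
  have hρ0 : 0 < ρ := by positivity
  have hρl : ρ⁻¹ - 1 = l := by rw [hρ, inv_inv]; ring
  have hGx : ∀ x, G (1 + x)⁻¹ = Real.cos (τ * √x) := fun x => by simp [hG]
  have hsl : 0 < √l := Real.sqrt_pos.2 hl
  have hd : deriv G ρ = τ * Real.sin (τ * √l) * (1 + l) ^ 2 / (2 * √l) := by
    have h1 : HasDerivAt (fun r : ℝ => r⁻¹ - 1) (-(ρ ^ 2)⁻¹) ρ :=
      (hasDerivAt_inv hρ0.ne').sub_const 1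
    have h2 := ((h1.sqrt (by rw [hρl]; exact hl.ne')).const_mul τ).cos
    refine h2.deriv.trans ?_
    rw [hρl, hρ]
    field_simp
  have hc : ContDiffAt ℝ 2 G ρ := by
    have h1 : ContDiffAt ℝ 2 (fun r : ℝ => r⁻¹ - 1) ρ :=
      (contDiffAt_inv ℝ hρ0.ne').sub contDiffAt_const
    exact (contDiffAt_const.mul (h1.sqrt (by rw [hρl]; exact hl.ne'))).cos
  obtain ⟨K, η, hη, hK⟩ := exists_abs_sub_taylor_le hc
  set c := deriv G ρ
  refine ⟨max K 0 + (2 + |c|) / η ^ 2, by positivity, fun x hx => ?_⟩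
  rw [← hd, ← hGx x, ← hGx l]
  have h1 : (1 + x)⁻¹ ≤ 1 := inv_le_one_of_one_le₀ (by linarith)
  have h2 : 0 < (1 + x)⁻¹ := by positivity
  have h3 : ρ ≤ 1 := inv_le_one_of_one_le₀ (by linarith)
  rw [add_mul]
  rcases lt_or_ge |(1 + x)⁻¹ - ρ| η with h | h
  · refine (hK _ h).trans (le_add_of_le_of_nonneg ?_ (by positivity))
    exact mul_le_mul_of_nonneg_right (le_max_left _ _) (sq_nonneg _)
  -- Away from `ρ` all terms are bounded while `(r - ρ)²/η²` is at least `1`, so a large constant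
  -- suffices.
  · refine le_add_of_nonneg_of_le (by positivity) ?_
    have h4 : 1 ≤ ((1 + x)⁻¹ - ρ) ^ 2 / η ^ 2 := by
      rw [le_div_iff₀ (by positivity), one_mul, ← sq_abs ((1 + x)⁻¹ - ρ)]
      gcongr
    have h5 : |(1 + x)⁻¹ - ρ| ≤ 1 := abs_le.2 ⟨by linarith, by linarith⟩
    have h6 : ∀ r, |G r| ≤ 1 := fun r => Real.abs_cos_le_one _
    calc _ ≤ |G (1 + x)⁻¹| + |G ρ| + |c * ((1 + x)⁻¹ - ρ)| :=
          (abs_sub _ _).trans (add_le_add (abs_sub _ _) le_rfl)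
      _ ≤ 1 + 1 + |c| * 1 := by
          rw [abs_mul]
          gcongr
          · exact h6 _
          · exact h6 _
      _ = (2 + |c|) * 1 := by ring
      _ ≤ (2 + |c|) * (((1 + x)⁻¹ - ρ) ^ 2 / η ^ 2) := by gcongr
      _ = _ := by ring

/-- The constant is chosen before the operator: it depends only on `τ` and `l`, so the estimate is
uniform in `ε` when applied to the oscillating operators. -/
theorem IsNonnegSelfAdjoint.exists_norm_inner_cosSqrt_sub_le (τ : ℝ) {l : ℝ} (hl : 0 < l) :
    ∃ K : ℝ, 0 ≤ K ∧ ∀ A : H →ₗ.[ℂ] H, IsNonnegSelfAdjoint A → ∀ v : H,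
      ‖⟪v, cosSqrt A τ v - ((Real.cos (τ * √l) : ℝ) : ℂ) • v -
        ((τ * Real.sin (τ * √l) * (1 + l) ^ 2 / (2 * √l) : ℝ) : ℂ) •
          (resolventNegOne A v - (((1 + l)⁻¹ : ℝ) : ℂ) • v)⟫_ℂ‖ ≤
      K * ‖resolventNegOne A v - (((1 + l)⁻¹ : ℝ) : ℂ) • v‖ ^ 2 := by
  obtain ⟨K, hK0, hK⟩ := exists_abs_cos_sqrt_sub_taylor_le τ hl
  refine ⟨K, hK0, fun A hA v => ?_⟩
  simp only [Complex.coe_smul]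
  exact hA.norm_inner_boundedCalculus_sub_le
    (φ := fun l => Real.cos (τ * √l)) (M := 1) (by fun_prop)
    (fun x _ => Real.abs_cos_le_one _) hK v

theorem IsNonnegSelfAdjoint.exists_norm_cosSqrt_sub_le (τ : ℝ) {l : ℝ} (hl : 0 < l) :
    ∃ K : ℝ, 0 ≤ K ∧ ∀ A : H →ₗ.[ℂ] H, IsNonnegSelfAdjoint A → ∀ v : H,
      ‖cosSqrt A τ v - ((Real.cos (τ * √l) : ℝ) : ℂ) • v‖ ≤
      K * ‖resolventNegOne A v - (((1 + l)⁻¹ : ℝ) : ℂ) • v‖ := by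
  refine ⟨(1 + l) * (2 * |τ| * (1 + l) ^ 2 / √l + 4 * (1 + l) + 2), by positivity,
    fun A hA v => ?_⟩
  simp only [Complex.coe_smul]
  exact hA.norm_cosSqrt_sub_le τ hl v

theorem IsNonnegSelfAdjoint.exists_norm_smoothing_sub_le {s : ℝ} (h0 : 0 ≤ s) (h2 : s ≤ 2)
    {l : ℝ} (hl : 0 ≤ l) :
    ∃ K : ℝ, 0 ≤ K ∧ ∀ A : H →ₗ.[ℂ] H, IsNonnegSelfAdjoint A → ∀ v : H,
      ‖smoothing A s v - (((1 + l) ^ (-s / 2) : ℝ) : ℂ) • v‖ ≤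
      K * ‖resolventNegOne A v - (((1 + l)⁻¹ : ℝ) : ℂ) • v‖ := by
  refine ⟨(1 + l) * ((1 + l)⁻¹ ^ (s / 2 - 1) + 2), by positivity, fun A hA v => ?_⟩
  simp only [Complex.coe_smul]
  exact hA.norm_smoothing_sub_le h0 h2 hl v

end SecondOrder

/-! ### Approximate eigenfunctions of `b(D)* g b(D)` -/

section QuasiMode

section Abstract

variable {E H K : Type*} [NormedAddCommGroup E] [InnerProductSpace ℂ E]
  [NormedAddCommGroup H] [InnerProductSpace ℂ H] [NormedAddCommGroup K] [InnerProductSpace ℂ K]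

/-- An approximate solution `ρU` of the variational equation with the solution `z`. -/
theorem variational_quasimode {W : Submodule ℂ E} {P : E →L[ℂ] H} {S : E →L[ℂ] K}
    {G : K →L[ℂ] K} {k : ℝ} (hk : 0 < k) (hPn : ∀ y, ‖P y‖ ≤ ‖y‖)
    (hcoer : ∀ y ∈ W, k * ‖y‖ ^ 2 ≤ ‖⟪S y, G (S y)⟫_ℂ + ⟪P y, P y⟫_ℂ‖)
    (hsym : ∀ y w, ⟪S y, G (S w)⟫_ℂ = (starRingEnd ℂ) ⟪S w, G (S y)⟫_ℂ)
    {U z : E} (hU : U ∈ W) (hz : z ∈ W) (hza : ∀ y ∈ W, ⟪S y, G (S z)⟫_ℂ = ⟪P y, P U - P z⟫_ℂ)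
    {ρ l M : ℝ} (hρ0 : 0 ≤ ρ) (hρ1 : ρ ≤ 1) (hρl : (ρ : ℂ) * (1 + l) = 1) (hM0 : 0 ≤ M)
    (hM : ∀ y ∈ W, ‖⟪S y, G (S U)⟫_ℂ - l * ⟪P y, P U⟫_ℂ‖ ≤ M * ‖y‖) :
    ‖P z - (ρ : ℂ) • P U‖ ≤ M / k ∧
    ‖⟪P U, P z - (ρ : ℂ) • P U⟫_ℂ +
      (ρ : ℂ) ^ 2 * (⟪S U, G (S U)⟫_ℂ - l * ⟪P U, P U⟫_ℂ)‖ ≤ M ^ 2 / k := by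
  have hEW : z - (ρ : ℂ) • U ∈ W := sub_mem hz (Submodule.smul_mem _ _ hU)
  -- By `1 - ρ = ρl`, the error `z - ρU` solves the same variational equation with `-ρ` times the
  -- residual of `U` as the right-hand side.
  have ha : ∀ y ∈ W, ⟪S y, G (S (z - (ρ : ℂ) • U))⟫_ℂ +
      ⟪P y, P (z - (ρ : ℂ) • U)⟫_ℂ = -ρ * (⟪S y, G (S U)⟫_ℂ - l * ⟪P y, P U⟫_ℂ) := by
    intro y hy
    have h1 := hza y hy
    rw [inner_sub_right] at h1
    simp only [map_sub, map_smul, inner_sub_right, inner_smul_right, h1]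
    linear_combination (-⟪P y, P U⟫_ℂ) * hρl
  rw [show P z - (ρ : ℂ) • P U = P (z - (ρ : ℂ) • U) by rw [map_sub, map_smul]]
  set F := z - (ρ : ℂ) • U with hF
  set q := ⟪S F, G (S F)⟫_ℂ + ⟪P F, P F⟫_ℂ with hq
  have hq1 : ‖q‖ ≤ ρ * (M * ‖F‖) := by
    rw [hq, ha F hEW, norm_mul, norm_neg, Complex.norm_real, Real.norm_of_nonneg hρ0]
    exact mul_le_mul_of_nonneg_left (hM F hEW) hρ0
  have hq2 : k * ‖F‖ ^ 2 ≤ ‖q‖ := hcoer F hEW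
  have hE1 : ‖F‖ ≤ M / k := by
    rw [le_div_iff₀ hk]
    rcases (norm_nonneg F).eq_or_lt with h | h
    · rw [← h, zero_mul]
      exact hM0
    · have h1 : k * ‖F‖ ^ 2 ≤ M * ‖F‖ :=
        (hq2.trans hq1).trans (mul_le_of_le_one_left (by positivity) hρ1)
      nlinarith
  refine ⟨(hPn F).trans hE1, ?_⟩
  -- The equation of `z` is tested with the error `F`, the relation `z = F + ρU` is inserted, and
  -- symmetry turns the pairing of `F` with `U` into the conjugate residual of `U` tested with `U`
  -- itself. What remains is the energy `q` of `F`, which is quadratic in the residual.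
  have e1 : ⟪P F, P U⟫_ℂ =
      q + ρ * (starRingEnd ℂ) (-ρ * (⟪S U, G (S U)⟫_ℂ - l * ⟪P U, P U⟫_ℂ)) := by
    have h1 := hza F hEW
    have h2 : z = F + (ρ : ℂ) • U := by rw [hF]; abel
    rw [inner_sub_right] at h1
    rw [← ha U hU, map_add, ← hsym F U, inner_conj_symm, hq]
    have h3 : ⟪S F, G (S z)⟫_ℂ = ⟪S F, G (S F)⟫_ℂ + ρ * ⟪S F, G (S U)⟫_ℂ := by
      rw [h2]
      simp only [map_add, map_smul, inner_add_right, inner_smul_right]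
    have h4 : ⟪P F, P z⟫_ℂ = ⟪P F, P F⟫_ℂ + ρ * ⟪P F, P U⟫_ℂ := by
      rw [h2]
      simp only [map_add, map_smul, inner_add_right, inner_smul_right]
    linear_combination -h1 + h3 + h4
  have e2 : ⟪P U, P F⟫_ℂ + (ρ : ℂ) ^ 2 * (⟪S U, G (S U)⟫_ℂ - l * ⟪P U, P U⟫_ℂ) =
      (starRingEnd ℂ) q := by
    rw [← inner_conj_symm (P U) (P F), e1]
    simp only [map_add, map_mul, map_neg, Complex.conj_conj, Complex.conj_ofReal]
    ring
  rw [e2, RCLike.norm_conj]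
  calc ‖q‖ ≤ ρ * (M * ‖F‖) := hq1
    _ ≤ 1 * (M * (M / k)) := by gcongr
    _ = _ := by ring

end Abstract

open scoped SchwartzMap

variable {d : ℕ} {ι κ : Type*} [Fintype ι] [Fintype κ]

/-- The estimate of the residual of an approximate eigenfunction in the weak sense gives an
estimate of its resolvent residual, and a second order formula for the quadratic form of the
resolvent. -/
theorem resolvent_quasimode {b : Fin d → Matrix κ ι ℂ} {c : ℝ} (hb : IsEllipticSymbol b c)
    {g : EuclideanSpace ℝ (Fin d) → Matrix κ κ ℂ} {c₁ c₂ : ℝ}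
    (hg : IsEllipticCoeff volume g c₁ c₂) {l : ℝ} (hl : 0 ≤ l) {U : JetL2 d ι}
    (hU : U ∈ sobolevJets d ι) {M : ℝ} (hM0 : 0 ≤ M)
    (hM : ∀ V, ‖⟪symbolL volume b (schwartzJet V), hg.mulL (symbolL volume b U)⟫_ℂ -
      l * ⟪compL volume none (schwartzJet V), compL volume none U⟫_ℂ‖ ≤ M * ‖schwartzJet V‖) :
    ‖resolventNegOne (divForm b g) (compL volume none U) -
      (((1 + l)⁻¹ : ℝ) : ℂ) • compL volume none U‖ ≤ M / energyConst d c c₁ ∧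
    ‖⟪compL volume none U, resolventNegOne (divForm b g) (compL volume none U) -
        (((1 + l)⁻¹ : ℝ) : ℂ) • compL volume none U⟫_ℂ +
      (((1 + l)⁻¹ : ℝ) : ℂ) ^ 2 * (⟪symbolL volume b U, hg.mulL (symbolL volume b U)⟫_ℂ -
        l * ⟪compL volume none U, compL volume none U⟫_ℂ)‖ ≤ M ^ 2 / energyConst d c c₁ := by
  have hA := isNonnegSelfAdjoint_divForm hb hg
  have hρl : (((1 + l)⁻¹ : ℝ) : ℂ) * (1 + l) = 1 := by
    exact_mod_cast inv_mul_cancel₀ (by positivity : (1 + l : ℝ) ≠ 0)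
  have hR := hA.resolvent_mem (compL volume none U)
  rw [graph_divForm, mem_divFormGraph_iff b hg] at hR
  obtain ⟨z, hz, hzu, hza⟩ := hR
  simp only [← hzu] at hza ⊢
  set r : JetL2 d ι := (symbolL volume b).adjoint (hg.mulL (symbolL volume b U)) -
    (l : ℂ) • (compL volume none).adjoint (compL volume none U) with hr
  have hrV : ∀ y, ⟪y, r⟫_ℂ = ⟪symbolL volume b y, hg.mulL (symbolL volume b U)⟫_ℂ -
      l * ⟪compL volume none y, compL volume none U⟫_ℂ := fun y => by
    rw [hr, inner_sub_right, inner_smul_right, ContinuousLinearMap.adjoint_inner_right,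
      ContinuousLinearMap.adjoint_inner_right]
  -- The residual was estimated only on Schwartz functions; density extends the estimate to `H¹`, in
  -- particular to the error of the resolvent.
  have hM' : ∀ y ∈ sobolevJets d ι, ‖⟪y, r⟫_ℂ‖ ≤ M * ‖y‖ := fun y hy =>
    norm_inner_le_of_schwartzJet (fun V => by rw [hrV]; exact hM V) hy
  refine variational_quasimode (energyConst_pos hg.pos) (norm_compL_le none) (fun y hy => ?_)
    (fun y w => ?_) hU hz hza (by positivity) (inv_le_one_of_one_le₀ (by linarith)) hρl hM0
    fun y hy => by rw [← hrV]; exact hM' y hy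
  · refine (hb.norm_sq_le hg.pos hy).trans (le_trans ?_ (Complex.re_le_norm _))
    rw [Complex.add_re, add_comm]
    exact add_le_add (hg.le_inner_mulL _)
      (inner_self_eq_norm_sq (𝕜 := ℂ) (compL volume none y)).ge
  · rw [inner_conj_symm]
    exact hg.inner_mulL _ _

end QuasiMode

/-! ### Functions periodic with respect to a lattice -/

section Periodic

variable {d : ℕ}

/-- `f` is periodic with respect to the lattice generated by `a`. -/
def IsLatticePeriodic {F : Type*} (a : Module.Basis (Fin d) ℝ (EuclideanSpace ℝ (Fin d)))
    (f : EuclideanSpace ℝ (Fin d) → F) : Prop := ∀ j x, f (x + a j) = f x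

variable {F : Type*} {a : Module.Basis (Fin d) ℝ (EuclideanSpace ℝ (Fin d))}
  {f : EuclideanSpace ℝ (Fin d) → F}

namespace IsLatticePeriodic

theorem add_mem (hf : IsLatticePeriodic a f) {v : EuclideanSpace ℝ (Fin d)}
    (hv : v ∈ Submodule.span ℤ (Set.range a)) : ∀ x, f (x + v) = f x := by
  induction hv using Submodule.span_induction with
  | mem v hv => obtain ⟨j, rfl⟩ := hv; exact hf j
  | zero => simp
  | add v w _ _ hv hw => intro x; rw [← add_assoc, hw, hv]
  | smul n v _ hv =>
    intro x
    induction n using Int.induction_on generalizing x with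
    | zero => simp
    | succ n ih => rw [add_smul, one_smul, ← add_assoc, hv, ih]
    | pred n ih => rw [← hv, sub_smul, one_smul, add_assoc, sub_add_cancel, ih]

theorem comp {F' : Type*} (hf : IsLatticePeriodic a f) (G : F → F') :
    IsLatticePeriodic a fun x => G (f x) := fun j x =>
  congrArg G (hf j x)

theorem fract (f : EuclideanSpace ℝ (Fin d) → F) :
    IsLatticePeriodic a fun x => f (ZSpan.fract a x) := fun j x =>
  congrArg f (ZSpan.fract_add_ZSpan _ _ (Submodule.subset_span ⟨j, rfl⟩))

theorem vadd_eq (hf : IsLatticePeriodic a f)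
    (v : (Submodule.span ℤ (Set.range a)).toAddSubgroup)
    (x : EuclideanSpace ℝ (Fin d)) : f (v +ᵥ x) = f x := by
  rw [AddSubgroup.vadd_def, vadd_eq_add, add_comm]
  exact hf.add_mem v.2 x

variable [NormedAddCommGroup F]

instance : Countable (Submodule.span ℤ (Set.range a)).toAddSubgroup :=
  inferInstanceAs (Countable (Submodule.span ℤ (Set.range a)))

theorem isAddFundamentalDomain_preimage (x : EuclideanSpace ℝ (Fin d)) :
    IsAddFundamentalDomain (Submodule.span ℤ (Set.range a)).toAddSubgroup
      ((x + ·) '' ZSpan.fundamentalDomain a) volume :=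
  (ZSpan.isAddFundamentalDomain' a volume).vadd_of_comm x

theorem map_restrict (x : EuclideanSpace ℝ (Fin d)) :
    MeasurePreserving (x + ·) (volume.restrict (ZSpan.fundamentalDomain a))
      (volume.restrict ((x + ·) '' ZSpan.fundamentalDomain a)) :=
  (measurePreserving_add_left volume x).restrict_image_emb (measurableEmbedding_addLeft x) _

theorem integrableOn_comp_add (hf : IsLatticePeriodic a f)
    (hi : IntegrableOn f (ZSpan.fundamentalDomain a)) (x : EuclideanSpace ℝ (Fin d)) :
    IntegrableOn (fun y => f (x + y)) (ZSpan.fundamentalDomain a) := by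
  have h := ((isAddFundamentalDomain_preimage x).integrableOn_iff
    (ZSpan.isAddFundamentalDomain' a volume) hf.vadd_eq).2 hi
  exact ((map_restrict x).integrable_comp_emb (measurableEmbedding_addLeft x)).2 h

theorem setIntegral_comp_add [NormedSpace ℝ F] (hf : IsLatticePeriodic a f)
    (x : EuclideanSpace ℝ (Fin d)) :
    ∫ y in ZSpan.fundamentalDomain a, f (x + y) = ∫ y in ZSpan.fundamentalDomain a, f y := by
  rw [(ZSpan.isAddFundamentalDomain' a volume).setIntegral_eq
    (isAddFundamentalDomain_preimage x) hf.vadd_eq]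
  exact (map_restrict x).integral_comp (measurableEmbedding_addLeft x) f

theorem volume_fundamentalDomain_lt_top :
    volume (ZSpan.fundamentalDomain a) < ⊤ := (ZSpan.fundamentalDomain_isBounded a).measure_lt_top

instance : IsFiniteMeasure (volume.restrict (ZSpan.fundamentalDomain a)) :=
  ⟨by rw [Measure.restrict_apply_univ]; exact volume_fundamentalDomain_lt_top⟩

theorem volume_real_fundamentalDomain_pos :
    0 < volume.real (ZSpan.fundamentalDomain a) :=
  ENNReal.toReal_pos (ZSpan.measure_fundamentalDomain_ne_zero a)
    volume_fundamentalDomain_lt_top.ne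

theorem exists_norm_le_of_mem_fundamentalDomain
    (a : Module.Basis (Fin d) ℝ (EuclideanSpace ℝ (Fin d))) :
    ∃ D : ℝ, 0 < D ∧ ∀ y ∈ ZSpan.fundamentalDomain a, ‖y‖ ≤ D := by
  obtain ⟨D, hD, h⟩ := (ZSpan.fundamentalDomain_isBounded a).exists_pos_norm_le
  exact ⟨D, hD, h⟩

/-- By periodicity the integral of `‖f(x + y)‖` over the cell in `y` does not depend on `x`, so
Tonelli's theorem applies on `K × Ω`. Averaging over shifts by the cell is the common tool of the
following lemmas. -/
theorem integrable_prod (hf : IsLatticePeriodic a f) (hm : AEStronglyMeasurable f volume)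
    (hi : IntegrableOn f (ZSpan.fundamentalDomain a)) {K : Set (EuclideanSpace ℝ (Fin d))}
    (hK : volume K < ⊤) :
    Integrable (fun p : EuclideanSpace ℝ (Fin d) × EuclideanSpace ℝ (Fin d) => f (p.1 + p.2))
      ((volume.restrict K).prod (volume.restrict (ZSpan.fundamentalDomain a))) := by
  have hq : Measure.QuasiMeasurePreserving
      (fun p : EuclideanSpace ℝ (Fin d) × EuclideanSpace ℝ (Fin d) => p.1 + p.2)
      ((volume.restrict K).prod (volume.restrict (ZSpan.fundamentalDomain a))) volume :=
    (quasiMeasurePreserving_add volume volume).mono_left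
      (Measure.absolutelyContinuous_of_le
        (Measure.prod_mono Measure.restrict_le_self Measure.restrict_le_self))
  refine (integrable_prod_iff (hm.comp_quasiMeasurePreserving hq)).2 ?_
  refine ⟨.of_forall fun x => hf.integrableOn_comp_add hi x, ?_⟩
  have h : ∀ x, ∫ y in ZSpan.fundamentalDomain a, ‖f (x + y)‖ =
      ∫ y in ZSpan.fundamentalDomain a, ‖f y‖ := (hf.comp fun v => ‖v‖).setIntegral_comp_add
  change Integrable (fun x => ∫ y in ZSpan.fundamentalDomain a, ‖f (x + y)‖) _
  simp only [h]
  have : IsFiniteMeasure (volume.restrict K) :=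
    ⟨by rwa [Measure.restrict_apply_univ]⟩
  exact integrable_const _

/-- Fubini's theorem on a large ball times the cell gives one shift `y` for which `f(· + y)` is
integrable over the ball; the ball is large enough to cover the compact set after the shift. -/
theorem locallyIntegrable (hf : IsLatticePeriodic a f) (hm : AEStronglyMeasurable f volume)
    (hi : IntegrableOn f (ZSpan.fundamentalDomain a)) : LocallyIntegrable f volume := by
  refine locallyIntegrable_iff.2 fun k hk => ?_
  obtain ⟨D, hD, hΩ⟩ := exists_norm_le_of_mem_fundamentalDomain a
  obtain ⟨r, hr⟩ := hk.isBounded.subset_closedBall 0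
  have h := hf.integrable_prod hm hi (K := Metric.closedBall 0 (r + D))
    Metric.isBounded_closedBall.measure_lt_top
  have h2 := h.swap.prod_right_ae
  have h3 : ∃ y ∈ ZSpan.fundamentalDomain a, Integrable (fun x => f (x + y))
      (volume.restrict (Metric.closedBall 0 (r + D))) := by
    have : (volume.restrict (ZSpan.fundamentalDomain a)) ≠ 0 := by
      rw [Ne, Measure.restrict_eq_zero]
      exact ZSpan.measure_fundamentalDomain_ne_zero a
    have : NeBot (ae (volume.restrict (ZSpan.fundamentalDomain a))) := ae_neBot.2 this
    obtain ⟨y, hy1, hy2⟩ := (h2.and (ae_restrict_mem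
      (ZSpan.fundamentalDomain_measurableSet a))).exists
    exact ⟨y, hy2, hy1⟩
  obtain ⟨y, hy, h4⟩ := h3
  have h5 := ((measurePreserving_add_right volume y).restrict_image_emb
    (measurableEmbedding_addRight y) (Metric.closedBall 0 (r + D))).integrable_comp_emb
    (measurableEmbedding_addRight y) (g := f)
  have h6 : IntegrableOn f ((· + y) '' Metric.closedBall 0 (r + D)) := h5.1 h4
  refine h6.mono_set fun x hx => ⟨x - y, ?_, by simp⟩
  have h7 := hr hx
  rw [mem_closedBall_zero_iff] at h7 ⊢
  exact (norm_sub_le _ _).trans (add_le_add h7 (hΩ y hy))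

/-! ### Averages of rapidly oscillating functions -/

theorem exists_support_subset_closedBall {χ : EuclideanSpace ℝ (Fin d) → ℝ}
    (h : HasCompactSupport χ) : ∃ r : ℝ, 0 < r ∧ ∀ x, r < ‖x‖ → χ x = 0 := by
  obtain ⟨r, hr, hs⟩ := h.isCompact.isBounded.subset_closedBall_lt 0 0
  refine ⟨r, hr, fun x hx => ?_⟩
  by_contra hne
  have := hs (subset_tsupport _ hne)
  rw [mem_closedBall_zero_iff] at this
  linarith

variable [NormedSpace ℝ F] [CompleteSpace F]

/-- Both terms are integrals of `f(x + y)` over ball and cell. With the weight `χ(x + y)` the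
integral in `x` does not depend on `y`; with the weight `χ(x)` the integral in `y` does not depend
on `x`. The radius `r + D` leaves room for the shifted support. -/
theorem setIntegral_smul_sub (hf : IsLatticePeriodic a f) (hm : AEStronglyMeasurable f volume)
    (hi : IntegrableOn f (ZSpan.fundamentalDomain a)) {χ : EuclideanSpace ℝ (Fin d) → ℝ}
    (hc : Continuous χ) {D r : ℝ} (hD : ∀ y ∈ ZSpan.fundamentalDomain a, ‖y‖ ≤ D) (hD0 : 0 ≤ D)
    (hr : ∀ x, r < ‖x‖ → χ x = 0) :
    volume.real (ZSpan.fundamentalDomain a) • (∫ x, χ x • f x) -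
      (∫ x, χ x) • ∫ y in ZSpan.fundamentalDomain a, f y =
    ∫ p, (χ (p.1 + p.2) - χ p.1) • f (p.1 + p.2) ∂((volume.restrict (Metric.closedBall 0 (r + D))).prod
      (volume.restrict (ZSpan.fundamentalDomain a))) := by
  set K : Set (EuclideanSpace ℝ (Fin d)) := Metric.closedBall 0 (r + D)
  have hK : ∀ x, x ∉ K → r + D < ‖x‖ := fun x hx => by
    simpa [K] using hx
  have hcs : HasCompactSupport χ := by
    refine HasCompactSupport.of_support_subset_isCompact (isCompact_closedBall 0 r) fun x hx => ?_
    rw [mem_closedBall_zero_iff]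
    by_contra! h
    exact hx (hr x h)
  obtain ⟨C, hC⟩ := hc.bounded_above_of_compact_support hcs
  have hbase := hf.integrable_prod hm hi (K := K) Metric.isBounded_closedBall.measure_lt_top
  have i1 : Integrable (fun p : EuclideanSpace ℝ (Fin d) × EuclideanSpace ℝ (Fin d) =>
      χ (p.1 + p.2) • f (p.1 + p.2))
      ((volume.restrict K).prod (volume.restrict (ZSpan.fundamentalDomain a))) :=
    hbase.bdd_smul C (hc.comp (continuous_fst.add continuous_snd)).aestronglyMeasurable
      (.of_forall fun p => hC _)
  have i2 : Integrable (fun p : EuclideanSpace ℝ (Fin d) × EuclideanSpace ℝ (Fin d) =>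
      χ p.1 • f (p.1 + p.2))
      ((volume.restrict K).prod (volume.restrict (ZSpan.fundamentalDomain a))) :=
    hbase.bdd_smul C (hc.comp continuous_fst).aestronglyMeasurable (.of_forall fun p => hC _)
  simp only [sub_smul]
  rw [integral_sub i1 i2]
  congr 1
  · rw [integral_prod_symm _ i1]
    have : ∀ y ∈ ZSpan.fundamentalDomain a,
        ∫ x in K, χ (x + y) • f (x + y) = ∫ x, χ x • f x := fun y hy => by
      rw [setIntegral_eq_integral_of_forall_compl_eq_zero,
        integral_add_right_eq_self (fun x => χ x • f x) y]
      intro x hx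
      rw [hr, zero_smul]
      have h1 := hK x hx
      have h2 := hD y hy
      have h3 := norm_sub_norm_le x (-y)
      rw [norm_neg, sub_neg_eq_add] at h3
      linarith
    rw [setIntegral_congr_fun (ZSpan.fundamentalDomain_measurableSet a) this, setIntegral_const]
  · rw [integral_prod _ i2]
    simp only [integral_smul, hf.setIntegral_comp_add]
    rw [integral_smul_const]
    congr 1
    exact (setIntegral_eq_integral_of_forall_compl_eq_zero fun x hx =>
      hr x (by have := hK x hx; linarith)).symm

theorem tendsto_average_aux (hf : IsLatticePeriodic a f) (hm : AEStronglyMeasurable f volume)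
    (hi : IntegrableOn f (ZSpan.fundamentalDomain a)) {χ : EuclideanSpace ℝ (Fin d) → ℝ}
    (hc : Continuous χ) (hχ : HasCompactSupport χ) :
    Tendsto (fun δ : ℝ => δ ^ d • ∫ x, χ (δ • x) • f x) (𝓝[>] 0)
      (𝓝 ((∫ x, χ x) • (volume.real (ZSpan.fundamentalDomain a))⁻¹ •
        ∫ y in ZSpan.fundamentalDomain a, f y)) := by
  obtain ⟨D, hD0, hD⟩ := exists_norm_le_of_mem_fundamentalDomain a
  obtain ⟨r, hr0, hr⟩ := exists_support_subset_closedBall hχ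
  have hV : 0 < volume.real (ZSpan.fundamentalDomain a) := volume_real_fundamentalDomain_pos
  set V := volume.real (ZSpan.fundamentalDomain a)
  set I := ∫ y in ZSpan.fundamentalDomain a, f y
  set N := ∫ y in ZSpan.fundamentalDomain a, ‖f y‖
  have hN0 : 0 ≤ N := integral_nonneg fun _ => norm_nonneg _
  set B := volume.real (Metric.closedBall (0 : EuclideanSpace ℝ (Fin d)) (r + D))
  have hB0 : 0 ≤ B := measureReal_nonneg
  -- The two arguments of `χ` differ by at most `δD`, so the difference of the averages is governed
  -- by the modulus of continuity of `χ`.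
  have key : ∀ δ : ℝ, 0 < δ → δ ≤ 1 → ∀ η : ℝ, 0 ≤ η → (∀ x y, dist x y ≤ δ * D → dist (χ x) (χ y) ≤ η) →
      ‖V • (δ ^ d • ∫ x, χ (δ • x) • f x) - (∫ x, χ x) • I‖ ≤ η * (B * N) := by
    intro δ hδ hδ1 η hη0 hη
    have h1 := hf.setIntegral_smul_sub hm hi (χ := fun x => χ (δ • x)) (r := r / δ) (D := D)
      (hc.comp (continuous_const_smul δ)) hD hD0.le fun x hx => hr _ (by
        rw [norm_smul, Real.norm_of_nonneg hδ.le]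
        rwa [div_lt_iff₀' hδ] at hx)
    rw [Measure.integral_comp_smul, finrank_euclideanSpace_fin,
      abs_of_pos (by positivity : 0 < (δ ^ d)⁻¹)] at h1
    have h2 : V • (δ ^ d • ∫ x, χ (δ • x) • f x) - (∫ x, χ x) • I =
        δ ^ d • (V • (∫ x, χ (δ • x) • f x) - ((δ ^ d)⁻¹ • ∫ x, χ x) • I) := by
      rw [smul_sub, smul_comm V, smul_eq_mul, mul_smul (δ ^ d)⁻¹,
        smul_inv_smul₀ (by positivity : δ ^ d ≠ 0)]
    rw [h2, h1, norm_smul, Real.norm_of_nonneg (by positivity)]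
    set K : Set (EuclideanSpace ℝ (Fin d)) := Metric.closedBall 0 (r / δ + D)
    have hbase := hf.integrable_prod hm hi (K := K) Metric.isBounded_closedBall.measure_lt_top
    have h3 : ‖∫ p, (χ (δ • (p.1 + p.2)) - χ (δ • p.1)) • f (p.1 + p.2) ∂((volume.restrict K).prod
        (volume.restrict (ZSpan.fundamentalDomain a)))‖ ≤ ∫ p, η * ‖f (p.1 + p.2)‖
        ∂((volume.restrict K).prod (volume.restrict (ZSpan.fundamentalDomain a))) := by
      refine norm_integral_le_of_norm_le (hbase.norm.const_mul η) ?_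
      have h4 : ∀ᵐ p ∂((volume.restrict K).prod (volume.restrict (ZSpan.fundamentalDomain a))),
          p.2 ∈ ZSpan.fundamentalDomain a :=
        Measure.quasiMeasurePreserving_snd.ae
          (ae_restrict_mem (ZSpan.fundamentalDomain_measurableSet a))
      filter_upwards [h4] with p hp
      rw [norm_smul]
      refine mul_le_mul_of_nonneg_right ?_ (norm_nonneg _)
      rw [← dist_eq_norm]
      refine hη _ _ ?_
      rw [smul_add, dist_eq_norm, add_sub_cancel_left, norm_smul, Real.norm_of_nonneg hδ.le]
      exact mul_le_mul_of_nonneg_left (hD _ hp) hδ.le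
    have h5 : ∫ p, η * ‖f (p.1 + p.2)‖
        ∂((volume.restrict K).prod (volume.restrict (ZSpan.fundamentalDomain a))) =
        η * (volume.real K * N) := by
      rw [integral_const_mul, integral_prod _ hbase.norm]
      have h : ∀ x, ∫ y in ZSpan.fundamentalDomain a, ‖f (x + y)‖ =
      ∫ y in ZSpan.fundamentalDomain a, ‖f y‖ := (hf.comp fun v => ‖v‖).setIntegral_comp_add
      simp only [h]
      rw [setIntegral_const, smul_eq_mul]
    -- The ball has radius `r/δ + D`, and `δ(r/δ + D) ≤ r + D` because `δ ≤ 1`.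
    have h6 : δ ^ d * volume.real K ≤ B := by
      have e1 : volume.real K =
          (r / δ + D) ^ d * volume.real (Metric.ball (0 : EuclideanSpace ℝ (Fin d)) 1) := by
        have := Measure.addHaar_real_closedBall (volume : Measure (EuclideanSpace ℝ (Fin d))) 0
          (by positivity : 0 ≤ r / δ + D)
        rwa [finrank_euclideanSpace_fin] at this
      have e2 : B = (r + D) ^ d * volume.real (Metric.ball (0 : EuclideanSpace ℝ (Fin d)) 1) := by
        have := Measure.addHaar_real_closedBall (volume : Measure (EuclideanSpace ℝ (Fin d))) 0
          (by positivity : 0 ≤ r + D)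
        rwa [finrank_euclideanSpace_fin] at this
      rw [e1, e2, ← mul_assoc, ← mul_pow, mul_add, mul_div_cancel₀ _ hδ.ne']
      gcongr
      exact mul_le_of_le_one_left hD0.le hδ1
    calc _ ≤ δ ^ d * (η * (volume.real K * N)) :=
          mul_le_mul_of_nonneg_left (h3.trans_eq h5) (by positivity)
      _ = η * ((δ ^ d * volume.real K) * N) := by ring
      _ ≤ _ := by gcongr
  have h0 : Tendsto (fun δ : ℝ => V • (δ ^ d • ∫ x, χ (δ • x) • f x)) (𝓝[>] 0)
      (𝓝 ((∫ x, χ x) • I)) := by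
    rw [Metric.tendsto_nhds]
    intro e he
    have hu := hχ.uniformContinuous_of_continuous hc
    obtain ⟨ρ, hρ, hu⟩ := Metric.uniformContinuous_iff.1 hu (e / (2 * (B * N + 1))) (by positivity)
    have h1 : ∀ᶠ δ : ℝ in 𝓝[>] 0, δ < min 1 (ρ / (D + 1)) :=
      nhdsWithin_le_nhds (gt_mem_nhds (by positivity))
    filter_upwards [h1, self_mem_nhdsWithin] with δ h1 hδ
    have hδ : 0 < δ := hδ
    rw [lt_min_iff, lt_div_iff₀ (by positivity)] at h1
    rw [dist_eq_norm]
    refine (key δ hδ h1.1.le (e / (2 * (B * N + 1))) (by positivity) fun x y hxy =>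
      (hu (hxy.trans_lt ?_)).le).trans_lt ?_
    · nlinarith
    · rw [div_mul_eq_mul_div, div_lt_iff₀ (by positivity)]
      have : 0 ≤ B * N := by positivity
      nlinarith
  have h1 := h0.const_smul V⁻¹
  simp only [smul_smul, ← mul_assoc, inv_mul_cancel₀ hV.ne', one_mul] at h1 ⊢
  rwa [mul_comm (∫ x, χ x)]

/-- Rapidly oscillating periodic functions converge weakly to their mean values. -/
theorem tendsto_average (hf : IsLatticePeriodic a f) (hm : AEStronglyMeasurable f volume)
    (hi : IntegrableOn f (ZSpan.fundamentalDomain a)) {χ : EuclideanSpace ℝ (Fin d) → ℝ}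
    (hc : Continuous χ) (hχ : HasCompactSupport χ) {ε : ℝ} (hε : 0 < ε) :
    Tendsto (fun δ : ℝ => δ ^ d • ∫ x, χ (δ • x) • f (ε⁻¹ • x)) (𝓝[>] 0)
      (𝓝 ((∫ x, χ x) • (volume.real (ZSpan.fundamentalDomain a))⁻¹ •
        ∫ y in ZSpan.fundamentalDomain a, f y)) := by
  -- The substitution `x = εy` reduces the statement to the case of period scale one, with `δε` in
  -- place of `δ`.
  have h1 : Tendsto (fun δ : ℝ => δ * ε) (𝓝[>] 0) (𝓝[>] 0) := by
    refine tendsto_nhdsWithin_of_tendsto_nhds_of_eventually_within _ ?_ ?_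
    · have : Continuous fun δ : ℝ => δ * ε := by fun_prop
      simpa using (this.tendsto 0).mono_left nhdsWithin_le_nhds
    · filter_upwards [self_mem_nhdsWithin] with δ hδ
      exact mul_pos hδ hε
  refine ((hf.tendsto_average_aux hm hi hc hχ).comp h1).congr fun δ => ?_
  have h2 := Measure.integral_comp_smul (volume : Measure (EuclideanSpace ℝ (Fin d)))
    (fun x => χ ((δ * ε) • x) • f x) ε⁻¹
  simp only [smul_smul] at h2
  rw [mul_assoc, mul_inv_cancel₀ hε.ne', mul_one, finrank_euclideanSpace_fin] at h2
  rw [h2, Function.comp_apply, smul_smul, inv_pow, inv_inv, abs_of_pos (by positivity), mul_pow]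

end IsLatticePeriodic

end Periodic

/-! ### Translations of smooth functions -/

section Translation

variable {d : ℕ} {F : Type*} [NormedAddCommGroup F]

theorem lintegral_enorm_sq_eq {α : Type*} [MeasurableSpace α] {μ : Measure α} (f : α → F) :
    ∫⁻ x, ‖f x‖ₑ ^ 2 ∂μ = eLpNorm f 2 μ ^ 2 := by
  have := eLpNorm_nnreal_pow_eq_lintegral (f := f) (μ := μ) (p := 2) two_ne_zero
  simpa using! this.symm

variable [NormedSpace ℝ F] [CompleteSpace F]

/-- The increment is the integral of the directional derivative along the segment. Squaring under
the mean over `[0, 1]`, exchanging the integrals and using translation invariance give the bound. -/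
theorem eLpNorm_translate_sub_le {Y : EuclideanSpace ℝ (Fin d) → F} (hY : ContDiff ℝ 1 Y)
    (h : EuclideanSpace ℝ (Fin d)) :
    eLpNorm (fun x => Y (x + h) - Y x) 2 volume ≤
      eLpNorm (fun x => fderiv ℝ Y x h) 2 volume := by
  have hD : Continuous fun x => fderiv ℝ Y x h :=
    (hY.continuous_fderiv (by simp)).clm_apply continuous_const
  have hμ : IsProbabilityMeasure (volume.restrict (Set.Ioc (0 : ℝ) 1)) :=
    ⟨by simp⟩
  have h1 : ∀ x, ‖Y (x + h) - Y x‖ₑ ^ 2 ≤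
      ∫⁻ s in Set.Ioc (0 : ℝ) 1, ‖fderiv ℝ Y (x + s • h) h‖ₑ ^ 2 := by
    intro x
    have hc : Continuous fun s : ℝ => fderiv ℝ Y (x + s • h) h := hD.comp (by fun_prop)
    have e1 : Y (x + h) - Y x = ∫ s in (0 : ℝ)..1, fderiv ℝ Y (x + s • h) h := by
      have hd : ∀ s ∈ Set.uIcc (0 : ℝ) 1, HasDerivAt (fun s : ℝ => Y (x + s • h))
          (fderiv ℝ Y (x + s • h) h) s := fun s _ => by
        have h2 : HasDerivAt (fun s : ℝ => x + s • h) ((1 : ℝ) • h) s :=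
          ((hasDerivAt_id s).smul_const h).const_add x
        rw [one_smul] at h2
        exact (hY.differentiable (by simp) _).hasFDerivAt.comp_hasDerivAt s h2
      rw [intervalIntegral.integral_eq_sub_of_hasDerivAt hd (hc.intervalIntegrable _ _)]
      simp
    rw [e1, intervalIntegral.integral_of_le zero_le_one, lintegral_enorm_sq_eq]
    gcongr
    refine (enorm_integral_le_lintegral_enorm _).trans ?_
    rw [← eLpNorm_one_eq_lintegral_enorm]
    exact eLpNorm_le_eLpNorm_of_exponent_le (by norm_num) hc.aestronglyMeasurable
  have h2 : ∫⁻ x, ∫⁻ s in Set.Ioc (0 : ℝ) 1, ‖fderiv ℝ Y (x + s • h) h‖ₑ ^ 2 =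
      ∫⁻ x, ‖fderiv ℝ Y x h‖ₑ ^ 2 := by
    rw [lintegral_lintegral_swap]
    · have h3 : ∀ s : ℝ, ∫⁻ x, ‖fderiv ℝ Y (x + s • h) h‖ₑ ^ 2 =
          ∫⁻ x, ‖fderiv ℝ Y x h‖ₑ ^ 2 := fun s =>
        lintegral_add_right_eq_self (fun x => ‖fderiv ℝ Y x h‖ₑ ^ 2) (s • h)
      simp [h3]
    · have h4 : Continuous fun p : EuclideanSpace ℝ (Fin d) × ℝ =>
          ‖fderiv ℝ Y (p.1 + p.2 • h) h‖ₑ ^ 2 :=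
        (ENNReal.continuous_pow 2).comp (continuous_enorm.comp (hD.comp (by fun_prop)))
      exact h4.measurable.aemeasurable
  have h5 : eLpNorm (fun x => Y (x + h) - Y x) 2 volume ^ 2 ≤
      eLpNorm (fun x => fderiv ℝ Y x h) 2 volume ^ 2 := by
    rw [← lintegral_enorm_sq_eq, ← lintegral_enorm_sq_eq, ← h2]
    exact lintegral_mono h1
  exact (ENNReal.pow_le_pow_left_iff two_ne_zero).1 h5

end Translation

/-! ### The Cauchy–Schwarz inequality -/

section CauchySchwarz

variable {α : Type*} [MeasurableSpace α] {μ : Measure α} {F : Type*} [NormedAddCommGroup F]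
  [InnerProductSpace ℂ F]

theorem integral_norm_mul_norm_le {G G' : Type*} [NormedAddCommGroup G] [NormedAddCommGroup G']
    {f : α → G} {g : α → G'} (hf : MemLp f 2 μ) (hg : MemLp g 2 μ) :
    ∫ x, ‖f x‖ * ‖g x‖ ∂μ ≤ (eLpNorm f 2 μ).toReal * (eLpNorm g 2 μ).toReal := by
  have h := integral_mul_le_Lp_mul_Lq_of_nonneg (μ := μ) (p := 2) (q := 2)
    (f := fun x => ‖f x‖) (g := fun x => ‖g x‖) Real.HolderConjugate.two_two
    (.of_forall fun _ => norm_nonneg _) (.of_forall fun _ => norm_nonneg _)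
    (by simpa using hf.norm) (by simpa using hg.norm)
  refine h.trans_eq ?_
  rw [hf.eLpNorm_eq_integral_rpow_norm two_ne_zero ENNReal.ofNat_ne_top,
    hg.eLpNorm_eq_integral_rpow_norm two_ne_zero ENNReal.ofNat_ne_top,
    ENNReal.toReal_ofReal (by positivity), ENNReal.toReal_ofReal (by positivity)]
  simp

theorem norm_integral_inner_le {G : Type*} [NormedAddCommGroup G] {f g : α → F} {J : α → G}
    (hJ : MemLp J 2 μ) {C : ℝ} (hf : ∀ᵐ x ∂μ, ‖f x‖ ≤ C * ‖J x‖) (hg : MemLp g 2 μ) :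
    ‖∫ x, ⟪f x, g x⟫_ℂ ∂μ‖ ≤ C * (eLpNorm J 2 μ).toReal * (eLpNorm g 2 μ).toReal := by
  have hi : Integrable (fun x => C * (‖J x‖ * ‖g x‖)) μ :=
    (hJ.norm.integrable_mul hg.norm).const_mul C
  rcases le_or_gt 0 C with hC | hC
  · refine (norm_integral_le_of_norm_le hi (hf.mono fun x hx => ?_)).trans ?_
    · rw [← mul_assoc]
      exact (norm_inner_le_norm _ _).trans (mul_le_mul_of_nonneg_right hx (norm_nonneg _))
    · rw [integral_const_mul, mul_assoc]
      exact mul_le_mul_of_nonneg_left (integral_norm_mul_norm_le hJ hg) hC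
  -- For negative `C` the pointwise bound forces `J` and `f` to vanish, so both sides are zero.
  · have h1 : ∀ᵐ x ∂μ, J x = 0 ∧ f x = 0 := hf.mono fun x hx => by
      have h2 := norm_nonneg (J x)
      have h3 := norm_nonneg (f x)
      have h4 : ‖J x‖ = 0 := by nlinarith
      have h5 : ‖f x‖ = 0 := by rw [h4] at hx; linarith
      exact ⟨norm_eq_zero.1 h4, norm_eq_zero.1 h5⟩
    have h2 : ∫ x, ⟪f x, g x⟫_ℂ ∂μ = 0 :=
      integral_eq_zero_of_ae (h1.mono fun x hx => by simp [hx.2])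
    have h3 : eLpNorm J 2 μ = 0 :=
      (eLpNorm_congr_ae (g := fun _ => (0 : G)) (h1.mono fun x hx => hx.1)).trans
        eLpNorm_zero
    simp [h2, h3]

theorem MeasureTheory.MemLp.integrable_inner_of_two {f g : α → F} (hf : MemLp f 2 μ)
    (hg : MemLp g 2 μ) : Integrable (fun x => ⟪f x, g x⟫_ℂ) μ :=
  (hf.norm.integrable_mul hg.norm).mono' (hf.1.inner hg.1)
    (.of_forall fun _ => norm_inner_le_norm _ _)

end CauchySchwarz

/-! ### Oscillating functions with mean value zero -/

section MeanZero

variable {d : ℕ} {F : Type*} [NormedAddCommGroup F] [InnerProductSpace ℂ F] [CompleteSpace F]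
  {a : Module.Basis (Fin d) ℝ (EuclideanSpace ℝ (Fin d))}

open IsLatticePeriodic in
/-- The pairing of a periodic function with mean value zero with a smooth function is estimated
by the gradient. -/
theorem IsLatticePeriodic.norm_integral_inner_le_of_mean_zero {p : EuclideanSpace ℝ (Fin d) → F}
    (hp : IsLatticePeriodic a p) (hm : AEStronglyMeasurable p volume)
    (hi : IntegrableOn p (ZSpan.fundamentalDomain a))
    (h0 : ∫ y in ZSpan.fundamentalDomain a, p y = 0) {D r : ℝ}
    (hD : ∀ y ∈ ZSpan.fundamentalDomain a, ‖y‖ ≤ D)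
    {Y : EuclideanSpace ℝ (Fin d) → F} (hY : ContDiff ℝ 1 Y) (hr : ∀ x, r < ‖x‖ → Y x = 0)
    {ζ : EuclideanSpace ℝ (Fin d) → ℝ} (hζ : ∀ x, ‖x‖ ≤ r + D → ζ x = 1)
    (hL : MemLp (fun x => ζ x • p x) 2 volume) :
    ‖∫ x, ⟪Y x, p x⟫_ℂ‖ ≤ D * (eLpNorm (fderiv ℝ Y) 2 volume).toReal *
      (eLpNorm (fun x => ζ x • p x) 2 volume).toReal := by
  set V := volume.real (ZSpan.fundamentalDomain a)
  have hV : 0 < V := volume_real_fundamentalDomain_pos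
  set K : Set (EuclideanSpace ℝ (Fin d)) := Metric.closedBall 0 r
  have hYc : HasCompactSupport Y := by
    refine HasCompactSupport.of_support_subset_isCompact (isCompact_closedBall 0 r) fun x hx => ?_
    rw [mem_closedBall_zero_iff]
    by_contra! h
    exact hx (hr x h)
  have hY2 : MemLp Y 2 volume := hY.continuous.memLp_of_hasCompactSupport hYc
  have hD2 : MemLp (fderiv ℝ Y) 2 volume :=
    (hY.continuous_fderiv (by simp)).memLp_of_hasCompactSupport (hYc.fderiv ℝ)
  have hYy : ∀ y : EuclideanSpace ℝ (Fin d), MemLp (fun x => Y (x - y)) 2 volume := fun y =>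
    hY2.comp_measurePreserving (measurePreserving_sub_right volume y)
  have hζY : ∀ y : EuclideanSpace ℝ (Fin d), ‖y‖ ≤ D → ∀ x,
      ⟪Y (x - y), p x⟫_ℂ = ⟪Y (x - y), ζ x • p x⟫_ℂ := fun y hy x => by
    rcases le_or_gt ‖x‖ (r + D) with h | h
    · rw [hζ x h, one_smul]
    · rw [hr, inner_zero_left, inner_zero_left]
      have := norm_sub_norm_le x y
      linarith
  have hD0 : 0 ≤ D := (norm_nonneg _).trans
    (hD _ (ZSpan.fract_mem_fundamentalDomain a 0))
  have hiy : ∀ y : EuclideanSpace ℝ (Fin d), ‖y‖ ≤ D →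
      Integrable (fun x => ⟪Y (x - y), p x⟫_ℂ) volume := fun y hy =>
    ((hYy y).integrable_inner_of_two hL).congr (.of_forall fun x => (hζY y hy x).symm)
  set B := D * (eLpNorm (fderiv ℝ Y) 2 volume).toReal *
      (eLpNorm (fun x => ζ x • p x) 2 volume).toReal with hB
  set I := ∫ x, ⟪Y x, p x⟫_ℂ with hI
  -- Shifting `p` by `y` amounts to shifting `Y` by `-y`, which changes `Y` by at most `D‖∇Y‖` in
  -- `L₂`. The factor `ζ` is `1` wherever the shifted functions live and makes `p` square
  -- integrable.
  have hdiff : ∀ y ∈ ZSpan.fundamentalDomain a, ‖I - ∫ x, ⟪Y x, p (x + y)⟫_ℂ‖ ≤ B := by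
    intro y hy
    have hyD := hD y hy
    have e1 : ∫ x, ⟪Y x, p (x + y)⟫_ℂ = ∫ x, ⟪Y (x - y), p x⟫_ℂ := by
      rw [← integral_sub_right_eq_self (fun x => ⟪Y x, p (x + y)⟫_ℂ) y]
      simp only [sub_add_cancel]
    have i0 := hiy 0 (by simpa using hD0)
    simp only [sub_zero] at i0
    have e2 : I - ∫ x, ⟪Y x, p (x + y)⟫_ℂ = ∫ x, ⟪Y x - Y (x - y), ζ x • p x⟫_ℂ := by
      rw [e1, hI, ← integral_sub i0 (hiy y hyD)]
      refine integral_congr_ae (.of_forall fun x => ?_)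
      have h1 := hζY 0 (by simpa using hD0) x
      rw [sub_zero] at h1
      simp only [inner_sub_left]
      rw [← hζY y hyD, ← h1]
    rw [e2]
    have hJ : MemLp (fun x => Y x - Y (x - y)) 2 volume := hY2.sub (hYy y)
    refine (norm_integral_inner_le hJ (C := 1) (.of_forall fun x => (one_mul _).ge) hL).trans ?_
    rw [one_mul]
    refine mul_le_mul_of_nonneg_right ?_ ENNReal.toReal_nonneg
    have h2 : eLpNorm (fun x => Y x - Y (x - y)) 2 volume ≤
        ENNReal.ofReal D * eLpNorm (fderiv ℝ Y) 2 volume := by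
      have h3 := eLpNorm_translate_sub_le hY (-y)
      have h4 : eLpNorm (fun x => Y x - Y (x - y)) 2 volume =
          eLpNorm (fun x => Y (x + -y) - Y x) 2 volume := by
        rw [← eLpNorm_neg]
        congr 1
        ext1 x
        simp [sub_eq_add_neg]
      rw [h4]
      refine h3.trans (eLpNorm_le_mul_eLpNorm_of_ae_le_mul (.of_forall fun x => ?_) 2)
      rw [mul_comm]
      refine (ContinuousLinearMap.le_opNorm _ _).trans ?_
      rw [norm_neg]
      exact mul_le_mul_of_nonneg_left hyD (norm_nonneg _)
    have h5 := ENNReal.toReal_mono (ENNReal.mul_ne_top ENNReal.ofReal_ne_top hD2.2.ne) h2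
    rwa [ENNReal.toReal_mul, ENNReal.toReal_ofReal hD0] at h5
  obtain ⟨C, hC⟩ := hY.continuous.bounded_above_of_compact_support hYc
  have hprod : Integrable (fun q : EuclideanSpace ℝ (Fin d) × EuclideanSpace ℝ (Fin d) =>
      ⟪Y q.1, p (q.1 + q.2)⟫_ℂ)
      ((volume.restrict K).prod (volume.restrict (ZSpan.fundamentalDomain a))) := by
    have hb := hp.integrable_prod hm hi (K := K) Metric.isBounded_closedBall.measure_lt_top
    refine (hb.norm.const_mul C).mono'
      ((hY.continuous.comp continuous_fst).aestronglyMeasurable.inner hb.1)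
      (.of_forall fun q => (norm_inner_le_norm _ _).trans ?_)
    exact mul_le_mul_of_nonneg_right (hC _) (norm_nonneg _)
  have hK : ∀ y : EuclideanSpace ℝ (Fin d), ∫ x in K, ⟪Y x, p (x + y)⟫_ℂ =
      ∫ x, ⟪Y x, p (x + y)⟫_ℂ := fun y => by
    refine setIntegral_eq_integral_of_forall_compl_eq_zero fun x hx => ?_
    rw [hr, inner_zero_left]
    simpa [K] using hx
  -- The average over all shifts vanishes because `p` has mean value zero. Hence `I` is the mean of
  -- the differences estimated in `hdiff`.
  have hzero : ∫ y in ZSpan.fundamentalDomain a, ∫ x, ⟪Y x, p (x + y)⟫_ℂ = 0 := by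
    have h1 := integral_prod _ hprod
    rw [integral_prod_symm _ hprod] at h1
    simp only [hK] at h1
    rw [h1, ← integral_zero (EuclideanSpace ℝ (Fin d)) ℂ (μ := volume.restrict K)]
    refine integral_congr_ae (.of_forall fun x => ?_)
    change ∫ y in ZSpan.fundamentalDomain a, ⟪Y x, p (x + y)⟫_ℂ = 0
    rw [integral_inner (hp.integrableOn_comp_add hi x), hp.setIntegral_comp_add, h0,
      inner_zero_right]
  have hJi : IntegrableOn (fun y => ∫ x, ⟪Y x, p (x + y)⟫_ℂ) (ZSpan.fundamentalDomain a) := by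
    have := hprod.integral_prod_right
    simpa only [hK, IntegrableOn] using this
  have hmain : (V : ℂ) * I =
      ∫ y in ZSpan.fundamentalDomain a, (I - ∫ x, ⟪Y x, p (x + y)⟫_ℂ) := by
    rw [integral_sub (integrable_const _) hJi, hzero, sub_zero, setIntegral_const,
      Complex.real_smul]
  have h6 := norm_setIntegral_le_of_norm_le_const (μ := volume)
    (volume_fundamentalDomain_lt_top (a := a)) hdiff
  rw [← hmain, norm_mul, Complex.norm_real, Real.norm_of_nonneg hV.le, mul_comm] at h6
  exact le_of_mul_le_mul_right h6 hV

open scoped Pointwise in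
theorem image_smul_fundamentalDomain {ε : ℝ} (hε : ε ≠ 0) :
    ZSpan.fundamentalDomain (a.map (LinearEquiv.smulOfNeZero ℝ (EuclideanSpace ℝ (Fin d)) ε hε)) =
      ε • ZSpan.fundamentalDomain a :=
  (ZSpan.map_fundamentalDomain a
    (LinearEquiv.smulOfNeZero ℝ (EuclideanSpace ℝ (Fin d)) ε hε)).symm

open scoped Pointwise in
/-- A rapidly oscillating periodic function with mean value zero is small in the dual of `H¹`. -/
theorem IsLatticePeriodic.norm_integral_inner_scale_le {p : EuclideanSpace ℝ (Fin d) → F}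
    (hp : IsLatticePeriodic a p) (hm : AEStronglyMeasurable p volume)
    (hi : IntegrableOn p (ZSpan.fundamentalDomain a))
    (h0 : ∫ y in ZSpan.fundamentalDomain a, p y = 0) {D r ε : ℝ} (hε : 0 < ε)
    (hD : ∀ y ∈ ZSpan.fundamentalDomain a, ‖y‖ ≤ D)
    {Y : EuclideanSpace ℝ (Fin d) → F} (hY : ContDiff ℝ 1 Y) (hr : ∀ x, r < ‖x‖ → Y x = 0)
    {ζ : EuclideanSpace ℝ (Fin d) → ℝ} (hζ : ∀ x, ‖x‖ ≤ r + ε * D → ζ x = 1)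
    (hL : MemLp (fun x => ζ x • p (ε⁻¹ • x)) 2 volume) :
    ‖∫ x, ⟪Y x, p (ε⁻¹ • x)⟫_ℂ‖ ≤ ε * D * (eLpNorm (fderiv ℝ Y) 2 volume).toReal *
      (eLpNorm (fun x => ζ x • p (ε⁻¹ • x)) 2 volume).toReal := by
  have hq : Measure.QuasiMeasurePreserving (fun x : EuclideanSpace ℝ (Fin d) => ε⁻¹ • x)
      volume volume := Measure.quasiMeasurePreserving_smul volume (inv_ne_zero hε.ne')
  -- The scaled function is periodic with respect to the dilated lattice, whose cell has radius
  -- `εD`; this is where the factor `ε` comes from.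
  refine IsLatticePeriodic.norm_integral_inner_le_of_mean_zero
    (a := a.map (LinearEquiv.smulOfNeZero ℝ (EuclideanSpace ℝ (Fin d)) ε hε.ne'))
    (p := fun x => p (ε⁻¹ • x)) (fun j x => ?_) (hm.comp_quasiMeasurePreserving hq) ?_ ?_ ?_
    hY hr hζ hL
  · simp only [smul_add, Module.Basis.map_apply, LinearEquiv.smulOfNeZero_apply,
      inv_smul_smul₀ hε.ne']
    exact hp j _
  · rw [image_smul_fundamentalDomain, ← integrable_indicator_iff
      ((ZSpan.fundamentalDomain_measurableSet a).const_smul_of_ne_zero hε.ne')]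
    have h1 := (integrable_indicator_iff (ZSpan.fundamentalDomain_measurableSet a)).2 hi
    refine ((integrable_comp_smul_iff volume _ (inv_ne_zero hε.ne')).2 h1).congr
      (.of_forall fun x => ?_)
    change (ZSpan.fundamentalDomain a).indicator p (ε⁻¹ • x) = _
    have h2 := Set.mem_smul_set_iff_inv_smul_mem₀ hε.ne' (ZSpan.fundamentalDomain a) x
    by_cases h : ε⁻¹ • x ∈ ZSpan.fundamentalDomain a
    · rw [Set.indicator_of_mem h, Set.indicator_of_mem (h2.2 h)]
    · rw [Set.indicator_of_notMem h, Set.indicator_of_notMem (mt h2.1 h)]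
  · rw [image_smul_fundamentalDomain]
    have := Measure.setIntegral_comp_smul (volume : Measure (EuclideanSpace ℝ (Fin d))) p
      (ε • ZSpan.fundamentalDomain a) (inv_ne_zero hε.ne')
    rw [this, inv_smul_smul₀ hε.ne', h0, smul_zero]
  · intro y hy
    rw [image_smul_fundamentalDomain] at hy
    obtain ⟨z, hz, rfl⟩ := hy
    change ‖ε • z‖ ≤ _
    rw [norm_smul, Real.norm_of_nonneg hε.le]
    exact mul_le_mul_of_nonneg_left (hD z hz) hε.le

end MeanZero

/-! ### Further properties of weak gradients -/

namespace HasWeakGradient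

variable {d : ℕ} {F : Type*} [NormedAddCommGroup F] [NormedSpace ℝ F]
  {u : EuclideanSpace ℝ (Fin d) → F} {Du : Fin d → EuclideanSpace ℝ (Fin d) → F}

theorem const (w : F) : HasWeakGradient (fun _ : EuclideanSpace ℝ (Fin d) => w) fun _ _ => 0 := by
  have h := of_contDiff (d := d) (contDiff_const (c := w) (𝕜 := ℝ) (n := 1))
  simpa using h

theorem sum {κ : Type*} (s : Finset κ) {u : κ → EuclideanSpace ℝ (Fin d) → F}
    {Du : κ → Fin d → EuclideanSpace ℝ (Fin d) → F}
    (h : ∀ i ∈ s, HasWeakGradient (u i) (Du i)) :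
    HasWeakGradient (∑ i ∈ s, u i) (∑ i ∈ s, Du i) := by
  classical
  induction s using Finset.induction_on with
  | empty => exact zero
  | insert i s hi ih =>
    rw [Finset.sum_insert hi, Finset.sum_insert hi]
    exact (h i (Finset.mem_insert_self i s)).add
      (ih fun j hj => h j (Finset.mem_insert_of_mem hj))

omit [NormedSpace ℝ F] in
theorem locallyIntegrable_comp_smul {f : EuclideanSpace ℝ (Fin d) → F}
    (hf : LocallyIntegrable f volume) {r : ℝ} (hr : r ≠ 0) :
    LocallyIntegrable (fun x => f (r • x)) volume := by
  refine locallyIntegrable_iff.2 fun k hk => ?_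
  have hk' : IsCompact ((fun x => r • x) '' k) := hk.image (continuous_const_smul r)
  have h1 := (integrable_indicator_iff hk'.isClosed.measurableSet).2
    (hf.integrableOn_isCompact hk')
  refine (((integrable_comp_smul_iff volume _ hr).2 h1).integrableOn (s := k)).congr_fun
    (fun x hx => ?_) hk.isClosed.measurableSet
  exact Set.indicator_of_mem (Set.mem_image_of_mem (fun x => r • x) hx) f

/-- Weak gradients of scaled functions. -/
theorem comp_smul (h : HasWeakGradient u Du) {r : ℝ} (hr : r ≠ 0) :
    HasWeakGradient (fun x => u (r • x)) fun l x => r • Du l (r • x) where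
  locallyIntegrable := locallyIntegrable_comp_smul h.locallyIntegrable hr
  locallyIntegrable_deriv l :=
    (locallyIntegrable_comp_smul (h.locallyIntegrable_deriv l) hr).smul r
  integral_eq l φ h1 h2 := by
    have c1 : ContDiff ℝ ∞ fun x => φ (r⁻¹ • x) := h1.comp (contDiff_const_smul _)
    have c2 : HasCompactSupport fun x => φ (r⁻¹ • x) := h2.comp_smul (inv_ne_zero hr)
    have e := h.integral_eq l _ c1 c2
    have hd : ∀ x, fderiv ℝ (fun x => φ (r⁻¹ • x)) x (EuclideanSpace.single l 1) =
        r⁻¹ * fderiv ℝ φ (r⁻¹ • x) (EuclideanSpace.single l 1) := fun x => by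
      have h3 : HasFDerivAt (fun x : EuclideanSpace ℝ (Fin d) => r⁻¹ • x)
        (r⁻¹ • ContinuousLinearMap.id ℝ _) x := (hasFDerivAt_id x).const_smul r⁻¹
      have h4 := ((h1.differentiable (by simp) (r⁻¹ • x)).hasFDerivAt.comp x h3).fderiv
      exact (DFunLike.congr_fun h4 _).trans (by simp)
    simp only [hd] at e
    have e1 := Measure.integral_comp_smul (volume : Measure (EuclideanSpace ℝ (Fin d)))
      (fun x => (r⁻¹ * fderiv ℝ φ (r⁻¹ • x) (EuclideanSpace.single l 1)) • u x) r
    have e2 := Measure.integral_comp_smul (volume : Measure (EuclideanSpace ℝ (Fin d)))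
      (fun x => φ (r⁻¹ • x) • Du l x) r
    simp only [inv_smul_smul₀ hr] at e1 e2
    rw [e, smul_neg, ← e2] at e1
    have e3 := congrArg (fun y => r • y) e1
    simp only [smul_neg, ← integral_smul, smul_smul, mul_inv_cancel_left₀ hr] at e3
    simp only [smul_smul]
    simpa only [mul_comm r] using e3

end HasWeakGradient

theorem quasiMeasurePreserving_smul_volume {d : ℕ} {r : ℝ} (hr : r ≠ 0) :
    Measure.QuasiMeasurePreserving (fun x : EuclideanSpace ℝ (Fin d) => r • x) volume volume :=
  Measure.quasiMeasurePreserving_smul volume hr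

theorem IsEllipticCoeff.comp_smul {d : ℕ} {κ : Type*} [Fintype κ]
    {g : EuclideanSpace ℝ (Fin d) → Matrix κ κ ℂ} {c₁ c₂ : ℝ} (h : IsEllipticCoeff volume g c₁ c₂)
    {r : ℝ} (hr : r ≠ 0) : IsEllipticCoeff volume (fun x => g (r • x)) c₁ c₂ where
  pos := h.pos
  measurable i j :=
    (h.measurable i j).comp_quasiMeasurePreserving (quasiMeasurePreserving_smul_volume hr)
  hermitian := (quasiMeasurePreserving_smul_volume hr).ae h.hermitian
  lower := (quasiMeasurePreserving_smul_volume hr).ae h.lower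
  upper := (quasiMeasurePreserving_smul_volume hr).ae h.upper

/-! ### The value of `b(D)u` in terms of the derivatives of `u` -/

section SymbolValue

variable {d : ℕ} {ι κ : Type*} [Fintype ι] [Fintype κ]

/-- The value `∑ₗ bₗ (-i pₗ)`. -/
noncomputable def symbolVal (b : Fin d → Matrix κ ι ℂ) (p : Fin d → EuclideanSpace ℂ ι) :
    EuclideanSpace ℂ κ := ∑ l, (-Complex.I) • matCLM (b l) (p l)

theorem ofLp_symbolVal (b : Fin d → Matrix κ ι ℂ) (p : Fin d → EuclideanSpace ℂ ι) :
    (symbolVal b p).ofLp = symbolD b fun l => (p l).ofLp := by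
  simp only [symbolVal, symbolD, WithLp.ofLp_sum, Matrix.mulVec_smul, WithLp.ofLp_smul,
    ofLp_matCLM]

theorem jetSymbol_eq_symbolVal (b : Fin d → Matrix κ ι ℂ) (v : Jet d ι) :
    jetSymbol b v = symbolVal b fun l => jetComp (some l) v := by
  simp only [jetSymbol, symbolVal, _root_.sum_apply, _root_.smul_apply,
    ContinuousLinearMap.comp_apply]

theorem symbolVal_add (b : Fin d → Matrix κ ι ℂ) (p q : Fin d → EuclideanSpace ℂ ι) :
    symbolVal b (fun l => p l + q l) = symbolVal b p + symbolVal b q := by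
  simp only [symbolVal, map_add, smul_add, Finset.sum_add_distrib]

theorem symbolVal_smul (b : Fin d → Matrix κ ι ℂ) (c : ℂ) (p : Fin d → EuclideanSpace ℂ ι) :
    symbolVal b (fun l => c • p l) = c • symbolVal b p := by
  simp only [symbolVal, map_smul, Finset.smul_sum, smul_comm c]

theorem symbolVal_real_smul (b : Fin d → Matrix κ ι ℂ) (x : EuclideanSpace ℝ (Fin d))
    (v : EuclideanSpace ℂ ι) :
    symbolVal b (fun l => (x l : ℂ) • v) = (-Complex.I) • matCLM (symbol b x) v := by
  simp only [symbolVal, symbol, map_sum, map_smul, _root_.sum_apply, _root_.smul_apply,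
    Finset.smul_sum]

/-- A bound for `b(D)u` in terms of the derivatives of `u`. -/
noncomputable def symbolBound (b : Fin d → Matrix κ ι ℂ) : ℝ := ∑ l, ‖matCLM (b l)‖

theorem symbolBound_nonneg (b : Fin d → Matrix κ ι ℂ) : 0 ≤ symbolBound b :=
  Finset.sum_nonneg fun _ _ => norm_nonneg _

theorem norm_symbolVal_le (b : Fin d → Matrix κ ι ℂ) {p : Fin d → EuclideanSpace ℂ ι} {C : ℝ}
    (h : ∀ l, ‖p l‖ ≤ C) : ‖symbolVal b p‖ ≤ symbolBound b * C := by
  refine (norm_sum_le _ _).trans ?_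
  rw [symbolBound, Finset.sum_mul]
  refine Finset.sum_le_sum fun l _ => ?_
  rw [norm_smul, norm_neg, Complex.norm_I, one_mul]
  exact (ContinuousLinearMap.le_opNorm _ _).trans
    (mul_le_mul_of_nonneg_left (h l) (norm_nonneg _))

theorem aestronglyMeasurable_symbolVal {α : Type*} [MeasurableSpace α] {μ : Measure α}
    (b : Fin d → Matrix κ ι ℂ) {p : Fin d → α → EuclideanSpace ℂ ι}
    (h : ∀ l, AEStronglyMeasurable (p l) μ) :
    AEStronglyMeasurable (fun x => symbolVal b fun l => p l x) μ := by
  simp only [symbolVal]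
  exact Finset.aestronglyMeasurable_fun_sum _ fun l _ =>
    ((matCLM (b l)).continuous.comp_aestronglyMeasurable (h l)).const_smul (-Complex.I)

theorem memLp_symbolVal {α : Type*} [MeasurableSpace α] {μ : Measure α}
    (b : Fin d → Matrix κ ι ℂ) {p : Fin d → α → EuclideanSpace ℂ ι}
    (h : ∀ l, MemLp (p l) 2 μ) : MemLp (fun x => symbolVal b fun l => p l x) 2 μ := by
  simp only [symbolVal]
  exact memLp_finsetSum _ fun l _ => ((matCLM (b l)).comp_memLp' (h l)).const_smul (-Complex.I)

end SymbolValue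

/-! ### Jets of functions -/

section FunctionJets

open scoped SchwartzMap

variable {d : ℕ} {ι κ : Type*} [Fintype ι] [Fintype κ]

theorem exists_jet {u : EuclideanSpace ℝ (Fin d) → EuclideanSpace ℂ ι}
    {Du : Fin d → EuclideanSpace ℝ (Fin d) → EuclideanSpace ℂ ι} (h : HasWeakGradient u Du)
    (hu : MemLp u 2 volume) (hD : ∀ l, MemLp (Du l) 2 volume) :
    ∃ z ∈ sobolevJets d ι, (compL volume none z =ᵐ[volume] u) ∧
      ∀ b : Fin d → Matrix κ ι ℂ,
        symbolL volume b z =ᵐ[volume] fun x => symbolVal b fun l => Du l x := by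
  set z : JetL2 d ι := lpJet fun o => o.elim (hu.toLp u) fun l => (hD l).toLp (Du l) with hz
  have hn : compL volume none z = hu.toLp u := compL_lpJet _ _
  have hs : ∀ l, compL volume (some l) z = (hD l).toLp (Du l) := fun l => compL_lpJet _ _
  refine ⟨z, ?_, ?_, fun b => ?_⟩
  · rw [mem_sobolevJets, hn]
    simp only [hs]
    exact h.congr hu.coeFn_toLp.symm fun l => (hD l).coeFn_toLp.symm
  · rw [hn]
    exact hu.coeFn_toLp
  · filter_upwards [ae_symbolL b z, ae_compL z, ae_all_iff.2 fun l => (hD l).coeFn_toLp]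
      with x h1 h2 h3
    rw [h1, jetSymbol_eq_symbolVal]
    congr 1
    ext1 l
    rw [← h2, hs, h3]

theorem ae_schwartzJet (V : 𝓢(EuclideanSpace ℝ (Fin d), EuclideanSpace ℂ ι)) :
    ∀ᵐ x, jetComp none (schwartzJet V x) = V x ∧
      ∀ l, jetComp (some l) (schwartzJet V x) = fderiv ℝ V x (EuclideanSpace.single l 1) := by
  have h : ∀ l : Fin d, (LineDeriv.lineDerivOp (EuclideanSpace.single l (1 : ℝ)) V).toLp 2 volume
      =ᵐ[volume] fun x => fderiv ℝ V x (EuclideanSpace.single l 1) := fun l =>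
    (LineDeriv.lineDerivOp (EuclideanSpace.single l (1 : ℝ)) V).coeFn_toLp 2 volume
  filter_upwards [ae_compL (schwartzJet V), V.coeFn_toLp 2 volume, ae_all_iff.2 h]
    with x h1 h2 h3
  refine ⟨?_, fun l => ?_⟩
  · rw [← h1, compL_none_schwartzJet, h2]
  · rw [← h1, compL_some_schwartzJet, h3]

end FunctionJets

/-! ### Local norms -/

section LocalNorm

variable {d : ℕ} {F : Type*} [NormedAddCommGroup F] [NormedSpace ℝ F]

theorem cutoff_eq_one {x : EuclideanSpace ℝ (Fin d)} (h : ‖x‖ ≤ 1) : cutoff d x = 1 :=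
  ContDiffBump.one_of_mem_closedBall _ (by simpa using h)

theorem cutoff_eq_zero {x : EuclideanSpace ℝ (Fin d)} (h : 2 ≤ ‖x‖) : cutoff d x = 0 :=
  ContDiffBump.zero_of_le_dist _ (by simpa using h)

/-- The norm over a large ball. -/
noncomputable def localNorm (δ : ℝ) (f : EuclideanSpace ℝ (Fin d) → F) : ℝ :=
  (eLpNorm (fun x => cutoff d ((δ / 4) • x) • f x) 2 volume).toReal

theorem localNorm_nonneg (δ : ℝ) (f : EuclideanSpace ℝ (Fin d) → F) : 0 ≤ localNorm δ f :=
  ENNReal.toReal_nonneg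

/-- `f` belongs to `L₂` locally. -/
def IsLocallyL2 (f : EuclideanSpace ℝ (Fin d) → F) : Prop :=
  ∀ δ : ℝ, 0 < δ → MemLp (fun x => cutoff d ((δ / 4) • x) • f x) 2 volume

omit [NormedSpace ℝ F] in
theorem eLpNorm_two_toReal_sq {α : Type*} [MeasurableSpace α] {μ : Measure α} {f : α → F}
    (hf : MemLp f 2 μ) : (eLpNorm f 2 μ).toReal ^ 2 = ∫ x, ‖f x‖ ^ 2 ∂μ := by
  rw [hf.eLpNorm_eq_integral_rpow_norm two_ne_zero ENNReal.ofNat_ne_top,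
    ENNReal.toReal_ofReal (by positivity), ← Real.sqrt_sq (by positivity :
      0 ≤ (∫ x, ‖f x‖ ^ ENNReal.toReal 2 ∂μ) ^ (ENNReal.toReal 2)⁻¹)]
  rw [Real.sqrt_sq (by positivity), ← Real.rpow_natCast, ← Real.rpow_mul (by positivity)]
  simp

omit [NormedSpace ℝ F] in
theorem IsLatticePeriodic.locallyIntegrable_norm_sq {a : Module.Basis (Fin d) ℝ (EuclideanSpace ℝ (Fin d))}
    {h : EuclideanSpace ℝ (Fin d) → F} (hp : IsLatticePeriodic a h)
    (hm : AEStronglyMeasurable h volume)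
    (h2 : MemLp h 2 (volume.restrict (ZSpan.fundamentalDomain a))) :
    LocallyIntegrable (fun x => ‖h x‖ ^ 2) volume :=
  (hp.comp fun v => ‖v‖ ^ 2).locallyIntegrable (hm.norm.pow 2)
    ((memLp_two_iff_integrable_sq_norm hm.restrict).1 h2)

theorem IsLatticePeriodic.memLp_smul {a : Module.Basis (Fin d) ℝ (EuclideanSpace ℝ (Fin d))}
    {h : EuclideanSpace ℝ (Fin d) → F} (hp : IsLatticePeriodic a h)
    (hm : AEStronglyMeasurable h volume)
    (h2 : MemLp h 2 (volume.restrict (ZSpan.fundamentalDomain a))) {ε : ℝ} (hε : 0 < ε)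
    {χ : EuclideanSpace ℝ (Fin d) → ℝ} (hc : Continuous χ) (hχ : HasCompactSupport χ) :
    MemLp (fun x => χ x • h (ε⁻¹ • x)) 2 volume := by
  have hme : AEStronglyMeasurable (fun x => h (ε⁻¹ • x)) volume :=
    hm.comp_quasiMeasurePreserving (quasiMeasurePreserving_smul_volume (inv_ne_zero hε.ne'))
  refine (memLp_two_iff_integrable_sq_norm (f := fun x => χ x • h (ε⁻¹ • x))
    (hc.aestronglyMeasurable.smul hme)).2 ?_
  have hl := HasWeakGradient.locallyIntegrable_comp_smul (hp.locallyIntegrable_norm_sq hm h2)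
    (inv_ne_zero hε.ne')
  have h3 := hl.integrable_smul_left_of_hasCompactSupport (g := fun x => χ x ^ 2) (hc.pow 2)
    (hχ.comp_left (g := fun r : ℝ => r ^ 2) (by simp))
  refine h3.congr (.of_forall fun x => ?_)
  simp [norm_smul, mul_pow]

theorem IsLatticePeriodic.isLocallyL2 {a : Module.Basis (Fin d) ℝ (EuclideanSpace ℝ (Fin d))}
    {h : EuclideanSpace ℝ (Fin d) → F} (hp : IsLatticePeriodic a h)
    (hm : AEStronglyMeasurable h volume)
    (h2 : MemLp h 2 (volume.restrict (ZSpan.fundamentalDomain a))) {ε : ℝ} (hε : 0 < ε) :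
    IsLocallyL2 fun x => h (ε⁻¹ • x) := fun δ hδ =>
  hp.memLp_smul hm h2 hε (continuous_cutoff.comp (continuous_const_smul _))
    (hasCompactSupport_cutoff_smul (by positivity))

/-- The limit of the normalized local norms of oscillating functions. -/
noncomputable def meanNorm (a : Module.Basis (Fin d) ℝ (EuclideanSpace ℝ (Fin d)))
    (h : EuclideanSpace ℝ (Fin d) → F) : ℝ :=
  √((∫ x, cutoff d ((1 / 4 : ℝ) • x) ^ 2) * ((volume.real (ZSpan.fundamentalDomain a))⁻¹ *
    ∫ y in ZSpan.fundamentalDomain a, ‖h y‖ ^ 2))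

/-- The averaging theorem for the periodic function `‖h‖²` with the weight `χ²`, followed by a
square root; hence the normalization `√(δ ^ d)`. -/
theorem IsLatticePeriodic.tendsto_norm_sq {a : Module.Basis (Fin d) ℝ (EuclideanSpace ℝ (Fin d))}
    {h : EuclideanSpace ℝ (Fin d) → F} (hp : IsLatticePeriodic a h)
    (hm : AEStronglyMeasurable h volume)
    (h2 : MemLp h 2 (volume.restrict (ZSpan.fundamentalDomain a))) {ε : ℝ} (hε : 0 < ε)
    {χ : EuclideanSpace ℝ (Fin d) → ℝ} (hc : Continuous χ) (hχ : HasCompactSupport χ) :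
    Tendsto (fun δ : ℝ => √(δ ^ d) *
        (eLpNorm (fun x => χ (δ • x) • h (ε⁻¹ • x)) 2 volume).toReal) (𝓝[>] 0)
      (𝓝 (√((∫ x, χ x ^ 2) * ((volume.real (ZSpan.fundamentalDomain a))⁻¹ *
        ∫ y in ZSpan.fundamentalDomain a, ‖h y‖ ^ 2)))) := by
  have h3 := (hp.comp fun v => ‖v‖ ^ 2).tendsto_average (hm.norm.pow 2)
    ((memLp_two_iff_integrable_sq_norm hm.restrict).1 h2) (χ := fun x => χ x ^ 2) (hc.pow 2)
    (hχ.comp_left (g := fun r : ℝ => r ^ 2) (by simp)) hε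
  refine ((Real.continuous_sqrt.tendsto _).comp h3).congr' ?_
  filter_upwards [self_mem_nhdsWithin] with δ hδ
  have hδ : 0 < δ := hδ
  have h4 := eLpNorm_two_toReal_sq (hp.memLp_smul hm h2 hε
    (hc.comp (continuous_const_smul δ)) (hχ.comp_smul hδ.ne'))
  rw [Function.comp_apply, smul_eq_mul, Real.sqrt_mul (by positivity),
    ← Real.sqrt_sq (ENNReal.toReal_nonneg (a := eLpNorm (fun x => χ (δ • x) • h (ε⁻¹ • x)) 2 volume))]
  congr 2
  refine Eq.trans ?_ h4.symm
  refine integral_congr_ae (.of_forall fun x => ?_)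
  simp [norm_smul, mul_pow]

theorem IsLatticePeriodic.tendsto_localNorm {a : Module.Basis (Fin d) ℝ (EuclideanSpace ℝ (Fin d))}
    {h : EuclideanSpace ℝ (Fin d) → F} (hp : IsLatticePeriodic a h)
    (hm : AEStronglyMeasurable h volume)
    (h2 : MemLp h 2 (volume.restrict (ZSpan.fundamentalDomain a))) {ε : ℝ} (hε : 0 < ε) :
    Tendsto (fun δ : ℝ => √(δ ^ d) * localNorm δ fun x => h (ε⁻¹ • x)) (𝓝[>] 0)
      (𝓝 (meanNorm a h)) := by
  have := hp.tendsto_norm_sq hm h2 hε (χ := fun x => cutoff d ((1 / 4 : ℝ) • x))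
    (continuous_cutoff.comp (continuous_const_smul _))
    (hasCompactSupport_cutoff_smul (by norm_num))
  simp only [smul_smul, one_div_mul_eq_div] at this
  exact this

omit [NormedSpace ℝ F] in
theorem meanNorm_eq_zero {a : Module.Basis (Fin d) ℝ (EuclideanSpace ℝ (Fin d))}
    {h : EuclideanSpace ℝ (Fin d) → F} (h0 : ∀ x, h x = 0) : meanNorm a h = 0 := by
  simp [meanNorm, h0]

end LocalNorm

/-! ### Wave packets -/

section WavePackets

variable {d : ℕ} {ι κ : Type*} [Fintype ι] [Fintype κ]

/-- A bound for the derivative of `cutoff d`. -/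
noncomputable def cutoffBound (d : ℕ) : ℝ := (exists_norm_fderiv_cutoff_le d).choose

theorem cutoffBound_nonneg : 0 ≤ cutoffBound d := (exists_norm_fderiv_cutoff_le d).choose_spec.1

theorem norm_fderiv_cutoff_le (x : EuclideanSpace ℝ (Fin d)) :
    ‖fderiv ℝ (cutoff d) x‖ ≤ cutoffBound d := (exists_norm_fderiv_cutoff_le d).choose_spec.2 x

/-- The narrow cutoff lives where `‖δx‖ ≤ 2`, and there the cutoff at scale `δ/4` equals `1`. The
spare room absorbs shifts by the scaled cell. -/
theorem cutoff_smul_le {δ : ℝ} (hδ : 0 < δ) (x : EuclideanSpace ℝ (Fin d)) :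
    cutoff d (δ • x) ≤ cutoff d ((δ / 4) • x) := by
  rcases le_or_gt 2 ‖δ • x‖ with h | h
  · rw [cutoff_eq_zero h]
    exact cutoff_nonneg _
  · rw [cutoff_eq_one (x := (δ / 4) • x)]
    · exact cutoff_le_one _
    · rw [norm_smul, Real.norm_of_nonneg (by positivity)] at h ⊢
      linarith

theorem cutoff_div_four_eq_one {δ : ℝ} (hδ : 0 < δ) {x : EuclideanSpace ℝ (Fin d)}
    (h : ‖δ • x‖ ≤ 2) : cutoff d ((δ / 4) • x) = 1 := by
  refine cutoff_eq_one ?_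
  rw [norm_smul, Real.norm_of_nonneg (by positivity)] at h ⊢
  linarith

theorem fderiv_cutoff_smul_eq_zero {δ : ℝ} {x : EuclideanSpace ℝ (Fin d)} (h : 2 < ‖δ • x‖) :
    fderiv ℝ (fun x => cutoff d (δ • x)) x = 0 := by
  have h1 : (fun x => cutoff d (δ • x)) =ᶠ[𝓝 x] fun _ => 0 := by
    have h2 : ∀ᶠ y in 𝓝 x, 2 < ‖δ • y‖ :=
      (continuous_const_smul δ).norm.continuousAt.eventually (lt_mem_nhds h)
    exact h2.mono fun y hy => cutoff_eq_zero hy.le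
  rw [h1.fderiv_eq]
  simp

/-- A derivative falling on the cutoff costs a factor `δ` and is supported where the wide cutoff is
`1`; such terms disappear in the limit of wide cutoffs. -/
theorem norm_fderiv_cutoff_smul_le {δ : ℝ} (hδ : 0 < δ) (x : EuclideanSpace ℝ (Fin d)) :
    ‖fderiv ℝ (fun x => cutoff d (δ • x)) x‖ ≤ δ * cutoffBound d * cutoff d ((δ / 4) • x) := by
  rcases le_or_gt ‖δ • x‖ 2 with h | h
  · rw [cutoff_div_four_eq_one hδ h, mul_one]
    refine ContinuousLinearMap.opNorm_le_bound _ (mul_nonneg hδ.le cutoffBound_nonneg) fun v => ?_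
    rw [fderiv_cutoff_smul, norm_mul, Real.norm_of_nonneg hδ.le, mul_assoc]
    refine mul_le_mul_of_nonneg_left ?_ hδ.le
    exact (ContinuousLinearMap.le_opNorm _ _).trans
      (mul_le_mul_of_nonneg_right (norm_fderiv_cutoff_le _) (norm_nonneg _))
  · rw [fderiv_cutoff_smul_eq_zero h, norm_zero]
    exact mul_nonneg (mul_nonneg hδ.le cutoffBound_nonneg) (cutoff_nonneg _)

/-- The plane wave `e^{i⟨ξ, x⟩}`. -/
noncomputable def planeWave (ξ x : EuclideanSpace ℝ (Fin d)) : ℂ :=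
  Complex.exp ((⟪ξ, x⟫_ℝ : ℝ) * Complex.I)

theorem norm_planeWave (ξ x : EuclideanSpace ℝ (Fin d)) : ‖planeWave ξ x‖ = 1 :=
  Complex.norm_exp_ofReal_mul_I _

theorem conj_planeWave (ξ x : EuclideanSpace ℝ (Fin d)) :
    (starRingEnd ℂ) (planeWave ξ x) = planeWave (-ξ) x := by
  rw [planeWave, planeWave, ← Complex.exp_conj]
  simp

theorem hasFDerivAt_planeWave (ξ x : EuclideanSpace ℝ (Fin d)) :
    HasFDerivAt (planeWave ξ)
      ((planeWave ξ x * Complex.I) • (Complex.ofRealCLM ∘L innerSL ℝ ξ)) x := by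
  have h1 : HasFDerivAt (fun x => ((⟪ξ, x⟫_ℝ : ℝ) : ℂ)) (Complex.ofRealCLM ∘L innerSL ℝ ξ) x :=
    (Complex.ofRealCLM ∘L innerSL ℝ ξ).hasFDerivAt
  have h2 := (h1.mul_const Complex.I).cexp
  refine h2.congr_fderiv ?_
  ext v
  simp [planeWave, mul_comm, mul_assoc, mul_left_comm]

theorem contDiff_planeWave (ξ : EuclideanSpace ℝ (Fin d)) {k : ℕ∞} :
    ContDiff ℝ k (planeWave ξ) := by
  have h1 : ContDiff ℝ k fun x => ((⟪ξ, x⟫_ℝ : ℝ) : ℂ) :=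
    (Complex.ofRealCLM ∘L innerSL ℝ ξ).contDiff
  exact (h1.mul contDiff_const).cexp

/-- A plane wave multiplied by a wide cutoff function. -/
noncomputable def wavePacket (ξ : EuclideanSpace ℝ (Fin d)) (δ : ℝ)
    (x : EuclideanSpace ℝ (Fin d)) : ℂ := (cutoff d (δ • x) : ℂ) * planeWave ξ x

theorem conj_wavePacket (ξ : EuclideanSpace ℝ (Fin d)) (δ : ℝ) (x : EuclideanSpace ℝ (Fin d)) :
    (starRingEnd ℂ) (wavePacket ξ δ x) = wavePacket (-ξ) δ x := by
  rw [wavePacket, wavePacket, map_mul, conj_planeWave, Complex.conj_ofReal]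

theorem contDiff_wavePacket (ξ : EuclideanSpace ℝ (Fin d)) (δ : ℝ) {k : ℕ∞} :
    ContDiff ℝ k (wavePacket ξ δ) :=
  (Complex.ofRealCLM.contDiff.comp (contDiff_cutoff_smul δ)).mul (contDiff_planeWave ξ)

theorem norm_wavePacket (ξ : EuclideanSpace ℝ (Fin d)) (δ : ℝ) (x : EuclideanSpace ℝ (Fin d)) :
    ‖wavePacket ξ δ x‖ = cutoff d (δ • x) := by
  rw [wavePacket, norm_mul, norm_planeWave, mul_one, Complex.norm_real,
    Real.norm_of_nonneg (cutoff_nonneg _)]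

theorem wavePacket_eq_zero {ξ : EuclideanSpace ℝ (Fin d)} {δ : ℝ} (hδ : 0 < δ)
    {x : EuclideanSpace ℝ (Fin d)} (h : 2 / δ < ‖x‖) : wavePacket ξ δ x = 0 := by
  rw [← norm_eq_zero, norm_wavePacket]
  refine cutoff_eq_zero ?_
  rw [norm_smul, Real.norm_of_nonneg hδ.le]
  rw [div_lt_iff₀ hδ] at h
  linarith

theorem hasCompactSupport_wavePacket (ξ : EuclideanSpace ℝ (Fin d)) {δ : ℝ} (hδ : 0 < δ) :
    HasCompactSupport (wavePacket ξ δ) := by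
  refine HasCompactSupport.of_support_subset_isCompact
    (isCompact_closedBall (0 : EuclideanSpace ℝ (Fin d)) (2 / δ)) fun x hx => ?_
  rw [mem_closedBall_zero_iff]
  by_contra! h
  exact hx (wavePacket_eq_zero hδ h)

theorem fderiv_wavePacket (ξ : EuclideanSpace ℝ (Fin d)) (δ : ℝ) (x v : EuclideanSpace ℝ (Fin d)) :
    fderiv ℝ (wavePacket ξ δ) x v =
      ((fderiv ℝ (fun x => cutoff d (δ • x)) x v : ℝ) : ℂ) * planeWave ξ x +
        (⟪ξ, v⟫_ℝ : ℝ) * Complex.I * wavePacket ξ δ x := by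
  have h1 : HasFDerivAt (fun x => cutoff d (δ • x)) (fderiv ℝ (fun x => cutoff d (δ • x)) x) x :=
    ((contDiff_cutoff_smul δ).differentiable (n := ((1 : ℕ∞) : WithTop ℕ∞)) (by simp) x).hasFDerivAt
  have h2 : HasFDerivAt (fun x => ((cutoff d (δ • x) : ℝ) : ℂ)) _ x :=
    Complex.ofRealCLM.hasFDerivAt.comp x h1
  have h3 := (h2.mul (hasFDerivAt_planeWave ξ x)).fderiv
  refine (DFunLike.congr_fun h3 v).trans ?_
  simp [wavePacket]
  ring

theorem norm_fderiv_wavePacket_le (ξ : EuclideanSpace ℝ (Fin d)) {δ : ℝ} (hδ : 0 < δ)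
    (x : EuclideanSpace ℝ (Fin d)) : ‖fderiv ℝ (wavePacket ξ δ) x‖ ≤
      (δ * cutoffBound d + ‖ξ‖) * cutoff d ((δ / 4) • x) := by
  have h0 := cutoff_nonneg ((δ / 4) • x)
  have h1 : 0 ≤ (δ * cutoffBound d + ‖ξ‖) * cutoff d ((δ / 4) • x) :=
    mul_nonneg (add_nonneg (mul_nonneg hδ.le cutoffBound_nonneg) (norm_nonneg _)) h0
  refine ContinuousLinearMap.opNorm_le_bound _ h1 fun v => ?_
  rw [fderiv_wavePacket]
  refine (norm_add_le _ _).trans ?_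
  rw [norm_mul, norm_planeWave, norm_mul, norm_mul, norm_wavePacket, Complex.norm_I,
    Complex.norm_real, Complex.norm_real, mul_one, mul_one, add_mul, add_mul]
  refine add_le_add ?_ ?_
  · exact (ContinuousLinearMap.le_opNorm _ _).trans
      (mul_le_mul_of_nonneg_right (norm_fderiv_cutoff_smul_le hδ x) (norm_nonneg _))
  · calc ‖⟪ξ, v⟫_ℝ‖ * cutoff d (δ • x) ≤ (‖ξ‖ * ‖v‖) * cutoff d ((δ / 4) • x) :=
          mul_le_mul (norm_inner_le_norm _ _) (cutoff_smul_le hδ x) (cutoff_nonneg _) (by positivity)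
      _ = _ := by ring

/-- The commutator of `b(D)` with the cutoff function. -/
noncomputable def cutoffSymbol (b : Fin d → Matrix κ ι ℂ) (δ : ℝ) (x : EuclideanSpace ℝ (Fin d))
    (z : EuclideanSpace ℂ ι) : EuclideanSpace ℂ κ :=
  symbolVal b fun l =>
    ((fderiv ℝ (fun x => cutoff d (δ • x)) x (EuclideanSpace.single l 1) : ℝ) : ℂ) • z

theorem norm_cutoffSymbol_le (b : Fin d → Matrix κ ι ℂ) {δ : ℝ} (hδ : 0 < δ)
    (x : EuclideanSpace ℝ (Fin d)) (z : EuclideanSpace ℂ ι) :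
    ‖cutoffSymbol b δ x z‖ ≤
      symbolBound b * (δ * cutoffBound d * cutoff d ((δ / 4) • x) * ‖z‖) := by
  refine norm_symbolVal_le b fun l => ?_
  rw [norm_smul, Complex.norm_real]
  refine mul_le_mul_of_nonneg_right ?_ (norm_nonneg _)
  refine (ContinuousLinearMap.le_opNorm _ _).trans ?_
  rw [PiLp.norm_single, norm_one, mul_one]
  exact norm_fderiv_cutoff_smul_le hδ x

theorem cutoff_smul_cutoffSymbol (b : Fin d → Matrix κ ι ℂ) {δ : ℝ} (hδ : 0 < δ)
    (x : EuclideanSpace ℝ (Fin d)) (z : EuclideanSpace ℂ ι) :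
    ((cutoff d ((δ / 4) • x) : ℝ) : ℂ) • cutoffSymbol b δ x z = cutoffSymbol b δ x z := by
  rcases le_or_gt ‖δ • x‖ 2 with h | h
  · rw [cutoff_div_four_eq_one hδ h, Complex.ofReal_one, one_smul]
  · have h1 : cutoffSymbol b δ x z = 0 := by
      simp [cutoffSymbol, fderiv_cutoff_smul_eq_zero h, symbolVal]
    rw [h1, smul_zero]

/-- The Leibniz rule for `b(D)`: the exponential contributes the symbol `b(ξ)`, the cutoff a
commutator of order `δ`. -/
theorem symbolVal_fderiv_wavePacket (b : Fin d → Matrix κ ι ℂ) (ξ : EuclideanSpace ℝ (Fin d))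
    (δ : ℝ) (x : EuclideanSpace ℝ (Fin d)) (z : EuclideanSpace ℂ ι) :
    symbolVal b (fun l => fderiv ℝ (wavePacket ξ δ) x (EuclideanSpace.single l 1) • z) =
      planeWave ξ x • cutoffSymbol b δ x z +
        wavePacket ξ δ x • matCLM (symbol b ξ) z := by
  have h1 : ∀ l, fderiv ℝ (wavePacket ξ δ) x (EuclideanSpace.single l 1) • z =
      planeWave ξ x •
        (((fderiv ℝ (fun x => cutoff d (δ • x)) x (EuclideanSpace.single l 1) : ℝ) : ℂ) • z) +
      (Complex.I * wavePacket ξ δ x) • ((ξ l : ℂ) • z) := fun l => by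
    rw [fderiv_wavePacket, add_smul, smul_smul, smul_smul, EuclideanSpace.inner_single_right]
    congr 2
    · ring
    · simp; ring
  simp only [h1]
  rw [symbolVal_add, symbolVal_smul, symbolVal_smul, symbolVal_real_smul, cutoffSymbol, smul_smul]
  congr 2
  linear_combination (-wavePacket ξ δ x) * Complex.I_mul_I

end WavePackets

/-! ### Estimates in terms of local norms -/

section LocalEstimates

variable {d : ℕ} {F : Type*} [NormedAddCommGroup F] [NormedSpace ℝ F]

theorem IsLocallyL2.memLp_of_norm_le {F' : Type*} [NormedAddCommGroup F']
    {h : EuclideanSpace ℝ (Fin d) → F} (hh : IsLocallyL2 h)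
    {δ : ℝ} (hδ : 0 < δ) {f : EuclideanSpace ℝ (Fin d) → F'}
    (hf : AEStronglyMeasurable f volume) {C : ℝ}
    (hC : ∀ᵐ x, ‖f x‖ ≤ C * (cutoff d ((δ / 4) • x) * ‖h x‖)) : MemLp f 2 volume := by
  refine (hh δ hδ).of_le_mul (c := C) hf ?_
  filter_upwards [hC] with x hx
  rwa [norm_smul, Real.norm_of_nonneg (cutoff_nonneg _)]

theorem IsLocallyL2.eLpNorm_toReal_le {F' : Type*} [NormedAddCommGroup F']
    {h : EuclideanSpace ℝ (Fin d) → F} (hh : IsLocallyL2 h)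
    {δ : ℝ} (hδ : 0 < δ) {f : EuclideanSpace ℝ (Fin d) → F'} {C : ℝ} (hC0 : 0 ≤ C)
    (hC : ∀ᵐ x, ‖f x‖ ≤ C * (cutoff d ((δ / 4) • x) * ‖h x‖)) :
    (eLpNorm f 2 volume).toReal ≤ C * localNorm δ h := by
  have h1 : eLpNorm f 2 volume ≤
      ENNReal.ofReal C * eLpNorm (fun x => cutoff d ((δ / 4) • x) • h x) 2 volume := by
    refine eLpNorm_le_mul_eLpNorm_of_ae_le_mul ?_ 2
    filter_upwards [hC] with x hx
    rwa [norm_smul, Real.norm_of_nonneg (cutoff_nonneg _)]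
  have h2 := ENNReal.toReal_mono (ENNReal.mul_ne_top ENNReal.ofReal_ne_top (hh δ hδ).2.ne) h1
  rwa [ENNReal.toReal_mul, ENNReal.toReal_ofReal hC0] at h2

/-- An integral of a product of a function bounded by a jet and of a locally bounded one. -/
theorem norm_integral_inner_le_localNorm {F' E : Type*} [NormedAddCommGroup F']
    [InnerProductSpace ℂ F'] [NormedAddCommGroup E]
    {h : EuclideanSpace ℝ (Fin d) → F} (hh : IsLocallyL2 h) {δ : ℝ} (hδ : 0 < δ)
    {J : EuclideanSpace ℝ (Fin d) → E} (hJ : MemLp J 2 volume)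
    {f g : EuclideanSpace ℝ (Fin d) → F'} (hfm : AEStronglyMeasurable f volume)
    (hgm : AEStronglyMeasurable g volume) {C C' : ℝ} (hC' : 0 ≤ C') (hC : 0 ≤ C)
    (hf : ∀ᵐ x, ‖f x‖ ≤ C * ‖J x‖)
    (hg : ∀ᵐ x, ‖g x‖ ≤ C' * (cutoff d ((δ / 4) • x) * ‖h x‖)) :
    Integrable (fun x => ⟪f x, g x⟫_ℂ) volume ∧ ‖∫ x, ⟪f x, g x⟫_ℂ‖ ≤
      C * C' * localNorm δ h * (eLpNorm J 2 volume).toReal := by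
  have hg2 : MemLp g 2 volume := hh.memLp_of_norm_le hδ hgm hg
  refine ⟨(hJ.of_le_mul hfm hf).integrable_inner_of_two hg2,
    (norm_integral_inner_le hJ hf hg2).trans ?_⟩
  have h1 := hh.eLpNorm_toReal_le hδ hC' hg
  calc C * (eLpNorm J 2 volume).toReal * (eLpNorm g 2 volume).toReal
      ≤ C * (eLpNorm J 2 volume).toReal * (C' * localNorm δ h) :=
        mul_le_mul_of_nonneg_left h1 (mul_nonneg hC ENNReal.toReal_nonneg)
    _ = _ := by ring

theorem IsLocallyL2.integrable_inner {F' : Type*} [NormedAddCommGroup F'] [InnerProductSpace ℂ F']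
    {h Y : EuclideanSpace ℝ (Fin d) → F'} (hh : IsLocallyL2 h) {δ : ℝ} (hδ : 0 < δ)
    (hY : Continuous Y) (hr : ∀ x, 2 / δ < ‖x‖ → Y x = 0) :
    Integrable (fun x => ⟪Y x, h x⟫_ℂ) volume := by
  have hc : HasCompactSupport Y := by
    refine HasCompactSupport.of_support_subset_isCompact
      (isCompact_closedBall (0 : EuclideanSpace ℝ (Fin d)) (2 / δ)) fun x hx => ?_
    rw [mem_closedBall_zero_iff]
    by_contra! h
    exact hx (hr x h)
  have h1 : MemLp Y 2 volume := hY.memLp_of_hasCompactSupport hc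
  refine (h1.integrable_inner_of_two (hh δ hδ)).congr (.of_forall fun x => ?_)
  rcases le_or_gt ‖x‖ (2 / δ) with hx | hx
  · simp only
    rw [cutoff_div_four_eq_one hδ, one_smul]
    rwa [norm_smul, Real.norm_of_nonneg hδ.le, mul_comm, ← le_div_iff₀ hδ]
  · simp only [hr x hx, inner_zero_left]

end LocalEstimates

/-! ### First order correctors -/

section Correctors

variable {d : ℕ} {ι κ : Type*} [Fintype ι] [Fintype κ]

/-- The leading term `b(D)v + b(θ)η` of the field of a corrected wave. -/
noncomputable def waveField (b : Fin d → Matrix κ ι ℂ) (θ : EuclideanSpace ℝ (Fin d))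
    (η : EuclideanSpace ℂ ι) (Dv : Fin d → EuclideanSpace ℝ (Fin d) → EuclideanSpace ℂ ι)
    (x : EuclideanSpace ℝ (Fin d)) : EuclideanSpace ℂ κ :=
  symbolVal b (fun l => Dv l x) + matCLM (symbol b θ) η

/-- The leading term of the flux of a corrected wave. -/
noncomputable def waveFlux (b : Fin d → Matrix κ ι ℂ) (g : EuclideanSpace ℝ (Fin d) → Matrix κ κ ℂ)
    (θ : EuclideanSpace ℝ (Fin d)) (η : EuclideanSpace ℂ ι)
    (Dv : Fin d → EuclideanSpace ℝ (Fin d) → EuclideanSpace ℂ ι)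
    (x : EuclideanSpace ℝ (Fin d)) : EuclideanSpace ℂ κ :=
  matCLM (g x) (waveField b θ η Dv x)

/-- The residual of the corrected wave on the cell. -/
noncomputable def waveDefect (b : Fin d → Matrix κ ι ℂ)
    (g : EuclideanSpace ℝ (Fin d) → Matrix κ κ ℂ)
    (θ : EuclideanSpace ℝ (Fin d)) (γ : ℝ) (η : EuclideanSpace ℂ ι)
    (Dv : Fin d → EuclideanSpace ℝ (Fin d) → EuclideanSpace ℂ ι)
    (x : EuclideanSpace ℝ (Fin d)) : EuclideanSpace ℂ ι :=
  matCLM (symbol b θ)ᴴ (waveFlux b g θ η Dv x) - (γ : ℂ) • η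

/-- `v` is the first order corrector for the wave with the direction `θ` and the amplitude `η`,
an eigenvector of the effective symbol with the eigenvalue `γ`. -/
structure IsCorrector (a : Module.Basis (Fin d) ℝ (EuclideanSpace ℝ (Fin d)))
    (b : Fin d → Matrix κ ι ℂ) (g : EuclideanSpace ℝ (Fin d) → Matrix κ κ ℂ)
    (θ : EuclideanSpace ℝ (Fin d)) (γ : ℝ) (η : EuclideanSpace ℂ ι)
    (v : EuclideanSpace ℝ (Fin d) → EuclideanSpace ℂ ι)
    (Dv : Fin d → EuclideanSpace ℝ (Fin d) → EuclideanSpace ℂ ι) : Prop where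
  coeff_periodic : IsLatticePeriodic a g
  periodic : IsLatticePeriodic a v
  periodic_deriv : ∀ l, IsLatticePeriodic a (Dv l)
  weakGradient : HasWeakGradient v Dv
  memLp : MemLp v 2 (volume.restrict (ZSpan.fundamentalDomain a))
  memLp_deriv : ∀ l, MemLp (Dv l) 2 (volume.restrict (ZSpan.fundamentalDomain a))
  weak_eq : ∀ Y : EuclideanSpace ℝ (Fin d) → EuclideanSpace ℂ ι, ContDiff ℝ ∞ Y →
    HasCompactSupport Y →
      ∫ x, ⟪symbolVal b fun l => fderiv ℝ Y x (EuclideanSpace.single l 1),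
        waveFlux b g θ η Dv x⟫_ℂ = 0
  integral_defect : ∫ x in ZSpan.fundamentalDomain a, waveDefect b g θ γ η Dv x = 0

/-- The periodic factor of the corrected wave. -/
noncomputable def amplitude (η : EuclideanSpace ℂ ι)
    (v : EuclideanSpace ℝ (Fin d) → EuclideanSpace ℂ ι) (s : ℝ)
    (y : EuclideanSpace ℝ (Fin d)) : EuclideanSpace ℂ ι := η + (s : ℂ) • v y

/-- The periodic factor of the field of the corrected wave. -/
noncomputable def fieldAmplitude (b : Fin d → Matrix κ ι ℂ) (θ : EuclideanSpace ℝ (Fin d))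
    (η : EuclideanSpace ℂ ι) (v : EuclideanSpace ℝ (Fin d) → EuclideanSpace ℂ ι)
    (Dv : Fin d → EuclideanSpace ℝ (Fin d) → EuclideanSpace ℂ ι) (s : ℝ)
    (y : EuclideanSpace ℝ (Fin d)) : EuclideanSpace ℂ κ :=
  waveField b θ η Dv y + (s : ℂ) • matCLM (symbol b θ) (v y)

/-- The corrected wave multiplied by a cutoff function. -/
noncomputable def quasiMode (θ : EuclideanSpace ℝ (Fin d)) (η : EuclideanSpace ℂ ι)
    (v : EuclideanSpace ℝ (Fin d) → EuclideanSpace ℂ ι) (k ε δ : ℝ)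
    (x : EuclideanSpace ℝ (Fin d)) : EuclideanSpace ℂ ι :=
  wavePacket (k • θ) δ x • amplitude η v (ε * k) (ε⁻¹ • x)

/-- `b(D)` of the corrected wave multiplied by a cutoff function. -/
noncomputable def quasiField (b : Fin d → Matrix κ ι ℂ) (θ : EuclideanSpace ℝ (Fin d))
    (η : EuclideanSpace ℂ ι) (v : EuclideanSpace ℝ (Fin d) → EuclideanSpace ℂ ι)
    (Dv : Fin d → EuclideanSpace ℝ (Fin d) → EuclideanSpace ℂ ι) (k ε δ : ℝ)
    (x : EuclideanSpace ℝ (Fin d)) : EuclideanSpace ℂ κ :=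
  (k * wavePacket (k • θ) δ x) • fieldAmplitude b θ η v Dv (ε * k) (ε⁻¹ • x) +
    planeWave (k • θ) x • cutoffSymbol b δ x (amplitude η v (ε * k) (ε⁻¹ • x))

omit [Fintype ι] [Fintype κ] in
theorem symbol_smul (b : Fin d → Matrix κ ι ℂ) (k : ℝ) (θ : EuclideanSpace ℝ (Fin d)) :
    symbol b (k • θ) = (k : ℂ) • symbol b θ := by
  simp only [symbol, Finset.smul_sum, smul_smul, PiLp.smul_apply, smul_eq_mul, Complex.ofReal_mul]

theorem matCLM_smul_apply (c : ℂ) (A : Matrix κ ι ℂ) (z : EuclideanSpace ℂ ι) :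
    matCLM (c • A) z = c • matCLM A z := by
  rw [map_smul, _root_.smul_apply]

namespace IsCorrector

variable {a : Module.Basis (Fin d) ℝ (EuclideanSpace ℝ (Fin d))}
  {b : Fin d → Matrix κ ι ℂ} {g : EuclideanSpace ℝ (Fin d) → Matrix κ κ ℂ}
  {θ : EuclideanSpace ℝ (Fin d)} {γ : ℝ} {η : EuclideanSpace ℂ ι}
  {v : EuclideanSpace ℝ (Fin d) → EuclideanSpace ℂ ι}
  {Dv : Fin d → EuclideanSpace ℝ (Fin d) → EuclideanSpace ℂ ι}
  (h : IsCorrector a b g θ γ η v Dv) {c₁ c₂ : ℝ} (hg : IsEllipticCoeff volume g c₁ c₂)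
include h

theorem aestronglyMeasurable : AEStronglyMeasurable v volume :=
  h.weakGradient.locallyIntegrable.aestronglyMeasurable

theorem aestronglyMeasurable_deriv (l : Fin d) : AEStronglyMeasurable (Dv l) volume :=
  (h.weakGradient.locallyIntegrable_deriv l).aestronglyMeasurable

theorem periodic_field : IsLatticePeriodic a (waveField b θ η Dv) := fun j x => by
  simp only [waveField, h.periodic_deriv _ j x]

theorem aestronglyMeasurable_field : AEStronglyMeasurable (waveField b θ η Dv) volume :=
  (aestronglyMeasurable_symbolVal b h.aestronglyMeasurable_deriv).add
    aestronglyMeasurable_const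

theorem memLp_field :
    MemLp (waveField b θ η Dv) 2 (volume.restrict (ZSpan.fundamentalDomain a)) :=
  (memLp_symbolVal b h.memLp_deriv).add (memLp_const _)

theorem periodic_flux : IsLatticePeriodic a (waveFlux b g θ η Dv) := fun j x => by
  rw [waveFlux, waveFlux, h.coeff_periodic, h.periodic_field]

theorem periodic_defect : IsLatticePeriodic a (waveDefect b g θ γ η Dv) := fun j x => by
  rw [waveDefect, waveDefect, h.periodic_flux]

theorem periodic_cross : IsLatticePeriodic a fun x => matCLM (g x) (matCLM (symbol b θ) (v x)) :=
  fun j x => by simp only [h.coeff_periodic j x, h.periodic j x]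

theorem periodic_amplitude (s : ℝ) : IsLatticePeriodic a (amplitude η v s) := fun j x => by
  rw [amplitude, amplitude, h.periodic]

theorem aestronglyMeasurable_amplitude (s : ℝ) :
    AEStronglyMeasurable (amplitude η v s) volume :=
  aestronglyMeasurable_const.add (h.aestronglyMeasurable.const_smul (s : ℂ))

theorem memLp_amplitude (s : ℝ) :
    MemLp (amplitude η v s) 2 (volume.restrict (ZSpan.fundamentalDomain a)) := by
  have h1 : MemLp (fun _ => η) 2 (volume.restrict (ZSpan.fundamentalDomain a)) := memLp_const η
  have h2 := h1.add (h.memLp.const_smul (s : ℂ))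
  exact h2

theorem periodic_fieldAmplitude (s : ℝ) : IsLatticePeriodic a (fieldAmplitude b θ η v Dv s) :=
  fun j x => by rw [fieldAmplitude, fieldAmplitude, h.periodic_field, h.periodic]

theorem aestronglyMeasurable_fieldAmplitude (s : ℝ) :
    AEStronglyMeasurable (fieldAmplitude b θ η v Dv s) volume :=
  h.aestronglyMeasurable_field.add (((matCLM (symbol b θ)).continuous.comp_aestronglyMeasurable
    h.aestronglyMeasurable).const_smul (s : ℂ))

theorem memLp_fieldAmplitude (s : ℝ) :
    MemLp (fieldAmplitude b θ η v Dv s) 2 (volume.restrict (ZSpan.fundamentalDomain a)) :=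
  h.memLp_field.add (((matCLM (symbol b θ)).comp_memLp' h.memLp).const_smul (s : ℂ))

theorem isLocallyL2_amplitude (s : ℝ) {ε : ℝ} (hε : 0 < ε) :
    IsLocallyL2 fun x => amplitude η v s (ε⁻¹ • x) :=
  (h.periodic_amplitude s).isLocallyL2 (h.aestronglyMeasurable_amplitude s)
    (h.memLp_amplitude s) hε

theorem isLocallyL2_fieldAmplitude (s : ℝ) {ε : ℝ} (hε : 0 < ε) :
    IsLocallyL2 fun x => fieldAmplitude b θ η v Dv s (ε⁻¹ • x) :=
  (h.periodic_fieldAmplitude s).isLocallyL2 (h.aestronglyMeasurable_fieldAmplitude s)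
    (h.memLp_fieldAmplitude s) hε

theorem isLocallyL2_corrector {ε : ℝ} (hε : 0 < ε) : IsLocallyL2 fun x => v (ε⁻¹ • x) :=
  h.periodic.isLocallyL2 h.aestronglyMeasurable h.memLp hε

/-- The dilation multiplies all first derivatives of the test function by `ε` and the measure by a
power of `ε`, and the right-hand side is zero. -/
theorem weak_eq_scaled {ε : ℝ} (hε : 0 < ε)
    {Y : EuclideanSpace ℝ (Fin d) → EuclideanSpace ℂ ι} (h1 : ContDiff ℝ ∞ Y)
    (h2 : HasCompactSupport Y) :
    ∫ x, ⟪symbolVal b fun l => fderiv ℝ Y x (EuclideanSpace.single l 1),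
        waveFlux b g θ η Dv (ε⁻¹ • x)⟫_ℂ = 0 := by
  have h3 := h.weak_eq (fun y => Y (ε • y)) (h1.comp (contDiff_const_smul _))
    (h2.comp_smul hε.ne')
  have hd : ∀ y e, fderiv ℝ (fun y => Y (ε • y)) y e = (ε : ℂ) • fderiv ℝ Y (ε • y) e :=
    fun y e => by
      have h5 : HasFDerivAt (fun x : EuclideanSpace ℝ (Fin d) => ε • x)
        (ε • ContinuousLinearMap.id ℝ _) y := (hasFDerivAt_id y).const_smul ε
      have h4 := ((h1.differentiable (by simp) (ε • y)).hasFDerivAt.comp y h5).fderiv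
      exact (DFunLike.congr_fun h4 _).trans (by simp)
  simp only [hd, symbolVal_smul, inner_smul_left, Complex.conj_ofReal, integral_const_mul] at h3
  have h4 := (mul_eq_zero.1 h3).resolve_left (Complex.ofReal_ne_zero.2 hε.ne')
  have h5 := Measure.integral_comp_smul (volume : Measure (EuclideanSpace ℝ (Fin d)))
    (fun y => ⟪symbolVal b fun l => fderiv ℝ Y (ε • y) (EuclideanSpace.single l 1),
        waveFlux b g θ η Dv y⟫_ℂ) ε⁻¹
  rw [h4, smul_zero] at h5
  simpa only [smul_inv_smul₀ hε.ne'] using h5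

/-- Differentiating `v(x/ε)` gives `ε⁻¹`, which cancels the `ε` in front of the corrector. The
corrector thus changes the field at leading order, although it changes the amplitude only by `O(ε)`.
-/
theorem hasWeakGradient_quasiMode (k δ : ℝ) {ε : ℝ} (hε : 0 < ε) :
    HasWeakGradient (quasiMode θ η v k ε δ) fun l x =>
      wavePacket (k • θ) δ x • ((k : ℂ) • Dv l (ε⁻¹ • x)) +
        fderiv ℝ (wavePacket (k • θ) δ) x (EuclideanSpace.single l 1) •
          amplitude η v (ε * k) (ε⁻¹ • x) := by
  have h1 := ((HasWeakGradient.const η).add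
    ((h.weakGradient.comp_smul (inv_ne_zero hε.ne')).smul ((ε * k : ℝ) : ℂ))).smul_contDiff
    (contDiff_wavePacket (k • θ) δ)
  refine h1.congr (.of_forall fun x => rfl) fun l => .of_forall fun x => ?_
  simp only [Pi.add_apply, Pi.smul_apply, zero_add]
  congr 2
  rw [← Complex.coe_smul, smul_smul, ← Complex.ofReal_mul]
  congr 2
  field_simp

omit h in
theorem symbolVal_quasiMode (k δ ε : ℝ) (x : EuclideanSpace ℝ (Fin d)) :
    symbolVal b (fun l => wavePacket (k • θ) δ x • ((k : ℂ) • Dv l (ε⁻¹ • x)) +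
        fderiv ℝ (wavePacket (k • θ) δ) x (EuclideanSpace.single l 1) •
          amplitude η v (ε * k) (ε⁻¹ • x)) = quasiField b θ η v Dv k ε δ x := by
  rw [symbolVal_add, symbolVal_smul, symbolVal_smul, symbolVal_fderiv_wavePacket, symbol_smul,
    matCLM_smul_apply, quasiField, fieldAmplitude, waveField, amplitude, map_add, map_smul]
  module

theorem memLp_quasiMode (k : ℝ) {ε δ : ℝ} (hε : 0 < ε) (hδ : 0 < δ) :
    MemLp (quasiMode θ η v k ε δ) 2 volume := by
  refine (h.isLocallyL2_amplitude (ε * k) hε).memLp_of_norm_le hδ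
    (h.hasWeakGradient_quasiMode k δ hε).locallyIntegrable.aestronglyMeasurable (C := 1)
    (.of_forall fun x => ?_)
  rw [one_mul, quasiMode, norm_smul, norm_wavePacket]
  exact mul_le_mul_of_nonneg_right (cutoff_smul_le hδ x) (norm_nonneg _)

theorem exists_jet_quasiMode (k : ℝ) {ε δ : ℝ} (hε : 0 < ε) (hδ : 0 < δ) :
    ∃ U ∈ sobolevJets d ι, (compL volume none U =ᵐ[volume] quasiMode θ η v k ε δ) ∧
      symbolL volume b U =ᵐ[volume] quasiField b θ η v Dv k ε δ := by
  have h0 := h.hasWeakGradient_quasiMode k δ hε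
  obtain ⟨U, h1, h2, h3⟩ := exists_jet (κ := κ) h0 (h.memLp_quasiMode k hε hδ) fun l => by
    have e1 : IsLocallyL2 fun x => Dv l (ε⁻¹ • x) :=
      (h.periodic_deriv l).isLocallyL2 (h.aestronglyMeasurable_deriv l) (h.memLp_deriv l) hε
    have m1 : AEStronglyMeasurable (fun x => wavePacket (k • θ) δ x • ((k : ℂ) • Dv l (ε⁻¹ • x)))
        volume :=
      (contDiff_wavePacket (k := 0) (k • θ) δ).continuous.aestronglyMeasurable.smul
        (((h.aestronglyMeasurable_deriv l).comp_quasiMeasurePreserving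
          (quasiMeasurePreserving_smul_volume (inv_ne_zero hε.ne'))).const_smul (k : ℂ))
    have m2 : AEStronglyMeasurable (fun x =>
        fderiv ℝ (wavePacket (k • θ) δ) x (EuclideanSpace.single l 1) •
          amplitude η v (ε * k) (ε⁻¹ • x)) volume :=
      (((contDiff_wavePacket (k := 1) (k • θ) δ).continuous_fderiv (by simp)).clm_apply
        continuous_const).aestronglyMeasurable.smul
        ((h.aestronglyMeasurable_amplitude (ε * k)).comp_quasiMeasurePreserving
          (quasiMeasurePreserving_smul_volume (inv_ne_zero hε.ne')))
    refine (e1.memLp_of_norm_le hδ m1 (C := |k|) (.of_forall fun x => ?_)).add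
      ((h.isLocallyL2_amplitude (ε * k) hε).memLp_of_norm_le hδ m2
        (C := δ * cutoffBound d + ‖k • θ‖) (.of_forall fun x => ?_))
    · rw [norm_smul, norm_smul, norm_wavePacket, Complex.norm_real, Real.norm_eq_abs,
        mul_left_comm]
      exact mul_le_mul_of_nonneg_left
        (mul_le_mul_of_nonneg_right (cutoff_smul_le hδ x) (norm_nonneg _)) (abs_nonneg k)
    · rw [norm_smul, ← mul_assoc]
      refine mul_le_mul_of_nonneg_right ?_ (norm_nonneg _)
      refine (ContinuousLinearMap.le_opNorm _ _).trans ?_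
      rw [PiLp.norm_single, norm_one, mul_one]
      exact norm_fderiv_wavePacket_le _ hδ x
  refine ⟨U, h1, h2, (h3 b).trans (.of_forall fun x => ?_)⟩
  exact symbolVal_quasiMode k δ ε x

end IsCorrector

end Correctors

/-! ### The residual of a corrected wave -/

section Residual

open scoped SchwartzMap

variable {d : ℕ} {ι κ : Type*} [Fintype ι] [Fintype κ]

theorem opNorm_le_sum_single {F : Type*} [NormedAddCommGroup F] [NormedSpace ℝ F]
    (L : EuclideanSpace ℝ (Fin d) →L[ℝ] F) {C : ℝ} (hC : 0 ≤ C)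
    (h : ∀ l, ‖L (EuclideanSpace.single l 1)‖ ≤ C) : ‖L‖ ≤ d * C := by
  refine ContinuousLinearMap.opNorm_le_bound _ (by positivity) fun v => ?_
  have h1 : v = ∑ l, v l • EuclideanSpace.single l (1 : ℝ) := by
    ext i
    simp [Finset.sum_apply, Pi.single_apply]
  calc ‖L v‖ = ‖∑ l, v l • L (EuclideanSpace.single l 1)‖ := by
        conv_lhs => rw [h1]
        simp only [map_sum, map_smul]
    _ ≤ ∑ _l : Fin d, C * ‖v‖ := by
        refine norm_sum_le_of_le _ fun l _ => ?_
        rw [norm_smul, mul_comm]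
        exact mul_le_mul (h l) (PiLp.norm_apply_le v l) (norm_nonneg _) hC
    _ = _ := by simp; ring

/-- The wave is moved to the test function `Y = c'V`, whose `b(D)`-value is `p'`. This separates the
flux paired with `b(D)Y` (zero by the cell equation), the defect paired with `Y` (small because its
mean is zero), and a remainder whose terms contain either `s = εk` or a derivative of the cutoff. -/
theorem residual_identity {E K : Type*} [NormedAddCommGroup E] [InnerProductSpace ℂ E]
    [NormedAddCommGroup K] [InnerProductSpace ℂ K] {B : E →L[ℂ] K} {B' : K →L[ℂ] E} {G : K →L[ℂ] K}
    (hB : ∀ y q, ⟪B y, q⟫_ℂ = ⟪y, B' q⟫_ℂ) {k s γ : ℝ} {c c' e e' : ℂ}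
    (hc : (starRingEnd ℂ) c' = c) (he : (starRingEnd ℂ) e' = e) {y v : E} {p f z z' p' : K}
    (hp' : p' = c' • p + (e' • z' - (k * c') • B y)) {η : E} :
    ⟪p, G ((k * c) • (f + (s : ℂ) • B v) + e • z)⟫_ℂ -
        ((γ * k ^ 2 : ℝ) : ℂ) * ⟪y, c • (η + (s : ℂ) • v)⟫_ℂ =
      k * ⟪p', G f⟫_ℂ + k ^ 2 * ⟪c' • y, B' (G f) - (γ : ℂ) • η⟫_ℂ +
      (⟪e' • z', (-k : ℂ) • G f⟫_ℂ + ⟪p, (s * k * c) • G (B v)⟫_ℂ + ⟪p, e • G z⟫_ℂ +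
        ⟪y, (-(γ * k ^ 2 * s) * c) • v⟫_ℂ) := by
  rw [hp']
  simp only [map_add, map_smul, inner_add_left, inner_add_right, inner_sub_left, inner_sub_right,
    inner_smul_left, inner_smul_right, hB, hc, he, map_mul, Complex.conj_ofReal, smul_add]
  push_cast
  ring

/-- A bound for the points of the cell. -/
noncomputable def cellRadius (a : Module.Basis (Fin d) ℝ (EuclideanSpace ℝ (Fin d))) : ℝ :=
  (IsLatticePeriodic.exists_norm_le_of_mem_fundamentalDomain a).choose

theorem norm_le_cellRadius {a : Module.Basis (Fin d) ℝ (EuclideanSpace ℝ (Fin d))}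
    {y : EuclideanSpace ℝ (Fin d)} (hy : y ∈ ZSpan.fundamentalDomain a) : ‖y‖ ≤ cellRadius a :=
  (IsLatticePeriodic.exists_norm_le_of_mem_fundamentalDomain a).choose_spec.2 y hy

theorem cellRadius_nonneg {a : Module.Basis (Fin d) ℝ (EuclideanSpace ℝ (Fin d))} :
    0 ≤ cellRadius a :=
  (norm_nonneg _).trans (norm_le_cellRadius (ZSpan.fract_mem_fundamentalDomain a 0))

/-- The bound for the residual of the corrected wave multiplied by a cutoff function. -/
noncomputable def residualBound (a : Module.Basis (Fin d) ℝ (EuclideanSpace ℝ (Fin d)))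
    (b : Fin d → Matrix κ ι ℂ) (g : EuclideanSpace ℝ (Fin d) → Matrix κ κ ℂ)
    (θ : EuclideanSpace ℝ (Fin d)) (γ : ℝ) (η : EuclideanSpace ℂ ι)
    (v : EuclideanSpace ℝ (Fin d) → EuclideanSpace ℂ ι)
    (Dv : Fin d → EuclideanSpace ℝ (Fin d) → EuclideanSpace ℂ ι) (c₂ k ε δ : ℝ) : ℝ :=
  ε * (k ^ 2 * (cellRadius a * (d * (1 + (cutoffBound d + ‖k • θ‖)))) *
        localNorm δ (fun x => waveDefect b g θ γ η Dv (ε⁻¹ • x)) +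
      symbolBound b * (|k| * |k|) *
        localNorm δ (fun x => matCLM (g (ε⁻¹ • x)) (matCLM (symbol b θ) (v (ε⁻¹ • x)))) +
      |γ * k ^ 2| * |k| * localNorm δ (fun x => v (ε⁻¹ • x))) +
    δ * (symbolBound b * cutoffBound d * |k| *
        localNorm δ (fun x => waveFlux b g θ η Dv (ε⁻¹ • x)) +
      symbolBound b * (c₂ * (symbolBound b * cutoffBound d)) *
        localNorm δ (fun x => amplitude η v (ε * k) (ε⁻¹ • x)))

namespace IsCorrector

variable {a : Module.Basis (Fin d) ℝ (EuclideanSpace ℝ (Fin d))}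
  {b : Fin d → Matrix κ ι ℂ} {g : EuclideanSpace ℝ (Fin d) → Matrix κ κ ℂ}
  {θ : EuclideanSpace ℝ (Fin d)} {γ : ℝ} {η : EuclideanSpace ℂ ι}
  {v : EuclideanSpace ℝ (Fin d) → EuclideanSpace ℂ ι}
  {Dv : Fin d → EuclideanSpace ℝ (Fin d) → EuclideanSpace ℂ ι}
  (h : IsCorrector a b g θ γ η v Dv) {c₁ c₂ : ℝ} (hg : IsEllipticCoeff volume g c₁ c₂)
include h hg

theorem aestronglyMeasurable_flux : AEStronglyMeasurable (waveFlux b g θ η Dv) volume :=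
  hg.aestronglyMeasurable_mul h.aestronglyMeasurable_field

theorem memLp_flux :
    MemLp (waveFlux b g θ η Dv) 2 (volume.restrict (ZSpan.fundamentalDomain a)) :=
  (hg.restrict _).memLp_mul h.memLp_field

theorem aestronglyMeasurable_defect : AEStronglyMeasurable (waveDefect b g θ γ η Dv) volume :=
  ((matCLM (symbol b θ)ᴴ).continuous.comp_aestronglyMeasurable
    (h.aestronglyMeasurable_flux hg)).sub aestronglyMeasurable_const

theorem memLp_defect :
    MemLp (waveDefect b g θ γ η Dv) 2 (volume.restrict (ZSpan.fundamentalDomain a)) := by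
  have h1 : MemLp (fun _ => (γ : ℂ) • η) 2 (volume.restrict (ZSpan.fundamentalDomain a)) :=
    memLp_const _
  have h2 := ((matCLM (symbol b θ)ᴴ).comp_memLp' (h.memLp_flux hg)).sub h1
  exact h2

theorem aestronglyMeasurable_cross :
    AEStronglyMeasurable (fun x => matCLM (g x) (matCLM (symbol b θ) (v x))) volume :=
  hg.aestronglyMeasurable_mul
    ((matCLM (symbol b θ)).continuous.comp_aestronglyMeasurable h.aestronglyMeasurable)

theorem memLp_cross : MemLp (fun x => matCLM (g x) (matCLM (symbol b θ) (v x))) 2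
    (volume.restrict (ZSpan.fundamentalDomain a)) :=
  (hg.restrict _).memLp_mul ((matCLM (symbol b θ)).comp_memLp' h.memLp)

theorem isLocallyL2_flux {ε : ℝ} (hε : 0 < ε) :
    IsLocallyL2 fun x => waveFlux b g θ η Dv (ε⁻¹ • x) :=
  h.periodic_flux.isLocallyL2 (h.aestronglyMeasurable_flux hg) (h.memLp_flux hg) hε

theorem isLocallyL2_defect {ε : ℝ} (hε : 0 < ε) :
    IsLocallyL2 fun x => waveDefect b g θ γ η Dv (ε⁻¹ • x) :=
  h.periodic_defect.isLocallyL2 (h.aestronglyMeasurable_defect hg) (h.memLp_defect hg) hε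

theorem isLocallyL2_cross {ε : ℝ} (hε : 0 < ε) :
    IsLocallyL2 fun x => matCLM (g (ε⁻¹ • x)) (matCLM (symbol b θ) (v (ε⁻¹ • x))) :=
  h.periodic_cross.isLocallyL2 (h.aestronglyMeasurable_cross hg) (h.memLp_cross hg) hε

theorem norm_integral_defect_le (k : ℝ) {ε δ : ℝ} (hε : 0 < ε) (hδ : 0 < δ) (hδ1 : δ ≤ 1)
    (hεδ : δ * (ε * cellRadius a) ≤ 2) (V : 𝓢(EuclideanSpace ℝ (Fin d), EuclideanSpace ℂ ι)) :
    ‖∫ x, ⟪wavePacket (-(k • θ)) δ x • V x, waveDefect b g θ γ η Dv (ε⁻¹ • x)⟫_ℂ‖ ≤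
      ε * (cellRadius a * (d * (1 + (cutoffBound d + ‖k • θ‖)))) *
        localNorm δ (fun x => waveDefect b g θ γ η Dv (ε⁻¹ • x)) * ‖schwartzJet V‖ := by
  have hY : ContDiff ℝ 1 fun x => wavePacket (-(k • θ)) δ x • V x :=
    (contDiff_wavePacket _ δ (k := 1)).smul (V.smooth 1)
  have hC := cutoffBound_nonneg (d := d)
  -- The defect has mean value zero because `η` is an eigenvector of the effective symbol, so
  -- pairing with a function of class `H¹` gains a factor `ε`. The assumption `δεD ≤ 2` ensures that
  -- the cutoff at scale `δ/4` is `1` on the ball of radius `2/δ + εD`.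
  have h1 := h.periodic_defect.norm_integral_inner_scale_le (h.aestronglyMeasurable_defect hg)
    ((h.memLp_defect hg).integrable one_le_two) h.integral_defect hε
    (fun y hy => norm_le_cellRadius hy) hY (r := 2 / δ)
    (fun x hx => by rw [wavePacket_eq_zero hδ hx, zero_smul])
    (ζ := fun x => cutoff d ((δ / 4) • x)) (fun x hx => cutoff_eq_one (by
      rw [norm_smul, Real.norm_of_nonneg (by positivity)]
      calc δ / 4 * ‖x‖ ≤ δ / 4 * (2 / δ + ε * cellRadius a) := by gcongr
        _ = 1 / 2 + δ * (ε * cellRadius a) / 4 := by field_simp; ring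
        _ ≤ 1 := by linarith)) (h.isLocallyL2_defect hg hε δ hδ)
  have h2 : (eLpNorm (fderiv ℝ fun x => wavePacket (-(k • θ)) δ x • V x) 2 volume).toReal ≤
      (d * (1 + (cutoffBound d + ‖k • θ‖))) * ‖schwartzJet V‖ := by
    rw [Lp.norm_def, ← ENNReal.toReal_ofReal
      (by positivity : 0 ≤ (d * (1 + (cutoffBound d + ‖k • θ‖)) : ℝ)), ← ENNReal.toReal_mul]
    refine ENNReal.toReal_mono (ENNReal.mul_ne_top ENNReal.ofReal_ne_top (Lp.eLpNorm_ne_top _))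
      (eLpNorm_le_mul_eLpNorm_of_ae_le_mul ?_ 2)
    filter_upwards [ae_schwartzJet V] with x ⟨hx0, hx1⟩
    rw [mul_assoc]
    refine opNorm_le_sum_single _ (by positivity) fun l => ?_
    rw [fderiv_fun_smul ((contDiff_wavePacket (-(k • θ)) δ (k := 1)).differentiable (by simp) x)
      V.differentiableAt]
    change ‖wavePacket (-(k • θ)) δ x • fderiv ℝ V x (EuclideanSpace.single l 1) +
      fderiv ℝ (wavePacket (-(k • θ)) δ) x (EuclideanSpace.single l 1) • V x‖ ≤ _
    refine (norm_add_le _ _).trans ?_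
    rw [norm_smul, norm_smul, norm_wavePacket, add_mul, ← hx1 l, ← hx0]
    refine add_le_add (mul_le_mul (cutoff_le_one _) (norm_jetComp_le _ _) (norm_nonneg _)
      zero_le_one) (mul_le_mul ?_ (norm_jetComp_le _ _) (norm_nonneg _) (by positivity))
    refine (ContinuousLinearMap.le_opNorm _ _).trans ?_
    rw [PiLp.norm_single, norm_one, mul_one]
    refine (norm_fderiv_wavePacket_le _ hδ x).trans ?_
    rw [norm_neg]
    refine (mul_le_of_le_one_right (by positivity) (cutoff_le_one _)).trans ?_
    have := mul_le_of_le_one_left hC hδ1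
    linarith
  refine h1.trans ?_
  change _ * localNorm δ _ ≤ _
  calc ε * cellRadius a *
        (eLpNorm (fderiv ℝ fun x => wavePacket (-(k • θ)) δ x • V x) 2 volume).toReal *
        localNorm δ (fun x => waveDefect b g θ γ η Dv (ε⁻¹ • x)) ≤
      ε * cellRadius a * ((d * (1 + (cutoffBound d + ‖k • θ‖))) * ‖schwartzJet V‖) *
        localNorm δ (fun x => waveDefect b g θ γ η Dv (ε⁻¹ • x)) := by
        refine mul_le_mul_of_nonneg_right ?_ (localNorm_nonneg _ _)
        exact mul_le_mul_of_nonneg_left h2 (mul_nonneg hε.le cellRadius_nonneg)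
    _ = _ := by ring

end IsCorrector

end Residual

/-! ### The residual of the corrected wave in the dual of `H¹`. -/

section ResidualEstimate

open scoped SchwartzMap

variable {d : ℕ} {ι κ : Type*} [Fintype ι] [Fintype κ]

theorem continuous_symbolVal {α : Type*} [TopologicalSpace α] (b : Fin d → Matrix κ ι ℂ)
    {p : Fin d → α → EuclideanSpace ℂ ι} (h : ∀ l, Continuous (p l)) :
    Continuous fun x => symbolVal b fun l => p l x := by
  simp only [symbolVal]
  refine continuous_finsetSum _ fun l _ => ?_
  have h1 := ((matCLM (b l)).continuous.comp (h l)).const_smul (-Complex.I)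
  exact h1

theorem integral_residual_terms {α : Type*} [MeasurableSpace α] {μ : Measure α}
    {f₀ f₁ t₁ t₂ t₃ t₄ : α → ℂ} (h₀ : Integrable f₀ μ) (h₁ : Integrable f₁ μ)
    (i₁ : Integrable t₁ μ) (i₂ : Integrable t₂ μ) (i₃ : Integrable t₃ μ) (i₄ : Integrable t₄ μ)
    (c₀ c₁ : ℂ) :
    ∫ x, (c₀ * f₀ x + c₁ * f₁ x + (t₁ x + t₂ x + t₃ x + t₄ x)) ∂μ =
      c₀ * ∫ x, f₀ x ∂μ + c₁ * ∫ x, f₁ x ∂μ +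
        (∫ x, t₁ x ∂μ + ∫ x, t₂ x ∂μ + ∫ x, t₃ x ∂μ + ∫ x, t₄ x ∂μ) := by
  have e1 := integral_add ((h₀.const_mul c₀).add (h₁.const_mul c₁)) (((i₁.add i₂).add i₃).add i₄)
  have e2 := integral_add (h₀.const_mul c₀) (h₁.const_mul c₁)
  have e3 := integral_add ((i₁.add i₂).add i₃) i₄
  have e4 := integral_add (i₁.add i₂) i₃
  have e5 := integral_add i₁ i₂
  simp only [Pi.add_apply, integral_const_mul] at e1 e2 e3 e4 e5
  rw [e1, e2, e3, e4, e5]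

theorem continuous_fderiv_cutoff_smul (δ : ℝ) (e : EuclideanSpace ℝ (Fin d)) :
    Continuous fun x => fderiv ℝ (fun x => cutoff d (δ • x)) x e :=
  ((contDiff_cutoff_smul δ (k := 1)).continuous_fderiv (by simp)).clm_apply continuous_const

theorem aestronglyMeasurable_cutoffSymbol (b : Fin d → Matrix κ ι ℂ) (δ : ℝ)
    {f : EuclideanSpace ℝ (Fin d) → EuclideanSpace ℂ ι} (hf : AEStronglyMeasurable f volume) :
    AEStronglyMeasurable (fun x => cutoffSymbol b δ x (f x)) volume :=
  aestronglyMeasurable_symbolVal b fun _ => (Complex.continuous_ofReal.comp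
    (continuous_fderiv_cutoff_smul δ _)).aestronglyMeasurable.smul hf

theorem norm_integral_wavePacket_le {F E : Type*} [NormedAddCommGroup F] [InnerProductSpace ℂ F]
    [NormedAddCommGroup E] {h : EuclideanSpace ℝ (Fin d) → F} (hh : IsLocallyL2 h)
    (hm : AEStronglyMeasurable h volume) {δ : ℝ} (hδ : 0 < δ)
    {J : EuclideanSpace ℝ (Fin d) → E} (hJ : MemLp J 2 volume)
    {f : EuclideanSpace ℝ (Fin d) → F} (hfm : AEStronglyMeasurable f volume) {C : ℝ} (hC : 0 ≤ C)
    (hf : ∀ᵐ x, ‖f x‖ ≤ C * ‖J x‖) (r : ℂ) (ξ : EuclideanSpace ℝ (Fin d)) :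
    Integrable (fun x => ⟪f x, (r * wavePacket ξ δ x) • h x⟫_ℂ) volume ∧
      ‖∫ x, ⟪f x, (r * wavePacket ξ δ x) • h x⟫_ℂ‖ ≤
        C * ‖r‖ * localNorm δ h * (eLpNorm J 2 volume).toReal := by
  refine norm_integral_inner_le_localNorm hh hδ hJ hfm
    (g := fun x => (r * wavePacket ξ δ x) • h x) ((continuous_const.mul
    (contDiff_wavePacket ξ δ (k := 0)).continuous).aestronglyMeasurable.smul hm)
    (norm_nonneg r) hC hf (.of_forall fun x => ?_)
  rw [norm_smul, norm_mul, norm_wavePacket, mul_assoc]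
  exact mul_le_mul_of_nonneg_left
    (mul_le_mul_of_nonneg_right (cutoff_smul_le hδ x) (norm_nonneg _)) (norm_nonneg r)

namespace IsCorrector

variable {a : Module.Basis (Fin d) ℝ (EuclideanSpace ℝ (Fin d))}
  {b : Fin d → Matrix κ ι ℂ} {g : EuclideanSpace ℝ (Fin d) → Matrix κ κ ℂ}
  {θ : EuclideanSpace ℝ (Fin d)} {γ : ℝ} {η : EuclideanSpace ℂ ι}
  {v : EuclideanSpace ℝ (Fin d) → EuclideanSpace ℂ ι}
  {Dv : Fin d → EuclideanSpace ℝ (Fin d) → EuclideanSpace ℂ ι}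
  (h : IsCorrector a b g θ γ η v Dv) {c₁ c₂ : ℝ} (hg : IsEllipticCoeff volume g c₁ c₂)
include h hg

theorem norm_integral_residual_le (hc₂ : 0 ≤ c₂) (k : ℝ) {ε δ : ℝ} (hε : 0 < ε) (hδ : 0 < δ)
    (hδ1 : δ ≤ 1) (hεδ : δ * (ε * cellRadius a) ≤ 2)
    (V : 𝓢(EuclideanSpace ℝ (Fin d), EuclideanSpace ℂ ι)) :
    ‖∫ x, (⟪symbolVal b fun l => fderiv ℝ V x (EuclideanSpace.single l 1),
        matCLM (g (ε⁻¹ • x)) (quasiField b θ η v Dv k ε δ x)⟫_ℂ -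
        ((γ * k ^ 2 : ℝ) : ℂ) * ⟪V x, quasiMode θ η v k ε δ x⟫_ℂ)‖ ≤
      residualBound a b g θ γ η v Dv c₂ k ε δ * ‖schwartzJet V‖ := by
  have hq := quasiMeasurePreserving_smul_volume (d := d) (inv_ne_zero hε.ne')
  have hB := symbolBound_nonneg b
  have hK := cutoffBound_nonneg (d := d)
  have hJ := Lp.memLp (schwartzJet V)
  have hJn : (eLpNorm (schwartzJet V) 2 volume).toReal = ‖schwartzJet V‖ := (Lp.norm_def _).symm
  have hV0 : ∀ᵐ x, ‖V x‖ ≤ ‖schwartzJet V x‖ := by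
    filter_upwards [ae_schwartzJet V] with x hx
    rw [← hx.1]
    exact norm_jetComp_le _ _
  have hV1 : ∀ᵐ x, ‖symbolVal b fun l => fderiv ℝ V x (EuclideanSpace.single l 1)‖ ≤
      symbolBound b * ‖schwartzJet V x‖ := by
    filter_upwards [ae_schwartzJet V] with x hx
    refine norm_symbolVal_le b fun l => ?_
    rw [← hx.2]
    exact norm_jetComp_le _ _
  have cV1 : Continuous fun x => symbolVal b fun l => fderiv ℝ V x (EuclideanSpace.single l 1) :=
    continuous_symbolVal b fun l =>
      (((V.smooth 1).continuous_fderiv (by simp)).clm_apply continuous_const)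
  have cV0 : Continuous V := V.continuous
  have cc : Continuous (wavePacket (k • θ) δ) :=
    (contDiff_wavePacket (k • θ) δ (k := 0)).continuous
  have cc' : Continuous (wavePacket (-(k • θ)) δ) :=
    (contDiff_wavePacket (-(k • θ)) δ (k := 0)).continuous
  have ce : Continuous (planeWave (k • θ)) := (contDiff_planeWave (k • θ) (k := 0)).continuous
  have ce' : Continuous (planeWave (-(k • θ))) :=
    (contDiff_planeWave (-(k • θ)) (k := 0)).continuous
  have mq := (h.aestronglyMeasurable_flux hg).comp_quasiMeasurePreserving hq
  have mr := (h.aestronglyMeasurable_cross hg).comp_quasiMeasurePreserving hq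
  have mv := h.aestronglyMeasurable.comp_quasiMeasurePreserving hq
  have mw := (h.aestronglyMeasurable_amplitude (ε * k)).comp_quasiMeasurePreserving hq
  have mp := (h.aestronglyMeasurable_defect hg).comp_quasiMeasurePreserving hq
  have ζ0 : ∀ x : EuclideanSpace ℝ (Fin d), 0 ≤ cutoff d ((δ / 4) • x) := fun x => cutoff_nonneg _
  have hcζ : ∀ (ξ : EuclideanSpace ℝ (Fin d)) x, ‖wavePacket ξ δ x‖ ≤ cutoff d ((δ / 4) • x) :=
    fun ξ x => (norm_wavePacket ξ δ x).le.trans (cutoff_smul_le hδ x)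
  -- The flux is square integrable only locally, so the wide cutoff is inserted in front of it; this
  -- changes nothing where the commutator lives, as `hζz` confirms.
  have A1 := norm_integral_inner_le_localNorm (h.isLocallyL2_flux hg hε) hδ hJ
    (f := fun x => planeWave (-(k • θ)) x • cutoffSymbol b δ x (V x))
    (g := fun x => cutoff d ((δ / 4) • x) • ((-k : ℂ) • waveFlux b g θ η Dv (ε⁻¹ • x)))
    (ce'.aestronglyMeasurable.smul
      (aestronglyMeasurable_cutoffSymbol b δ cV0.aestronglyMeasurable))
    ((continuous_cutoff.comp (continuous_const_smul _)).aestronglyMeasurable.smul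
      (mq.const_smul (-k : ℂ)))
    (C := symbolBound b * (δ * cutoffBound d)) (C' := |k|) (abs_nonneg k) (by positivity)
    (by
      filter_upwards [hV0] with x hx
      rw [norm_smul, norm_planeWave, one_mul]
      refine (norm_cutoffSymbol_le b hδ x _).trans ?_
      rw [mul_assoc (symbolBound b)]
      refine mul_le_mul_of_nonneg_left ?_ hB
      refine mul_le_mul (mul_le_of_le_one_right (by positivity) (cutoff_le_one _)) hx
        (norm_nonneg _) (by positivity))
    (.of_forall fun x => by
      rw [norm_smul, norm_smul, norm_neg, Complex.norm_real, Real.norm_of_nonneg (ζ0 x),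
        Real.norm_eq_abs]
      exact (mul_left_comm _ _ _).le)
  have A2 := norm_integral_wavePacket_le (h.isLocallyL2_cross hg hε) mr hδ hJ
    cV1.aestronglyMeasurable hB hV1 (((ε * k : ℝ) : ℂ) * k) (k • θ)
  have A3 := norm_integral_inner_le_localNorm (h.isLocallyL2_amplitude (ε * k) hε) hδ hJ
    (f := fun x => symbolVal b fun l => fderiv ℝ V x (EuclideanSpace.single l 1))
    (g := fun x => planeWave (k • θ) x •
      matCLM (g (ε⁻¹ • x)) (cutoffSymbol b δ x (amplitude η v (ε * k) (ε⁻¹ • x))))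
    cV1.aestronglyMeasurable (ce.aestronglyMeasurable.smul
      ((hg.comp_smul (inv_ne_zero hε.ne')).aestronglyMeasurable_mul
        (aestronglyMeasurable_cutoffSymbol b δ mw)))
    (C := symbolBound b) (C' := c₂ * (symbolBound b * (δ * cutoffBound d))) (by positivity) hB hV1
    (by
      filter_upwards [(hg.comp_smul (inv_ne_zero hε.ne')).upper] with x hx
      rw [norm_smul, norm_planeWave, one_mul, mul_assoc, mul_assoc]
      refine (hx _).trans (mul_le_mul_of_nonneg_left ?_ hc₂)
      refine (norm_cutoffSymbol_le b hδ x _).trans (le_of_eq (by ring)))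
  have A4 := norm_integral_wavePacket_le (h.isLocallyL2_corrector hε) mv hδ hJ
    cV0.aestronglyMeasurable zero_le_one (hV0.mono fun x hx => hx.trans (one_mul _).ge)
    (-((γ : ℂ) * k ^ 2 * ((ε * k : ℝ) : ℂ))) (k • θ)
  have A0 := h.norm_integral_defect_le hg k hε hδ hδ1 hεδ V
  have hY : ContDiff ℝ ∞ fun x => wavePacket (-(k • θ)) δ x • V x :=
    (contDiff_wavePacket _ δ).smul (V.smooth ⊤)
  have hYr : ∀ x, 2 / δ < ‖x‖ → wavePacket (-(k • θ)) δ x • V x = 0 := fun x hx => by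
    rw [wavePacket_eq_zero hδ hx, zero_smul]
  have hYd : ∀ x, 2 / δ < ‖x‖ → fderiv ℝ (fun x => wavePacket (-(k • θ)) δ x • V x) x = 0 :=
    fun x hx => by
      have h1 : (fun x => wavePacket (-(k • θ)) δ x • V x) =ᶠ[𝓝 x] fun _ => 0 :=
        (continuous_norm.continuousAt.eventually (lt_mem_nhds hx)).mono fun y hy => hYr y hy
      rw [h1.fderiv_eq]
      simp
  have hYs : ∀ x, symbolVal b (fun l => fderiv ℝ (fun x => wavePacket (-(k • θ)) δ x • V x) x
      (EuclideanSpace.single l 1)) = wavePacket (-(k • θ)) δ x •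
        symbolVal b (fun l => fderiv ℝ V x (EuclideanSpace.single l 1)) +
      (planeWave (-(k • θ)) x • cutoffSymbol b δ x (V x) -
        ((k : ℂ) * wavePacket (-(k • θ)) δ x) • matCLM (symbol b θ) (V x)) := fun x => by
    have h1 : ∀ l, fderiv ℝ (fun x => wavePacket (-(k • θ)) δ x • V x) x
      (EuclideanSpace.single l 1) =
        wavePacket (-(k • θ)) δ x • fderiv ℝ V x (EuclideanSpace.single l 1) +
        fderiv ℝ (wavePacket (-(k • θ)) δ) x (EuclideanSpace.single l 1) • V x := fun l => by
      rw [fderiv_fun_smul ((contDiff_wavePacket (-(k • θ)) δ (k := 1)).differentiable (by simp) x)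
        V.differentiableAt]
      rfl
    simp only [h1]
    rw [symbolVal_add, symbolVal_smul, symbolVal_fderiv_wavePacket, ← neg_smul, symbol_smul,
      matCLM_smul_apply]
    push_cast
    module
  have hYc : HasCompactSupport fun x => wavePacket (-(k • θ)) δ x • V x :=
    (hasCompactSupport_wavePacket _ hδ).smul_right
  have I0 := (h.isLocallyL2_defect hg hε).integrable_inner hδ hY.continuous hYr
  have I1 := (h.isLocallyL2_flux hg hε).integrable_inner hδ
    (continuous_symbolVal b fun l => (hY.continuous_fderiv (by simp)).clm_apply
      (continuous_const (y := EuclideanSpace.single l (1 : ℝ)))) fun x hx => by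
      simp [hYd x hx, symbolVal]
  -- `residual_identity` at each point; the conjugate of the wave packet is the packet with the
  -- opposite frequency. The underscore stands for the four terms estimated in `A1`–`A4`.
  have hid : ∀ x, ⟪symbolVal b fun l => fderiv ℝ V x (EuclideanSpace.single l 1),
        matCLM (g (ε⁻¹ • x)) (quasiField b θ η v Dv k ε δ x)⟫_ℂ -
        ((γ * k ^ 2 : ℝ) : ℂ) * ⟪V x, quasiMode θ η v k ε δ x⟫_ℂ =
      k * ⟪symbolVal b (fun l => fderiv ℝ (fun x => wavePacket (-(k • θ)) δ x • V x) x
        (EuclideanSpace.single l 1)), waveFlux b g θ η Dv (ε⁻¹ • x)⟫_ℂ +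
      k ^ 2 * ⟪wavePacket (-(k • θ)) δ x • V x, waveDefect b g θ γ η Dv (ε⁻¹ • x)⟫_ℂ + _ :=
    fun x => residual_identity (fun y q => inner_matCLM_left (symbol b θ) y q)
      (by rw [conj_wavePacket, neg_neg]) (by rw [conj_planeWave, neg_neg]) (hYs x)
  have hζz : ∀ x, ⟪planeWave (-(k • θ)) x • cutoffSymbol b δ x (V x),
      (-k : ℂ) • matCLM (g (ε⁻¹ • x)) (waveField b θ η Dv (ε⁻¹ • x))⟫_ℂ =
      ⟪planeWave (-(k • θ)) x • cutoffSymbol b δ x (V x),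
        cutoff d ((δ / 4) • x) • ((-k : ℂ) • waveFlux b g θ η Dv (ε⁻¹ • x))⟫_ℂ := fun x => by
    have e1 : ∀ y, ⟪cutoffSymbol b δ x (V x), y⟫_ℂ =
        (cutoff d ((δ / 4) • x) : ℂ) * ⟪cutoffSymbol b δ x (V x), y⟫_ℂ := fun y => by
      conv_lhs => rw [← cutoff_smul_cutoffSymbol b hδ x (V x), inner_smul_left, Complex.conj_ofReal]
    rw [← Complex.coe_smul (cutoff d ((δ / 4) • x)), inner_smul_right _ _
      ((cutoff d ((δ / 4) • x) : ℝ) : ℂ), inner_smul_left, inner_smul_left, e1, waveFlux]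
    ring
  simp only [hid, hζz]
  -- The term of order `k` vanishes exactly, by the cell equation. This is the effect of the
  -- corrector.
  have W := h.weak_eq_scaled hε hY hYc
  have S := integral_residual_terms I1 I0 A1.1 A2.1 A3.1 A4.1 k (k ^ 2)
  rw [W, mul_zero, zero_add] at S
  refine (congrArg norm S).le.trans ?_
  have n1 : ‖((ε * k : ℝ) : ℂ) * k‖ = ε * (|k| * |k|) := by
    rw [norm_mul, Complex.norm_real, Complex.norm_real, norm_mul, Real.norm_of_nonneg hε.le,
      Real.norm_eq_abs, mul_assoc]
  have n2 : ‖-((γ : ℂ) * k ^ 2 * ((ε * k : ℝ) : ℂ))‖ = ε * (|γ * k ^ 2| * |k|) := by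
    rw [norm_neg, ← Complex.ofReal_pow, ← Complex.ofReal_mul, ← Complex.ofReal_mul,
      Complex.norm_real, Real.norm_eq_abs, abs_mul, abs_mul ε, abs_of_pos hε]
    ring
  have B1 := A1.2
  have B2 := A2.2
  have B3 := A3.2
  have B4 := A4.2
  rw [hJn] at B1 B2 B3 B4
  rw [n1] at B2
  rw [n2] at B4
  refine (norm_add_le _ _).trans ((add_le_add ((norm_mul_le _ _).trans
    (mul_le_mul_of_nonneg_left A0 (norm_nonneg _)))
    ((norm_add_le _ _).trans (add_le_add ((norm_add_le _ _).trans (add_le_add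
      ((norm_add_le _ _).trans (add_le_add B1 B2)) B3)) B4))).trans (le_of_eq ?_))
  rw [norm_pow, Complex.norm_real, Real.norm_eq_abs, sq_abs, residualBound]
  ring

end IsCorrector

end ResidualEstimate

/-! ### Limits of wide cutoffs -/

section WideCutoffs

variable {d : ℕ} {ι κ : Type*} [Fintype ι] [Fintype κ]

/-- The mean value over the cell. -/
noncomputable def cellAverage {F : Type*} [NormedAddCommGroup F] [NormedSpace ℝ F]
    (a : Module.Basis (Fin d) ℝ (EuclideanSpace ℝ (Fin d))) (f : EuclideanSpace ℝ (Fin d) → F) :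
    F := (volume.real (ZSpan.fundamentalDomain a))⁻¹ • ∫ y in ZSpan.fundamentalDomain a, f y

/-- The squared norm of the cutoff function. -/
noncomputable def cutoffMass (d : ℕ) : ℝ := ∫ x, cutoff d x ^ 2

theorem cutoffMass_pos : 0 < cutoffMass d := by
  have hc : Continuous fun x => cutoff d x ^ 2 := continuous_cutoff.pow 2
  refine hc.integral_pos_of_hasCompactSupport_nonneg_nonzero
    (hasCompactSupport_cutoff.comp_left (g := fun r : ℝ => r ^ 2) (by simp))
    (fun x => sq_nonneg _) (x := 0) ?_
  simp [cutoff_zero]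

/-- The bound for the residual in the limit of wide cutoff functions. -/
noncomputable def residualLimit (a : Module.Basis (Fin d) ℝ (EuclideanSpace ℝ (Fin d)))
    (b : Fin d → Matrix κ ι ℂ) (g : EuclideanSpace ℝ (Fin d) → Matrix κ κ ℂ)
    (θ : EuclideanSpace ℝ (Fin d)) (γ : ℝ) (η : EuclideanSpace ℂ ι)
    (v : EuclideanSpace ℝ (Fin d) → EuclideanSpace ℂ ι)
    (Dv : Fin d → EuclideanSpace ℝ (Fin d) → EuclideanSpace ℂ ι) (k : ℝ) : ℝ :=
  k ^ 2 * (cellRadius a * (d * (1 + (cutoffBound d + ‖k • θ‖)))) *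
      meanNorm a (waveDefect b g θ γ η Dv) +
    symbolBound b * (|k| * |k|) * meanNorm a (fun x => matCLM (g x) (matCLM (symbol b θ) (v x))) +
    |γ * k ^ 2| * |k| * meanNorm a v

/-- The value of the quadratic form of `b(D)* g b(D) - γk²` on a corrected wave. -/
noncomputable def quasiEnergy (b : Fin d → Matrix κ ι ℂ)
    (g : EuclideanSpace ℝ (Fin d) → Matrix κ κ ℂ)
    (θ : EuclideanSpace ℝ (Fin d)) (γ : ℝ) (η : EuclideanSpace ℂ ι)
    (v : EuclideanSpace ℝ (Fin d) → EuclideanSpace ℂ ι)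
    (Dv : Fin d → EuclideanSpace ℝ (Fin d) → EuclideanSpace ℂ ι) (k ε δ : ℝ) : ℂ :=
  (∫ x, ⟪quasiField b θ η v Dv k ε δ x, matCLM (g (ε⁻¹ • x)) (quasiField b θ η v Dv k ε δ x)⟫_ℂ) -
    ((γ * k ^ 2 : ℝ) : ℂ) * ∫ x, ⟪quasiMode θ η v k ε δ x, quasiMode θ η v k ε δ x⟫_ℂ

/-- The normalized limit of `quasiEnergy`. -/
noncomputable def meanEnergy (a : Module.Basis (Fin d) ℝ (EuclideanSpace ℝ (Fin d)))
    (b : Fin d → Matrix κ ι ℂ) (g : EuclideanSpace ℝ (Fin d) → Matrix κ κ ℂ)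
    (θ : EuclideanSpace ℝ (Fin d)) (γ : ℝ) (η : EuclideanSpace ℂ ι)
    (v : EuclideanSpace ℝ (Fin d) → EuclideanSpace ℂ ι)
    (Dv : Fin d → EuclideanSpace ℝ (Fin d) → EuclideanSpace ℂ ι) (s : ℝ) : ℂ :=
  cellAverage a (fun y => ⟪fieldAmplitude b θ η v Dv s y,
      matCLM (g y) (fieldAmplitude b θ η v Dv s y)⟫_ℂ) -
    (γ : ℂ) * cellAverage a (fun y => ⟪amplitude η v s y, amplitude η v s y⟫_ℂ)

theorem tendsto_sqrt_pow_mul {f : ℝ → ℝ} {L : ℝ}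
    (h : Tendsto (fun δ : ℝ => √(δ ^ d) * f δ) (𝓝[>] 0) (𝓝 L)) (c : ℝ) :
    Tendsto (fun δ : ℝ => √(δ ^ d) * (c * f δ)) (𝓝[>] 0) (𝓝 (c * L)) := by
  simpa only [mul_left_comm c] using h.const_mul c

namespace IsCorrector

variable {a : Module.Basis (Fin d) ℝ (EuclideanSpace ℝ (Fin d))}
  {b : Fin d → Matrix κ ι ℂ} {g : EuclideanSpace ℝ (Fin d) → Matrix κ κ ℂ}
  {θ : EuclideanSpace ℝ (Fin d)} {γ : ℝ} {η : EuclideanSpace ℂ ι}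
  {v : EuclideanSpace ℝ (Fin d) → EuclideanSpace ℂ ι}
  {Dv : Fin d → EuclideanSpace ℝ (Fin d) → EuclideanSpace ℂ ι}
  (h : IsCorrector a b g θ γ η v Dv) {c₁ c₂ : ℝ}

theorem residualBound_nonneg (hc₂ : 0 ≤ c₂) (k : ℝ) {ε δ : ℝ} (hε : 0 < ε) (hδ : 0 < δ) :
    0 ≤ residualBound a b g θ γ η v Dv c₂ k ε δ := by
  have hB := symbolBound_nonneg b
  have hK := cutoffBound_nonneg (d := d)
  have hr := cellRadius_nonneg (a := a)
  have l1 := localNorm_nonneg δ (fun x => waveDefect b g θ γ η Dv (ε⁻¹ • x))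
  have l2 := localNorm_nonneg δ
    (fun x => matCLM (g (ε⁻¹ • x)) (matCLM (symbol b θ) (v (ε⁻¹ • x))))
  have l3 := localNorm_nonneg δ (fun x => v (ε⁻¹ • x))
  have l4 := localNorm_nonneg δ (fun x => waveFlux b g θ η Dv (ε⁻¹ • x))
  have l5 := localNorm_nonneg δ (fun x => amplitude η v (ε * k) (ε⁻¹ • x))
  rw [residualBound]
  generalize localNorm δ (fun x => waveDefect b g θ γ η Dv (ε⁻¹ • x)) = x₁ at l1 ⊢
  generalize localNorm δ (fun x => matCLM (g (ε⁻¹ • x)) (matCLM (symbol b θ) (v (ε⁻¹ • x)))) = x₂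
    at l2 ⊢
  generalize localNorm δ (fun x => v (ε⁻¹ • x)) = x₃ at l3 ⊢
  generalize localNorm δ (fun x => waveFlux b g θ η Dv (ε⁻¹ • x)) = x₄ at l4 ⊢
  generalize localNorm δ (fun x => amplitude η v (ε * k) (ε⁻¹ • x)) = x₅ at l5 ⊢
  positivity

include h in
theorem tendsto_amplitude (s : ℝ) {ε : ℝ} (hε : 0 < ε) :
    Tendsto (fun δ : ℝ => √(δ ^ d) * localNorm δ fun x => amplitude η v s (ε⁻¹ • x)) (𝓝[>] 0)
      (𝓝 (meanNorm a (amplitude η v s))) :=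
  (h.periodic_amplitude s).tendsto_localNorm (h.aestronglyMeasurable_amplitude s)
    (h.memLp_amplitude s) hε

-- The part of the bound proportional to `δ` comes from derivatives of the cutoff; the normalized
-- norms multiplying it converge, so only the part proportional to `ε` survives.
include h in
theorem tendsto_residualBound (hg : IsEllipticCoeff volume g c₁ c₂) (k : ℝ) {ε : ℝ} (hε : 0 < ε) :
    Tendsto (fun δ : ℝ => √(δ ^ d) * residualBound a b g θ γ η v Dv c₂ k ε δ) (𝓝[>] 0)
      (𝓝 (ε * residualLimit a b g θ γ η v Dv k)) := by
  have t1 := h.periodic_defect.tendsto_localNorm (h.aestronglyMeasurable_defect hg)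
    (h.memLp_defect hg) hε
  have t2 := h.periodic_cross.tendsto_localNorm (h.aestronglyMeasurable_cross hg)
    (h.memLp_cross hg) hε
  have t3 := h.periodic.tendsto_localNorm h.aestronglyMeasurable h.memLp hε
  have t4 := h.periodic_flux.tendsto_localNorm (h.aestronglyMeasurable_flux hg)
    (h.memLp_flux hg) hε
  have t5 := h.tendsto_amplitude (ε * k) hε
  have t0 : Tendsto (fun δ : ℝ => δ) (𝓝[>] 0) (𝓝 0) := tendsto_nhdsWithin_of_tendsto_nhds tendsto_id
  have key := ((((t1.const_mul
      (k ^ 2 * (cellRadius a * (d * (1 + (cutoffBound d + ‖k • θ‖)))))).add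
    (t2.const_mul (symbolBound b * (|k| * |k|)))).add
    (t3.const_mul (|γ * k ^ 2| * |k|))).const_mul ε).add
    (t0.mul ((t4.const_mul (symbolBound b * cutoffBound d * |k|)).add
      (t5.const_mul (symbolBound b * (c₂ * (symbolBound b * cutoffBound d))))))
  rw [zero_mul, add_zero] at key
  refine key.congr fun δ => ?_
  rw [residualBound]
  ring

-- This applies `resolvent_quasimode` to the jet of the corrected wave, with
-- `norm_integral_residual_le` as its hypothesis, and identifies the form value with `quasiEnergy`.
include h in
theorem resolvent_le {c : ℝ} (hb : IsEllipticSymbol b c) (hg : IsEllipticCoeff volume g c₁ c₂)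
    (hc₂ : 0 ≤ c₂) (hγ : 0 ≤ γ) (k : ℝ) {ε δ : ℝ} (hε : 0 < ε) (hδ : 0 < δ)
    (hδ1 : δ ≤ 1) (hεδ : δ * (ε * cellRadius a) ≤ 2) {u : L2 d ι}
    (hu : u =ᵐ[volume] quasiMode θ η v k ε δ) :
    ‖resolventNegOne (divForm b fun x => g (ε⁻¹ • x)) u - (((1 + γ * k ^ 2)⁻¹ : ℝ) : ℂ) • u‖ ≤
      residualBound a b g θ γ η v Dv c₂ k ε δ / energyConst d c c₁ ∧
    ‖⟪u, resolventNegOne (divForm b fun x => g (ε⁻¹ • x)) u -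
        (((1 + γ * k ^ 2)⁻¹ : ℝ) : ℂ) • u⟫_ℂ + (((1 + γ * k ^ 2)⁻¹ : ℝ) : ℂ) ^ 2 *
        quasiEnergy b g θ γ η v Dv k ε δ‖ ≤
      residualBound a b g θ γ η v Dv c₂ k ε δ ^ 2 / energyConst d c c₁ := by
  obtain ⟨U, hU, hU0, hU1⟩ := h.exists_jet_quasiMode k hε hδ
  have hgε := hg.comp_smul (inv_ne_zero hε.ne')
  have hu' : u = compL volume none U := Lp.ext (hu.trans hU0.symm)
  have hV : ∀ V, ‖⟪symbolL volume b (schwartzJet V), hgε.mulL (symbolL volume b U)⟫_ℂ -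
      ((γ * k ^ 2 : ℝ) : ℂ) * ⟪compL volume none (schwartzJet V), compL volume none U⟫_ℂ‖ ≤
      residualBound a b g θ γ η v Dv c₂ k ε δ * ‖schwartzJet V‖ := fun V => by
    have e := h.norm_integral_residual_le hg hc₂ k hε hδ hδ1 hεδ V
    refine le_trans (le_of_eq (congrArg norm ?_)) e
    rw [L2.inner_def, L2.inner_def, ← integral_const_mul, ← integral_sub
      (L2.integrable_inner _ _) ((L2.integrable_inner _ _).const_mul _)]
    refine integral_congr_ae ?_
    filter_upwards [ae_schwartzJet V, ae_symbolL b (schwartzJet V), ae_compL (schwartzJet V),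
      hgε.coeFn_mulL (symbolL volume b U), hU0, hU1] with x h1 h2 h3 h4 h5 h6
    rw [h2, h4, h5, h6, h3, h1.1, jetSymbol_eq_symbolVal]
    simp only [h1.2]
  have hE : ⟪symbolL volume b U, hgε.mulL (symbolL volume b U)⟫_ℂ -
      ((γ * k ^ 2 : ℝ) : ℂ) * ⟪compL volume none U, compL volume none U⟫_ℂ =
      quasiEnergy b g θ γ η v Dv k ε δ := by
    have e1 : ⟪symbolL volume b U, hgε.mulL (symbolL volume b U)⟫_ℂ =
        ∫ x, ⟪quasiField b θ η v Dv k ε δ x,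
          matCLM (g (ε⁻¹ • x)) (quasiField b θ η v Dv k ε δ x)⟫_ℂ := by
      rw [L2.inner_def]
      refine integral_congr_ae ?_
      filter_upwards [hgε.coeFn_mulL (symbolL volume b U), hU1] with x h4 h6
      rw [h4, h6]
    have e2 : ⟪compL volume none U, compL volume none U⟫_ℂ =
        ∫ x, ⟪quasiMode θ η v k ε δ x, quasiMode θ η v k ε δ x⟫_ℂ := by
      rw [L2.inner_def]
      refine integral_congr_ae ?_
      filter_upwards [hU0] with x h4
      rw [h4]
    rw [e1, e2, quasiEnergy]
  have hR := resolvent_quasimode hb hgε (mul_nonneg hγ (sq_nonneg k)) hU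
    (residualBound_nonneg hc₂ k hε hδ) hV
  rw [hE] at hR
  rw [hu']
  exact hR

end IsCorrector

end WideCutoffs

/-! ### Normalized limits of the norms and energies of wave packets. -/

section WideCutoffLimits

variable {d : ℕ} {ι κ : Type*} [Fintype ι] [Fintype κ]

/-- The limit of the normalized norms of wave packets with a periodic factor. -/
noncomputable def waveNorm {F : Type*} [NormedAddCommGroup F]
    (a : Module.Basis (Fin d) ℝ (EuclideanSpace ℝ (Fin d))) (h : EuclideanSpace ℝ (Fin d) → F) :
    ℝ := √(cutoffMass d * cellAverage a fun y => ‖h y‖ ^ 2)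

theorem tendsto_wavePacket {F : Type*} [NormedAddCommGroup F] [NormedSpace ℂ F]
    {a : Module.Basis (Fin d) ℝ (EuclideanSpace ℝ (Fin d))} {h : EuclideanSpace ℝ (Fin d) → F}
    (hp : IsLatticePeriodic a h) (hm : AEStronglyMeasurable h volume)
    (h2 : MemLp h 2 (volume.restrict (ZSpan.fundamentalDomain a))) {ε : ℝ} (hε : 0 < ε)
    (ξ : EuclideanSpace ℝ (Fin d)) :
    Tendsto (fun δ : ℝ => √(δ ^ d) *
        (eLpNorm (fun x => wavePacket ξ δ x • h (ε⁻¹ • x)) 2 volume).toReal) (𝓝[>] 0)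
      (𝓝 (waveNorm a h)) := by
  have h3 := hp.tendsto_norm_sq hm h2 hε continuous_cutoff hasCompactSupport_cutoff
  refine h3.congr fun δ => ?_
  congr 2
  refine eLpNorm_congr_norm_ae (.of_forall fun x => ?_)
  rw [norm_smul, norm_smul, norm_wavePacket, Real.norm_of_nonneg (cutoff_nonneg _)]

theorem integral_inner_add_self {α F : Type*} [MeasurableSpace α] {μ : Measure α}
    [NormedAddCommGroup F] [InnerProductSpace ℂ F] (G : α → F →L[ℂ] F) {P E : α → F}
    (h1 : Integrable (fun x => ⟪P x, G x (P x)⟫_ℂ) μ)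
    (h2 : Integrable (fun x => ⟪P x, G x (E x)⟫_ℂ) μ)
    (h3 : Integrable (fun x => ⟪E x, G x (P x)⟫_ℂ) μ)
    (h4 : Integrable (fun x => ⟪E x, G x (E x)⟫_ℂ) μ) :
    ∫ x, ⟪P x + E x, G x (P x + E x)⟫_ℂ ∂μ =
      ∫ x, ⟪P x, G x (P x)⟫_ℂ ∂μ + (∫ x, ⟪P x, G x (E x)⟫_ℂ ∂μ +
        ∫ x, ⟪E x, G x (P x)⟫_ℂ ∂μ + ∫ x, ⟪E x, G x (E x)⟫_ℂ ∂μ) := by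
  have e1 := integral_add h1 ((h2.add h3).add h4)
  have e2 := integral_add (h2.add h3) h4
  have e3 := integral_add h2 h3
  simp only [Pi.add_apply] at e1 e2 e3
  rw [← e3, ← e2, ← e1]
  refine integral_congr_ae (.of_forall fun x => ?_)
  simp only [map_add, inner_add_left, inner_add_right]
  ring

theorem IsEllipticCoeff.norm_integral_inner_mul_le {α : Type*} [MeasurableSpace α] {μ : Measure α}
    {g : α → Matrix κ κ ℂ} {c₁ c₂ : ℝ} (hg : IsEllipticCoeff μ g c₁ c₂) (hc₂ : 0 ≤ c₂)
    {f f' : α → EuclideanSpace ℂ κ} (hf : MemLp f 2 μ) (hf' : MemLp f' 2 μ) :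
    Integrable (fun x => ⟪f x, matCLM (g x) (f' x)⟫_ℂ) μ ∧
      ‖∫ x, ⟪f x, matCLM (g x) (f' x)⟫_ℂ ∂μ‖ ≤
        c₂ * ((eLpNorm f 2 μ).toReal * (eLpNorm f' 2 μ).toReal) := by
  have h1 := hg.memLp_mul hf'
  refine ⟨hf.integrable_inner_of_two h1, ?_⟩
  have h2 := norm_integral_inner_le hf (C := 1) (.of_forall fun x => (one_mul _).ge) h1
  have h3 : (eLpNorm (fun x => matCLM (g x) (f' x)) 2 μ).toReal ≤
      c₂ * (eLpNorm f' 2 μ).toReal := by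
    have h4 := eLpNorm_le_mul_eLpNorm_of_ae_le_mul (hg.upper.mono fun x hx => hx (f' x)) 2
    have h5 := ENNReal.toReal_mono (ENNReal.mul_ne_top ENNReal.ofReal_ne_top hf'.2.ne) h4
    rwa [ENNReal.toReal_mul, ENNReal.toReal_ofReal hc₂] at h5
  refine h2.trans ?_
  rw [one_mul, mul_left_comm]
  exact mul_le_mul_of_nonneg_left h3 ENNReal.toReal_nonneg

theorem cellAverage_expansion {a : Module.Basis (Fin d) ℝ (EuclideanSpace ℝ (Fin d))}
    {f₀ f₁ f₂ : EuclideanSpace ℝ (Fin d) → ℂ}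
    (h₀ : Integrable f₀ (volume.restrict (ZSpan.fundamentalDomain a)))
    (h₁ : Integrable f₁ (volume.restrict (ZSpan.fundamentalDomain a)))
    (h₂ : Integrable f₂ (volume.restrict (ZSpan.fundamentalDomain a))) (s : ℂ) :
    cellAverage a (fun y => f₀ y + s * f₁ y + s ^ 2 * f₂ y) =
      cellAverage a f₀ + s * cellAverage a f₁ + s ^ 2 * cellAverage a f₂ := by
  have e1 := integral_add (h₀.add (h₁.const_mul s)) (h₂.const_mul (s ^ 2))
  have e2 := integral_add h₀ (h₁.const_mul s)
  simp only [Pi.add_apply, integral_const_mul] at e1 e2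
  simp only [cellAverage, e1, e2, Complex.real_smul]
  ring

namespace IsCorrector

variable {a : Module.Basis (Fin d) ℝ (EuclideanSpace ℝ (Fin d))}
  {b : Fin d → Matrix κ ι ℂ} {g : EuclideanSpace ℝ (Fin d) → Matrix κ κ ℂ}
  {θ : EuclideanSpace ℝ (Fin d)} {γ : ℝ} {η : EuclideanSpace ℂ ι}
  {v : EuclideanSpace ℝ (Fin d) → EuclideanSpace ℂ ι}
  {Dv : Fin d → EuclideanSpace ℝ (Fin d) → EuclideanSpace ℂ ι}
  (h : IsCorrector a b g θ γ η v Dv) {c₁ c₂ : ℝ}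
include h

theorem tendsto_quasiMode (k : ℝ) {ε : ℝ} (hε : 0 < ε) :
    Tendsto (fun δ : ℝ => √(δ ^ d) * (eLpNorm (quasiMode θ η v k ε δ) 2 volume).toReal)
      (𝓝[>] 0) (𝓝 (waveNorm a (amplitude η v (ε * k)))) :=
  tendsto_wavePacket (h.periodic_amplitude _) (h.aestronglyMeasurable_amplitude _)
    (h.memLp_amplitude _) hε _

/-- The difference between the corrected and the plain wave is the corrector alone, of size `ε|k|`.
It later multiplies a residual that is also `O(ε)`. -/
theorem tendsto_quasiMode_sub (k : ℝ) {ε : ℝ} (hε : 0 < ε) :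
    Tendsto (fun δ : ℝ => √(δ ^ d) *
      (eLpNorm (quasiMode θ η v k ε δ - quasiMode θ η 0 k ε δ) 2 volume).toReal)
      (𝓝[>] 0) (𝓝 (ε * |k| * waveNorm a v)) := by
  have h1 := tendsto_sqrt_pow_mul (tendsto_wavePacket h.periodic h.aestronglyMeasurable h.memLp hε
    (k • θ)) (ε * |k|)
  refine h1.congr fun δ => ?_
  have e : quasiMode θ η v k ε δ - quasiMode θ η 0 k ε δ =
      ((ε * k : ℝ) : ℂ) • fun x => wavePacket (k • θ) δ x • v (ε⁻¹ • x) := by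
    funext x
    simp only [Pi.sub_apply, Pi.smul_apply, quasiMode, amplitude, Pi.zero_apply, smul_zero,
      add_zero, smul_add, add_sub_cancel_left]
    rw [smul_comm]
  rw [e, eLpNorm_const_smul, ENNReal.toReal_mul]
  congr 2
  rw [toReal_enorm, Complex.norm_real, norm_mul, Real.norm_of_nonneg hε.le, Real.norm_eq_abs]

theorem tendsto_integral_quasiMode (k : ℝ) {ε : ℝ} (hε : 0 < ε) :
    Tendsto (fun δ : ℝ => ((δ ^ d : ℝ) : ℂ) *
        ∫ x, ⟪quasiMode θ η v k ε δ x, quasiMode θ η v k ε δ x⟫_ℂ) (𝓝[>] 0)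
      (𝓝 (cutoffMass d * cellAverage a fun y =>
        ⟪amplitude η v (ε * k) y, amplitude η v (ε * k) y⟫_ℂ)) := by
  have h1 := ((h.periodic_amplitude (ε * k)).comp fun z => ⟪z, z⟫_ℂ).tendsto_average
    ((h.aestronglyMeasurable_amplitude (ε * k)).inner (h.aestronglyMeasurable_amplitude (ε * k)))
    ((h.memLp_amplitude (ε * k)).integrable_inner_of_two (h.memLp_amplitude (ε * k)))
    (χ := fun x => cutoff d x ^ 2) (continuous_cutoff.pow 2)
    (hasCompactSupport_cutoff.comp_left (g := fun r : ℝ => r ^ 2) (by simp)) hε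
  rw [Complex.real_smul] at h1
  refine h1.congr fun δ => ?_
  rw [Complex.real_smul]
  congr 1
  refine integral_congr_ae (.of_forall fun x => ?_)
  simp only [quasiMode, inner_smul_left, inner_smul_right, Complex.real_smul]
  rw [← mul_assoc, Complex.mul_conj', norm_wavePacket]
  push_cast
  rfl

theorem tendsto_integral_quasiField (hg : IsEllipticCoeff volume g c₁ c₂) (hc₂ : 0 ≤ c₂)
    (k : ℝ) {ε : ℝ} (hε : 0 < ε) :
    Tendsto (fun δ : ℝ => ((δ ^ d : ℝ) : ℂ) * ∫ x, ⟪quasiField b θ η v Dv k ε δ x,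
        matCLM (g (ε⁻¹ • x)) (quasiField b θ η v Dv k ε δ x)⟫_ℂ) (𝓝[>] 0)
      (𝓝 (k ^ 2 * (cutoffMass d * cellAverage a fun y => ⟪fieldAmplitude b θ η v Dv (ε * k) y,
        matCLM (g y) (fieldAmplitude b θ η v Dv (ε * k) y)⟫_ℂ))) := by
  have hgε := hg.comp_smul (inv_ne_zero hε.ne')
  have hq := quasiMeasurePreserving_smul_volume (d := d) (inv_ne_zero hε.ne')
  have mΦ := h.aestronglyMeasurable_fieldAmplitude (ε * k)
  have mw := h.aestronglyMeasurable_amplitude (ε * k)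
  have hB := mul_nonneg (symbolBound_nonneg b) (cutoffBound_nonneg (d := d))
  -- The field splits into a wave packet `P` with a periodic amplitude and the commutator `E` with
  -- the cutoff. The normalized norm of `E` is `O(δ)`, so only the energy of `P` contributes, and
  -- there the modulus of the packet leaves `χ(δx)²` as the weight.
  set P : ℝ → EuclideanSpace ℝ (Fin d) → EuclideanSpace ℂ κ := fun δ x =>
    (k * wavePacket (k • θ) δ x) • fieldAmplitude b θ η v Dv (ε * k) (ε⁻¹ • x) with hP
  set E : ℝ → EuclideanSpace ℝ (Fin d) → EuclideanSpace ℂ κ := fun δ x =>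
    planeWave (k • θ) x • cutoffSymbol b δ x (amplitude η v (ε * k) (ε⁻¹ • x)) with hE
  have mP : ∀ δ, AEStronglyMeasurable (P δ) volume := fun δ =>
    (continuous_const.mul (contDiff_wavePacket (k := 0) (k • θ) δ).continuous).aestronglyMeasurable.smul
      (mΦ.comp_quasiMeasurePreserving hq)
  have mE : ∀ δ, AEStronglyMeasurable (E δ) volume := fun δ =>
    (contDiff_planeWave (k • θ) (k := 0)).continuous.aestronglyMeasurable.smul
      (aestronglyMeasurable_cutoffSymbol b δ (mw.comp_quasiMeasurePreserving hq))
  have bP : ∀ δ, 0 < δ → ∀ x, ‖P δ x‖ ≤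
      |k| * (cutoff d ((δ / 4) • x) * ‖fieldAmplitude b θ η v Dv (ε * k) (ε⁻¹ • x)‖) :=
    fun δ hδ x => by
      rw [hP]
      simp only
      rw [norm_smul, norm_mul, norm_wavePacket, Complex.norm_real, Real.norm_eq_abs, mul_assoc]
      exact mul_le_mul_of_nonneg_left
        (mul_le_mul_of_nonneg_right (cutoff_smul_le hδ x) (norm_nonneg _)) (abs_nonneg k)
  have bE : ∀ δ, 0 < δ → ∀ x, ‖E δ x‖ ≤ δ * (symbolBound b * cutoffBound d) *
      (cutoff d ((δ / 4) • x) * ‖amplitude η v (ε * k) (ε⁻¹ • x)‖) := fun δ hδ x => by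
    rw [hE]
    simp only
    rw [norm_smul, norm_planeWave, one_mul]
    exact (norm_cutoffSymbol_le b hδ x _).trans (le_of_eq (by ring))
  have lP : ∀ δ, 0 < δ → MemLp (P δ) 2 volume := fun δ hδ =>
    (h.isLocallyL2_fieldAmplitude (ε * k) hε).memLp_of_norm_le hδ (mP δ) (.of_forall (bP δ hδ))
  have lE : ∀ δ, 0 < δ → MemLp (E δ) 2 volume := fun δ hδ =>
    (h.isLocallyL2_amplitude (ε * k) hε).memLp_of_norm_le hδ (mE δ) (.of_forall (bE δ hδ))
  have nP : Tendsto (fun δ : ℝ => √(δ ^ d) * (eLpNorm (P δ) 2 volume).toReal) (𝓝[>] 0)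
      (𝓝 (|k| * waveNorm a (fieldAmplitude b θ η v Dv (ε * k)))) := by
    have h1 := tendsto_sqrt_pow_mul (tendsto_wavePacket (h.periodic_fieldAmplitude (ε * k)) mΦ
      (h.memLp_fieldAmplitude (ε * k)) hε (k • θ)) |k|
    refine h1.congr fun δ => ?_
    have e : P δ = (k : ℂ) • fun x => wavePacket (k • θ) δ x •
        fieldAmplitude b θ η v Dv (ε * k) (ε⁻¹ • x) := by
      funext x
      exact mul_smul _ _ _
    rw [e, eLpNorm_const_smul, ENNReal.toReal_mul, toReal_enorm, Complex.norm_real,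
      Real.norm_eq_abs]
  have nE : Tendsto (fun δ : ℝ => √(δ ^ d) * (eLpNorm (E δ) 2 volume).toReal) (𝓝[>] 0)
      (𝓝 0) := by
    have t0 : Tendsto (fun δ : ℝ => δ * (symbolBound b * cutoffBound d)) (𝓝[>] 0) (𝓝 0) := by
      have := (tendsto_id (α := ℝ) (x := 𝓝 0)).mul_const (symbolBound b * cutoffBound d)
      rw [zero_mul] at this
      exact tendsto_nhdsWithin_of_tendsto_nhds this
    have h1 := t0.mul (h.tendsto_amplitude (ε * k) hε)
    rw [zero_mul] at h1
    refine squeeze_zero' (.of_forall fun δ => by positivity) ?_ h1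
    filter_upwards [self_mem_nhdsWithin] with δ hδ
    have hδ : 0 < δ := hδ
    have h2 := (h.isLocallyL2_amplitude (ε * k) hε).eLpNorm_toReal_le hδ (by positivity)
      (.of_forall (bE δ hδ))
    calc _ ≤ √(δ ^ d) * (δ * (symbolBound b * cutoffBound d) *
          localNorm δ fun x => amplitude η v (ε * k) (ε⁻¹ • x)) :=
          mul_le_mul_of_nonneg_left h2 (Real.sqrt_nonneg _)
      _ = _ := by ring
  have pΨ : IsLatticePeriodic a fun y => ⟪fieldAmplitude b θ η v Dv (ε * k) y,
      matCLM (g y) (fieldAmplitude b θ η v Dv (ε * k) y)⟫_ℂ := fun j x => by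
    simp only [h.coeff_periodic j x, h.periodic_fieldAmplitude (ε * k) j x]
  have main := pΨ.tendsto_average (mΦ.inner (hg.aestronglyMeasurable_mul mΦ))
    ((h.memLp_fieldAmplitude (ε * k)).integrable_inner_of_two
      ((hg.restrict _).memLp_mul (h.memLp_fieldAmplitude (ε * k))))
    (χ := fun x => cutoff d x ^ 2) (continuous_cutoff.pow 2)
    (hasCompactSupport_cutoff.comp_left (g := fun r : ℝ => r ^ 2) (by simp)) hε
  rw [Complex.real_smul] at main
  have main' := main.const_mul ((k : ℂ) ^ 2)
  have hPP : ∀ δ : ℝ, (k : ℂ) ^ 2 * (δ ^ d • ∫ x, cutoff d (δ • x) ^ 2 •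
      ⟪fieldAmplitude b θ η v Dv (ε * k) (ε⁻¹ • x),
      matCLM (g (ε⁻¹ • x)) (fieldAmplitude b θ η v Dv (ε * k) (ε⁻¹ • x))⟫_ℂ) =
      ((δ ^ d : ℝ) : ℂ) * ∫ x, ⟪P δ x, matCLM (g (ε⁻¹ • x)) (P δ x)⟫_ℂ := fun δ => by
    rw [Complex.real_smul, mul_left_comm, ← integral_const_mul]
    congr 1
    refine integral_congr_ae (.of_forall fun x => ?_)
    simp only [hP, map_smul, inner_smul_left, inner_smul_right, Complex.real_smul, map_mul,
      Complex.conj_ofReal]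
    have e := Complex.mul_conj' (wavePacket (k • θ) δ x)
    rw [norm_wavePacket] at e
    push_cast
    rw [← e]
    ring
  have small : Tendsto (fun δ : ℝ => ((δ ^ d : ℝ) : ℂ) *
      ((∫ x, ⟪P δ x, matCLM (g (ε⁻¹ • x)) (E δ x)⟫_ℂ) +
        (∫ x, ⟪E δ x, matCLM (g (ε⁻¹ • x)) (P δ x)⟫_ℂ) +
        ∫ x, ⟪E δ x, matCLM (g (ε⁻¹ • x)) (E δ x)⟫_ℂ)) (𝓝[>] 0) (𝓝 0) := by
    have h1 := (((nP.mul nE).add (nE.mul nP)).add (nE.mul nE)).const_mul c₂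
    rw [mul_zero, zero_mul, zero_mul, add_zero, add_zero, mul_zero] at h1
    refine squeeze_zero_norm' ?_ h1
    filter_upwards [self_mem_nhdsWithin] with δ hδ
    have hδ : 0 < δ := hδ
    have b1 := (hgε.norm_integral_inner_mul_le hc₂ (lP δ hδ) (lE δ hδ)).2
    have b2 := (hgε.norm_integral_inner_mul_le hc₂ (lE δ hδ) (lP δ hδ)).2
    have b3 := (hgε.norm_integral_inner_mul_le hc₂ (lE δ hδ) (lE δ hδ)).2
    rw [norm_mul, Complex.norm_real, Real.norm_of_nonneg (by positivity)]
    refine (mul_le_mul_of_nonneg_left ((norm_add_le _ _).trans (add_le_add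
      ((norm_add_le _ _).trans (add_le_add b1 b2)) b3)) (by positivity)).trans (le_of_eq ?_)
    nth_rewrite 1 [← Real.mul_self_sqrt (by positivity : 0 ≤ δ ^ d)]
    ring
  have fin := main'.add small
  rw [add_zero] at fin
  refine fin.congr' ?_
  filter_upwards [self_mem_nhdsWithin] with δ hδ
  have hδ : 0 < δ := hδ
  rw [hPP, ← mul_add]
  congr 1
  exact (integral_inner_add_self (fun x => matCLM (g (ε⁻¹ • x)))
    (hgε.norm_integral_inner_mul_le hc₂ (lP δ hδ) (lP δ hδ)).1
    (hgε.norm_integral_inner_mul_le hc₂ (lP δ hδ) (lE δ hδ)).1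
    (hgε.norm_integral_inner_mul_le hc₂ (lE δ hδ) (lP δ hδ)).1
    (hgε.norm_integral_inner_mul_le hc₂ (lE δ hδ) (lE δ hδ)).1).symm

theorem tendsto_quasiEnergy (hg : IsEllipticCoeff volume g c₁ c₂) (hc₂ : 0 ≤ c₂)
    (k : ℝ) {ε : ℝ} (hε : 0 < ε) :
    Tendsto (fun δ : ℝ => ((δ ^ d : ℝ) : ℂ) * quasiEnergy b g θ γ η v Dv k ε δ) (𝓝[>] 0)
      (𝓝 (cutoffMass d * k ^ 2 * meanEnergy a b g θ γ η v Dv (ε * k))) := by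
  have h1 := (h.tendsto_integral_quasiField hg hc₂ k hε).sub
    ((h.tendsto_integral_quasiMode k hε).const_mul ((γ * k ^ 2 : ℝ) : ℂ))
  have e : ∀ X Y : ℂ, (cutoffMass d : ℂ) * k ^ 2 * (X - γ * Y) =
      k ^ 2 * (cutoffMass d * X) - ((γ * k ^ 2 : ℝ) : ℂ) * (cutoffMass d * Y) := fun X Y => by
    push_cast
    ring
  rw [meanEnergy, e]
  refine h1.congr fun δ => ?_
  rw [quasiEnergy]
  ring

/-- The expansion of the energy of the corrected wave in the small parameter. -/
theorem exists_meanEnergy_eq (hg : IsEllipticCoeff volume g c₁ c₂)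
    (hv : ∫ y in ZSpan.fundamentalDomain a, v y = 0)
    (hE : cellAverage a (fun y => ⟪waveField b θ η Dv y, waveFlux b g θ η Dv y⟫_ℂ) =
      γ * ⟪η, η⟫_ℂ) :
    ∃ B : ℂ, ∀ s : ℝ, meanEnergy a b g θ γ η v Dv s =
      s * cellAverage a (fun y => ⟪waveFlux b g θ η Dv y, matCLM (symbol b θ) (v y)⟫_ℂ +
        ⟪matCLM (symbol b θ) (v y), waveFlux b g θ η Dv y⟫_ℂ) + s ^ 2 * B := by
  set Ω := ZSpan.fundamentalDomain a
  have hgΩ := hg.restrict Ω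
  have lF := h.memLp_field
  have lq := h.memLp_flux hg
  have lB : MemLp (fun y => matCLM (symbol b θ) (v y)) 2 (volume.restrict Ω) :=
    (matCLM (symbol b θ)).comp_memLp' h.memLp
  have lr := h.memLp_cross hg
  -- The terms without `s` cancel by `hE`, and the linear term of `⟪amplitude, amplitude⟫` vanishes
  -- because `v` has mean value zero. The coefficient of `s ^ 2` is the witness.
  refine ⟨cellAverage a (fun y => ⟪matCLM (symbol b θ) (v y),
    matCLM (g y) (matCLM (symbol b θ) (v y))⟫_ℂ) - γ * cellAverage a (fun y => ⟪v y, v y⟫_ℂ),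
    fun s => ?_⟩
  have i1 := lF.integrable_inner_of_two lq
  have i2 := lq.integrable_inner_of_two lB
  have i3 := lB.integrable_inner_of_two lq
  have i4 := lB.integrable_inner_of_two lr
  have e1 : ∫ y in Ω, ⟪fieldAmplitude b θ η v Dv s y,
      matCLM (g y) (fieldAmplitude b θ η v Dv s y)⟫_ℂ =
      ∫ y in Ω, (⟪waveField b θ η Dv y, waveFlux b g θ η Dv y⟫_ℂ +
        s * (⟪waveFlux b g θ η Dv y, matCLM (symbol b θ) (v y)⟫_ℂ +
        ⟪matCLM (symbol b θ) (v y), waveFlux b g θ η Dv y⟫_ℂ) +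
        s ^ 2 * ⟪matCLM (symbol b θ) (v y), matCLM (g y) (matCLM (symbol b θ) (v y))⟫_ℂ) := by
    refine integral_congr_ae (hgΩ.hermitian.mono fun y hy => ?_)
    have e0 : ⟪waveFlux b g θ η Dv y, matCLM (symbol b θ) (v y)⟫_ℂ =
        ⟪waveField b θ η Dv y, matCLM (g y) (matCLM (symbol b θ) (v y))⟫_ℂ := by
      rw [waveFlux, inner_matCLM_left, hy.eq]
    simp only [e0]
    simp only [fieldAmplitude, waveFlux, map_add, map_smul, inner_add_left, inner_add_right,
      inner_smul_left, inner_smul_right, Complex.conj_ofReal]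
    ring
  have e2 : ∫ y in Ω, ⟪amplitude η v s y, amplitude η v s y⟫_ℂ =
      ∫ y in Ω, (⟪η, η⟫_ℂ + s * (⟪η, v y⟫_ℂ + ⟪v y, η⟫_ℂ) + s ^ 2 * ⟪v y, v y⟫_ℂ) := by
    refine integral_congr_ae (.of_forall fun y => ?_)
    simp only [amplitude, inner_add_left, inner_add_right,
      inner_smul_left, inner_smul_right, Complex.conj_ofReal]
    ring
  have iv : Integrable v (volume.restrict Ω) := h.memLp.integrable one_le_two
  have z1 : ∫ y in Ω, ⟪η, v y⟫_ℂ = 0 := by rw [integral_inner iv, hv, inner_zero_right]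
  have z2 : ∫ y in Ω, ⟪v y, η⟫_ℂ = 0 := by
    have e3 : ∀ y, ⟪v y, η⟫_ℂ = (starRingEnd ℂ) ⟪η, v y⟫_ℂ := fun y => (inner_conj_symm _ _).symm
    simp only [e3]
    rw [integral_conj, z1, map_zero]
  have i5 : Integrable (fun y => ⟪η, v y⟫_ℂ + ⟪v y, η⟫_ℂ) (volume.restrict Ω) :=
    (iv.const_inner η).add (iv.inner_const η)
  have z3 : cellAverage a (fun y => ⟪η, v y⟫_ℂ + ⟪v y, η⟫_ℂ) = 0 := by
    rw [cellAverage, integral_add (iv.const_inner η) (iv.inner_const η), z1, z2, add_zero,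
      smul_zero]
  have z4 : cellAverage a (fun _ => ⟪η, η⟫_ℂ) = ⟪η, η⟫_ℂ := by
    rw [cellAverage, setIntegral_const, smul_smul,
      inv_mul_cancel₀ (IsLatticePeriodic.volume_real_fundamentalDomain_pos (a := a)).ne', one_smul]
  rw [meanEnergy]
  have f1 := congrArg (fun z : ℂ => (volume.real Ω)⁻¹ • z) e1
  have f2 := congrArg (fun z : ℂ => (volume.real Ω)⁻¹ • z) e2
  have f1' := cellAverage_expansion (a := a) i1 (i2.add i3) i4 s
  have f2' := cellAverage_expansion (a := a) (integrable_const ⟪η, η⟫_ℂ) i5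
    (h.memLp.integrable_inner_of_two h.memLp) s
  refine (congrArg₂ (fun x y : ℂ => x - γ * y) (f1.trans f1') (f2.trans f2')).trans ?_
  rw [z3, z4, hE]
  simp only [Pi.add_def]
  ring

end IsCorrector

end WideCutoffLimits

/-! ### Comparison of two functions of operators on corrected waves -/

section Comparison

/-- One vector `u` in the quadratic form of `T - φ` is replaced by `f`, on which `S` and `T₀` nearly
act as the numbers `σ` and `φ`. By the symmetry of `T` the replacement costs only the product of
`‖Tu - φu‖` and `‖u - f‖`, which is of second order. -/
theorem norm_inner_sub_smul_le {H : Type*} [NormedAddCommGroup H] [InnerProductSpace ℂ H]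
    {T T₀ S : H →L[ℂ] H} (hT : ∀ x y, ⟪T x, y⟫_ℂ = ⟪x, T y⟫_ℂ) (h1 : ∀ x, ‖T x‖ ≤ ‖x‖)
    (h0 : ∀ x, ‖T₀ x‖ ≤ ‖x‖) {φ σ : ℝ} (hσ : 0 ≤ σ) (u f : H) :
    σ * ‖⟪u, T u - (φ : ℂ) • u⟫_ℂ‖ ≤ ‖(T - T₀) ∘L S‖ * (‖u‖ * ‖f‖) +
      2 * (‖u‖ * ‖S f - (σ : ℂ) • f‖) + σ * (‖u‖ * ‖T₀ f - (φ : ℂ) • f‖) +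
      σ * (‖T u - (φ : ℂ) • u‖ * ‖u - f‖) := by
  have e : (σ : ℂ) * ⟪u, T u - (φ : ℂ) • u⟫_ℂ = ⟪u, ((T - T₀) ∘L S) f⟫_ℂ -
      ⟪u, (T - T₀) (S f - (σ : ℂ) • f)⟫_ℂ + σ * ⟪u, T₀ f - (φ : ℂ) • f⟫_ℂ +
      σ * ⟪T u - (φ : ℂ) • u, u - f⟫_ℂ := by
    simp only [ContinuousLinearMap.comp_apply, _root_.sub_apply, map_sub, map_smul,
      inner_sub_left, inner_sub_right, inner_smul_left, inner_smul_right, hT, Complex.conj_ofReal]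
    ring
  have n0 : σ * ‖⟪u, T u - (φ : ℂ) • u⟫_ℂ‖ = ‖(σ : ℂ) * ⟪u, T u - (φ : ℂ) • u⟫_ℂ‖ := by
    rw [norm_mul, Complex.norm_real, Real.norm_of_nonneg hσ]
  have n1 : ‖⟪u, ((T - T₀) ∘L S) f⟫_ℂ‖ ≤ ‖(T - T₀) ∘L S‖ * (‖u‖ * ‖f‖) := by
    refine (norm_inner_le_norm _ _).trans ?_
    rw [mul_left_comm]
    exact mul_le_mul_of_nonneg_left (ContinuousLinearMap.le_opNorm _ _) (norm_nonneg _)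
  have n2 : ‖⟪u, (T - T₀) (S f - (σ : ℂ) • f)⟫_ℂ‖ ≤ 2 * (‖u‖ * ‖S f - (σ : ℂ) • f‖) := by
    refine (norm_inner_le_norm _ _).trans ?_
    rw [mul_left_comm]
    refine mul_le_mul_of_nonneg_left ?_ (norm_nonneg _)
    rw [_root_.sub_apply, two_mul]
    exact (norm_sub_le _ _).trans (add_le_add (h1 _) (h0 _))
  have n3 : ‖(σ : ℂ) * ⟪u, T₀ f - (φ : ℂ) • f⟫_ℂ‖ ≤ σ * (‖u‖ * ‖T₀ f - (φ : ℂ) • f‖) := by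
    rw [norm_mul, Complex.norm_real, Real.norm_of_nonneg hσ]
    exact mul_le_mul_of_nonneg_left (norm_inner_le_norm _ _) hσ
  have n4 : ‖(σ : ℂ) * ⟪T u - (φ : ℂ) • u, u - f⟫_ℂ‖ ≤
      σ * (‖T u - (φ : ℂ) • u‖ * ‖u - f‖) := by
    rw [norm_mul, Complex.norm_real, Real.norm_of_nonneg hσ]
    exact mul_le_mul_of_nonneg_left (norm_inner_le_norm _ _) hσ
  rw [n0, e]
  refine (norm_add_le _ _).trans (add_le_add ((norm_add_le _ _).trans (add_le_add
    ((norm_sub_le _ _).trans (add_le_add n1 n2)) n3)) n4)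

/-- The Taylor formula for the form of `T` and the formula for the form of the resolvent are
combined and solved for the energy `q`; both errors are quadratic in the residual. -/
theorem norm_mul_le_of_second_order {H : Type*} [NormedAddCommGroup H] [InnerProductSpace ℂ H]
    {T R : H →L[ℂ] H} {φ ρ ψ K M N : ℝ} (hK : 0 ≤ K) {u : H} {q : ℂ}
    (h1 : ‖⟪u, T u - (φ : ℂ) • u - (ψ : ℂ) • (R u - (ρ : ℂ) • u)⟫_ℂ‖ ≤
      K * ‖R u - (ρ : ℂ) • u‖ ^ 2)
    (h2 : ‖R u - (ρ : ℂ) • u‖ ≤ M) (h3 : ‖⟪u, R u - (ρ : ℂ) • u⟫_ℂ + (ρ : ℂ) ^ 2 * q‖ ≤ N) :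
    |ψ| * ρ ^ 2 * ‖q‖ ≤ ‖⟪u, T u - (φ : ℂ) • u⟫_ℂ‖ + (K * M ^ 2 + |ψ| * N) := by
  have h4 : ‖⟪u, T u - (φ : ℂ) • u - (ψ : ℂ) • (R u - (ρ : ℂ) • u)⟫_ℂ‖ ≤ K * M ^ 2 :=
    h1.trans (mul_le_mul_of_nonneg_left (pow_le_pow_left₀ (norm_nonneg _) h2 2) hK)
  have e : (ψ : ℂ) * ((ρ : ℂ) ^ 2 * q) =
      -⟪u, T u - (φ : ℂ) • u⟫_ℂ +
      (⟪u, T u - (φ : ℂ) • u - (ψ : ℂ) • (R u - (ρ : ℂ) • u)⟫_ℂ +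
      ψ * (⟪u, R u - (ρ : ℂ) • u⟫_ℂ + (ρ : ℂ) ^ 2 * q)) := by
    rw [inner_sub_right u (T u - (φ : ℂ) • u), inner_smul_right]
    ring
  have e2 : |ψ| * ρ ^ 2 * ‖q‖ = ‖(ψ : ℂ) * ((ρ : ℂ) ^ 2 * q)‖ := by
    rw [norm_mul, norm_mul, norm_pow, Complex.norm_real, Complex.norm_real, Real.norm_eq_abs,
      Real.norm_eq_abs, sq_abs, mul_assoc]
  rw [e2, e]
  refine (norm_add_le _ _).trans ?_
  rw [norm_neg]
  refine add_le_add le_rfl ((norm_add_le _ _).trans (add_le_add h4 ?_))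
  rw [norm_mul, Complex.norm_real, Real.norm_eq_abs]
  exact mul_le_mul_of_nonneg_left h3 (abs_nonneg _)

/-- Every term is homogeneous of degree two in the quantities normalized by `X`, so multiplying by
`X²` gives an inequality between convergent expressions. The terms with `s` and `t`, the defects of
the plain wave, drop out. -/
theorem limit_inequality {X Q U F s t M D : ℝ → ℝ} {A σ ψ C K K' κ₀ q u₀ f₀ m d₀ : ℝ}
    (hQ : Tendsto (fun δ => X δ ^ 2 * Q δ) (𝓝[>] 0) (𝓝 q))
    (hU : Tendsto (fun δ => X δ * U δ) (𝓝[>] 0) (𝓝 u₀))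
    (hF : Tendsto (fun δ => X δ * F δ) (𝓝[>] 0) (𝓝 f₀))
    (hs : Tendsto (fun δ => X δ * s δ) (𝓝[>] 0) (𝓝 0))
    (ht : Tendsto (fun δ => X δ * t δ) (𝓝[>] 0) (𝓝 0))
    (hM : Tendsto (fun δ => X δ * M δ) (𝓝[>] 0) (𝓝 m))
    (hD : Tendsto (fun δ => X δ * D δ) (𝓝[>] 0) (𝓝 d₀))
    (h : ∀ᶠ δ in 𝓝[>] 0, A * Q δ ≤ C * (U δ * F δ) + 2 * (U δ * s δ) + σ * (U δ * t δ) +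
      σ * (K' * (M δ / κ₀) * D δ) + σ * (K * (M δ / κ₀) ^ 2 + |ψ| * (M δ ^ 2 / κ₀))) :
    A * q ≤ C * (u₀ * f₀) + σ * (K' * (m / κ₀) * d₀) +
      σ * (K * (m / κ₀) ^ 2 + |ψ| * (m ^ 2 / κ₀)) := by
  have l1 := hQ.const_mul A
  have l2 := (((((hU.mul hF).const_mul C).add ((hU.mul hs).const_mul 2)).add
    ((hU.mul ht).const_mul σ)).add ((((hM.div_const κ₀).const_mul K').mul hD).const_mul σ)).add
    (((((hM.div_const κ₀).pow 2).const_mul K).add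
      (((hM.pow 2).div_const κ₀).const_mul |ψ|)).const_mul σ)
  simp only [mul_zero, add_zero] at l2
  refine le_of_tendsto_of_tendsto l1 l2 ?_
  filter_upwards [h] with δ hδ
  have := mul_le_mul_of_nonneg_left hδ (sq_nonneg (X δ))
  refine (le_of_eq (by ring)).trans (this.trans (le_of_eq (by ring)))

variable {d : ℕ} {ι κ : Type*} [Fintype ι] [Fintype κ]

namespace IsCorrector

variable {a : Module.Basis (Fin d) ℝ (EuclideanSpace ℝ (Fin d))}
  {b : Fin d → Matrix κ ι ℂ} {g : EuclideanSpace ℝ (Fin d) → Matrix κ κ ℂ}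
  {θ : EuclideanSpace ℝ (Fin d)} {γ : ℝ} {η : EuclideanSpace ℂ ι}
  {v : EuclideanSpace ℝ (Fin d) → EuclideanSpace ℂ ι}
  {Dv : Fin d → EuclideanSpace ℝ (Fin d) → EuclideanSpace ℂ ι}
  (h : IsCorrector a b g θ γ η v Dv) {c c₁ c₂ : ℝ}

theorem eventually_wide (ε : ℝ) :
    ∀ᶠ δ : ℝ in 𝓝[>] 0, 0 < δ ∧ δ ≤ 1 ∧ δ * (ε * cellRadius a) ≤ 2 := by
  have h1 : Tendsto (fun δ : ℝ => δ * (ε * cellRadius a)) (𝓝[>] 0) (𝓝 0) := by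
    have := (tendsto_id (α := ℝ) (x := 𝓝 0)).mul_const (ε * cellRadius a)
    rw [zero_mul] at this
    exact tendsto_nhdsWithin_of_tendsto_nhds this
  have h2 : ∀ᶠ δ : ℝ in 𝓝[>] 0, δ ≤ 1 :=
    mem_nhdsWithin_of_mem_nhds (Iic_mem_nhds zero_lt_one)
  filter_upwards [self_mem_nhdsWithin, h2, h1.eventually (ge_mem_nhds two_pos)] with δ a1 a2 a3
  exact ⟨a1, a2, a3⟩

include h in
/-- The resolvent residual of exact waves is negligible in the limit of wide cutoffs. -/
theorem tendsto_resolvent_sub (hb : IsEllipticSymbol b c) (hg : IsEllipticCoeff volume g c₁ c₂)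
    (hc₂ : 0 ≤ c₂) (hγ : 0 ≤ γ) {k : ℝ} (h0 : residualLimit a b g θ γ η v Dv k = 0)
    {ε : ℝ} (hε : 0 < ε) {u : ℝ → L2 d ι}
    (hu : ∀ δ, 0 < δ → u δ =ᵐ[volume] quasiMode θ η v k ε δ) :
    Tendsto (fun δ : ℝ => √(δ ^ d) * ‖resolventNegOne (divForm b fun x => g (ε⁻¹ • x)) (u δ) -
      (((1 + γ * k ^ 2)⁻¹ : ℝ) : ℂ) • u δ‖) (𝓝[>] 0) (𝓝 0) := by
  have h1 := (h.tendsto_residualBound hg k hε).mul_const (energyConst d c c₁)⁻¹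
  rw [h0, mul_zero, zero_mul] at h1
  refine squeeze_zero' (.of_forall fun δ => by positivity) ?_ h1
  filter_upwards [eventually_wide (a := a) ε] with δ ⟨d1, d2, d3⟩
  have h2 := (h.resolvent_le hb hg hc₂ hγ k hε d1 d2 d3 (hu δ d1)).1
  rw [mul_assoc, ← div_eq_mul_inv]
  exact mul_le_mul_of_nonneg_left h2 (Real.sqrt_nonneg _)

include h in
/-- The estimate for the operator cosines gives an estimate for the energy of corrected waves. -/
theorem norm_meanEnergy_le (hb : IsEllipticSymbol b c) (hg : IsEllipticCoeff volume g c₁ c₂)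
    (hc₂ : 0 ≤ c₂) (hγ : 0 < γ) {k : ℝ} (hk : k ≠ 0)
    {g₀ : Matrix κ κ ℂ} {e₁ e₂ : ℝ}
    (hg₀ : IsEllipticCoeff volume (fun _ : EuclideanSpace ℝ (Fin d) => g₀) e₁ e₂)
    (he₂ : 0 ≤ e₂) (h₀ : IsCorrector a b (fun _ => g₀) θ γ η 0 0)
    (hr₀ : residualLimit a b (fun _ => g₀) θ γ η 0 0 k = 0)
    {κ' : Type*} [Fintype κ'] {b' : Fin d → Matrix κ' ι ℂ} {c' : ℝ} (hb' : IsEllipticSymbol b' c')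
    {g' : Matrix κ' κ' ℂ} {f₁ f₂ : ℝ}
    (hg' : IsEllipticCoeff volume (fun _ : EuclideanSpace ℝ (Fin d) => g') f₁ f₂)
    (hf₂ : 0 ≤ f₂) (h' : IsCorrector a b' (fun _ => g') θ 1 η 0 0)
    (hr' : residualLimit a b' (fun _ => g') θ 1 η 0 0 k = 0)
    (τ : ℝ) {s : ℝ} (hs0 : 0 ≤ s) (hs2 : s ≤ 2) :
    ∃ K K' : ℝ, ∀ (ε : ℝ), 0 < ε → ∀ C : ℝ,
      ‖(cosSqrt (divForm b fun x => g (ε⁻¹ • x)) τ - cosSqrt (divForm b fun _ => g₀) τ) ∘L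
        smoothing (divForm b' fun _ => g') s‖ ≤ C →
      (1 + 1 * k ^ 2) ^ (-s / 2) *
        (|τ * Real.sin (τ * √(γ * k ^ 2)) * (1 + γ * k ^ 2) ^ 2 / (2 * √(γ * k ^ 2))| *
        (1 + γ * k ^ 2)⁻¹ ^ 2) * ‖(cutoffMass d : ℂ) * k ^ 2 * meanEnergy a b g θ γ η v Dv (ε * k)‖
      ≤ C * (waveNorm a (amplitude η v (ε * k)) * waveNorm a (amplitude η 0 (ε * k))) +
        (1 + 1 * k ^ 2) ^ (-s / 2) * (K' * (ε * residualLimit a b g θ γ η v Dv k /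
          energyConst d c c₁) * (ε * |k| * waveNorm a v)) +
        (1 + 1 * k ^ 2) ^ (-s / 2) * (K * (ε * residualLimit a b g θ γ η v Dv k /
          energyConst d c c₁) ^ 2 +
          |τ * Real.sin (τ * √(γ * k ^ 2)) * (1 + γ * k ^ 2) ^ 2 / (2 * √(γ * k ^ 2))| *
          ((ε * residualLimit a b g θ γ η v Dv k) ^ 2 / energyConst d c c₁)) := by
  have hl : 0 < γ * k ^ 2 := mul_pos hγ (by positivity)
  -- The constants depend on `τ`, `s` and the eigenvalues only and are fixed before `ε`.
  obtain ⟨K, hK0, hK⟩ := IsNonnegSelfAdjoint.exists_norm_inner_cosSqrt_sub_le (H := L2 d ι) τ hl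
  obtain ⟨K', hK'0, hK'⟩ := IsNonnegSelfAdjoint.exists_norm_cosSqrt_sub_le (H := L2 d ι) τ hl
  obtain ⟨K₂, hK₂0, hK₂⟩ := IsNonnegSelfAdjoint.exists_norm_smoothing_sub_le (H := L2 d ι) hs0 hs2
    (mul_nonneg zero_le_one (sq_nonneg k))
  refine ⟨K, K', fun ε hε C hC => ?_⟩
  have hgε := hg.comp_smul (inv_ne_zero hε.ne')
  have hA := isNonnegSelfAdjoint_divForm hb hgε
  have hA₀ := isNonnegSelfAdjoint_divForm hb hg₀
  have hA' := isNonnegSelfAdjoint_divForm hb' hg'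
  set ψ := τ * Real.sin (τ * √(γ * k ^ 2)) * (1 + γ * k ^ 2) ^ 2 / (2 * √(γ * k ^ 2)) with hψ
  set σ : ℝ := (1 + 1 * k ^ 2) ^ (-s / 2) with hσ
  have hσ0 : 0 ≤ σ := Real.rpow_nonneg (by positivity) _
  have eu : ∀ δ, 0 < δ → ∃ u : L2 d ι, u =ᵐ[volume] quasiMode θ η v k ε δ := fun δ hδ =>
    ⟨_, (h.memLp_quasiMode k hε hδ).coeFn_toLp⟩
  have ef : ∀ δ, 0 < δ → ∃ u : L2 d ι, u =ᵐ[volume] quasiMode θ η 0 k ε δ := fun δ hδ =>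
    ⟨_, (h₀.memLp_quasiMode k hε hδ).coeFn_toLp⟩
  choose! u hu using eu
  choose! f hf using ef
  have nu : ∀ δ, 0 < δ → (eLpNorm (quasiMode θ η v k ε δ) 2 volume).toReal = ‖u δ‖ := fun δ hδ => by
    rw [Lp.norm_def, eLpNorm_congr_ae (hu δ hδ)]
  have nf : ∀ δ, 0 < δ → (eLpNorm (quasiMode θ η 0 k ε δ) 2 volume).toReal = ‖f δ‖ := fun δ hδ => by
    rw [Lp.norm_def, eLpNorm_congr_ae (hf δ hδ)]
  have nuf : ∀ δ, 0 < δ → (eLpNorm (quasiMode θ η v k ε δ - quasiMode θ η 0 k ε δ) 2 volume).toReal =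
      ‖u δ - f δ‖ := fun δ hδ => by
    rw [Lp.norm_def, eLpNorm_congr_ae ((Lp.coeFn_sub _ _).trans ((hu δ hδ).sub (hf δ hδ)))]
  have tU : Tendsto (fun δ : ℝ => √(δ ^ d) * ‖u δ‖) (𝓝[>] 0)
      (𝓝 (waveNorm a (amplitude η v (ε * k)))) :=
    (h.tendsto_quasiMode k hε).congr' (by
      filter_upwards [self_mem_nhdsWithin] with δ hδ
      rw [nu δ hδ])
  have tF : Tendsto (fun δ : ℝ => √(δ ^ d) * ‖f δ‖) (𝓝[>] 0)
      (𝓝 (waveNorm a (amplitude η 0 (ε * k)))) :=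
    (h₀.tendsto_quasiMode k hε).congr' (by
      filter_upwards [self_mem_nhdsWithin] with δ hδ
      rw [nf δ hδ])
  have tD : Tendsto (fun δ : ℝ => √(δ ^ d) * ‖u δ - f δ‖) (𝓝[>] 0)
      (𝓝 (ε * |k| * waveNorm a v)) :=
    (h.tendsto_quasiMode_sub k hε).congr' (by
      filter_upwards [self_mem_nhdsWithin] with δ hδ
      rw [nuf δ hδ])
  have tQ : Tendsto (fun δ : ℝ => √(δ ^ d) ^ 2 * ‖quasiEnergy b g θ γ η v Dv k ε δ‖) (𝓝[>] 0)
      (𝓝 ‖(cutoffMass d : ℂ) * k ^ 2 * meanEnergy a b g θ γ η v Dv (ε * k)‖) := by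
    refine (h.tendsto_quasiEnergy hg hc₂ k hε).norm.congr' ?_
    filter_upwards [self_mem_nhdsWithin] with δ hδ
    have hδ : 0 < δ := hδ
    rw [norm_mul, Complex.norm_real, Real.norm_of_nonneg (by positivity),
      Real.sq_sqrt (by positivity)]
  -- For constant coefficients the plain wave is an exact eigenfunction up to the cutoff, so its
  -- defects for the effective operator and for the smoothing operator vanish in the limit.
  have tt := (h₀.tendsto_resolvent_sub hb hg₀ he₂ hγ.le hr₀ hε hf).const_mul K'
  have ts := (h'.tendsto_resolvent_sub hb' hg' hf₂ zero_le_one hr' hε hf).const_mul K₂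
  rw [mul_zero] at tt ts
  simp only [mul_left_comm K'] at tt
  simp only [mul_left_comm K₂] at ts
  refine limit_inequality tQ tU tF ts tt (h.tendsto_residualBound hg k hε) tD ?_
  filter_upwards [eventually_wide (a := a) ε] with δ ⟨d1, d2, d3⟩
  obtain ⟨r1, r2⟩ := h.resolvent_le hb hg hc₂ hγ.le k hε d1 d2 d3 (hu δ d1)
  have s1 := norm_mul_le_of_second_order hK0 (hK _ hA (u δ)) r1 r2
  have s2 := norm_inner_sub_smul_le (T₀ := cosSqrt (divForm b fun _ => g₀) τ)
    (S := smoothing (divForm b' fun _ => g') s) (fun x y => hA.cosSqrt_inner τ x y)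
    (hA.norm_cosSqrt_apply_le τ) (hA₀.norm_cosSqrt_apply_le τ) (φ := Real.cos (τ * √(γ * k ^ 2)))
    hσ0 (u δ) (f δ)
  have s3 := hK₂ _ hA' (f δ)
  have s4 := hK' _ hA₀ (f δ)
  have s5 := (hK' _ hA (u δ)).trans (mul_le_mul_of_nonneg_left r1 hK'0)
  have s6 := mul_le_mul_of_nonneg_left s1 hσ0
  calc σ * (|ψ| * (1 + γ * k ^ 2)⁻¹ ^ 2) * ‖quasiEnergy b g θ γ η v Dv k ε δ‖
      = σ * (|ψ| * (1 + γ * k ^ 2)⁻¹ ^ 2 * ‖quasiEnergy b g θ γ η v Dv k ε δ‖) := by ring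
    _ ≤ _ := s6
    _ = σ * _ + σ * _ := mul_add _ _ _
    _ ≤ _ := by
      refine add_le_add (s2.trans ?_) le_rfl
      refine add_le_add (add_le_add (add_le_add
        (mul_le_mul_of_nonneg_right hC (by positivity)) ?_) ?_) ?_
      · exact mul_le_mul_of_nonneg_left (mul_le_mul_of_nonneg_left s3 (norm_nonneg _)) two_pos.le
      · exact mul_le_mul_of_nonneg_left (mul_le_mul_of_nonneg_left s4 (norm_nonneg _)) hσ0
      · exact mul_le_mul_of_nonneg_left (mul_le_mul_of_nonneg_right s5 (norm_nonneg _)) hσ0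

end IsCorrector

end Comparison

/-! ### The limit of small `ε` and the choice of the frequency. -/

section HighFrequency

variable {d : ℕ} {ι κ : Type*} [Fintype ι] [Fintype κ]

/-- Division by `ε` and the limit `ε → 0` compare the first order coefficients. -/
theorem le_of_eventually_linear {a₁ a₂ a₃ a₄ : ℝ}
    (h : ∀ᶠ ε : ℝ in 𝓝[>] 0, ε * a₁ - ε ^ 2 * a₂ ≤ ε * a₃ + ε ^ 2 * a₄) : a₁ ≤ a₃ := by
  have t0 : Tendsto (fun ε : ℝ => ε) (𝓝[>] 0) (𝓝 0) := tendsto_nhdsWithin_of_tendsto_nhds tendsto_id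
  have l1 := (tendsto_const_nhds (x := a₁)).sub (t0.mul_const a₂)
  have l2 := (tendsto_const_nhds (x := a₃)).add (t0.mul_const a₄)
  rw [zero_mul, sub_zero] at l1
  rw [zero_mul, add_zero] at l2
  refine le_of_tendsto_of_tendsto l1 l2 ?_
  filter_upwards [h, self_mem_nhdsWithin] with ε h1 hε
  have hε : 0 < ε := hε
  refine le_of_mul_le_mul_left ?_ hε
  calc ε * (a₁ - ε * a₂) = ε * a₁ - ε ^ 2 * a₂ := by ring
    _ ≤ _ := h1
    _ = _ := by ring

/-- Large frequencies violate an estimate that would follow from the one for operator cosines. -/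
theorem exists_frequency {τ γ s A B : ℝ} (hτ : τ ≠ 0) (hγ : 0 < γ) (hs : s < 2) (hA : 0 < A) :
    ∃ k : ℝ, 0 < k ∧ B < (1 + 1 * k ^ 2) ^ (-s / 2) *
      (|τ * Real.sin (τ * √(γ * k ^ 2)) * (1 + γ * k ^ 2) ^ 2 / (2 * √(γ * k ^ 2))| *
        (1 + γ * k ^ 2)⁻¹ ^ 2) * (k ^ 2 * |k| * A) := by
  have hτ' : 0 < |τ| := abs_pos.2 hτ
  have hg : 0 < √γ := Real.sqrt_pos.2 hγ
  -- At these frequencies `|τ|√γ k` equals `π/2` modulo `2π`, so the sine has modulus one.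
  set k : ℕ → ℝ := fun N => (Real.pi / 2 + N * (2 * Real.pi)) / (|τ| * √γ) with hk
  have kpos : ∀ N, 0 < k N := fun N => by
    have := Real.pi_pos
    positivity
  have ksin : ∀ N, |Real.sin (τ * √(γ * k N ^ 2))| = 1 := fun N => by
    have e0 : |τ| * (√γ * k N) = Real.pi / 2 + N * (2 * Real.pi) := by
      rw [hk]
      field_simp
    have e1 : |Real.sin (|τ| * (√γ * k N))| = 1 := by
      rw [e0, Real.sin_add_nat_mul_two_pi, Real.sin_pi_div_two, abs_one]
    rw [Real.sqrt_mul hγ.le, Real.sqrt_sq (kpos N).le]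
    rcases abs_choice τ with h | h
    · rwa [h] at e1
    · rwa [h, neg_mul, Real.sin_neg, abs_neg] at e1
  have ktop : Tendsto k atTop atTop := by
    refine Tendsto.atTop_div_const (by positivity) ?_
    exact tendsto_atTop_add_const_left _ _ (tendsto_natCast_atTop_atTop.atTop_mul_const
      (by have := Real.pi_pos; positivity))
  -- This is where `s < 2` is used: the expression to be made large is comparable with the power `1
  -- - s/2` of `1 + k²`.
  have ttop : Tendsto (fun N => (1 + 1 * k N ^ 2) ^ (1 - s / 2)) atTop atTop := by
    refine (tendsto_rpow_atTop (by linarith)).comp ?_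
    refine tendsto_atTop_add_const_left _ _ ?_
    simp only [one_mul]
    exact (tendsto_pow_atTop two_ne_zero).comp ktop
  obtain ⟨N, h1, h2⟩ := ((ttop.eventually_gt_atTop (B * (4 * √γ) / (|τ| * A))).and
    (ktop.eventually_ge_atTop 1)).exists
  refine ⟨k N, kpos N, ?_⟩
  have hkN := kpos N
  have hsin := ksin N
  set x := k N
  -- The factor `(1 + γk²)²` from differentiation in the resolvent variable cancels against the
  -- square of the resolvent value.
  have e1 : |τ * Real.sin (τ * √(γ * x ^ 2)) * (1 + γ * x ^ 2) ^ 2 / (2 * √(γ * x ^ 2))| *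
        (1 + γ * x ^ 2)⁻¹ ^ 2 = |τ| / (2 * (√γ * x)) := by
    rw [abs_div, abs_mul, abs_mul, hsin, Real.sqrt_mul hγ.le, Real.sqrt_sq hkN.le,
      abs_of_pos (by positivity : 0 < (1 + γ * x ^ 2) ^ 2),
      abs_of_pos (by positivity : 0 < 2 * (√γ * x))]
    have : 1 + γ * x ^ 2 ≠ 0 := by positivity
    field_simp
  have e2 : (1 + 1 * x ^ 2) ^ (1 - s / 2) = (1 + 1 * x ^ 2) ^ (-s / 2) * (1 + x ^ 2) := by
    have h3 : (0 : ℝ) < 1 + 1 * x ^ 2 := by positivity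
    have h4 := Real.rpow_add h3 (-s / 2) 1
    rw [Real.rpow_one] at h4
    rw [show 1 - s / 2 = -s / 2 + 1 by ring, h4, one_mul]
  have hσ : (0 : ℝ) < (1 + 1 * x ^ 2) ^ (-s / 2) := Real.rpow_pos_of_pos (by positivity) _
  rw [e1, abs_of_pos hkN]
  rw [e2, div_lt_iff₀ (by positivity)] at h1
  have h5 : 1 + x ^ 2 ≤ 2 * x ^ 2 := by nlinarith
  have h6 : (1 + 1 * x ^ 2) ^ (-s / 2) * (1 + x ^ 2) * (|τ| * A) ≤
      (1 + 1 * x ^ 2) ^ (-s / 2) * (2 * x ^ 2) * (|τ| * A) := by gcongr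
  have h7 : (1 + 1 * x ^ 2) ^ (-s / 2) * (|τ| / (2 * (√γ * x))) * (x ^ 2 * x * A) * (4 * √γ) =
      (1 + 1 * x ^ 2) ^ (-s / 2) * (2 * x ^ 2) * (|τ| * A) := by
    field_simp
    ring
  have h8 : B * (4 * √γ) < (1 + 1 * x ^ 2) ^ (-s / 2) * (|τ| / (2 * (√γ * x))) *
      (x ^ 2 * x * A) * (4 * √γ) := by
    rw [h7]
    exact h1.trans_le h6
  exact lt_of_mul_lt_mul_right h8 (by positivity)

/-- The bound depends neither on `ε` nor on `k` as long as `|εk| ≤ 1`. The right-hand side of the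
final inequality is therefore fixed before the frequency is chosen; the lemma is used with `v' = v`
and with `v' = 0`. -/
theorem waveNorm_amplitude_le {a : Module.Basis (Fin d) ℝ (EuclideanSpace ℝ (Fin d))}
    {η : EuclideanSpace ℂ ι} {v v' : EuclideanSpace ℝ (Fin d) → EuclideanSpace ℂ ι}
    (hv : MemLp v 2 (volume.restrict (ZSpan.fundamentalDomain a)))
    (hv' : MemLp v' 2 (volume.restrict (ZSpan.fundamentalDomain a))) (hvv : ∀ y, ‖v' y‖ ≤ ‖v y‖)
    {s : ℝ} (hs : |s| ≤ 1) :
    waveNorm a (amplitude η v' s) ≤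
      √(cutoffMass d * cellAverage a fun y => 2 * ‖η‖ ^ 2 + 2 * ‖v y‖ ^ 2) := by
  refine Real.sqrt_le_sqrt (mul_le_mul_of_nonneg_left ?_ cutoffMass_pos.le)
  rw [cellAverage, cellAverage]
  refine smul_le_smul_of_nonneg_left (integral_mono ?_ ?_ fun y => ?_) (by positivity)
  · have h1 : MemLp (fun _ => η) 2 (volume.restrict (ZSpan.fundamentalDomain a)) := memLp_const η
    have h2 := h1.add (hv'.const_smul (s : ℂ))
    have h3 := (memLp_two_iff_integrable_sq_norm h2.1).1 h2
    exact h3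
  · exact (integrable_const _).add (((memLp_two_iff_integrable_sq_norm hv.1).1 hv).const_mul 2)
  · have h1 : ‖amplitude η v' s y‖ ≤ ‖η‖ + ‖v y‖ := by
      refine (norm_add_le _ _).trans (add_le_add le_rfl ?_)
      rw [norm_smul, Complex.norm_real, Real.norm_eq_abs]
      exact (mul_le_of_le_one_left (norm_nonneg _) hs).trans (hvv y)
    have h2 := pow_le_pow_left₀ (norm_nonneg _) h1 2
    simp only
    nlinarith [sq_nonneg (‖η‖ - ‖v y‖)]

end HighFrequency

/-! ### Constant coefficients: plane waves are exact. -/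

section Constant

variable {d : ℕ} {ι κ : Type*} [Fintype ι] [Fintype κ]

theorem integrable_fderiv_single {F : Type*} [NormedAddCommGroup F] [NormedSpace ℝ F]
    {Y : EuclideanSpace ℝ (Fin d) → F} (h1 : ContDiff ℝ 1 Y) (h2 : HasCompactSupport Y)
    (e : EuclideanSpace ℝ (Fin d)) : Integrable (fun x => fderiv ℝ Y x e) volume :=
  ((h1.continuous_fderiv (by simp)).clm_apply continuous_const).integrable_of_hasCompactSupport
    (h2.fderiv_apply ℝ _)

theorem integral_fderiv_eq_zero {F : Type*} [NormedAddCommGroup F] [NormedSpace ℝ F]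
    {Y : EuclideanSpace ℝ (Fin d) → F} (h1 : ContDiff ℝ 1 Y) (h2 : HasCompactSupport Y)
    (e : EuclideanSpace ℝ (Fin d)) : ∫ x, fderiv ℝ Y x e = 0 := by
  have i1 := integrable_fderiv_single h1 h2 e
  have := integral_smul_fderiv_eq_neg_fderiv_smul_of_integrable (𝕜 := ℝ) (μ := volume)
    (f := fun _ : EuclideanSpace ℝ (Fin d) => (1 : ℝ)) (g := Y) (v := e)
    (by simp) (by simpa using i1)
    (by simpa using h1.continuous.integrable_of_hasCompactSupport h2)
    (fun x _ => differentiableAt_const _) (fun x _ => (h1.differentiable (by simp)).differentiableAt)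
  simpa using this

theorem integrable_symbolVal {α : Type*} [MeasurableSpace α] {μ : Measure α}
    (b : Fin d → Matrix κ ι ℂ) {p : Fin d → α → EuclideanSpace ℂ ι}
    (h : ∀ l, Integrable (p l) μ) : Integrable (fun x => symbolVal b fun l => p l x) μ := by
  simp only [symbolVal]
  exact integrable_finsetSum _ fun l _ => ((matCLM (b l)).integrable_comp (h l)).smul (-Complex.I)

theorem integral_symbolVal {α : Type*} [MeasurableSpace α] {μ : Measure α}
    (b : Fin d → Matrix κ ι ℂ) {p : Fin d → α → EuclideanSpace ℂ ι}
    (h : ∀ l, Integrable (p l) μ) :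
    ∫ x, symbolVal b (fun l => p l x) ∂μ = symbolVal b fun l => ∫ x, p l x ∂μ := by
  simp only [symbolVal]
  have hi : ∀ l ∈ Finset.univ, Integrable (fun x => -Complex.I • matCLM (b l) (p l x)) μ :=
    fun l _ => ((matCLM (b l)).integrable_comp (h l)).smul (-Complex.I)
  rw [integral_finsetSum _ hi]
  refine Finset.sum_congr rfl fun l _ => ?_
  rw [integral_smul, ContinuousLinearMap.integral_comp_comm _ (h l)]

theorem symbolVal_zero (b : Fin d → Matrix κ ι ℂ) : symbolVal b (fun _ => 0) = 0 := by
  simp [symbolVal]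

variable {a : Module.Basis (Fin d) ℝ (EuclideanSpace ℝ (Fin d))} {b : Fin d → Matrix κ ι ℂ}
  {g₀ : Matrix κ κ ℂ} {θ : EuclideanSpace ℝ (Fin d)} {γ : ℝ} {η : EuclideanSpace ℂ ι}

theorem waveFlux_const (x : EuclideanSpace ℝ (Fin d)) :
    waveFlux b (fun _ => g₀) θ η 0 x = matCLM g₀ (matCLM (symbol b θ) η) := by
  have : symbolVal b (fun l => (0 : Fin d → EuclideanSpace ℝ (Fin d) → EuclideanSpace ℂ ι) l x) = 0 :=
    symbolVal_zero b
  rw [waveFlux, waveField, this, zero_add]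

theorem waveDefect_const (h : matCLM (symbol b θ)ᴴ (matCLM g₀ (matCLM (symbol b θ) η)) = (γ : ℂ) • η)
    (x : EuclideanSpace ℝ (Fin d)) : waveDefect b (fun _ => g₀) θ γ η 0 x = 0 := by
  rw [waveDefect, waveFlux_const, h, sub_self]

/-- For constant coefficients the plane waves need no correction. -/
theorem isCorrector_const (a : Module.Basis (Fin d) ℝ (EuclideanSpace ℝ (Fin d)))
    (h : matCLM (symbol b θ)ᴴ (matCLM g₀ (matCLM (symbol b θ) η)) = (γ : ℂ) • η) :
    IsCorrector a b (fun _ => g₀) θ γ η 0 0 where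
  coeff_periodic _ _ := rfl
  periodic _ _ := rfl
  periodic_deriv _ _ _ := rfl
  weakGradient := HasWeakGradient.zero
  memLp := MemLp.zero'
  memLp_deriv _ := MemLp.zero'
  weak_eq Y h1 h2 := by
    have h1' : ContDiff ℝ 1 Y := h1.of_le (by exact_mod_cast le_top)
    have hi := fun l : Fin d => integrable_fderiv_single h1' h2 (EuclideanSpace.single l (1 : ℝ))
    simp only [waveFlux_const]
    generalize matCLM g₀ (matCLM (symbol b θ) η) = q
    have e1 : ∫ x, ⟪q, symbolVal b fun l => fderiv ℝ Y x (EuclideanSpace.single l 1)⟫_ℂ = 0 := by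
      rw [integral_inner (integrable_symbolVal b hi), integral_symbolVal b hi]
      simp only [integral_fderiv_eq_zero h1' h2, symbolVal_zero, inner_zero_right]
    have e2 : ∫ x, ⟪symbolVal b (fun l => fderiv ℝ Y x (EuclideanSpace.single l 1)), q⟫_ℂ =
        ∫ x, (starRingEnd ℂ)
          ⟪q, symbolVal b fun l => fderiv ℝ Y x (EuclideanSpace.single l 1)⟫_ℂ := by
      simp only [inner_conj_symm]
    rw [e2, integral_conj, e1, map_zero]
  integral_defect := by simp only [waveDefect_const h, integral_zero]

/-- The defect vanishes pointwise by the eigenvalue equation, and the corrector is zero. -/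
theorem residualLimit_const (a : Module.Basis (Fin d) ℝ (EuclideanSpace ℝ (Fin d)))
    (h : matCLM (symbol b θ)ᴴ (matCLM g₀ (matCLM (symbol b θ) η)) = (γ : ℂ) • η) (k : ℝ) :
    residualLimit a b (fun _ => g₀) θ γ η 0 0 k = 0 := by
  rw [residualLimit, meanNorm_eq_zero (waveDefect_const h), meanNorm_eq_zero (by simp),
    meanNorm_eq_zero (by simp)]
  simp

end Constant

/-! ### The contradiction with the assumed estimate. -/

section Contradiction

variable {d : ℕ} {ι κ : Type*} [Fintype ι] [Fintype κ]
  {a : Module.Basis (Fin d) ℝ (EuclideanSpace ℝ (Fin d))} {b : Fin d → Matrix κ ι ℂ} {c : ℝ}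
  {g : EuclideanSpace ℝ (Fin d) → Matrix κ κ ℂ} {c₁ c₂ : ℝ}
  {θ : EuclideanSpace ℝ (Fin d)} {γ : ℝ} {η : EuclideanSpace ℂ ι}
  {v : EuclideanSpace ℝ (Fin d) → EuclideanSpace ℂ ι}
  {Dv : Fin d → EuclideanSpace ℝ (Fin d) → EuclideanSpace ℂ ι}

theorem eventually_mul_const_le {k : ℝ} : ∀ᶠ ε : ℝ in 𝓝[>] 0, |ε * k| ≤ 1 := by
  have h1 : Tendsto (fun ε : ℝ => |ε * k|) (𝓝[>] 0) (𝓝 0) := by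
    have h2 : Tendsto (fun ε : ℝ => |ε * k|) (𝓝 0) (𝓝 |0 * k|) :=
      (continuous_id.mul continuous_const).abs.tendsto 0
    rw [zero_mul, abs_zero] at h2
    exact tendsto_nhdsWithin_of_tendsto_nhds h2
  exact h1.eventually (ge_mem_nhds one_pos)

/-- If the average energy of corrected waves has a nonzero derivative, then the operator cosines
are not `O(ε)`-close. -/
theorem IsCorrector.not_exists_bound (h : IsCorrector a b g θ γ η v Dv)
    (hb : IsEllipticSymbol b c) (hg : IsEllipticCoeff volume g c₁ c₂)
    (hc₂ : 0 ≤ c₂) (hγ : 0 < γ) {g₀ : Matrix κ κ ℂ} {e₁ e₂ : ℝ}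
    (hg₀ : IsEllipticCoeff volume (fun _ : EuclideanSpace ℝ (Fin d) => g₀) e₁ e₂)
    (he₂ : 0 ≤ e₂)
    (h₀ : matCLM (symbol b θ)ᴴ (matCLM g₀ (matCLM (symbol b θ) η)) = (γ : ℂ) • η)
    {κ' : Type*} [Fintype κ'] {b' : Fin d → Matrix κ' ι ℂ} {c' : ℝ} (hb' : IsEllipticSymbol b' c')
    {g' : Matrix κ' κ' ℂ} {f₁ f₂ : ℝ}
    (hg' : IsEllipticCoeff volume (fun _ : EuclideanSpace ℝ (Fin d) => g') f₁ f₂)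
    (hf₂ : 0 ≤ f₂)
    (h' : matCLM (symbol b' θ)ᴴ (matCLM g' (matCLM (symbol b' θ) η)) = ((1 : ℝ) : ℂ) • η)
    (hv : ∫ y in ZSpan.fundamentalDomain a, v y = 0)
    (hE : cellAverage a (fun y => ⟪waveField b θ η Dv y, waveFlux b g θ η Dv y⟫_ℂ) =
      γ * ⟪η, η⟫_ℂ)
    (hμ : cellAverage a (fun y => ⟪waveFlux b g θ η Dv y, matCLM (symbol b θ) (v y)⟫_ℂ +
      ⟪matCLM (symbol b θ) (v y), waveFlux b g θ η Dv y⟫_ℂ) ≠ 0)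
    {τ s : ℝ} (hτ : τ ≠ 0) (hs0 : 0 ≤ s) (hs2 : s < 2) :
    ¬ ∃ C : ℝ, 0 < C ∧ ∀ᶠ ε : ℝ in 𝓝[>] 0,
      ‖(cosSqrt (divForm b fun x => g (ε⁻¹ • x)) τ - cosSqrt (divForm b fun _ => g₀) τ) ∘L
        smoothing (divForm b' fun _ => g') s‖ ≤ C * ε := by
  rintro ⟨C, hC, hest⟩
  obtain ⟨B, hB⟩ := h.exists_meanEnergy_eq hg hv hE
  set μ := cellAverage a (fun y => ⟪waveFlux b g θ η Dv y, matCLM (symbol b θ) (v y)⟫_ℂ +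
      ⟪matCLM (symbol b θ) (v y), waveFlux b g θ η Dv y⟫_ℂ) with hμd
  set W := √(cutoffMass d * cellAverage a fun y => 2 * ‖η‖ ^ 2 + 2 * ‖v y‖ ^ 2) with hW
  have hm := cutoffMass_pos (d := d)
  -- The frequency is chosen so that the first order coefficient exceeds `C W²`, the bound coming
  -- from the assumed estimate; only afterwards `ε` tends to zero.
  obtain ⟨k, hk, hlt⟩ := exists_frequency (τ := τ) (s := s) (B := C * (W * W)) hτ hγ hs2
    (mul_pos hm (norm_pos_iff.2 hμ))
  obtain ⟨K, K', hK⟩ := h.norm_meanEnergy_le hb hg hc₂ hγ hk.ne' hg₀ he₂ (isCorrector_const a h₀)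
    (residualLimit_const a h₀ k) hb' hg' hf₂ (isCorrector_const a h') (residualLimit_const a h' k)
    τ hs0 hs2.le
  set ψ := |τ * Real.sin (τ * √(γ * k ^ 2)) * (1 + γ * k ^ 2) ^ 2 / (2 * √(γ * k ^ 2))| with hψ
  set σ : ℝ := (1 + 1 * k ^ 2) ^ (-s / 2) with hσd
  have hσ : 0 ≤ σ := Real.rpow_nonneg (by positivity) _
  have hψ0 : 0 ≤ ψ := abs_nonneg _
  set r := residualLimit a b g θ γ η v Dv k
  set E := energyConst d c c₁
  set ω₁ := waveNorm a v
  set m := cutoffMass d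
  set ρ : ℝ := (1 + γ * k ^ 2)⁻¹ ^ 2 with hρ
  have hρ0 : 0 ≤ ρ := sq_nonneg _
  -- Here `a₂` collects the second order part of the energy, and `a₄` the errors quadratic in the
  -- residual together with the product of the residual and the corrector.
  refine hlt.not_ge (le_of_eventually_linear (a₂ := σ * (ψ * ρ) * (m * k ^ 2 * (k ^ 2 * ‖B‖)))
    (a₄ := σ * (K' * (r / E) * (|k| * ω₁)) + σ * (K * (r / E) ^ 2 + ψ * (r ^ 2 / E))) ?_)
  filter_upwards [hest, self_mem_nhdsWithin, eventually_mul_const_le (k := k)] with ε h1 hε h2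
  have hε : 0 < ε := hε
  have h3 := hK ε hε _ h1
  have n1 : waveNorm a (amplitude η v (ε * k)) ≤ W :=
    waveNorm_amplitude_le h.memLp h.memLp (fun y => le_rfl) h2
  have n2 : waveNorm a (amplitude η (0 : EuclideanSpace ℝ (Fin d) → EuclideanSpace ℂ ι) (ε * k)) ≤ W :=
    waveNorm_amplitude_le h.memLp MemLp.zero' (fun y => by simp) h2
  have n3 : waveNorm a (amplitude η v (ε * k)) *
      waveNorm a (amplitude η (0 : EuclideanSpace ℝ (Fin d) → EuclideanSpace ℂ ι) (ε * k)) ≤ W * W :=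
    mul_le_mul n1 n2 (Real.sqrt_nonneg _) (Real.sqrt_nonneg _)
  have n4 : m * k ^ 2 * (ε * |k| * ‖μ‖ - ε ^ 2 * (k ^ 2 * ‖B‖)) ≤
      ‖(m : ℂ) * k ^ 2 * meanEnergy a b g θ γ η v Dv (ε * k)‖ := by
    have e1 : ‖(m : ℂ) * (k : ℂ) ^ 2‖ = m * k ^ 2 := by
      rw [norm_mul, norm_pow, Complex.norm_real, Complex.norm_real, Real.norm_of_nonneg hm.le,
        Real.norm_eq_abs, sq_abs]
    rw [norm_mul, e1, hB]
    refine mul_le_mul_of_nonneg_left ?_ (by positivity)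
    have e2 : ‖(((ε * k : ℝ)) : ℂ) * μ‖ = ε * |k| * ‖μ‖ := by
      rw [norm_mul, Complex.norm_real, Real.norm_eq_abs, abs_mul, abs_of_pos hε]
    have e3 : ‖((ε * k : ℝ) : ℂ) ^ 2 * B‖ = ε ^ 2 * (k ^ 2 * ‖B‖) := by
      rw [norm_mul, norm_pow, Complex.norm_real, Real.norm_eq_abs, sq_abs]
      ring
    rw [← e2, ← e3]
    exact norm_sub_le_norm_add _ _
  have n5 := mul_le_mul_of_nonneg_left n4 (mul_nonneg hσ (mul_nonneg hψ0 hρ0))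
  have n6 := mul_le_mul_of_nonneg_left n3 (mul_nonneg hC.le hε.le)
  calc ε * (σ * (ψ * ρ) * (k ^ 2 * |k| * (m * ‖μ‖))) -
        ε ^ 2 * (σ * (ψ * ρ) * (m * k ^ 2 * (k ^ 2 * ‖B‖))) =
      σ * (ψ * ρ) * (m * k ^ 2 * (ε * |k| * ‖μ‖ - ε ^ 2 * (k ^ 2 * ‖B‖))) := by ring
    _ ≤ _ := n5
    _ ≤ _ := h3
    _ ≤ C * ε * (W * W) + σ * (K' * (ε * r / E) * (ε * |k| * ω₁)) +
        σ * (K * (ε * r / E) ^ 2 + ψ * ((ε * r) ^ 2 / E)) := by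
      exact add_le_add (add_le_add n6 le_rfl) le_rfl
    _ = _ := by ring

end Contradiction

/-! ### Ellipticity constants from the hypotheses on `b` and `g`. -/

section Ellipticity

variable {d : ℕ} {ι κ : Type*} [Fintype ι] [Fintype κ]

theorem mulVec_injective_of_rank_eq {M : Matrix κ ι ℂ} (h : M.rank = Fintype.card ι) :
    Function.Injective (matCLM M) := by
  have h1 := LinearMap.finrank_range_add_finrank_ker M.mulVecLin
  rw [← Matrix.rank, h, Module.finrank_fintype_fun_eq_card, add_eq_left,
    Submodule.finrank_eq_zero, LinearMap.ker_eq_bot] at h1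
  intro v w hvw
  exact WithLp.ofLp_injective 2 (h1 (congrArg WithLp.ofLp hvw))

theorem continuous_matCLM_symbol (b : Fin d → Matrix κ ι ℂ) :
    Continuous fun p : EuclideanSpace ℝ (Fin d) × EuclideanSpace ℂ ι =>
      matCLM (symbol b p.1) p.2 := by
  simp only [symbol, map_sum, map_smul, _root_.sum_apply, _root_.smul_apply]
  refine continuous_finsetSum _ fun l _ => ?_
  have h1 : Continuous fun p : EuclideanSpace ℝ (Fin d) × EuclideanSpace ℂ ι => ((p.1 l : ℝ) : ℂ) :=
    Complex.continuous_ofReal.comp ((EuclideanSpace.proj l).continuous.comp continuous_fst)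
  exact h1.smul ((matCLM (b l)).continuous.comp continuous_snd)

/-- By full rank the norm of `b(ξ)v` is positive on the compact product of unit spheres, hence
bounded below there; homogeneity in `ξ` and `v` extends the bound. -/
theorem exists_isEllipticSymbol (b : Fin d → Matrix κ ι ℂ)
    (hb : ∀ ξ : EuclideanSpace ℝ (Fin d), ξ ≠ 0 → (symbol b ξ).rank = Fintype.card ι) :
    ∃ c, IsEllipticSymbol b c := by
  set K : Set (EuclideanSpace ℝ (Fin d) × EuclideanSpace ℂ ι) :=
    Metric.sphere 0 1 ×ˢ Metric.sphere 0 1 with hK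
  have hKc : IsCompact K := (isCompact_sphere 0 1).prod (isCompact_sphere 0 1)
  have hpos : ∀ p ∈ K, 0 < ‖matCLM (symbol b p.1) p.2‖ := by
    rintro ⟨ξ, v⟩ ⟨h1, h2⟩
    have hξ : ξ ≠ 0 := ne_zero_of_mem_unit_sphere ⟨ξ, h1⟩
    have hv : v ≠ 0 := ne_zero_of_mem_unit_sphere ⟨v, h2⟩
    rw [norm_pos_iff, Ne, ← map_zero (matCLM (symbol b ξ)),
      (mulVec_injective_of_rank_eq (hb ξ hξ)).eq_iff]
    exact hv
  obtain ⟨c, hc, h⟩ : ∃ c : ℝ, 0 < c ∧ ∀ p ∈ K, c ≤ ‖matCLM (symbol b p.1) p.2‖ := by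
    -- The product of spheres is empty if one of the spaces is trivial; then any constant will do.
    rcases K.eq_empty_or_nonempty with h0 | h0
    · exact ⟨1, one_pos, by simp [h0]⟩
    · obtain ⟨p, hp, hmin⟩ := hKc.exists_isMinOn h0
        (continuous_matCLM_symbol b).norm.continuousOn
      exact ⟨_, hpos p hp, fun q hq => hmin hq⟩
  refine ⟨c, hc, fun ξ v => ?_⟩
  rcases eq_or_ne ξ 0 with rfl | hξ
  · simp
  rcases eq_or_ne v 0 with rfl | hv
  · simp
  have hξ' := norm_pos_iff.2 hξ
  have hv' := norm_pos_iff.2 hv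
  have h1 := h (‖ξ‖⁻¹ • ξ, (‖v‖⁻¹ : ℂ) • v) ⟨by simp [norm_smul, hξ'.ne'], by simp [norm_smul, hv'.ne']⟩
  simp only [symbol_smul, map_smul, _root_.smul_apply, norm_smul, norm_inv, Complex.norm_real,
    norm_norm, Complex.ofReal_inv] at h1
  rw [← mul_assoc, ← mul_inv, mul_comm, ← div_eq_mul_inv, le_div_iff₀ (by positivity)] at h1
  linarith

theorem inner_matCLM_eq_star_dotProduct (M : Matrix κ κ ℂ) (v : EuclideanSpace ℂ κ) :
    ⟪v, matCLM M v⟫_ℂ = star v.ofLp ⬝ᵥ (M *ᵥ v.ofLp) := by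
  rw [inner_eq_dotProduct, ofLp_matCLM]

/-- This converts the entrywise `L∞` bounds of the hypotheses into bounds for operator norms. -/
theorem norm_matCLM_le [DecidableEq ι] [DecidableEq κ] (M : Matrix κ ι ℂ) :
    ‖matCLM M‖ ≤ ∑ i, ∑ j, ‖M i j‖ * ‖matCLM (Matrix.single i j (1 : ℂ) : Matrix κ ι ℂ)‖ := by
  have e : M = ∑ i, ∑ j, M i j • (Matrix.single i j (1 : ℂ) : Matrix κ ι ℂ) := by
    conv_lhs => rw [Matrix.matrix_eq_sum_single M]
    simp [Matrix.smul_single]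
  conv_lhs => rw [e]
  simp only [map_sum, map_smul]
  refine (norm_sum_le _ _).trans (Finset.sum_le_sum fun i _ => (norm_sum_le _ _).trans
    (Finset.sum_le_sum fun j _ => ?_))
  rw [norm_smul]

theorem exists_ae_norm_matCLM_le {α : Type*} [MeasurableSpace α] {μ : Measure α}
    {g : α → Matrix κ ι ℂ} (h : ∀ i j, MemLp (fun x => g x i j) ∞ μ) :
    ∃ C : ℝ, 0 < C ∧ ∀ᵐ x ∂μ, ‖matCLM (g x)‖ ≤ C := by
  classical
  have h1 : ∀ i j, ∃ C : ℝ, ∀ᵐ x ∂μ, ‖g x i j‖ ≤ C := fun i j => by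
    refine ⟨(eLpNormEssSup (fun x => g x i j) μ).toReal, ?_⟩
    have h2 := (h i j).2
    rw [eLpNorm_exponent_top] at h2
    filter_upwards [ae_le_eLpNormEssSup (f := fun x => g x i j) (μ := μ)] with x hx
    rw [← toReal_enorm]
    exact ENNReal.toReal_mono h2.ne hx
  choose C hC using h1
  refine ⟨|∑ i, ∑ j, C i j * ‖matCLM (Matrix.single i j (1 : ℂ) : Matrix κ ι ℂ)‖| + 1,
    by positivity, ?_⟩
  filter_upwards [ae_all_iff.2 fun i => ae_all_iff.2 (hC i)] with x hx
  refine (norm_matCLM_le _).trans (le_trans ?_ ((le_abs_self _).trans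
    (le_add_of_nonneg_right zero_le_one)))
  exact Finset.sum_le_sum fun i _ => Finset.sum_le_sum fun j _ =>
    mul_le_mul_of_nonneg_right (hx i j) (norm_nonneg _)

/-- A positive definite matrix is bounded below by the reciprocal of the norm of its inverse. -/
theorem le_inner_matCLM_of_norm_inv_le [DecidableEq κ] {G : Matrix κ κ ℂ} (hG : G.PosDef) {C : ℝ}
    (hC0 : 0 < C) (hC : ‖matCLM G⁻¹‖ ≤ C) (v : EuclideanSpace ℂ κ) :
    C⁻¹ * ‖v‖ ^ 2 ≤ (⟪v, matCLM G v⟫_ℂ).re := by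
  set w := matCLM G⁻¹ v with hw
  have hGw : matCLM G w = v := by
    rw [hw, ← matCLM_mul, Matrix.mul_nonsing_inv _ ((Matrix.isUnit_iff_isUnit_det _).1 hG.isUnit)]
    exact WithLp.ofLp_injective 2 (Matrix.one_mulVec _)
  -- Positivity of the form at `v - C⁻¹G⁻¹v` gives `⟨v, Gv⟩ ≥ 2C⁻¹‖v‖² - C⁻²⟨G⁻¹v, v⟩`, and the last
  -- product is at most `C‖v‖²`.
  have h0 : 0 ≤ (⟪v - (C⁻¹ : ℂ) • w, matCLM G (v - (C⁻¹ : ℂ) • w)⟫_ℂ).re := by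
    rw [inner_matCLM_eq_star_dotProduct]
    exact (Complex.nonneg_iff.1 (hG.posSemidef.dotProduct_mulVec_nonneg _)).1
  have h1 : ⟪w, matCLM G v⟫_ℂ = ⟪v, v⟫_ℂ := by
    rw [← hG.1.eq, ← inner_matCLM_left, hGw]
  have h2 : (⟪w, v⟫_ℂ).re ≤ C * ‖v‖ ^ 2 := by
    refine (Complex.re_le_norm _).trans ((norm_inner_le_norm _ _).trans ?_)
    rw [sq, ← mul_assoc]
    exact mul_le_mul_of_nonneg_right ((matCLM G⁻¹).le_of_opNorm_le hC v) (norm_nonneg _)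
  have h3 : (⟪v, v⟫_ℂ).re = ‖v‖ ^ 2 := inner_self_eq_norm_sq (𝕜 := ℂ) v
  have e : (⟪v - (C⁻¹ : ℂ) • w, matCLM G (v - (C⁻¹ : ℂ) • w)⟫_ℂ).re =
      (⟪v, matCLM G v⟫_ℂ).re - 2 * (C⁻¹ * ‖v‖ ^ 2) + C⁻¹ * (C⁻¹ * (⟪w, v⟫_ℂ).re) := by
    rw [map_sub, map_smul, hGw, inner_sub_left, inner_sub_right, inner_sub_right, inner_smul_left,
      inner_smul_right, inner_smul_left, inner_smul_right, h1, ← Complex.ofReal_inv,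
      Complex.conj_ofReal]
    simp only [Complex.sub_re, Complex.re_ofReal_mul, h3]
    ring
  have h4 : C⁻¹ * (⟪w, v⟫_ℂ).re ≤ ‖v‖ ^ 2 := by
    rw [inv_mul_le_iff₀ hC0]
    exact h2
  have h5 := mul_le_mul_of_nonneg_left h4 (inv_nonneg.2 hC0.le)
  linarith

theorem exists_isEllipticCoeff [DecidableEq κ] {α : Type*} [MeasurableSpace α] {μ : Measure α}
    {g : α → Matrix κ κ ℂ}
    (hp : ∀ᵐ x ∂μ, (g x).PosDef) (hg : ∀ i j, MemLp (fun x => g x i j) ∞ μ)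
    (hi : ∀ i j, MemLp (fun x => (g x)⁻¹ i j) ∞ μ) :
    ∃ c₁ c₂, 0 ≤ c₂ ∧ IsEllipticCoeff μ g c₁ c₂ := by
  obtain ⟨C, hC0, hC⟩ := exists_ae_norm_matCLM_le hg
  obtain ⟨C', hC'0, hC'⟩ := exists_ae_norm_matCLM_le hi
  refine ⟨C'⁻¹, C, hC0.le, inv_pos.2 hC'0, fun i j => (hg i j).1, hp.mono fun x h => h.1, ?_, ?_⟩
  · filter_upwards [hp, hC'] with x h1 h2
    exact le_inner_matCLM_of_norm_inv_le h1 hC'0 h2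
  · filter_upwards [hC] with x h1 v
    exact (matCLM (g x)).le_of_opNorm_le h1 v

theorem isEllipticCoeff_one [DecidableEq κ] {α : Type*} [MeasurableSpace α] (μ : Measure α) :
    IsEllipticCoeff μ (fun _ : α => (1 : Matrix κ κ ℂ)) 1 1 := by
  have e : ∀ v : EuclideanSpace ℂ κ, matCLM (1 : Matrix κ κ ℂ) v = v := fun v =>
    WithLp.ofLp_injective 2 (Matrix.one_mulVec _)
  refine ⟨one_pos, fun i j => aestronglyMeasurable_const, .of_forall fun _ => Matrix.isHermitian_one,
    .of_forall fun _ v => ?_, .of_forall fun _ v => ?_⟩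
  · rw [e, one_mul]
    exact (inner_self_eq_norm_sq (𝕜 := ℂ) v).ge
  · rw [e, one_mul]

theorem matCLM_symbol_gradCoeff_apply [DecidableEq ι] (ξ : EuclideanSpace ℝ (Fin d))
    (v : EuclideanSpace ℂ ι) (p : Fin d × ι) :
    matCLM (symbol (gradCoeff d ι) ξ) v p = (ξ p.1 : ℂ) * v p.2 := by
  obtain ⟨l, i⟩ := p
  have h : ∀ j, symbol (gradCoeff d ι) ξ (l, i) j = if i = j then (ξ l : ℂ) else 0 := fun j => by
    rw [symbol, Matrix.sum_apply, Finset.sum_eq_single l]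
    · simp [gradCoeff]
    · intro l' _ hl
      simp [gradCoeff, Ne.symm hl]
    · simp
  change (symbol (gradCoeff d ι) ξ *ᵥ v.ofLp) (l, i) = _
  simp [Matrix.mulVec, dotProduct, h]

/-- The symbol of the gradient sends `v` to `ξ ⊗ v`. Hence `H₀` fits the same framework, with
eigenvalue `1` on every vector in a unit direction. -/
theorem inner_symbol_gradCoeff [DecidableEq ι] (ξ : EuclideanSpace ℝ (Fin d))
    (v w : EuclideanSpace ℂ ι) :
    ⟪matCLM (symbol (gradCoeff d ι) ξ) v, matCLM (symbol (gradCoeff d ι) ξ) w⟫_ℂ =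
      (‖ξ‖ ^ 2 : ℝ) * ⟪v, w⟫_ℂ := by
  rw [PiLp.inner_apply, PiLp.inner_apply, Fintype.sum_prod_type, EuclideanSpace.norm_sq_eq,
    Complex.ofReal_sum, Finset.sum_mul_sum]
  refine Finset.sum_congr rfl fun l _ => Finset.sum_congr rfl fun i _ => ?_
  simp only [matCLM_symbol_gradCoeff_apply, RCLike.inner_apply, map_mul, Complex.conj_ofReal,
    Real.norm_eq_abs, sq_abs, Complex.ofReal_pow]
  ring

theorem isEllipticSymbol_gradCoeff [DecidableEq ι] : IsEllipticSymbol (gradCoeff d ι) 1 where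
  pos := one_pos
  le ξ v := by
    rw [one_mul]
    refine le_of_eq ((sq_eq_sq₀ (by positivity) (norm_nonneg _)).1 ?_)
    have h1 := congrArg Complex.re (inner_symbol_gradCoeff ξ v v)
    have h2 : (⟪v, v⟫_ℂ).re = ‖v‖ ^ 2 := inner_self_eq_norm_sq (𝕜 := ℂ) v
    rw [Complex.re_ofReal_mul, h2, ← mul_pow] at h1
    rw [← h1]
    exact inner_self_eq_norm_sq (𝕜 := ℂ) _

theorem symbol_gradCoeff_sq [DecidableEq ι] {θ : EuclideanSpace ℝ (Fin d)} (hθ : ‖θ‖ = 1)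
    (v : EuclideanSpace ℂ ι) :
    matCLM (symbol (gradCoeff d ι) θ)ᴴ
      (matCLM (1 : Matrix (Fin d × ι) (Fin d × ι) ℂ) (matCLM (symbol (gradCoeff d ι) θ) v)) =
      ((1 : ℝ) : ℂ) • v := by
  have e : ∀ v : EuclideanSpace ℂ (Fin d × ι), matCLM (1 : Matrix (Fin d × ι) (Fin d × ι) ℂ) v = v :=
    fun v => WithLp.ofLp_injective 2 (Matrix.one_mulVec _)
  rw [e, Complex.ofReal_one, one_smul]
  refine ext_inner_left ℂ fun w => ?_
  rw [← inner_matCLM_left, inner_symbol_gradCoeff, hθ]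
  simp

end Ellipticity

/-! ### Periodicity and mean values of weak derivatives. -/

section Translation

variable {d : ℕ} {F : Type*} [NormedAddCommGroup F] [NormedSpace ℝ F]

omit [NormedSpace ℝ F] in
theorem MeasureTheory.LocallyIntegrable.comp_add_right {f : EuclideanSpace ℝ (Fin d) → F}
    (hf : LocallyIntegrable f volume) (y : EuclideanSpace ℝ (Fin d)) :
    LocallyIntegrable (fun x => f (x + y)) volume := by
  rw [locallyIntegrable_iff]
  intro K hK
  have h1 := hf.integrableOn_isCompact (hK.image (continuous_add_const y))
  exact ((measurePreserving_add_right volume y).integrableOn_image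
    (measurableEmbedding_addRight y)).1 h1

namespace HasWeakGradient

variable {u : EuclideanSpace ℝ (Fin d) → F} {Du : Fin d → EuclideanSpace ℝ (Fin d) → F}

theorem comp_add_right (h : HasWeakGradient u Du) (y : EuclideanSpace ℝ (Fin d)) :
    HasWeakGradient (fun x => u (x + y)) fun l x => Du l (x + y) where
  locallyIntegrable := h.locallyIntegrable.comp_add_right y
  locallyIntegrable_deriv l := (h.locallyIntegrable_deriv l).comp_add_right y
  integral_eq l φ h1 h2 := by
    have e := h.integral_eq l (fun x => φ (x - y)) (h1.comp (contDiff_id.sub contDiff_const))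
      (h2.comp_homeomorph (Homeomorph.subRight y))
    rw [← integral_add_right_eq_self (fun x => fderiv ℝ (fun x => φ (x - y)) x _ • u x) y,
      ← integral_add_right_eq_self (fun x => φ (x - y) • Du l x) y] at e
    simpa only [fderiv_comp_sub, add_sub_cancel_right] using e

/-- Weak gradients are determined by the restrictions to balls. -/
theorem of_forall_ball (h : ∀ R : ℝ, ∃ w Dw, HasWeakGradient w Dw ∧
    ∀ x, ‖x‖ ≤ R → u x = w x ∧ ∀ l, Du l x = Dw l x) : HasWeakGradient u Du where
  locallyIntegrable := by
    rw [locallyIntegrable_iff]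
    intro K hK
    obtain ⟨R, hR⟩ := hK.isBounded.exists_norm_le
    obtain ⟨w, Dw, hw, e⟩ := h R
    exact (hw.locallyIntegrable.integrableOn_isCompact hK).congr_fun
      (fun x hx => ((e x (hR x hx)).1).symm) hK.measurableSet
  locallyIntegrable_deriv l := by
    rw [locallyIntegrable_iff]
    intro K hK
    obtain ⟨R, hR⟩ := hK.isBounded.exists_norm_le
    obtain ⟨w, Dw, hw, e⟩ := h R
    exact ((hw.locallyIntegrable_deriv l).integrableOn_isCompact hK).congr_fun
      (fun x hx => ((e x (hR x hx)).2 l).symm) hK.measurableSet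
  integral_eq l φ h1 h2 := by
    obtain ⟨R, hR⟩ := h2.isCompact.isBounded.exists_norm_le
    obtain ⟨w, Dw, hw, e⟩ := h R
    have e1 : ∀ x, fderiv ℝ φ x (EuclideanSpace.single l 1) • u x =
        fderiv ℝ φ x (EuclideanSpace.single l 1) • w x := fun x => by
      by_cases hx : x ∈ tsupport φ
      · rw [(e x (hR x hx)).1]
      · rw [image_eq_zero_of_notMem_tsupport fun h => hx (tsupport_fderiv_subset ℝ h)]
        simp
    have e2 : ∀ x, φ x • Du l x = φ x • Dw l x := fun x => by
      by_cases hx : x ∈ tsupport φ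
      · rw [(e x (hR x hx)).2]
      · rw [image_eq_zero_of_notMem_tsupport hx, zero_smul, zero_smul]
    simp only [e1, e2]
    exact hw.integral_eq l φ h1 h2

variable {a : Module.Basis (Fin d) ℝ (EuclideanSpace ℝ (Fin d))}

/-- The weak derivatives of a periodic function are periodic up to a null set. -/
theorem fract_ae_eq [CompleteSpace F] (h : HasWeakGradient u Du) (hu : IsLatticePeriodic a u)
    (l : Fin d) : (fun x => Du l (ZSpan.fract a x)) =ᵐ[volume] Du l := by
  -- Each lattice shift of the derivatives is again a weak gradient of `u`, so it agrees with the
  -- original off a null set; the lattice is countable.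
  have h1 : ∀ᵐ x, ∀ y : Submodule.span ℤ (Set.range a), Du l (x + y) = Du l x := by
    have : Countable (Submodule.span ℤ (Set.range a)) := inferInstance
    refine ae_all_iff.2 fun y => ?_
    exact (h.comp_add_right (y : EuclideanSpace ℝ (Fin d))).ae_eq_of_ae_eq h
      (.of_forall fun x => hu.add_mem y.2 x) l
  filter_upwards [h1] with x hx
  rw [ZSpan.fract_apply, sub_eq_add_neg]
  exact hx (-(ZSpan.floor a x))

/-- `PeriodicH1` does not require the derivatives to be periodic. Composing with the fractional part
yields exactly periodic representatives, as needed in `IsCorrector`. -/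
theorem fract (h : HasWeakGradient u Du) [CompleteSpace F] (hu : IsLatticePeriodic a u) :
    HasWeakGradient u fun l x => Du l (ZSpan.fract a x) :=
  h.congr (.refl _ _) fun l => (h.fract_ae_eq hu l).symm

/-- The weak derivatives of a periodic function have mean value zero. -/
theorem setIntegral_deriv_eq_zero [CompleteSpace F] (h : HasWeakGradient u Du)
    (hu : IsLatticePeriodic a u) (hD : ∀ l, IsLatticePeriodic a (Du l)) (l : Fin d) :
    ∫ x in ZSpan.fundamentalDomain a, Du l x = 0 := by
  have hΩ := ZSpan.fundamentalDomain_isBounded a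
  have ion : ∀ {f : EuclideanSpace ℝ (Fin d) → F}, LocallyIntegrable f volume →
      IntegrableOn f (ZSpan.fundamentalDomain a) := fun hf =>
    (hf.integrableOn_isCompact hΩ.isCompact_closure).mono_set subset_closure
  set χ : EuclideanSpace ℝ (Fin d) → ℝ := fun x => cutoff d x ^ 2 with hχ
  have c1 : ContDiff ℝ ∞ χ := (contDiff_cutoff (k := ⊤)).pow 2
  have c2 : HasCompactSupport χ :=
    hasCompactSupport_cutoff.comp_left (g := fun r : ℝ => r ^ 2) (by simp)
  -- Integration by parts against `χ(δx)` equates the normalized average of the derivative with `-δ`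
  -- times a convergent average of `u`. The limit is zero, while the weight `χ` has positive
  -- integral.
  have t1 := (hD l).tendsto_average (h.locallyIntegrable_deriv l).aestronglyMeasurable
    (ion (h.locallyIntegrable_deriv l)) c1.continuous c2 one_pos
  have t2 := hu.tendsto_average h.locallyIntegrable.aestronglyMeasurable
    (ion h.locallyIntegrable) (χ := fun x => fderiv ℝ χ x (EuclideanSpace.single l 1))
    ((c1.continuous_fderiv (by simp)).clm_apply continuous_const) (c2.fderiv_apply ℝ _) one_pos
  have t0 : Tendsto (fun δ : ℝ => -δ) (𝓝[>] 0) (𝓝 (-0)) :=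
    (tendsto_nhdsWithin_of_tendsto_nhds tendsto_id).neg
  have t3 := t0.smul t2
  have e := tendsto_nhds_unique_of_eventuallyEq t1 t3 ?_
  · rw [neg_zero, zero_smul, smul_smul] at e
    refine (smul_eq_zero.1 e).resolve_left (mul_ne_zero ?_ ?_)
    · exact (cutoffMass_pos (d := d)).ne'
    · exact inv_ne_zero IsLatticePeriodic.volume_real_fundamentalDomain_pos.ne'
  · filter_upwards [self_mem_nhdsWithin] with δ hδ
    have hδ : δ ≠ 0 := ne_of_gt hδ
    have e1 := h.integral_eq l (fun x => χ (δ • x)) (c1.comp (contDiff_const_smul δ))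
      (c2.comp_homeomorph (Homeomorph.smulOfNeZero δ hδ))
    have e2 : ∀ x, fderiv ℝ (fun x => χ (δ • x)) x (EuclideanSpace.single l 1) =
        δ * fderiv ℝ χ (δ • x) (EuclideanSpace.single l 1) := fun x => by
      rw [fderiv_comp_smul]
      rfl
    simp only [e2, mul_smul, integral_smul] at e1
    simp only [inv_one, one_smul]
    rw [← neg_eq_iff_eq_neg.2 e1, smul_neg, neg_smul, smul_comm]

end HasWeakGradient

end Translation

/-! ### Periodization of compactly supported functions. -/

section Periodization

variable {d : ℕ} {F : Type*} [NormedAddCommGroup F]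
  {a : Module.Basis (Fin d) ℝ (EuclideanSpace ℝ (Fin d))}

/-- The sum of the lattice translates of a function. -/
noncomputable def latticeSum (a : Module.Basis (Fin d) ℝ (EuclideanSpace ℝ (Fin d)))
    (f : EuclideanSpace ℝ (Fin d) → F) (x : EuclideanSpace ℝ (Fin d)) : F :=
  ∑' y : (Submodule.span ℤ (Set.range a)).toAddSubgroup, f (x + y)

theorem isLatticePeriodic_latticeSum (f : EuclideanSpace ℝ (Fin d) → F) :
    IsLatticePeriodic a (latticeSum a f) := fun j x => by
  have h : a j ∈ (Submodule.span ℤ (Set.range a)).toAddSubgroup := Submodule.subset_span ⟨j, rfl⟩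
  have e := (Equiv.addLeft ⟨a j, h⟩).tsum_eq fun y :
    (Submodule.span ℤ (Set.range a)).toAddSubgroup => f (x + y)
  simp only [Equiv.coe_addLeft, AddSubgroup.coe_add, ← add_assoc] at e
  exact e

/-- Only finitely many lattice points lie in a ball, so on bounded sets every lattice sum is a
finite sum over one fixed set of shifts. -/
theorem exists_finset_translates {K : Set (EuclideanSpace ℝ (Fin d))} (hK : IsCompact K) (R : ℝ) :
    ∃ S : Finset (Submodule.span ℤ (Set.range a)).toAddSubgroup,
      ∀ x : EuclideanSpace ℝ (Fin d), ‖x‖ ≤ R → ∀ y ∉ S, x + y ∉ K := by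
  obtain ⟨r, hr⟩ := hK.isBounded.exists_norm_le
  have hf := ZSpan.setFinite_inter a (Metric.isBounded_closedBall (x := 0) (r := r + R))
  have hf' : {y : (Submodule.span ℤ (Set.range a)).toAddSubgroup |
      ‖(y : EuclideanSpace ℝ (Fin d))‖ ≤ r + R}.Finite := by
    refine Set.Finite.of_finite_image (hf.subset ?_) Subtype.val_injective.injOn
    rintro _ ⟨y, hy, rfl⟩
    exact ⟨by simpa using hy, y.2⟩
  refine ⟨hf'.toFinset, fun x hx y hy hxy => hy ?_⟩
  rw [Set.Finite.mem_toFinset]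
  have h1 := hr _ hxy
  have h2 : ‖(y : EuclideanSpace ℝ (Fin d))‖ ≤ ‖x + y‖ + ‖x‖ := by
    have := norm_sub_le (x + (y : EuclideanSpace ℝ (Fin d))) x
    rwa [add_sub_cancel_left] at this
  exact h2.trans (add_le_add h1 hx)

theorem latticeSum_eq_sum {f : EuclideanSpace ℝ (Fin d) → F} {x : EuclideanSpace ℝ (Fin d)}
    {S : Finset (Submodule.span ℤ (Set.range a)).toAddSubgroup}
    (hS : ∀ y ∉ S, x + y ∉ tsupport f) : latticeSum a f x = ∑ y ∈ S, f (x + y) :=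
  tsum_eq_sum fun y hy => image_eq_zero_of_notMem_tsupport (hS y hy)

variable [NormedSpace ℝ F]

theorem contDiff_sum_translates {f : EuclideanSpace ℝ (Fin d) → F} {k : ℕ∞} (hf : ContDiff ℝ k f)
    (S : Finset (Submodule.span ℤ (Set.range a)).toAddSubgroup) :
    ContDiff ℝ k fun x : EuclideanSpace ℝ (Fin d) => ∑ y ∈ S, f (x + y) :=
  ContDiff.sum fun _ _ => hf.comp (contDiff_id.add contDiff_const)

/-- On each ball the sum is finite and differentiable termwise, and weak gradients are local. -/
theorem hasWeakGradient_latticeSum {f : EuclideanSpace ℝ (Fin d) → F} (h1 : ContDiff ℝ 1 f)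
    (h2 : HasCompactSupport f) : HasWeakGradient (latticeSum a f) fun l =>
      latticeSum a fun x => fderiv ℝ f x (EuclideanSpace.single l 1) := by
  refine HasWeakGradient.of_forall_ball fun R => ?_
  obtain ⟨S, hS⟩ := exists_finset_translates (a := a) h2.isCompact R
  refine ⟨fun x => ∑ y ∈ S, f (x + y), _,
    HasWeakGradient.of_contDiff (contDiff_sum_translates (k := 1) h1 S), fun x hx =>
      ⟨latticeSum_eq_sum (hS x hx), fun l => ?_⟩⟩
  have hd : ∀ y ∈ S, DifferentiableAt ℝ (fun x : EuclideanSpace ℝ (Fin d) => f (x + y)) x :=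
    fun y _ => (h1.comp (contDiff_id.add contDiff_const)).differentiable one_ne_zero x
  rw [latticeSum_eq_sum fun y hy h => hS x hx y hy (tsupport_fderiv_apply_subset ℝ _ h),
    fderiv_fun_sum hd, _root_.sum_apply]
  simp only [fderiv_comp_add_right]

omit [NormedSpace ℝ F] in
theorem memLp_latticeSum {f : EuclideanSpace ℝ (Fin d) → F} (h1 : Continuous f)
    (h2 : HasCompactSupport f) :
    MemLp (latticeSum a f) 2 (volume.restrict (ZSpan.fundamentalDomain a)) := by
  obtain ⟨D, -, hD⟩ := IsLatticePeriodic.exists_norm_le_of_mem_fundamentalDomain a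
  obtain ⟨S, hS⟩ := exists_finset_translates (a := a) h2.isCompact D
  have h3 : MemLp (fun x => ∑ y ∈ S, f (x + y)) 2 volume :=
    memLp_finsetSum _ fun y _ =>
      (h1.comp (continuous_add_const _)).memLp_of_hasCompactSupport
        (h2.comp_homeomorph (Homeomorph.addRight (y : EuclideanSpace ℝ (Fin d))))
  refine (memLp_congr_ae ?_).2 (h3.restrict (ZSpan.fundamentalDomain a))
  filter_upwards [ae_restrict_mem (ZSpan.fundamentalDomain_measurableSet a)] with x hx
  exact latticeSum_eq_sum (hS x (hD x hx))

/-- Integrals against a periodic function unfold to the whole space. -/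
theorem integral_inner_eq_setIntegral_latticeSum {G : Type*} [NormedAddCommGroup G]
    [InnerProductSpace ℂ G] {X q : EuclideanSpace ℝ (Fin d) → G} (h1 : Continuous X)
    (h2 : HasCompactSupport X) (hq : IsLatticePeriodic a q) (hl : LocallyIntegrable q volume) :
    ∫ x, ⟪X x, q x⟫_ℂ = ∫ x in ZSpan.fundamentalDomain a, ⟪latticeSum a X x, q x⟫_ℂ := by
  obtain ⟨D, -, hD⟩ := IsLatticePeriodic.exists_norm_le_of_mem_fundamentalDomain a
  obtain ⟨S, hS⟩ := exists_finset_translates (a := a) h2.isCompact D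
  have hi : ∀ {Z : EuclideanSpace ℝ (Fin d) → G}, Continuous Z → HasCompactSupport Z →
      Integrable (fun x => ⟪Z x, q x⟫_ℂ) volume := fun {Z} c1 c2 => by
    obtain ⟨C, hC⟩ := c2.exists_bound_of_continuous c1
    have i1 := hl.integrableOn_isCompact c2.isCompact
    have i2 : IntegrableOn (fun x => ⟪Z x, q x⟫_ℂ) (tsupport Z) := by
      refine (i1.norm.const_mul C).mono' (c1.aestronglyMeasurable.inner i1.1) (.of_forall fun x => ?_)
      exact (norm_inner_le_norm _ _).trans (mul_le_mul_of_nonneg_right (hC x) (norm_nonneg _))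
    refine (integrableOn_iff_integrable_of_support_subset fun x hx => ?_).1 i2
    by_contra h
    exact hx (by simp only [image_eq_zero_of_notMem_tsupport h, inner_zero_left])
  have c1 : ∀ y : (Submodule.span ℤ (Set.range a)).toAddSubgroup,
      Continuous fun x : EuclideanSpace ℝ (Fin d) => X (x + y) :=
    fun y => h1.comp (continuous_add_const _)
  have c2 : ∀ y : (Submodule.span ℤ (Set.range a)).toAddSubgroup,
      HasCompactSupport fun x : EuclideanSpace ℝ (Fin d) => X (x + y) := fun y =>
    h2.comp_homeomorph (Homeomorph.addRight (y : EuclideanSpace ℝ (Fin d)))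
  have e1 : ∀ y : (Submodule.span ℤ (Set.range a)).toAddSubgroup, ∀ x : EuclideanSpace ℝ (Fin d),
      ⟪X (y +ᵥ x), q (y +ᵥ x)⟫_ℂ = ⟪X (x + y), q x⟫_ℂ := fun y x => by
    rw [hq.vadd_eq, AddSubgroup.vadd_def, vadd_eq_add, add_comm]
  rw [(ZSpan.isAddFundamentalDomain' a volume).integral_eq_tsum'' _ (hi h1 h2)]
  simp only [e1]
  rw [tsum_eq_sum (s := S), ← integral_finsetSum _ fun y _ => (hi (c1 y) (c2 y)).integrableOn]
  · refine setIntegral_congr_fun (ZSpan.fundamentalDomain_measurableSet a) fun x hx => ?_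
    simp only [latticeSum_eq_sum (hS x (hD x hx)), sum_inner]
  · intro y hy
    refine setIntegral_eq_zero_of_forall_eq_zero fun x hx => ?_
    rw [image_eq_zero_of_notMem_tsupport (hS x (hD x hx) y hy), inner_zero_left]

end Periodization

/-! ### Fields and fluxes of the cell problem. -/

section CellFields

variable {d n m : ℕ}

/-- The linear combinations of the columns of the solution of the cell problem. -/
noncomputable def cellVector (Λ : EuclideanSpace ℝ (Fin d) → Matrix (Fin n) (Fin m) ℂ)
    (z : EuclideanSpace ℂ (Fin m)) (x : EuclideanSpace ℝ (Fin d)) : EuclideanSpace ℂ (Fin n) :=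
  matCLM (Λ x) z

/-- The exactly periodic representatives of the derivatives of `cellVector`. -/
noncomputable def cellDeriv (a : Module.Basis (Fin d) ℝ (EuclideanSpace ℝ (Fin d)))
    (DΛ : Fin d → EuclideanSpace ℝ (Fin d) → Matrix (Fin n) (Fin m) ℂ)
    (z : EuclideanSpace ℂ (Fin m)) (l : Fin d) (x : EuclideanSpace ℝ (Fin d)) :
    EuclideanSpace ℂ (Fin n) :=
  matCLM (DΛ l (ZSpan.fract a x)) z

noncomputable def cellField (a : Module.Basis (Fin d) ℝ (EuclideanSpace ℝ (Fin d)))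
    (b : Fin d → Matrix (Fin m) (Fin n) ℂ)
    (DΛ : Fin d → EuclideanSpace ℝ (Fin d) → Matrix (Fin n) (Fin m) ℂ)
    (z : EuclideanSpace ℂ (Fin m)) (x : EuclideanSpace ℝ (Fin d)) : EuclideanSpace ℂ (Fin m) :=
  symbolVal b (fun l => cellDeriv a DΛ z l x) + z

noncomputable def cellFlux (a : Module.Basis (Fin d) ℝ (EuclideanSpace ℝ (Fin d)))
    (b : Fin d → Matrix (Fin m) (Fin n) ℂ)
    (g : EuclideanSpace ℝ (Fin d) → Matrix (Fin m) (Fin m) ℂ)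
    (DΛ : Fin d → EuclideanSpace ℝ (Fin d) → Matrix (Fin n) (Fin m) ℂ)
    (z : EuclideanSpace ℂ (Fin m)) (x : EuclideanSpace ℝ (Fin d)) : EuclideanSpace ℂ (Fin m) :=
  matCLM (g x) (cellField a b DΛ z x)

/-- The contribution of a column to the product of a matrix with a vector. -/
noncomputable def columnCLM (c : ℂ) : (Fin n → ℂ) →L[ℝ] EuclideanSpace ℂ (Fin n) :=
  (c • ((EuclideanSpace.equiv (Fin n) ℂ).symm : (Fin n → ℂ) →L[ℂ] EuclideanSpace ℂ (Fin n))
    ).restrictScalars ℝ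

theorem ofLp_columnCLM (c : ℂ) (f : Fin n → ℂ) (i : Fin n) : columnCLM c f i = c * f i := rfl

theorem matCLM_eq_sum_columnCLM (M : Matrix (Fin n) (Fin m) ℂ) (z : EuclideanSpace ℂ (Fin m)) :
    matCLM M z = ∑ k, columnCLM (z k) fun i => M i k := by
  refine WithLp.ofLp_injective 2 (funext fun i => ?_)
  rw [ofLp_matCLM, WithLp.ofLp_sum, Finset.sum_apply]
  simp only [ofLp_columnCLM, Matrix.mulVec, dotProduct, mul_comm]

variable {a : Module.Basis (Fin d) ℝ (EuclideanSpace ℝ (Fin d))}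
  {b : Fin d → Matrix (Fin m) (Fin n) ℂ} {g : EuclideanSpace ℝ (Fin d) → Matrix (Fin m) (Fin m) ℂ}
  {Λ : EuclideanSpace ℝ (Fin d) → Matrix (Fin n) (Fin m) ℂ}
  {DΛ : Fin d → EuclideanSpace ℝ (Fin d) → Matrix (Fin n) (Fin m) ℂ}

theorem matCLM_fluxFactor (x : EuclideanSpace ℝ (Fin d)) (z : EuclideanSpace ℂ (Fin m)) :
    matCLM (fluxFactor b DΛ x) z = symbolVal b (fun l => matCLM (DΛ l x) z) + z := by
  have e : matCLM (1 : Matrix (Fin m) (Fin m) ℂ) z = z :=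
    WithLp.ofLp_injective 2 (Matrix.one_mulVec _)
  simp only [fluxFactor, symbolVal, map_add, map_sum, _root_.add_apply, _root_.sum_apply, e,
    matCLM_mul, map_smul, _root_.smul_apply]

namespace IsCellSolution

variable (h : IsCellSolution a b g Λ DΛ) (z : EuclideanSpace ℂ (Fin m))

include h

theorem isLatticePeriodic : IsLatticePeriodic a (cellVector Λ z) := fun j x => by
  have e : Λ (x + a j) = Λ x := by
    ext i k
    exact congrFun ((h.periodicH1 k).periodic j x) i
  rw [cellVector, e, cellVector]

theorem hasWeakGradient : HasWeakGradient (cellVector Λ z) fun l x => matCLM (DΛ l x) z := by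
  have h1 := HasWeakGradient.sum (s := Finset.univ) fun k _ =>
    (h.periodicH1 k).weakGradient.clm_comp (columnCLM (z k))
  refine h1.congr (.of_forall fun x => ?_) fun l => .of_forall fun x => ?_
  · simp only [cellVector, matCLM_eq_sum_columnCLM, Finset.sum_apply]
  · simp only [matCLM_eq_sum_columnCLM, Finset.sum_apply]

theorem cellDeriv_ae_eq (l : Fin d) :
    cellDeriv a DΛ z l =ᵐ[volume] fun x => matCLM (DΛ l x) z :=
  (h.hasWeakGradient z).fract_ae_eq (h.isLatticePeriodic z) l

theorem hasWeakGradient_cellDeriv : HasWeakGradient (cellVector Λ z) (cellDeriv a DΛ z) :=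
  (h.hasWeakGradient z).fract (h.isLatticePeriodic z)

theorem memLp_cellVector :
    MemLp (cellVector Λ z) 2 (volume.restrict (ZSpan.fundamentalDomain a)) := by
  have h1 : MemLp (fun x => ∑ k, columnCLM (z k) fun i => Λ x i k) 2
      (volume.restrict (ZSpan.fundamentalDomain a)) :=
    memLp_finsetSum _ fun k _ => (columnCLM (z k)).comp_memLp' (h.periodicH1 k).memLp
  simp only [← matCLM_eq_sum_columnCLM] at h1
  exact h1

theorem memLp_cellDeriv (l : Fin d) :
    MemLp (cellDeriv a DΛ z l) 2 (volume.restrict (ZSpan.fundamentalDomain a)) := by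
  have h1 : MemLp (fun x => ∑ k, columnCLM (z k) fun i => DΛ l x i k) 2
      (volume.restrict (ZSpan.fundamentalDomain a)) :=
    memLp_finsetSum _ fun k _ => (columnCLM (z k)).comp_memLp' ((h.periodicH1 k).memLp_deriv l)
  simp only [← matCLM_eq_sum_columnCLM] at h1
  exact (memLp_congr_ae (ae_restrict_of_ae (h.cellDeriv_ae_eq z l))).2 h1

theorem memLp_cellField :
    MemLp (cellField a b DΛ z) 2 (volume.restrict (ZSpan.fundamentalDomain a)) := by
  have h1 := memLp_symbolVal b fun l => h.memLp_cellDeriv z l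
  have h2 : MemLp (fun _ : EuclideanSpace ℝ (Fin d) => z) 2
    (volume.restrict (ZSpan.fundamentalDomain a)) := memLp_const z
  have h3 := h1.add h2
  exact h3

theorem memLp_cellFlux {c₁ c₂ : ℝ} (hg : IsEllipticCoeff volume g c₁ c₂) :
    MemLp (cellFlux a b g DΛ z) 2 (volume.restrict (ZSpan.fundamentalDomain a)) :=
  (hg.restrict _).memLp_mul (h.memLp_cellField z)

theorem cellFlux_ae_eq :
    cellFlux a b g DΛ z =ᵐ[volume] fun x => matCLM (g x * fluxFactor b DΛ x) z := by
  filter_upwards [ae_all_iff.2 fun l => h.cellDeriv_ae_eq z l] with x hx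
  simp only [cellFlux, cellField, hx, matCLM_mul, matCLM_fluxFactor]

theorem setIntegral_cellVector : ∫ x in ZSpan.fundamentalDomain a, cellVector Λ z x = 0 := by
  have hi : ∀ k ∈ Finset.univ, Integrable (fun x => columnCLM (z k) fun i => Λ x i k)
      (volume.restrict (ZSpan.fundamentalDomain a)) := fun k _ =>
    (columnCLM (z k)).integrable_comp ((h.periodicH1 k).memLp.integrable (by norm_num))
  have e : ∀ k, ∫ x in ZSpan.fundamentalDomain a, (fun i => Λ x i k) = 0 := fun k => by
    refine funext fun i => ?_
    rw [eval_integral fun i => ((h.periodicH1 k).memLp.integrable (by norm_num)).eval i]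
    exact h.mean_zero i k
  simp only [cellVector, matCLM_eq_sum_columnCLM]
  rw [integral_finsetSum _ hi]
  refine Finset.sum_eq_zero fun k _ => ?_
  rw [ContinuousLinearMap.integral_comp_comm _ ((h.periodicH1 k).memLp.integrable (by norm_num)),
    e, map_zero]

/-- Derivatives of periodic functions have mean value zero, so the field `b(D)Λz + z` has mean value
`z`. -/
theorem setIntegral_symbolVal_cellDeriv :
    ∫ x in ZSpan.fundamentalDomain a, symbolVal b (fun l => cellDeriv a DΛ z l x) = 0 := by
  rw [integral_symbolVal b fun l => (h.memLp_cellDeriv z l).integrable (by norm_num)]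
  simp only [(h.hasWeakGradient_cellDeriv z).setIntegral_deriv_eq_zero (h.isLatticePeriodic z)
    fun l => IsLatticePeriodic.fract (fun x => matCLM (DΛ l x) z), symbolVal_zero]

/-- The weak form of the cell problem for vector-valued test functions. -/
theorem setIntegral_inner_cellFlux {c₁ c₂ : ℝ} (hg : IsEllipticCoeff volume g c₁ c₂)
    {w : EuclideanSpace ℝ (Fin d) → EuclideanSpace ℂ (Fin n)}
    {Dw : Fin d → EuclideanSpace ℝ (Fin d) → EuclideanSpace ℂ (Fin n)}
    (hw : IsLatticePeriodic a w) (hD : HasWeakGradient w Dw)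
    (hm : MemLp w 2 (volume.restrict (ZSpan.fundamentalDomain a)))
    (hDm : ∀ l, MemLp (Dw l) 2 (volume.restrict (ZSpan.fundamentalDomain a))) :
    ∫ x in ZSpan.fundamentalDomain a, ⟪symbolVal b fun l => Dw l x, cellFlux a b g DΛ z x⟫_ℂ = 0 := by
  set L : EuclideanSpace ℂ (Fin n) →L[ℝ] (Fin n → ℂ) :=
    ((EuclideanSpace.equiv (Fin n) ℂ : EuclideanSpace ℂ (Fin n) →L[ℂ] (Fin n → ℂ))
      ).restrictScalars ℝ with hL
  have hp : PeriodicH1 a (fun x => L (w x)) fun l x => L (Dw l x) :=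
    ⟨fun j x => congrArg L (hw j x), hD.clm_comp L, L.comp_memLp' hm, fun l => L.comp_memLp' (hDm l)⟩
  -- The cell problem is stated column by column; the columns correspond to the basis vectors, and
  -- `z` is a linear combination of them.
  have e1 : ∀ k, ∫ x in ZSpan.fundamentalDomain a, ⟪symbolVal b fun l => Dw l x,
      cellFlux a b g DΛ (EuclideanSpace.single k 1) x⟫_ℂ = 0 := fun k => by
    rw [← h.weak_eq k _ _ hp]
    refine integral_congr_ae (ae_restrict_of_ae ?_)
    filter_upwards [h.cellFlux_ae_eq (EuclideanSpace.single k 1)] with x hx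
    rw [hx, inner_eq_dotProduct, ofLp_symbolVal, ofLp_matCLM]
    congr 1
    funext j
    simp [Matrix.mulVec, dotProduct, PiLp.single_apply]
  have i1 : ∀ k, Integrable (fun x => ⟪symbolVal b fun l => Dw l x,
      cellFlux a b g DΛ (EuclideanSpace.single k 1) x⟫_ℂ)
      (volume.restrict (ZSpan.fundamentalDomain a)) := fun k =>
    (memLp_symbolVal b hDm).integrable_inner_of_two (h.memLp_cellFlux _ hg)
  have e2 : ∀ᵐ x ∂volume.restrict (ZSpan.fundamentalDomain a),
      ⟪symbolVal b fun l => Dw l x, cellFlux a b g DΛ z x⟫_ℂ =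
      ∑ k, z k * ⟪symbolVal b fun l => Dw l x,
        cellFlux a b g DΛ (EuclideanSpace.single k 1) x⟫_ℂ := by
    refine ae_restrict_of_ae ?_
    filter_upwards [h.cellFlux_ae_eq z,
      ae_all_iff.2 fun k => h.cellFlux_ae_eq (EuclideanSpace.single k 1)] with x h1 h2
    have hz : z = ∑ k, z k • EuclideanSpace.single k (1 : ℂ) := by
      ext i
      rw [WithLp.ofLp_sum, Finset.sum_apply, Finset.sum_eq_single i]
      · simp
      · intro k _ hk
        simp [Ne.symm hk]
      · simp
    rw [h1]
    conv_lhs => rw [hz]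
    simp only [h2, map_sum, map_smul, inner_sum, inner_smul_right]
  rw [integral_congr_ae e2, integral_finsetSum _ fun k _ => (i1 k).const_mul _]
  simp only [integral_const_mul, e1, mul_zero, Finset.sum_const_zero]

end IsCellSolution

end CellFields

/-! ### The effective matrix as an energy. -/

section EffectiveMatrix

variable {d n m : ℕ} {a : Module.Basis (Fin d) ℝ (EuclideanSpace ℝ (Fin d))}

theorem inner_matCLM_eq_sum {κ : Type*} [Fintype κ] (A : Matrix κ κ ℂ) (z z' : EuclideanSpace ℂ κ) :
    ⟪z', matCLM A z⟫_ℂ = ∑ i, ∑ j, star (z' i) * z j * A i j := by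
  rw [inner_eq_dotProduct, ofLp_matCLM]
  simp only [dotProduct, Matrix.mulVec, Finset.mul_sum, Pi.star_apply]
  exact Finset.sum_congr rfl fun i _ => Finset.sum_congr rfl fun j _ => by ring

theorem inner_single_matCLM_single {κ : Type*} [Fintype κ] [DecidableEq κ] (A : Matrix κ κ ℂ)
    (i j : κ) :
    ⟪EuclideanSpace.single i (1 : ℂ), matCLM A (EuclideanSpace.single j (1 : ℂ))⟫_ℂ = A i j := by
  rw [inner_matCLM_eq_sum, Finset.sum_eq_single i, Finset.sum_eq_single j]
  · simp
  · intro k _ hk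
    simp [hk]
  · simp
  · intro k _ hk
    simp [PiLp.single_apply, hk]
  · simp

/-- Mean values of quadratic forms. -/
theorem inner_cellMean {M : EuclideanSpace ℝ (Fin d) → Matrix (Fin m) (Fin m) ℂ}
    (hM : ∀ z z' : EuclideanSpace ℂ (Fin m),
      IntegrableOn (fun x => ⟪z', matCLM (M x) z⟫_ℂ) (ZSpan.fundamentalDomain a))
    (z z' : EuclideanSpace ℂ (Fin m)) :
    ⟪z', matCLM (cellMean a M) z⟫_ℂ = cellAverage a fun x => ⟪z', matCLM (M x) z⟫_ℂ := by
  have hi : ∀ i j, IntegrableOn (fun x => M x i j) (ZSpan.fundamentalDomain a) := fun i j => by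
    have := hM (EuclideanSpace.single j 1) (EuclideanSpace.single i 1)
    simpa only [inner_single_matCLM_single] using this
  have hi2 : ∀ i ∈ Finset.univ, Integrable (fun x => ∑ j, star (z' i) * z j * M x i j)
      (volume.restrict (ZSpan.fundamentalDomain a)) := fun i _ =>
    integrable_finsetSum _ fun j _ => (hi i j).const_mul _
  rw [cellAverage]
  simp only [inner_matCLM_eq_sum]
  rw [integral_finsetSum _ hi2, Finset.smul_sum]
  refine Finset.sum_congr rfl fun i _ => ?_
  rw [integral_finsetSum _ fun j _ => (hi i j).const_mul _, Finset.smul_sum]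
  refine Finset.sum_congr rfl fun j _ => ?_
  rw [integral_const_mul, cellMean, Matrix.of_apply, Complex.real_smul, Complex.ofReal_inv]
  ring

variable {b : Fin d → Matrix (Fin m) (Fin n) ℂ}
  {g : EuclideanSpace ℝ (Fin d) → Matrix (Fin m) (Fin m) ℂ} {c₁ c₂ : ℝ}

namespace IsCellSolution

variable (h : IsCellSolution a b g (cellSolution a b g).1 (cellSolution a b g).2)
  (hg : IsEllipticCoeff volume g c₁ c₂) (z z' : EuclideanSpace ℂ (Fin m))

include h

theorem cellFlux_ae_eq_gTilde :
    cellFlux a b g (cellSolution a b g).2 z =ᵐ[volume] fun x => matCLM (gTilde a b g x) z :=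
  h.cellFlux_ae_eq z

include hg

theorem inner_effectiveMatrix :
    ⟪z', matCLM (effectiveMatrix a b g) z⟫_ℂ =
      cellAverage a fun x => ⟪z', cellFlux a b g (cellSolution a b g).2 z x⟫_ℂ := by
  have e : ∀ z z', (fun x => ⟪z', cellFlux a b g (cellSolution a b g).2 z x⟫_ℂ)
      =ᵐ[volume.restrict (ZSpan.fundamentalDomain a)] fun x => ⟪z', matCLM (gTilde a b g x) z⟫_ℂ :=
    fun z z' => ae_restrict_of_ae ((h.cellFlux_ae_eq_gTilde z).mono fun x hx => by simp only [hx])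
  rw [effectiveMatrix, inner_cellMean, cellAverage, cellAverage, integral_congr_ae (e z z')]
  exact fun z z' => (((h.memLp_cellFlux z hg).integrable (by norm_num)).const_inner z').congr (e z z')

/-- The weak cell equation tested with `Λz'` allows one to add `b(D)Λz'` to `z'` without changing
the mean. This symmetric form is the source of the Hermitian property and of the ellipticity of the
effective matrix. -/
theorem inner_effectiveMatrix_eq_energy :
    ⟪z', matCLM (effectiveMatrix a b g) z⟫_ℂ =
      cellAverage a fun x => ⟪cellField a b (cellSolution a b g).2 z' x,
        cellFlux a b g (cellSolution a b g).2 z x⟫_ℂ := by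
  have i1 := (memLp_symbolVal b fun l => h.memLp_cellDeriv z' l).integrable_inner_of_two
    (h.memLp_cellFlux z hg)
  have i2 := ((h.memLp_cellFlux z hg).integrable (by norm_num)).const_inner (𝕜 := ℂ) z'
  rw [h.inner_effectiveMatrix hg, cellAverage, cellAverage]
  simp only [cellField, inner_add_left]
  rw [integral_add i1 i2, h.setIntegral_inner_cellFlux z hg (h.isLatticePeriodic z')
    (h.hasWeakGradient_cellDeriv z') (h.memLp_cellVector z') (h.memLp_cellDeriv z'), zero_add]

theorem cellAverage_cellFlux :
    cellAverage a (cellFlux a b g (cellSolution a b g).2 z) = matCLM (effectiveMatrix a b g) z := by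
  refine ext_inner_left ℂ fun w => ?_
  rw [h.inner_effectiveMatrix hg, cellAverage, cellAverage, Complex.real_smul, ← Complex.coe_smul,
    inner_smul_right, integral_inner ((h.memLp_cellFlux z hg).integrable (by norm_num))]

theorem isHermitian_effectiveMatrix : (effectiveMatrix a b g).IsHermitian := by
  have e : ∀ z z' : EuclideanSpace ℂ (Fin m), (starRingEnd ℂ) ⟪z', matCLM (effectiveMatrix a b g) z⟫_ℂ =
      ⟪z, matCLM (effectiveMatrix a b g) z'⟫_ℂ := fun z z' => by
    rw [h.inner_effectiveMatrix_eq_energy hg, h.inner_effectiveMatrix_eq_energy hg, cellAverage,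
      cellAverage, Complex.real_smul, Complex.real_smul, map_mul, Complex.conj_ofReal, ← integral_conj]
    congr 1
    refine integral_congr_ae (ae_restrict_of_ae ?_)
    filter_upwards [hg.hermitian] with x hx
    rw [inner_conj_symm, cellFlux, cellFlux, inner_matCLM_left, hx.eq]
  ext i j
  have := e (EuclideanSpace.single i 1) (EuclideanSpace.single j 1)
  rwa [inner_single_matCLM_single, inner_single_matCLM_single] at this

/-- The field `f` has mean value `z`, and `‖f‖² ≥ 2 Re⟨z, f⟩ - ‖z‖²` pointwise; averaging shows that
the lower bound of `g` is inherited. -/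
theorem isEllipticCoeff_effectiveMatrix :
    IsEllipticCoeff volume (fun _ : EuclideanSpace ℝ (Fin d) => effectiveMatrix a b g) c₁
      ‖matCLM (effectiveMatrix a b g)‖ := by
  refine ⟨hg.pos, fun i j => aestronglyMeasurable_const,
    .of_forall fun _ => h.isHermitian_effectiveMatrix hg, .of_forall fun _ z => ?_,
    .of_forall fun _ z => (matCLM (effectiveMatrix a b g)).le_opNorm z⟩
  set Ω := ZSpan.fundamentalDomain a with hΩ
  set f := cellField a b (cellSolution a b g).2 z with hf
  have hV : 0 < volume.real Ω := IsLatticePeriodic.volume_real_fundamentalDomain_pos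
  have if2 := h.memLp_cellField z
  have if1 : Integrable f (volume.restrict Ω) := if2.integrable (by norm_num)
  have iz := if1.const_inner (𝕜 := ℂ) z
  have i3 : Integrable (fun x => 2 * (⟪z, f x⟫_ℂ).re) (volume.restrict Ω) := iz.re.const_mul 2
  have ie := if2.integrable_inner_of_two (h.memLp_cellFlux z hg)
  have mf : ∫ x in Ω, f x = (volume.real Ω : ℂ) • z := by
    have h1 := (memLp_symbolVal b fun l => h.memLp_cellDeriv z l).integrable
      (by norm_num : (1 : ℝ≥0∞) ≤ 2)
    simp only [hf, cellField]
    rw [integral_add h1 (integrable_const z), h.setIntegral_symbolVal_cellDeriv, zero_add,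
      setIntegral_const, Complex.coe_smul]
  rw [h.inner_effectiveMatrix_eq_energy hg, cellAverage, Complex.smul_re, smul_eq_mul,
    ← div_eq_inv_mul, le_div_iff₀ hV]
  have e1 : (∫ x in Ω, ⟪f x, cellFlux a b g (cellSolution a b g).2 z x⟫_ℂ).re =
      ∫ x in Ω, (⟪f x, cellFlux a b g (cellSolution a b g).2 z x⟫_ℂ).re :=
    (integral_re ie).symm
  have e2 : ∫ x in Ω, c₁ * (2 * (⟪z, f x⟫_ℂ).re - ‖z‖ ^ 2) = c₁ * ‖z‖ ^ 2 * volume.real Ω := by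
    have e3 : ∫ x in Ω, (⟪z, f x⟫_ℂ).re = volume.real Ω * ‖z‖ ^ 2 := by
      have := (integral_re iz).trans (congrArg Complex.re (integral_inner if1 z))
      rw [mf, inner_smul_right, Complex.re_ofReal_mul] at this
      rw [← inner_self_eq_norm_sq (𝕜 := ℂ)]
      exact this
    rw [integral_const_mul, integral_sub i3 (integrable_const _), integral_const_mul, e3,
      setIntegral_const, smul_eq_mul]
    ring
  rw [e1, ← e2]
  refine integral_mono_ae ((i3.sub (integrable_const _)).const_mul _) ie.re
    (ae_restrict_of_ae ?_)
  filter_upwards [hg.lower] with x hx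
  refine le_trans (mul_le_mul_of_nonneg_left ?_ hg.pos.le) (hx (f x))
  have h1 := norm_sub_sq (𝕜 := ℂ) z (f x)
  have h2 := sq_nonneg ‖z - f x‖
  have h3 : RCLike.re ⟪z, f x⟫_ℂ = (⟪z, f x⟫_ℂ).re := rfl
  linarith

end IsCellSolution

end EffectiveMatrix

/-! ### The cell solution as a corrector of plane waves. -/

section CellCorrector

variable {d n m : ℕ} {a : Module.Basis (Fin d) ℝ (EuclideanSpace ℝ (Fin d))}
  {b : Fin d → Matrix (Fin m) (Fin n) ℂ}
  {g : EuclideanSpace ℝ (Fin d) → Matrix (Fin m) (Fin m) ℂ} {c₁ c₂ : ℝ}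

theorem symbolVal_sum {ι κ S : Type*} [Fintype ι] [Fintype κ] (b : Fin d → Matrix κ ι ℂ)
    (s : Finset S) (p : S → Fin d → EuclideanSpace ℂ ι) :
    symbolVal b (fun l => ∑ y ∈ s, p y l) = ∑ y ∈ s, symbolVal b (p y) := by
  simp only [symbolVal, map_sum, Finset.smul_sum]
  exact Finset.sum_comm

theorem symbolVal_latticeSum {ι κ : Type*} [Fintype ι] [Fintype κ] (b : Fin d → Matrix κ ι ℂ)
    {Y : EuclideanSpace ℝ (Fin d) → EuclideanSpace ℂ ι} (hY : HasCompactSupport Y)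
    (x : EuclideanSpace ℝ (Fin d)) :
    latticeSum a (fun x => symbolVal b fun l => fderiv ℝ Y x (EuclideanSpace.single l 1)) x =
      symbolVal b fun l => latticeSum a (fun x => fderiv ℝ Y x (EuclideanSpace.single l 1)) x := by
  obtain ⟨S, hS⟩ := exists_finset_translates (a := a) hY.isCompact ‖x‖
  have h0 : ∀ y ∉ S, fderiv ℝ Y (x + y) = 0 := fun y hy =>
    image_eq_zero_of_notMem_tsupport fun h => hS x le_rfl y hy (tsupport_fderiv_subset ℝ h)
  have e1 : ∀ l, latticeSum a (fun x => fderiv ℝ Y x (EuclideanSpace.single l 1)) x =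
      ∑ y ∈ S, fderiv ℝ Y (x + y) (EuclideanSpace.single l 1) := fun l =>
    tsum_eq_sum fun y hy => by
      simp only [h0 y hy, _root_.zero_apply]
  simp only [e1, symbolVal_sum]
  refine tsum_eq_sum fun y hy => ?_
  simp only [h0 y hy, _root_.zero_apply, symbolVal_zero]

namespace IsCellSolution

variable (h : IsCellSolution a b g (cellSolution a b g).1 (cellSolution a b g).2)
  (hg : IsEllipticCoeff volume g c₁ c₂) (hp : IsLatticePeriodic a g)

theorem isLatticePeriodic_cellField
    (DΛ : Fin d → EuclideanSpace ℝ (Fin d) → Matrix (Fin n) (Fin m) ℂ)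
    (z : EuclideanSpace ℂ (Fin m)) : IsLatticePeriodic a (cellField a b DΛ z) :=
  IsLatticePeriodic.fract fun x => symbolVal b (fun l => matCLM (DΛ l x) z) + z

include hp in
theorem isLatticePeriodic_cellFlux
    (DΛ : Fin d → EuclideanSpace ℝ (Fin d) → Matrix (Fin n) (Fin m) ℂ)
    (z : EuclideanSpace ℂ (Fin m)) : IsLatticePeriodic a (cellFlux a b g DΛ z) := fun j x => by
  rw [cellFlux, cellFlux, hp, isLatticePeriodic_cellField]

include h hg hp in
theorem locallyIntegrable_cellFlux (z : EuclideanSpace ℂ (Fin m)) :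
    LocallyIntegrable (cellFlux a b g (cellSolution a b g).2 z) volume := by
  refine (isLatticePeriodic_cellFlux hp _ z).locallyIntegrable ?_
    ((h.memLp_cellFlux z hg).integrable (by norm_num))
  refine hg.aestronglyMeasurable_mul ((aestronglyMeasurable_symbolVal b fun l => ?_).add
    aestronglyMeasurable_const)
  exact ((h.hasWeakGradient_cellDeriv z).locallyIntegrable_deriv l).aestronglyMeasurable

include h hg hp in
/-- The solution of the cell problem provides correctors for plane waves. -/
theorem isCorrector {θ : EuclideanSpace ℝ (Fin d)} {γ : ℝ} {η : EuclideanSpace ℂ (Fin n)}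
    (hη : matCLM (symbol b θ)ᴴ (matCLM (effectiveMatrix a b g) (matCLM (symbol b θ) η)) =
      (γ : ℂ) • η) :
    IsCorrector a b g θ γ η (cellVector (cellSolution a b g).1 (matCLM (symbol b θ) η))
      (cellDeriv a (cellSolution a b g).2 (matCLM (symbol b θ) η)) where
  coeff_periodic := hp
  periodic := h.isLatticePeriodic _
  periodic_deriv l := IsLatticePeriodic.fract fun x =>
    matCLM ((cellSolution a b g).2 l x) (matCLM (symbol b θ) η)
  weakGradient := h.hasWeakGradient_cellDeriv _
  memLp := h.memLp_cellVector _
  memLp_deriv := h.memLp_cellDeriv _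
  weak_eq Y h1 h2 := by
    have h1' : ContDiff ℝ 1 Y := h1.of_le (by exact_mod_cast le_top)
    have c1 : Continuous fun x => symbolVal b fun l => fderiv ℝ Y x (EuclideanSpace.single l 1) :=
      continuous_symbolVal b fun l =>
        (h1'.continuous_fderiv one_ne_zero).clm_apply continuous_const
    have c2 : HasCompactSupport fun x =>
        symbolVal b fun l => fderiv ℝ Y x (EuclideanSpace.single l 1) :=
      (h2.fderiv ℝ).comp_left (g := fun L : EuclideanSpace ℝ (Fin d) →L[ℝ] EuclideanSpace ℂ (Fin n) =>
        symbolVal b fun l => L (EuclideanSpace.single l 1)) (symbolVal_zero b)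
    -- The cell equation admits periodic test functions, while `IsCorrector` requires compactly
    -- supported ones. The integral over the whole space folds into one over the cell, with the
    -- lattice sum of `Y` as the test function.
    have e := integral_inner_eq_setIntegral_latticeSum c1 c2
      (isLatticePeriodic_cellFlux hp (cellSolution a b g).2 (matCLM (symbol b θ) η))
      (h.locallyIntegrable_cellFlux hg hp (matCLM (symbol b θ) η))
    refine e.trans ?_
    simp only [symbolVal_latticeSum b h2]
    exact h.setIntegral_inner_cellFlux _ hg (isLatticePeriodic_latticeSum Y)
      (hasWeakGradient_latticeSum h1' h2) (memLp_latticeSum h1.continuous h2) fun l =>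
        memLp_latticeSum ((h1'.continuous_fderiv one_ne_zero).clm_apply continuous_const)
          (h2.fderiv_apply ℝ _)
  integral_defect := by
    have hV : (volume.real (ZSpan.fundamentalDomain a)) ≠ 0 :=
      IsLatticePeriodic.volume_real_fundamentalDomain_pos.ne'
    have i1 := (h.memLp_cellFlux (matCLM (symbol b θ) η) hg).integrable
      (by norm_num : (1 : ℝ≥0∞) ≤ 2)
    have e1 := h.cellAverage_cellFlux hg (matCLM (symbol b θ) η)
    rw [cellAverage, inv_smul_eq_iff₀ hV] at e1
    change ∫ x in ZSpan.fundamentalDomain a, (matCLM (symbol b θ)ᴴ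
      (cellFlux a b g (cellSolution a b g).2 (matCLM (symbol b θ) η) x) - (γ : ℂ) • η) = 0
    -- The mean flux is `g⁰ b(θ)η`, and applying `b(θ)*` gives the germ at `η`, that is `γη`.
    rw [integral_sub ((matCLM (symbol b θ)ᴴ).integrable_comp i1) (integrable_const _),
      ContinuousLinearMap.integral_comp_comm _ i1, e1, ← Complex.coe_smul, map_smul, hη,
      setIntegral_const, Complex.coe_smul, sub_self]

-- The mean energy of the cell field is the form of the effective matrix at `b(θ)η`, which equals
-- `γ⟨η, η⟩`. It cancels the zeroth order term of the energy expansion.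
include h hg in
theorem cellAverage_energy {θ : EuclideanSpace ℝ (Fin d)} {γ : ℝ} {η : EuclideanSpace ℂ (Fin n)}
    (hη : matCLM (symbol b θ)ᴴ (matCLM (effectiveMatrix a b g) (matCLM (symbol b θ) η)) =
      (γ : ℂ) • η) :
    cellAverage a (fun y => ⟪waveField b θ η (cellDeriv a (cellSolution a b g).2
      (matCLM (symbol b θ) η)) y, waveFlux b g θ η (cellDeriv a (cellSolution a b g).2
      (matCLM (symbol b θ) η)) y⟫_ℂ) = γ * ⟪η, η⟫_ℂ := by
  refine (h.inner_effectiveMatrix_eq_energy hg (matCLM (symbol b θ) η)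
    (matCLM (symbol b θ) η)).symm.trans ?_
  rw [inner_matCLM_left, hη, inner_smul_right]

include h hg in
/-- The quadratic form of `matrixN` is the average of the interaction of the flux with the
corrector. -/
theorem inner_matrixN (θ : EuclideanSpace ℝ (Fin d)) (η : EuclideanSpace ℂ (Fin n)) :
    ⟪η, matCLM (matrixN a b g θ) η⟫_ℂ = cellAverage a (fun y =>
      ⟪waveFlux b g θ η (cellDeriv a (cellSolution a b g).2 (matCLM (symbol b θ) η)) y,
        matCLM (symbol b θ) (cellVector (cellSolution a b g).1 (matCLM (symbol b θ) η) y)⟫_ℂ +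
      ⟪matCLM (symbol b θ) (cellVector (cellSolution a b g).1 (matCLM (symbol b θ) η) y),
        waveFlux b g θ η (cellDeriv a (cellSolution a b g).2 (matCLM (symbol b θ) η)) y⟫_ℂ) := by
  set Λ := (cellSolution a b g).1 with hΛ
  set DΛ := (cellSolution a b g).2 with hDΛ
  have e : ∀ z z' : EuclideanSpace ℂ (Fin m),
      (fun x => ⟪cellFlux a b g DΛ z' x, matCLM (symbol b θ) (cellVector Λ z x)⟫_ℂ +
        ⟪matCLM (symbol b θ) (cellVector Λ z' x), cellFlux a b g DΛ z x⟫_ℂ)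
      =ᵐ[volume.restrict (ZSpan.fundamentalDomain a)] fun x =>
        ⟪z', matCLM ((Λ x)ᴴ * (symbol b θ)ᴴ * gTilde a b g x +
          (gTilde a b g x)ᴴ * symbol b θ * Λ x) z⟫_ℂ := fun z z' => by
    refine ae_restrict_of_ae ?_
    filter_upwards [h.cellFlux_ae_eq_gTilde z, h.cellFlux_ae_eq_gTilde z'] with x h1 h2
    rw [h1, h2, map_add, _root_.add_apply, inner_add_right, matCLM_mul, matCLM_mul, matCLM_mul,
      matCLM_mul, add_comm, inner_matCLM_left, cellVector, inner_matCLM_left, inner_matCLM_left,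
      cellVector]
  have i : ∀ z z' : EuclideanSpace ℂ (Fin m),
      IntegrableOn (fun x => ⟪cellFlux a b g DΛ z' x, matCLM (symbol b θ) (cellVector Λ z x)⟫_ℂ +
        ⟪matCLM (symbol b θ) (cellVector Λ z' x), cellFlux a b g DΛ z x⟫_ℂ)
        (ZSpan.fundamentalDomain a) := fun z z' =>
    ((h.memLp_cellFlux z' hg).integrable_inner_of_two
      ((matCLM (symbol b θ)).comp_memLp' (h.memLp_cellVector z))).add
    (((matCLM (symbol b θ)).comp_memLp' (h.memLp_cellVector z')).integrable_inner_of_two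
      (h.memLp_cellFlux z hg))
  rw [matrixN, matCLM_mul, matCLM_mul, ← inner_matCLM_left, matrixL,
    inner_cellMean fun z z' => (i z z').congr (e z z'), cellAverage, cellAverage,
    ← integral_congr_ae (e _ _)]
  rfl

end IsCellSolution

end CellCorrector

/-! ### Eigenvectors of the germ and the theorem itself. -/

section Spectral

variable {d n m : ℕ} {a : Module.Basis (Fin d) ℝ (EuclideanSpace ℝ (Fin d))}
  {b : Fin d → Matrix (Fin m) (Fin n) ℂ}
  {g : EuclideanSpace ℝ (Fin d) → Matrix (Fin m) (Fin m) ℂ}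

/-- A compression to a subspace vanishes if the quadratic form vanishes there. -/
theorem compression_eq_zero {E : Type*} [NormedAddCommGroup E] [InnerProductSpace ℂ E]
    (K : Submodule ℂ E) [K.HasOrthogonalProjection] (T : E →ₗ[ℂ] E)
    (h : ∀ η ∈ K, ⟪η, T η⟫_ℂ = 0) :
    K.starProjection.toLinearMap ∘ₗ T ∘ₗ K.starProjection.toLinearMap = 0 := by
  refine (inner_map_self_eq_zero _).1 fun x => ?_
  have h1 := h (K.starProjection x) (K.starProjection_apply_mem x)
  rw [← inner_conj_symm]
  change (starRingEnd ℂ) ⟪x, K.starProjection (T (K.starProjection x))⟫_ℂ = 0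
  rw [← K.inner_starProjection_left_eq_right, h1, map_zero]

/-- If the form of `N̂` vanished on every eigenspace, each compressed summand of `N̂₀` would vanish,
by polarization over `ℂ`. -/
theorem exists_eigenvector_of_operatorN0_ne_zero {θ : EuclideanSpace ℝ (Fin d)}
    (hN : operatorN0 a b g θ ≠ 0) :
    ∃ (γ : ℂ) (η : EuclideanSpace ℂ (Fin n)), matCLM (germ a b g θ) η = γ • η ∧
      ⟪η, matCLM (matrixN a b g θ) η⟫_ℂ ≠ 0 := by
  by_contra! hc
  refine hN (Finset.sum_eq_zero fun γ _ => compression_eq_zero _ _ fun η hη => ?_)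
  exact hc γ.1 η (Module.End.mem_eigenspace_iff.1 hη)

/-- Solvability of the cell problem follows from the hypothesis: otherwise `cellSolution` takes its
default value `0`, both summands of `matrixL` contain the factor `Λ = 0`, and `N̂₀` would be zero.
-/
theorem exists_isCellSolution_of_operatorN0_ne_zero {θ : EuclideanSpace ℝ (Fin d)}
    (hN : operatorN0 a b g θ ≠ 0) :
    IsCellSolution a b g (cellSolution a b g).1 (cellSolution a b g).2 := by
  by_cases h : ∃ Z : (EuclideanSpace ℝ (Fin d) → Matrix (Fin n) (Fin m) ℂ) ×
      (Fin d → EuclideanSpace ℝ (Fin d) → Matrix (Fin n) (Fin m) ℂ), IsCellSolution a b g Z.1 Z.2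
  · rw [cellSolution, dif_pos h]
    exact h.choose_spec
  · obtain ⟨-, η, -, hη⟩ := exists_eigenvector_of_operatorN0_ne_zero hN
    have e0 : cellSolution a b g = 0 := dif_neg h
    have e1 : matrixL a b g θ = 0 := by
      ext i j
      simp [matrixL, cellMean, e0]
    exact absurd (by simp [matrixN, e1]) hη

end Spectral

theorem mainTheorem1 {d n m : ℕ} (hnm : n ≤ m)
    (a : Module.Basis (Fin d) ℝ (EuclideanSpace ℝ (Fin d)))
    (b : Fin d → Matrix (Fin m) (Fin n) ℂ)
    (hb : ∀ ξ : EuclideanSpace ℝ (Fin d), ξ ≠ 0 → (symbol b ξ).rank = n)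
    (g : EuclideanSpace ℝ (Fin d) → Matrix (Fin m) (Fin m) ℂ)
    (hg_per : ∀ j x, g (x + a j) = g x)
    (hg_pos : ∀ᵐ x, (g x).PosDef)
    (hg_bdd : ∀ i j, MemLp (fun x => g x i j) ∞ volume)
    (hg_inv : ∀ i j, MemLp (fun x => (g x)⁻¹ i j) ∞ volume)
    (θ₀ : EuclideanSpace ℝ (Fin d)) (hθ₀ : ‖θ₀‖ = 1) (hN : operatorN0 a b g θ₀ ≠ 0)
    (τ : ℝ) (hτ : τ ≠ 0) (s : ℝ) (hs₀ : 0 ≤ s) (hs₂ : s < 2) :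
    ¬ ∃ C : ℝ, 0 < C ∧ ∀ᶠ ε : ℝ in 𝓝[>] 0,
      ‖(cosSqrt (divForm b fun x => g (ε⁻¹ • x)) τ -
          cosSqrt (divForm b fun _ => effectiveMatrix a b g) τ) ∘L
        smoothing (negLaplacian d (Fin n)) s‖ ≤ C * ε := by
  obtain ⟨c, hbc⟩ := exists_isEllipticSymbol b fun ξ hξ => by rw [hb ξ hξ, Fintype.card_fin]
  obtain ⟨c₁, c₂, hc₂, hg⟩ := exists_isEllipticCoeff hg_pos hg_bdd hg_inv
  have h := exists_isCellSolution_of_operatorN0_ne_zero hN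
  have hg₀ := h.isEllipticCoeff_effectiveMatrix hg
  obtain ⟨γ, η, hγ, hη⟩ := exists_eigenvector_of_operatorN0_ne_zero hN
  rw [germ, matCLM_mul, matCLM_mul] at hγ
  have hη0 : η ≠ 0 := by
    rintro rfl
    exact hη (inner_zero_left _)
  have e1 : ⟪matCLM (symbol b θ₀) η, matCLM (effectiveMatrix a b g) (matCLM (symbol b θ₀) η)⟫_ℂ =
      γ * (‖η‖ ^ 2 : ℝ) := by
    rw [inner_matCLM_left, hγ, inner_smul_right, inner_self_eq_norm_sq_to_K]
    norm_cast
  have hη2 : 0 < ‖η‖ ^ 2 := pow_pos (norm_pos_iff.2 hη0) 2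
  have him : γ.im = 0 := by
    have e2 : (starRingEnd ℂ) (γ * (‖η‖ ^ 2 : ℝ)) = γ * (‖η‖ ^ 2 : ℝ) := by
      rw [← e1, inner_conj_symm, inner_matCLM_left, (h.isHermitian_effectiveMatrix hg).eq]
    have e3 := Complex.conj_eq_iff_im.1 e2
    rw [Complex.im_mul_ofReal] at e3
    exact (mul_eq_zero.1 e3).resolve_right hη2.ne'
  -- The eigenvalue is positive because the symbol is elliptic at the unit vector `θ₀` and the
  -- effective matrix is bounded below; positivity makes `√(γk²)` nonzero in the Taylor expansion of
  -- the cosine.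
  have hre : 0 < γ.re := by
    obtain ⟨x, hx⟩ := hg₀.lower.exists
    have e2 := hx (matCLM (symbol b θ₀) η)
    rw [e1, Complex.re_mul_ofReal] at e2
    have e3 := hbc.le θ₀ η
    rw [hθ₀, mul_one] at e3
    have e4 : 0 < ‖matCLM (symbol b θ₀) η‖ :=
      (mul_pos hbc.pos (norm_pos_iff.2 hη0)).trans_le e3
    have e5 := mul_pos hg.pos (pow_pos e4 2)
    exact pos_of_mul_pos_left (e5.trans_le e2) hη2.le
  have hγr : γ = (γ.re : ℂ) := Complex.ext rfl (by simpa using him)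
  rw [hγr] at hγ
  have hμ := hη
  rw [h.inner_matrixN hg] at hμ
  -- The smoothing operator enters as the form operator of the gradient with the identity
  -- coefficient, for which every `η` has eigenvalue `1`.
  exact (h.isCorrector hg hg_per hγ).not_exists_bound hbc hg hc₂ hre hg₀ (norm_nonneg _) hγ
    isEllipticSymbol_gradCoeff (isEllipticCoeff_one volume) zero_le_one (symbol_gradCoeff_sq hθ₀ η)
    (h.setIntegral_cellVector _) (h.cellAverage_energy hg hγ) hμ hτ hs₀ hs₂
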